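/- Let $\Omega=\mathbb R^3_+=\{x=(x_1,x_2,z): z>0\}$, $\varphi(z)=z/(1+z)$, $Z_1=\partial_1$, $Z_2=\partial_2$, $Z_3=\varphi\,\partial_z$, and $Z^\alpha=Z_1^{\alpha_1}Z_2^{\alpha_2}Z_3^{\alpha_3}$ for $\alpha\in\mathbb N_0^3$ (derivatives in the sense of distributions). Put $$\|f\|_m^2=\sum_{|\alpha|\le m}\|Z^\alpha f\|_{L^2(\Omega)}^2,\qquad \|f\|_{m,\infty}=\sum_{|\alpha|\le m}\|Z^\alpha f\|_{L^\infty(\Omega)},\qquad \|f\|_{W^{1,\infty}}=\sum_{|\alpha|\le 1}\|\partial^\alpha f\|_{L^\infty(\Omega)},$$ with the value $+\infty$ if some of the derivatives involved is not a function in the respective space. There is a universal constant $C$ with the following property. Let $T>0$ and let $u\in C([0,T];H^5(\Omega))$ be a solution, with pressure $p$, of the incompressible Euler equations $$\partial_t u+u\cdot\nabla u+\nabla p=0,\qquad \nabla\cdot u=0\qquad\text{in }\Omega\times(0,T),$$ $$u_3=0\qquad\text{on }\{z=0\}\times(0,T),$$ where the equations are understood in the sense of distributions, $p\in L^1_{\mathrm{loc}}(\Omega\times(0,T))$,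 and $u(t)$ denotes the representative that is continuous on $\overline\Omega$. Write $u_0=u(0)$. Then, for every $t\in[0,T]$, $$\|u(t)\|_4^2\le C\left(\|u_0\|_4^2+\int_0^t\Bigl(\|u(s)\|_4^2\bigl(\|u(s)\|_{W^{1,\infty}}+\|u(s)\|_{2,\infty}+1\bigr)+\|u(s)\|_4\,\|\nabla p(s)\|_3\Bigr)\,ds\right).$$ -/

import Mathlib

open MeasureTheory Filter Topology Set TopologicalSpace
open scoped ENNReal NNReal Distributions

noncomputable section

namespace ConormalEuler

/-- Three-dimensional Euclidean space. A point is `x = (x 0, x 1, x 2)`; the coordinate `x 2` is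
the normal variable `z`. -/
abbrev E3 : Type := EuclideanSpace ℝ (Fin 3)

/-- The standard basis vector `e_i`. -/
def basisVec (i : Fin 3) : E3 := EuclideanSpace.single i 1

/-- The open half-space `Ω = {z > 0}`. -/
def halfSpace : Opens E3 where
  carrier := {x | 0 < x 2}
  is_open' := isOpen_lt continuous_const (by fun_prop)

/-- The open space-time cylinder `(0, T) × Ω`. -/
def spaceTime (T : ℝ) : Opens (ℝ × E3) where
  carrier := Ioo 0 T ×ˢ (halfSpace : Set E3)
  is_open' := isOpen_Ioo.prod halfSpace.isOpen

/-! ### Weak derivatives along the vector fields `Yᵢ = wᵢ ∂ᵢ` -/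

/-- The weights `(1, 1, 1)`, giving the usual partial derivatives `∂₁, ∂₂, ∂_z`. -/
def euclideanWeight : Fin 3 → E3 → ℝ := fun _ _ => 1

/-- The weights `(1, 1, φ)` with `φ(z) = z / (1 + z)`, giving the conormal derivatives
`Z₁ = ∂₁`, `Z₂ = ∂₂`, `Z₃ = φ ∂_z`. -/
def conormalWeight : Fin 3 → E3 → ℝ :=
  ![fun _ => 1, fun _ => 1, fun x => x 2 / (1 + x 2)]

/-- The formal transpose `ψ ↦ -∂ᵢ(wᵢ ψ)` of the vector field `Yᵢ = wᵢ ∂ᵢ`. -/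
def transposeField (w : Fin 3 → E3 → ℝ) (i : Fin 3) (ψ : E3 → ℝ) : E3 → ℝ :=
  fun x => -(fderiv ℝ (fun y => w i y * ψ y) x (basisVec i))

/-- The formal transpose of `Y^α = Y₁^{α₁} Y₂^{α₂} Y₃^{α₃}`. -/
def transposeIter (w : Fin 3 → E3 → ℝ) (α : Fin 3 → ℕ) (ψ : E3 → ℝ) : E3 → ℝ :=
  (transposeField w 2)^[α 2] ((transposeField w 1)^[α 1] ((transposeField w 0)^[α 0] ψ))

/-- `g = Y^α f` in the sense of distributions on `Ω`, where `Yᵢ = wᵢ ∂ᵢ`. -/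
structure IsWeakDeriv {F : Type*} [NormedAddCommGroup F] [NormedSpace ℝ F]
    (w : Fin 3 → E3 → ℝ) (α : Fin 3 → ℕ) (f g : E3 → F) : Prop where
  locallyIntegrable_fun : LocallyIntegrableOn f halfSpace
  locallyIntegrable_deriv : LocallyIntegrableOn g halfSpace
  integral_eq : ∀ ψ : 𝓓(halfSpace, ℝ),
    ∫ x in (halfSpace : Set E3), transposeIter w α ψ x • f x =
      ∫ x in (halfSpace : Set E3), ψ x • g x

/-! ### Norms (with value `∞` outside the corresponding space) -/

/-- The multi-indices `α ∈ ℕ³` with `|α| ≤ m`. -/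
def multiIndices (m : ℕ) : Finset (Fin 3 → ℕ) :=
  (Fintype.piFinset fun _ : Fin 3 => Finset.range (m + 1)).filter fun α => ∑ i, α i ≤ m

/-- `‖Y^α f‖_{L^q(Ω)}`. The weak derivative is unique up to null sets, so the infimum is over
at most one value; it is `∞` if `f` has no locally integrable weak derivative `Y^α f`. -/
def weakDerivNorm {F : Type*} [NormedAddCommGroup F] [NormedSpace ℝ F]
    (w : Fin 3 → E3 → ℝ) (q : ℝ≥0∞) (α : Fin 3 → ℕ) (f : E3 → F) : ℝ≥0∞ :=
  ⨅ (g : E3 → F) (_ : IsWeakDeriv w α f g), eLpNorm g q (volume.restrict (halfSpace : Set E3))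

/-- The `L²`-based norm `(∑_{|α| ≤ m} ‖Y^α f‖²_{L²(Ω)})^{1/2}`. -/
def l2Norm {F : Type*} [NormedAddCommGroup F] [NormedSpace ℝ F]
    (w : Fin 3 → E3 → ℝ) (m : ℕ) (f : E3 → F) : ℝ≥0∞ :=
  (∑ α ∈ multiIndices m, weakDerivNorm w 2 α f ^ 2) ^ (1 / 2 : ℝ)

/-- The `L^∞`-based norm `∑_{|α| ≤ m} ‖Y^α f‖_{L^∞(Ω)}`. -/
def lInftyNorm {F : Type*} [NormedAddCommGroup F] [NormedSpace ℝ F]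
    (w : Fin 3 → E3 → ℝ) (m : ℕ) (f : E3 → F) : ℝ≥0∞ :=
  ∑ α ∈ multiIndices m, weakDerivNorm w ∞ α f

/-- The Sobolev norm of `H^m(Ω)`. -/
def sobolevNorm {F : Type*} [NormedAddCommGroup F] [NormedSpace ℝ F] (m : ℕ) (f : E3 → F) :
    ℝ≥0∞ := l2Norm euclideanWeight m f

/-- The norm of `W^{m,∞}(Ω)`. -/
def sobolevInftyNorm {F : Type*} [NormedAddCommGroup F] [NormedSpace ℝ F] (m : ℕ) (f : E3 → F) :
    ℝ≥0∞ := lInftyNorm euclideanWeight m f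

/-- The conormal Sobolev norm `‖f‖_m` of `H^m_co(Ω)`. -/
def conormalNorm {F : Type*} [NormedAddCommGroup F] [NormedSpace ℝ F] (m : ℕ) (f : E3 → F) :
    ℝ≥0∞ := l2Norm conormalWeight m f

/-- The conormal norm `‖f‖_{m,∞}` of `W^{m,∞}_co(Ω)`. -/
def conormalInftyNorm {F : Type*} [NormedAddCommGroup F] [NormedSpace ℝ F] (m : ℕ)
    (f : E3 → F) : ℝ≥0∞ := lInftyNorm conormalWeight m f

/-- `G = ∇p` in the sense of distributions on `Ω`. -/
def IsWeakGradient (p : E3 → ℝ) (G : E3 → E3) : Prop :=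
  ∀ i : Fin 3, IsWeakDeriv euclideanWeight (Pi.single i 1) p (fun x => G x i)

/-- `‖∇p‖_m`, the `H^m_co(Ω)` norm of the distributional gradient of `p`. -/
def gradConormalNorm (m : ℕ) (p : E3 → ℝ) : ℝ≥0∞ :=
  ⨅ (G : E3 → E3) (_ : IsWeakGradient p G), conormalNorm m G

/-! ### Solutions of the Euler equations -/

/-- `u ∈ C([0, T]; H^m(Ω))`. -/
def ContinuousInSobolev (m : ℕ) (T : ℝ) (u : ℝ → E3 → E3) : Prop :=
  (∀ t ∈ Icc 0 T, sobolevNorm m (u t) < ∞) ∧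
    ∀ t ∈ Icc 0 T, Tendsto (fun s => sobolevNorm m (u s - u t)) (𝓝[Icc 0 T] t) (𝓝 0)

/-- `u ∈ C([0, T]; H⁵(Ω))` solves, with pressure `p`, the Euler equations
`∂ₜu + u·∇u + ∇p = 0`, `∇·u = 0` in `Ω × (0, T)` in the sense of distributions, with the slip
condition `u₃ = 0` on `∂Ω × (0, T)`. Since `H⁵(Ω) ⊂ C(Ω̄)`, each `u t` is taken to be the
continuous representative of its class, which gives the boundary values their meaning. -/
structure IsEulerSolution (T : ℝ) (u : ℝ → E3 → E3) (p : ℝ → E3 → ℝ) : Prop where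
  regular : ContinuousInSobolev 5 T u
  continuousOn : ∀ t ∈ Icc 0 T, ContinuousOn (u t) (closure (halfSpace : Set E3))
  pressure_locallyIntegrable :
    LocallyIntegrableOn (fun z : ℝ × E3 => p z.1 z.2) (spaceTime T)
  /-- The momentum equation tested against a compactly supported vector field `Φ`:
  `∫∫ u · ∂ₜΦ + (u ⊗ u) : ∇Φ + p ∇·Φ = 0`. -/
  momentum : ∀ Φ : 𝓓(spaceTime T, E3),
    ∫ z in (spaceTime T : Set (ℝ × E3)),
      (inner ℝ (u z.1 z.2) (fderiv ℝ Φ z (1, 0))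
        + inner ℝ (u z.1 z.2) (fderiv ℝ Φ z (0, u z.1 z.2))
        + p z.1 z.2 * ∑ i : Fin 3, (fderiv ℝ Φ z (0, basisVec i)) i) = 0
  incompressible : ∀ t ∈ Ioo 0 T, ∀ ψ : 𝓓(halfSpace, ℝ),
    ∫ x in (halfSpace : Set E3), fderiv ℝ ψ x (u t x) = 0
  slip : ∀ t ∈ Ioo 0 T, ∀ x : E3, x 2 = 0 → u t x 2 = 0

end ConormalEuler

end

noncomputable section

namespace ConormalEuler

/-! ### Test functions on the half-space -/

/-! The estimate is the `L²` energy estimate for `Z^α u`, `|α| ≤ 4`. Formally, apply `Z^α` to the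
momentum equation and pair with `Z^α u`. The transport term `u·∇ Z^α u` drops out, because `u` is
divergence free and tangential to the boundary (`Flow.integral_transp`). The commutator `[Z^α, u·∇]
u` and the pressure remain.

Commutator. In conormal form `u·∇ = u₁ Z₁ + u₂ Z₂ + (u₃/φ) Z₃`, so conormal bounds on `u₃/φ` are
needed (`exists_zReg_wq`). Tangential derivatives are handled by Hardy's inequality, using `1/φ = 1
+ 1/z` and `∂_z u₃ = -∂₁u₁ - ∂₂u₂`; normal ones by `Z₃(u₃/φ) = ∂_z u₃ - φ' u₃/φ`. Hardy costs one
derivative, so four tangential derivatives of `u₃/φ` are not controlled; there the weight is moved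
to the other factor, `Z^α(u₃/φ) Z₃u = Z^α u₃ ∂_z u`, and the Lipschitz norm enters. The one product
in which neither factor is bounded is treated by a Gagliardo-Nirenberg inequality
(`CD.eLpNorm_sq_le`). The outcome is `exists_commutator`.

Pressure. Only three conormal derivatives of `∇p` are available. Commuting the gradient outwards and
integrating by parts leaves `Z^α p` against `div Z^α u` and lower order terms
(`exists_pressure_pairing`). Here `Z^α p` contains three conormal derivatives of `∇p`, and `div Z^α
u` is of lower order since `div u = 0` (`exists_div_zd`).

Rigour. The equation is weak, `p` has no regularity in time, and `u ∈ H⁵` gives a fifth derivative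
whose bound `K` must not enter the result. For two close times `s₀ < s₁` the energy increment is the
sum of the pairings of `Z^α u(s₁) - Z^α u(s₀)` with `Z^α u(s₁) + Z^α u(s₀)`. The second factor is
approximated by a time-independent test field with controlled divergence (`exists_tests`), and the
equation integrated over `(s₀, s₁]` (`IsEulerSolution.sub_eq_integral_flux`) is tested with the
transposed derivatives of that field. At a time `t` in between, the field is close to `2 Z^α u(t)`.
The transport term vanishes on `2 Z^α u(t)`, so `K` only multiplies the small difference, which is
absorbed as long as the energy is bounded below by some `c > 0` (`exists_flux_le_rate`,
`exists_energy_step`). Such a lower bound is free of charge: it is enough to argue after the last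
time at which the energy is at most its initial value (`exists_energy_le`). -/

/-- The smoothness exponent `∞`. -/
abbrev smoothExp : WithTop ℕ∞ := ((⊤ : ℕ∞) : WithTop ℕ∞)

/-- Lebesgue measure on the half-space. -/
abbrev hsMeasure : Measure E3 := volume.restrict (halfSpace : Set E3)

/-- The partial derivative `∂ᵢ ψ`. -/
def pd (i : Fin 3) (ψ : E3 → ℝ) : E3 → ℝ := fun x => fderiv ℝ ψ x (basisVec i)

/-- Smooth real functions with compact support in the half-space. -/
structure IsTest (ψ : E3 → ℝ) : Prop where
  smooth : ContDiff ℝ smoothExp ψ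
  compact : HasCompactSupport ψ
  subset : tsupport ψ ⊆ (halfSpace : Set E3)

lemma isOpen_hs : IsOpen (halfSpace : Set E3) := halfSpace.isOpen

lemma measurableSet_hs : MeasurableSet (halfSpace : Set E3) := isOpen_hs.measurableSet

lemma mem_hs {x : E3} : x ∈ (halfSpace : Set E3) ↔ 0 < x 2 := Iff.rfl

lemma isTest_coe (ψ : 𝓓(halfSpace, ℝ)) : IsTest ψ :=
  ⟨ψ.contDiff, ψ.hasCompactSupport, ψ.tsupport_subset⟩

/-- The bundled test function. -/
def IsTest.toTestFunction {ψ : E3 → ℝ} (h : IsTest ψ) : 𝓓(halfSpace, ℝ) :=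
  ⟨ψ, h.smooth, h.compact, h.subset⟩

lemma IsTest.coe_toTestFunction {ψ : E3 → ℝ} (h : IsTest ψ) : ⇑h.toTestFunction = ψ := rfl

lemma IsTest.continuous {ψ : E3 → ℝ} (h : IsTest ψ) : Continuous ψ := h.smooth.continuous

lemma IsTest.differentiable {ψ : E3 → ℝ} (h : IsTest ψ) : Differentiable ℝ ψ :=
  h.smooth.differentiable (by simp)

lemma IsTest.zero : IsTest (fun _ => 0) :=
  ⟨contDiff_const, HasCompactSupport.zero, by
    have : tsupport (fun _ : E3 => (0 : ℝ)) = ∅ := by simp [tsupport, Function.support]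
    rw [this]; exact empty_subset _⟩

lemma IsTest.add {ψ χ : E3 → ℝ} (h : IsTest ψ) (h' : IsTest χ) : IsTest (fun x => ψ x + χ x) :=
  ⟨h.smooth.add h'.smooth, h.compact.add h'.compact,
    (tsupport_add ψ χ).trans (union_subset h.subset h'.subset)⟩

lemma IsTest.neg {ψ : E3 → ℝ} (h : IsTest ψ) : IsTest (fun x => -ψ x) :=
  ⟨h.smooth.neg, h.compact.neg, by
    have : tsupport (fun x => -ψ x) = tsupport ψ := by
      simp only [tsupport]; congr 1; ext x; simp
    rw [this]; exact h.subset⟩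

lemma IsTest.sum {ι : Type*} (s : Finset ι) {ψ : ι → E3 → ℝ} (h : ∀ i ∈ s, IsTest (ψ i)) :
    IsTest (fun x => ∑ i ∈ s, ψ i x) := by
  classical
  induction s using Finset.induction_on with
  | empty => simpa using IsTest.zero
  | insert a s ha ih =>
    simp only [Finset.sum_insert ha]
    exact (h a (Finset.mem_insert_self a s)).add
      (ih fun i hi => h i (Finset.mem_insert_of_mem hi))

lemma IsTest.eventually_zero {ψ : E3 → ℝ} (h : IsTest ψ) {x : E3}
    (hx : x ∉ (halfSpace : Set E3)) : ψ =ᶠ[𝓝 x] 0 :=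
  notMem_tsupport_iff_eventuallyEq.mp fun hx' => hx (h.subset hx')

lemma IsTest.eq_zero {ψ : E3 → ℝ} (h : IsTest ψ) {x : E3}
    (hx : x ∉ (halfSpace : Set E3)) : ψ x = 0 := (h.eventually_zero hx).eq_of_nhds

/-- The factor may blow up at the boundary, as `1/φ` and `1/z` do: near a point outside the
half-space `ψ`, and with it the product, vanishes identically. -/
lemma IsTest.mul_smoothOn {a ψ : E3 → ℝ} (h : IsTest ψ)
    (ha : ContDiffOn ℝ smoothExp a halfSpace) : IsTest (fun x => a x * ψ x) := by
  refine ⟨contDiff_iff_contDiffAt.mpr fun x => ?_, h.compact.mul_left, ?_⟩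
  · by_cases hx : x ∈ (halfSpace : Set E3)
    · exact (ha.contDiffAt (isOpen_hs.mem_nhds hx)).mul h.smooth.contDiffAt
    · have : (fun x => a x * ψ x) =ᶠ[𝓝 x] fun _ => 0 := by
        filter_upwards [h.eventually_zero hx] with y hy
        simp [hy]
      exact contDiffAt_const.congr_of_eventuallyEq this
  · exact (tsupport_mul_subset_right (f := a) (g := ψ)).trans h.subset

lemma IsTest.mul {a ψ : E3 → ℝ} (h : IsTest ψ) (ha : ContDiff ℝ smoothExp a) :
    IsTest (fun x => a x * ψ x) := h.mul_smoothOn ha.contDiffOn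

lemma pd_eq_zero_of_eventually {i : Fin 3} {ψ : E3 → ℝ} {x : E3} (h : ψ =ᶠ[𝓝 x] 0) :
    pd i ψ x = 0 := by
  have := h.fderiv_eq (𝕜 := ℝ)
  simp [pd, this]

lemma IsTest.pd_eq_zero {ψ : E3 → ℝ} (h : IsTest ψ) (i : Fin 3) {x : E3}
    (hx : x ∉ (halfSpace : Set E3)) : pd i ψ x = 0 :=
  pd_eq_zero_of_eventually (h.eventually_zero hx)

lemma contDiff_pd {ψ : E3 → ℝ} (h : ContDiff ℝ smoothExp ψ) (i : Fin 3) :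
    ContDiff ℝ smoothExp (pd i ψ) := by
  have h1 : ContDiff ℝ smoothExp (fderiv ℝ ψ) := h.fderiv_right (by simp)
  exact h1.clm_apply contDiff_const

lemma hasCompactSupport_pd {ψ : E3 → ℝ} (h : HasCompactSupport ψ) (i : Fin 3) :
    HasCompactSupport (pd i ψ) := h.fderiv_apply (𝕜 := ℝ) _

lemma tsupport_pd_subset (ψ : E3 → ℝ) (i : Fin 3) : tsupport (pd i ψ) ⊆ tsupport ψ :=
  tsupport_fderiv_apply_subset ℝ _

lemma IsTest.pd {ψ : E3 → ℝ} (h : IsTest ψ) (i : Fin 3) : IsTest (pd i ψ) :=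
  ⟨contDiff_pd h.smooth i, hasCompactSupport_pd h.compact i,
    (tsupport_pd_subset ψ i).trans h.subset⟩

lemma pd_add {ψ χ : E3 → ℝ} {x : E3} (i : Fin 3) (h : DifferentiableAt ℝ ψ x)
    (h' : DifferentiableAt ℝ χ x) :
    ConormalEuler.pd i (fun y => ψ y + χ y) x = ConormalEuler.pd i ψ x + ConormalEuler.pd i χ x := by
  simp only [ConormalEuler.pd]
  rw [show (fun y => ψ y + χ y) = ψ + χ from rfl, fderiv_add h h']
  rfl

lemma pd_neg {ψ : E3 → ℝ} {x : E3} (i : Fin 3) :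
    ConormalEuler.pd i (fun y => -ψ y) x = -ConormalEuler.pd i ψ x := by
  simp only [ConormalEuler.pd]
  rw [show (fun y => -ψ y) = -ψ from rfl, fderiv_neg]
  rfl

lemma pd_mul {a ψ : E3 → ℝ} {x : E3} (i : Fin 3) (ha : DifferentiableAt ℝ a x)
    (h : DifferentiableAt ℝ ψ x) :
    ConormalEuler.pd i (fun y => a y * ψ y) x
      = ConormalEuler.pd i a x * ψ x + a x * ConormalEuler.pd i ψ x := by
  simp only [ConormalEuler.pd]
  rw [show (fun y => a y * ψ y) = a * ψ from rfl, fderiv_mul ha h]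
  simp; ring

lemma differentiableAt_of_smoothOn {a : E3 → ℝ} (ha : ContDiffOn ℝ smoothExp a halfSpace) {x : E3}
    (hx : x ∈ (halfSpace : Set E3)) : DifferentiableAt ℝ a x :=
  (ha.contDiffAt (isOpen_hs.mem_nhds hx)).differentiableAt (by simp)

lemma IsTest.pd_mul_smoothOn {a ψ : E3 → ℝ} (h : IsTest ψ)
    (ha : ContDiffOn ℝ smoothExp a halfSpace) (i : Fin 3) (x : E3) :
    ConormalEuler.pd i (fun y => a y * ψ y) x
      = ConormalEuler.pd i a x * ψ x + a x * ConormalEuler.pd i ψ x := by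
  by_cases hx : x ∈ (halfSpace : Set E3)
  · exact pd_mul i (differentiableAt_of_smoothOn ha hx) (h.differentiable x)
  · rw [(h.mul_smoothOn ha).pd_eq_zero i hx, h.pd_eq_zero i hx, h.eq_zero hx]
    simp

lemma pd_comm {ψ : E3 → ℝ} (h : ContDiff ℝ smoothExp ψ) (i j : Fin 3) :
    ConormalEuler.pd i (ConormalEuler.pd j ψ) = ConormalEuler.pd j (ConormalEuler.pd i ψ) := by
  funext x
  have hs : IsSymmSndFDerivAt ℝ ψ x :=
    h.contDiffAt.isSymmSndFDerivAt (by simp [minSmoothness_of_isRCLikeNormedField]; norm_cast)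
  have hd : DifferentiableAt ℝ (fderiv ℝ ψ) x :=
    ((h.fderiv_right (m := smoothExp) (by simp)).differentiable (by simp)) x
  have key : ∀ k l : Fin 3, ConormalEuler.pd k (ConormalEuler.pd l ψ) x
      = fderiv ℝ (fderiv ℝ ψ) x (basisVec k) (basisVec l) := by
    intro k l
    have : ConormalEuler.pd l ψ = fun y => fderiv ℝ ψ y (basisVec l) := rfl
    rw [ConormalEuler.pd, this, fderiv_clm_apply hd (differentiableAt_const _)]
    simp
  rw [key, key]
  exact hs _ _

lemma smoothOn_pd {a : E3 → ℝ} (ha : ContDiffOn ℝ smoothExp a halfSpace) (i : Fin 3) :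
    ContDiffOn ℝ smoothExp (ConormalEuler.pd i a) halfSpace := by
  have h1 : ContDiffOn ℝ smoothExp (fderiv ℝ a) halfSpace :=
    ha.fderiv_of_isOpen isOpen_hs (by simp)
  exact h1.clm_apply contDiffOn_const

/-! ### Weights -/

/-- Weights that are smooth in the half-space, where `wᵢ` only depends on the `i`-th coordinate. -/
structure GoodWeight (w : Fin 3 → E3 → ℝ) : Prop where
  smooth : ∀ i, ContDiffOn ℝ smoothExp (w i) halfSpace
  pd_eq_zero : ∀ i j, i ≠ j → ∀ x ∈ (halfSpace : Set E3), ConormalEuler.pd j (w i) x = 0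

/-- The function `q = 1 / (1 + z)`. -/
def qf (x : E3) : ℝ := 1 / (1 + x 2)

/-- A polynomial in `q = 1 / (1 + z)`. -/
def polyQ (P : Polynomial ℝ) (x : E3) : ℝ := P.eval (qf x)

lemma smoothOn_qf : ContDiffOn ℝ smoothExp qf halfSpace := by
  refine ContDiffOn.div contDiffOn_const (by fun_prop) fun x hx => ?_
  have := mem_hs.mp hx
  positivity

lemma smoothOn_polyQ (P : Polynomial ℝ) : ContDiffOn ℝ smoothExp (polyQ P) halfSpace := by
  have h : ContDiff ℝ smoothExp (fun t : ℝ => P.eval t) := by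
    simpa using P.contDiff_aeval (𝕜 := ℝ) smoothExp
  exact h.comp_contDiffOn smoothOn_qf

lemma hasFDerivAt_coord (i : Fin 3) (x : E3) :
    HasFDerivAt (fun y : E3 => y i) (EuclideanSpace.proj i : E3 →L[ℝ] ℝ) x :=
  (EuclideanSpace.proj i : E3 →L[ℝ] ℝ).hasFDerivAt

lemma basisVec_apply (i j : Fin 3) : basisVec i j = if j = i then 1 else 0 := by
  simp [basisVec]

lemma pd_comp_z {g : ℝ → ℝ} {g' : ℝ} {x : E3} (hg : HasDerivAt g g' (x 2)) (i : Fin 3) :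
    ConormalEuler.pd i (fun y : E3 => g (y 2)) x = if i = 2 then g' else 0 := by
  have h := hg.comp_hasFDerivAt x (hasFDerivAt_coord 2 x)
  simp only [ConormalEuler.pd]
  rw [show (fun y : E3 => g (y 2)) = g ∘ fun y : E3 => y 2 from rfl, h.fderiv]
  fin_cases i <;> simp [basisVec]

/-- Since `∂_z q = -q²`, polynomials in `q` are closed under `∂_z`. They are bounded because `0 < q
< 1`, and they contain `φ = 1 - q` and `φ' = q²`. Every coefficient produced by commuting
derivatives lies in this class. -/
lemma pd_polyQ (P : Polynomial ℝ) {x : E3} (hx : x ∈ (halfSpace : Set E3)) (i : Fin 3) :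
    ConormalEuler.pd i (polyQ P) x
      = if i = 2 then polyQ (-(Polynomial.X ^ 2 * Polynomial.derivative P)) x else 0 := by
  have hx' : (1 + x 2) ≠ 0 := by have := mem_hs.mp hx; positivity
  have h0 : HasDerivAt (fun t : ℝ => 1 + t) 1 (x 2) := (hasDerivAt_id _).const_add 1
  have h1 : HasDerivAt (fun t : ℝ => 1 / (1 + t)) (-(1 / (1 + x 2)) ^ 2) (x 2) := by
    have h := (h0.inv hx').congr_deriv (g' := -(1 / (1 + x 2)) ^ 2) (by
      rw [div_pow, one_pow, neg_div])
    refine h.congr_of_eventuallyEq (Eventually.of_forall fun t => ?_)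
    simp
  have h2 := (P.hasDerivAt (1 / (1 + x 2))).comp (x 2) h1
  have h3 := pd_comp_z (g := fun t => P.eval (1 / (1 + t))) h2 i
  simp only [polyQ, qf] at h3 ⊢
  rw [show polyQ P = fun y : E3 => P.eval (1 / (1 + y 2)) from rfl, h3]
  split_ifs
  · simp; ring
  · rfl

lemma conormalWeight_eq (i : Fin 3) {x : E3} (hx : x ∈ (halfSpace : Set E3)) :
    conormalWeight i x = polyQ (if i = 2 then 1 - Polynomial.X else 1) x := by
  have hx' : (1 + x 2) ≠ 0 := by have := mem_hs.mp hx; positivity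
  fin_cases i <;> simp [conormalWeight, polyQ, qf]
  rw [div_eq_iff hx', sub_mul, inv_mul_cancel₀ hx']; ring

lemma smoothOn_conormalWeight (i : Fin 3) :
    ContDiffOn ℝ smoothExp (conormalWeight i) halfSpace :=
  (smoothOn_polyQ _).congr fun _ hx => conormalWeight_eq i hx

lemma pd_congr {a b : E3 → ℝ} (h : EqOn a b halfSpace) {x : E3} (hx : x ∈ (halfSpace : Set E3))
    (i : Fin 3) : ConormalEuler.pd i a x = ConormalEuler.pd i b x := by
  have : a =ᶠ[𝓝 x] b := by
    filter_upwards [isOpen_hs.mem_nhds hx] with y hy using h hy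
  simp [ConormalEuler.pd, this.fderiv_eq]

lemma pd_conormalWeight (i j : Fin 3) {x : E3} (hx : x ∈ (halfSpace : Set E3)) :
    ConormalEuler.pd j (conormalWeight i) x = if i = 2 ∧ j = 2 then qf x ^ 2 else 0 := by
  rw [pd_congr (fun y hy => conormalWeight_eq i hy) hx, pd_polyQ _ hx]
  by_cases hi : i = 2 <;> by_cases hj : j = 2 <;> simp [hi, hj, polyQ]

lemma goodWeight_conormal : GoodWeight conormalWeight :=
  ⟨smoothOn_conormalWeight, fun i j hij x hx => by
    rw [pd_conormalWeight i j hx, if_neg]; rintro ⟨rfl, rfl⟩; exact hij rfl⟩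

lemma goodWeight_euclidean : GoodWeight euclideanWeight :=
  ⟨fun _ => contDiffOn_const, fun i j _ x _ => by
    rw [show euclideanWeight i = fun _ => 1 from rfl]; simp [ConormalEuler.pd]⟩

lemma qf_pos {x : E3} (hx : x ∈ (halfSpace : Set E3)) : 0 < qf x := by
  have := mem_hs.mp hx; unfold qf; positivity

lemma qf_lt_one {x : E3} (hx : x ∈ (halfSpace : Set E3)) : qf x < 1 := by
  have := mem_hs.mp hx; unfold qf; rw [div_lt_one (by positivity)]; linarith

lemma polyQ_bound (P : Polynomial ℝ) :
    ∃ C : ℝ≥0, ∀ x ∈ (halfSpace : Set E3), |polyQ P x| ≤ C := by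
  obtain ⟨C, hC⟩ := (isCompact_Icc (a := (0 : ℝ)) (b := 1)).exists_bound_of_continuousOn
    (f := fun t => P.eval t) P.continuous.continuousOn
  refine ⟨C.toNNReal, fun x hx => ?_⟩
  exact (hC _ ⟨(qf_pos hx).le, (qf_lt_one hx).le⟩).trans (Real.le_coe_toNNReal C)

lemma conormalWeight_pos (i : Fin 3) {x : E3} (hx : x ∈ (halfSpace : Set E3)) :
    0 < conormalWeight i x := by
  have := mem_hs.mp hx
  fin_cases i <;> simp [conormalWeight]; positivity

lemma conormalWeight_le_one (i : Fin 3) {x : E3} (hx : x ∈ (halfSpace : Set E3)) :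
    conormalWeight i x ≤ 1 := by
  have := mem_hs.mp hx
  fin_cases i <;> simp [conormalWeight]
  rw [div_le_one (by positivity)]; linarith

/-! ### Transposes of vector fields -/

lemma transposeField_eq (w : Fin 3 → E3 → ℝ) (i : Fin 3) (ψ : E3 → ℝ) :
    transposeField w i ψ = fun x => -ConormalEuler.pd i (fun y => w i y * ψ y) x := rfl

section Transpose

variable {w : Fin 3 → E3 → ℝ}

lemma IsTest.transposeField {ψ : E3 → ℝ} (h : IsTest ψ) (hw : GoodWeight w) (i : Fin 3) :
    IsTest (transposeField w i ψ) :=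
  ((h.mul_smoothOn (hw.smooth i)).pd i).neg

/-- For `i ≠ j` the weight `wᵢ` does not depend on the `j`-th coordinate, so both sides are `∂ᵢ∂ⱼ(wᵢ
wⱼ ψ)`. -/
lemma transposeField_comm (hw : GoodWeight w) {ψ : E3 → ℝ} (h : IsTest ψ) (i j : Fin 3) :
    transposeField w i (transposeField w j ψ) = transposeField w j (transposeField w i ψ) := by
  by_cases hij : i = j
  · rw [hij]
  have key : ∀ i j : Fin 3, i ≠ j → transposeField w i (transposeField w j ψ)
      = ConormalEuler.pd i (ConormalEuler.pd j (fun y => w i y * (w j y * ψ y))) := by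
    intro i j hij
    have ht := h.mul_smoothOn (hw.smooth j)
    have h1 : ConormalEuler.pd j (fun y => w i y * (w j y * ψ y))
        = fun x => w i x * ConormalEuler.pd j (fun y => w j y * ψ y) x := by
      funext x
      rw [ht.pd_mul_smoothOn (hw.smooth i) j x]
      by_cases hx : x ∈ (halfSpace : Set E3)
      · rw [hw.pd_eq_zero i j hij x hx]; simp
      · rw [ht.eq_zero hx]; simp
    rw [h1]
    funext x
    rw [transposeField_eq, transposeField_eq]
    simp only [mul_neg]
    rw [pd_neg, neg_neg]
  rw [key i j hij, key j i (Ne.symm hij),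
    pd_comm (((h.mul_smoothOn (hw.smooth j)).mul_smoothOn (hw.smooth i))).smooth]
  congr 2
  funext y; ring

lemma IsTest.iterate_transposeField {ψ : E3 → ℝ} (h : IsTest ψ) (hw : GoodWeight w) (i : Fin 3)
    (n : ℕ) : IsTest ((ConormalEuler.transposeField w i)^[n] ψ) := by
  induction n with
  | zero => exact h
  | succ n ih => rw [Function.iterate_succ_apply']; exact ih.transposeField hw i

lemma IsTest.transposeIter {ψ : E3 → ℝ} (h : IsTest ψ) (hw : GoodWeight w) (α : Fin 3 → ℕ) :
    IsTest (transposeIter w α ψ) :=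
  ((h.iterate_transposeField hw 0 _).iterate_transposeField hw 1 _).iterate_transposeField hw 2 _

lemma iterate_transposeField_comm (hw : GoodWeight w) {ψ : E3 → ℝ} (h : IsTest ψ) (i j : Fin 3)
    (n : ℕ) : (transposeField w i)^[n] (transposeField w j ψ)
      = transposeField w j ((transposeField w i)^[n] ψ) := by
  induction n with
  | zero => rfl
  | succ n ih =>
    rw [Function.iterate_succ_apply', Function.iterate_succ_apply', ih,
      transposeField_comm hw (h.iterate_transposeField hw i n)]

lemma transposeIter_transposeField (hw : GoodWeight w) {ψ : E3 → ℝ} (h : IsTest ψ) (α : Fin 3 → ℕ)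
    (i : Fin 3) : transposeIter w α (transposeField w i ψ)
      = transposeField w i (transposeIter w α ψ) := by
  unfold transposeIter
  rw [iterate_transposeField_comm hw h, iterate_transposeField_comm hw
    (h.iterate_transposeField hw 0 _), iterate_transposeField_comm hw
    ((h.iterate_transposeField hw 0 _).iterate_transposeField hw 1 _)]

lemma transposeIter_add_single (hw : GoodWeight w) {ψ : E3 → ℝ} (h : IsTest ψ) (α : Fin 3 → ℕ)
    (i : Fin 3) : transposeIter w (α + Pi.single i 1) ψ
      = transposeIter w α (transposeField w i ψ) := by
  have h0 := h.iterate_transposeField hw 0 (α 0)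
  have h1 := h0.iterate_transposeField hw 1 (α 1)
  rw [transposeIter_transposeField hw h]
  fin_cases i
  · simp only [transposeIter]
    simp only [Pi.add_apply, Pi.single_apply]
    simp [Function.iterate_succ_apply']
    rw [iterate_transposeField_comm hw h0, iterate_transposeField_comm hw h1]
  · simp only [transposeIter]
    simp only [Pi.add_apply, Pi.single_apply]
    simp [Function.iterate_succ_apply']
    rw [iterate_transposeField_comm hw h1]
  · simp only [transposeIter]
    simp only [Pi.add_apply, Pi.single_apply]
    simp [Function.iterate_succ_apply']

lemma transposeIter_single (i : Fin 3) (ψ : E3 → ℝ) :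
    transposeIter w (Pi.single i 1) ψ = transposeField w i ψ := by
  fin_cases i <;> simp [transposeIter]

lemma exists_add_single {α : Fin 3 → ℕ} {n : ℕ} (h : ∑ i, α i = n + 1) :
    ∃ (β : Fin 3 → ℕ) (i : Fin 3), α = β + Pi.single i 1 ∧ ∑ i, β i = n := by
  have : ∃ i, α i ≠ 0 := by
    by_contra! hc
    simp [hc] at h
  obtain ⟨i, hi⟩ := this
  refine ⟨α - Pi.single i 1, i, ?_, ?_⟩
  · funext j
    by_cases hj : j = i
    · subst hj; simp; omega
    · simp [hj]
  · have : α = (α - Pi.single i 1) + Pi.single i 1 := by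
      funext j
      by_cases hj : j = i
      · subst hj; simp; omega
      · simp [hj]
    rw [this] at h
    simp only [Pi.add_apply, Finset.sum_add_distrib] at h
    simp only [Finset.sum_pi_single', Finset.mem_univ, if_true] at h
    omega

/-- Commutation makes multi-indices additive although `transposeIter` fixes the order of the fields.
This is what allows weak derivatives to be composed and peeled off in any order. -/
lemma transposeIter_add (hw : GoodWeight w) (α β : Fin 3 → ℕ) :
    ∀ {ψ : E3 → ℝ}, IsTest ψ →
      transposeIter w (α + β) ψ = transposeIter w α (transposeIter w β ψ) := by
  obtain ⟨n, hn⟩ : ∃ n, ∑ i, β i = n := ⟨_, rfl⟩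
  induction n generalizing β with
  | zero =>
    have : β = 0 := by funext i; simpa using (Finset.sum_eq_zero_iff.mp hn) i
    subst this
    intro ψ _; rfl
  | succ n ih =>
    obtain ⟨γ, i, rfl, hγ⟩ := exists_add_single hn
    intro ψ h
    rw [← add_assoc, transposeIter_add_single hw h, ih γ hγ (h.transposeField hw i),
      transposeIter_add_single hw h]

end Transpose

end ConormalEuler

end

noncomputable section

namespace ConormalEuler

/-! ### Weak derivatives against unbundled test functions -/

/-- Local integrability on the half-space. -/
abbrev LocInt (f : E3 → ℝ) : Prop := LocallyIntegrableOn f (halfSpace : Set E3)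

lemma LocInt.integrableOn {f : E3 → ℝ} (h : LocInt f) {K : Set E3} (hK : IsCompact K)
    (hKs : K ⊆ halfSpace) : IntegrableOn f K :=
  h.integrableOn_compact_subset hKs hK

lemma LocInt.congr {f g : E3 → ℝ} (h : LocInt f) (hfg : f =ᵐ[hsMeasure] g) : LocInt g := by
  intro x hx
  obtain ⟨U, hU, hi⟩ := h x hx
  refine ⟨U ∩ halfSpace, inter_mem hU self_mem_nhdsWithin, ?_⟩
  exact (hi.mono_set inter_subset_left).congr
    (ae_restrict_of_ae_restrict_of_subset inter_subset_right hfg)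

lemma locInt_of_forall_compact {f : E3 → ℝ}
    (h : ∀ K : Set E3, IsCompact K → K ⊆ halfSpace → IntegrableOn f K) : LocInt f :=
  (locallyIntegrableOn_iff isOpen_hs.isLocallyClosed).mpr fun K hK hc => h K hc hK

lemma LocInt.mul_continuousOn {f a : E3 → ℝ} (h : LocInt f) (ha : ContinuousOn a halfSpace) :
    LocInt (fun x => a x * f x) :=
  locInt_of_forall_compact fun _ hK hKs =>
    (h.integrableOn hK hKs).continuousOn_mul (ha.mono hKs) hK

lemma LocInt.add {f g : E3 → ℝ} (h : LocInt f) (h' : LocInt g) : LocInt (fun x => f x + g x) :=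
  LocallyIntegrableOn.add h h'

lemma LocInt.neg {f : E3 → ℝ} (h : LocInt f) : LocInt (fun x => -f x) :=
  LocallyIntegrableOn.neg h

lemma LocInt.integrable_mul {f ψ : E3 → ℝ} (h : LocInt f) (hψ : IsTest ψ) :
    Integrable (fun x => f x * ψ x) hsMeasure := by
  have h1 : IntegrableOn (fun x => f x * ψ x) (tsupport ψ) :=
    (h.integrableOn hψ.compact hψ.subset).mul_continuousOn hψ.continuous.continuousOn hψ.compact
  have h2 : Integrable (fun x => f x * ψ x) :=
    (integrableOn_iff_integrable_of_support_subset (fun x hx => subset_tsupport ψ (by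
      intro h0; apply hx; simp [h0]))).mp h1
  exact h2.restrict

lemma isWeakDeriv_iff {w : Fin 3 → E3 → ℝ} {α : Fin 3 → ℕ} {f g : E3 → ℝ} :
    IsWeakDeriv w α f g ↔ LocInt f ∧ LocInt g ∧ ∀ ψ, IsTest ψ →
      ∫ x, f x * transposeIter w α ψ x ∂hsMeasure = ∫ x, g x * ψ x ∂hsMeasure := by
  constructor
  · rintro ⟨h1, h2, h3⟩
    refine ⟨h1, h2, fun ψ hψ => ?_⟩
    have := h3 hψ.toTestFunction
    simp only [hψ.coe_toTestFunction, smul_eq_mul] at this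
    simpa only [mul_comm] using this
  · rintro ⟨h1, h2, h3⟩
    refine ⟨h1, h2, fun ψ => ?_⟩
    have := h3 ψ (isTest_coe ψ)
    simp only [smul_eq_mul]
    simpa only [mul_comm] using this

lemma ae_eq_of_forall_test {f g : E3 → ℝ} (hf : LocInt f) (hg : LocInt g)
    (h : ∀ ψ, IsTest ψ → ∫ x, f x * ψ x ∂hsMeasure = ∫ x, g x * ψ x ∂hsMeasure) :
    f =ᵐ[hsMeasure] g := by
  have hfg : LocInt (fun x => f x - g x) := LocallyIntegrableOn.sub hf hg
  have := isOpen_hs.ae_eq_zero_of_integral_contDiff_smul_eq_zero (μ := volume) hfg (by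
    intro ψ h1 h2 h3
    have hψ : IsTest ψ := ⟨h1, h2, h3⟩
    have e : ∫ x, ψ x • (f x - g x) = ∫ x, ψ x • (f x - g x) ∂hsMeasure := by
      symm
      apply setIntegral_eq_integral_of_forall_compl_eq_zero
      intro x hx
      simp [hψ.eq_zero hx]
    rw [e]
    have : (fun x => ψ x • (f x - g x)) = fun x => f x * ψ x - g x * ψ x := by
      funext x; simp; ring
    rw [this, integral_sub (hf.integrable_mul hψ) (hg.integrable_mul hψ), h ψ hψ, sub_self])
  rw [EventuallyEq, ae_restrict_iff' measurableSet_hs]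
  filter_upwards [this] with x hx hxs
  linarith [hx hxs]

lemma integral_mul_congr {f f' : E3 → ℝ} (h : f =ᵐ[hsMeasure] f') (ψ : E3 → ℝ) :
    ∫ x, f x * ψ x ∂hsMeasure = ∫ x, f' x * ψ x ∂hsMeasure :=
  integral_congr_ae (h.mul (EventuallyEq.refl _ ψ))

section General

variable {w : Fin 3 → E3 → ℝ} {α β : Fin 3 → ℕ} {f g h : E3 → ℝ}

lemma IsWeakDeriv.unique {g' : E3 → ℝ} (h1 : IsWeakDeriv w α f g) (h2 : IsWeakDeriv w α f g') :
    g =ᵐ[hsMeasure] g' := by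
  rw [isWeakDeriv_iff] at h1 h2
  exact ae_eq_of_forall_test h1.2.1 h2.2.1 fun ψ hψ => by rw [← h1.2.2 ψ hψ, h2.2.2 ψ hψ]

lemma IsWeakDeriv.congr {f' g' : E3 → ℝ} (h : IsWeakDeriv w α f g) (hf : f =ᵐ[hsMeasure] f')
    (hg : g =ᵐ[hsMeasure] g') : IsWeakDeriv w α f' g' := by
  rw [isWeakDeriv_iff] at h ⊢
  refine ⟨h.1.congr hf, h.2.1.congr hg, fun ψ hψ => ?_⟩
  rw [← integral_mul_congr hf, ← integral_mul_congr hg]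
  exact h.2.2 ψ hψ

lemma IsWeakDeriv.comp (hw : GoodWeight w) (h1 : IsWeakDeriv w α f g)
    (h2 : IsWeakDeriv w β g h) : IsWeakDeriv w (α + β) f h := by
  rw [isWeakDeriv_iff] at h1 h2 ⊢
  refine ⟨h1.1, h2.2.1, fun ψ hψ => ?_⟩
  rw [transposeIter_add hw _ _ hψ, h1.2.2 _ (hψ.transposeIter hw β), h2.2.2 ψ hψ]

/-- The transpose of `Y^β` applied to a test function is again one, so it may be used to test `g =
Y^α f`. Norm bounds give each derivative of `f` separately; this turns them into successive
derivatives. -/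
lemma IsWeakDeriv.of_comp (hw : GoodWeight w) (h1 : IsWeakDeriv w α f g)
    (h2 : IsWeakDeriv w (α + β) f h) : IsWeakDeriv w β g h := by
  rw [isWeakDeriv_iff] at h1 h2 ⊢
  refine ⟨h1.2.1, h2.2.1, fun ψ hψ => ?_⟩
  rw [← h2.2.2 ψ hψ, transposeIter_add hw _ _ hψ, h1.2.2 _ (hψ.transposeIter hw β)]

lemma IsWeakDeriv.refl (hf : LocInt f) : IsWeakDeriv w 0 f f :=
  isWeakDeriv_iff.mpr ⟨hf, hf, fun _ _ => rfl⟩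

lemma IsWeakDeriv.add {f' g' : E3 → ℝ} (hw : GoodWeight w) (h1 : IsWeakDeriv w α f g)
    (h2 : IsWeakDeriv w α f' g') :
    IsWeakDeriv w α (fun x => f x + f' x) (fun x => g x + g' x) := by
  rw [isWeakDeriv_iff] at h1 h2 ⊢
  refine ⟨h1.1.add h2.1, h1.2.1.add h2.2.1, fun ψ hψ => ?_⟩
  simp only [add_mul]
  rw [integral_add (h1.1.integrable_mul (hψ.transposeIter hw α))
    (h2.1.integrable_mul (hψ.transposeIter hw α)), integral_add (h1.2.1.integrable_mul hψ)
    (h2.2.1.integrable_mul hψ), h1.2.2 ψ hψ, h2.2.2 ψ hψ]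

lemma IsWeakDeriv.neg (h1 : IsWeakDeriv w α f g) :
    IsWeakDeriv w α (fun x => -f x) (fun x => -g x) := by
  rw [isWeakDeriv_iff] at h1 ⊢
  refine ⟨h1.1.neg, h1.2.1.neg, fun ψ hψ => ?_⟩
  simp only [neg_mul, integral_neg, h1.2.2 ψ hψ]

lemma IsWeakDeriv.sub {f' g' : E3 → ℝ} (hw : GoodWeight w) (h1 : IsWeakDeriv w α f g)
    (h2 : IsWeakDeriv w α f' g') :
    IsWeakDeriv w α (fun x => f x - f' x) (fun x => g x - g' x) := by
  simpa only [sub_eq_add_neg] using h1.add hw h2.neg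

end General

/-- `∂ᵢ f = g` in the sense of distributions on the half-space. -/
structure WD (i : Fin 3) (f g : E3 → ℝ) : Prop where
  left : LocInt f
  right : LocInt g
  eq : ∀ ψ, IsTest ψ → ∫ x, f x * pd i ψ x ∂hsMeasure = -∫ x, g x * ψ x ∂hsMeasure

lemma setIntegral_hs_congr {f g : E3 → ℝ} (h : EqOn f g halfSpace) :
    ∫ x, f x ∂hsMeasure = ∫ x, g x ∂hsMeasure := setIntegral_congr_fun measurableSet_hs h

lemma ae_hs_of_forall {P : E3 → Prop} (h : ∀ x ∈ (halfSpace : Set E3), P x) :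
    ∀ᵐ x ∂hsMeasure, P x := by
  rw [ae_restrict_iff' measurableSet_hs]
  exact Eventually.of_forall h

section WDLemmas

variable {i : Fin 3} {f g f' g' : E3 → ℝ}

lemma WD.congr (h : WD i f g) (hf : f =ᵐ[hsMeasure] f') (hg : g =ᵐ[hsMeasure] g') :
    WD i f' g' := by
  refine ⟨h.left.congr hf, h.right.congr hg, fun ψ hψ => ?_⟩
  rw [← integral_mul_congr hf, ← integral_mul_congr hg]
  exact h.eq ψ hψ

lemma WD.unique (h : WD i f g) (h' : WD i f g') : g =ᵐ[hsMeasure] g' :=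
  ae_eq_of_forall_test h.right h'.right fun ψ hψ => by
    have := h.eq ψ hψ
    rw [h'.eq ψ hψ] at this
    linarith

lemma WD.add (h : WD i f g) (h' : WD i f' g') :
    WD i (fun x => f x + f' x) (fun x => g x + g' x) := by
  refine ⟨h.left.add h'.left, h.right.add h'.right, fun ψ hψ => ?_⟩
  simp only [add_mul]
  rw [integral_add (h.left.integrable_mul (hψ.pd i)) (h'.left.integrable_mul (hψ.pd i)),
    integral_add (h.right.integrable_mul hψ) (h'.right.integrable_mul hψ), h.eq ψ hψ, h'.eq ψ hψ]
  ring

lemma WD.mul_smooth {a : E3 → ℝ} (h : WD i f g) (ha : ContDiffOn ℝ smoothExp a halfSpace) :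
    WD i (fun x => a x * f x) (fun x => a x * g x + pd i a x * f x) := by
  have ha' := smoothOn_pd ha i
  have l1 := h.left.mul_continuousOn ha.continuousOn
  have l2 := h.right.mul_continuousOn ha.continuousOn
  have l3 := h.left.mul_continuousOn ha'.continuousOn
  refine ⟨l1, l2.add l3, fun ψ hψ => ?_⟩
  have key := h.eq _ (hψ.mul_smoothOn ha)
  have e1 : ∀ x, f x * pd i (fun y => a y * ψ y) x
      = pd i a x * f x * ψ x + a x * f x * pd i ψ x := by
    intro x; rw [hψ.pd_mul_smoothOn ha i x]; ring
  simp only [e1] at key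
  rw [integral_add (l3.integrable_mul hψ) (l1.integrable_mul (hψ.pd i))] at key
  have e2 : ∀ x, g x * (a x * ψ x) = a x * g x * ψ x := fun x => by ring
  simp only [e2] at key
  simp only [add_mul]
  rw [integral_add (l2.integrable_mul hψ) (l3.integrable_mul hψ)]
  linarith

lemma WD.comm_euclidean : WD i f g ↔ IsWeakDeriv euclideanWeight (Pi.single i 1) f g := by
  rw [isWeakDeriv_iff]
  have e : ∀ ψ : E3 → ℝ, transposeIter euclideanWeight (Pi.single i 1) ψ = fun x => -pd i ψ x := by
    intro ψ
    rw [transposeIter_single, transposeField_eq]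
    simp [euclideanWeight]
  simp only [e, mul_neg, integral_neg]
  constructor
  · rintro ⟨h1, h2, h3⟩
    exact ⟨h1, h2, fun ψ hψ => by rw [h3 ψ hψ, neg_neg]⟩
  · rintro ⟨h1, h2, h3⟩
    exact ⟨h1, h2, fun ψ hψ => by rw [← h3 ψ hψ, neg_neg]⟩

lemma IsTest.transposeField_apply {ψ : E3 → ℝ} (hψ : IsTest ψ) (i : Fin 3) {x : E3}
    (hx : x ∈ (halfSpace : Set E3)) : ConormalEuler.transposeField conormalWeight i ψ x
      = -(conormalWeight i x * ConormalEuler.pd i ψ x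
        + (if i = 2 then qf x ^ 2 else 0) * ψ x) := by
  rw [transposeField_eq]
  simp only
  rw [hψ.pd_mul_smoothOn (smoothOn_conormalWeight i), pd_conormalWeight i i hx]
  simp only [and_self]; ring

lemma WD.conormal (h : WD i f g) :
    IsWeakDeriv conormalWeight (Pi.single i 1) f (fun x => conormalWeight i x * g x) := by
  rw [isWeakDeriv_iff]
  refine ⟨h.left, h.right.mul_continuousOn (smoothOn_conormalWeight i).continuousOn,
    fun ψ hψ => ?_⟩
  rw [transposeIter_single, transposeField_eq]
  have := h.eq _ (hψ.mul_smoothOn (smoothOn_conormalWeight i))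
  simp only [mul_neg, integral_neg, this, neg_neg]
  exact integral_congr_ae (Eventually.of_forall fun x => by simp only; ring)

lemma smoothOn_inv_conormalWeight (i : Fin 3) :
    ContDiffOn ℝ smoothExp (fun x => 1 / conormalWeight i x) halfSpace :=
  contDiffOn_const.div (smoothOn_conormalWeight i) fun _ hx => (conormalWeight_pos i hx).ne'

/-- The converse of `WD.conormal`. -/
lemma wd_of_conormal
    (h : IsWeakDeriv conormalWeight (Pi.single i 1) f g) :
    WD i f (fun x => 1 / conormalWeight i x * g x) := by
  rw [isWeakDeriv_iff] at h
  refine ⟨h.1, h.2.1.mul_continuousOn (smoothOn_inv_conormalWeight i).continuousOn,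
    fun ψ hψ => ?_⟩
  have ht := hψ.mul_smoothOn (smoothOn_inv_conormalWeight i)
  have := h.2.2 _ ht
  rw [transposeIter_single, transposeField_eq] at this
  have e : (fun y => conormalWeight i y * (1 / conormalWeight i y * ψ y)) = ψ := by
    funext y
    by_cases hy : y ∈ (halfSpace : Set E3)
    · have := (conormalWeight_pos i hy).ne'
      field_simp
    · simp [hψ.eq_zero hy]
  rw [e] at this
  simp only [mul_neg, integral_neg] at this
  have e2 : ∀ x, g x * (1 / conormalWeight i x * ψ x) = 1 / conormalWeight i x * g x * ψ x :=
    fun x => by ring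
  simp only [e2] at this
  linarith

end WDLemmas

/-! ### Local square integrability -/

/-- Local square integrability on the half-space. -/
def L2loc (f : E3 → ℝ) : Prop :=
  ∀ K : Set E3, IsCompact K → K ⊆ halfSpace → MemLp f 2 (volume.restrict K)

section L2locLemmas

variable {f g : E3 → ℝ}

lemma L2loc.locInt (h : L2loc f) : LocInt f :=
  locInt_of_forall_compact fun K hK hKs => by
    have : IsFiniteMeasure (volume.restrict K) :=
      ⟨by simpa using hK.measure_lt_top⟩
    exact (h K hK hKs).integrable (by norm_num)

lemma _root_.MeasureTheory.MemLp.l2loc (h : MemLp f 2 hsMeasure) : L2loc f := fun _ _ hKs =>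
  h.mono_measure (Measure.restrict_mono hKs le_rfl)

lemma l2loc_of_top (h : MemLp f ∞ hsMeasure) : L2loc f := fun K hK hKs => by
  have : IsFiniteMeasure (volume.restrict K) :=
    ⟨by simpa using hK.measure_lt_top⟩
  exact (h.mono_measure (Measure.restrict_mono hKs le_rfl)).mono_exponent le_top

lemma L2loc.congr (h : L2loc f) (hfg : f =ᵐ[hsMeasure] g) : L2loc g := fun K hK hKs =>
  (h K hK hKs).ae_eq (ae_restrict_of_ae_restrict_of_subset hKs hfg)

lemma L2loc.add (h : L2loc f) (h' : L2loc g) : L2loc (fun x => f x + g x) :=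
  fun K hK hKs => (h K hK hKs).add (h' K hK hKs)

lemma L2loc.neg (h : L2loc f) : L2loc (fun x => -f x) :=
  fun K hK hKs => (h K hK hKs).neg

lemma memLp_top_of_continuousOn {a : E3 → ℝ} {K : Set E3} (hK : IsCompact K)
    (ha : ContinuousOn a K) : MemLp a ∞ (volume.restrict K) := by
  obtain ⟨C, hC⟩ := hK.exists_bound_of_continuousOn ha
  exact memLp_top_of_bound (ha.aestronglyMeasurable hK.measurableSet) C
    ((ae_restrict_iff' hK.measurableSet).mpr (Eventually.of_forall hC))

lemma L2loc.mul_continuousOn {a : E3 → ℝ} (h : L2loc f) (ha : ContinuousOn a halfSpace) :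
    L2loc (fun x => a x * f x) := fun K hK hKs =>
  (h K hK hKs).mul' (memLp_top_of_continuousOn hK (ha.mono hKs))

lemma L2loc.mul (h : L2loc f) (h' : L2loc g) : LocInt (fun x => f x * g x) :=
  locInt_of_forall_compact fun K hK hKs => by
    have := (h K hK hKs).integrable_mul (h' K hK hKs)
    exact this

end L2locLemmas

end ConormalEuler

end

noncomputable section

namespace ConormalEuler

/-! ### Mollification in `L²` -/

lemma eLpNorm_two_sq {X F : Type*} [MeasurableSpace X] [NormedAddCommGroup F] (f : X → F)
    (μ : Measure X) : eLpNorm f 2 μ ^ 2 = ∫⁻ x, ‖f x‖ₑ ^ 2 ∂μ := by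
  have := eLpNorm_nnreal_pow_eq_lintegral (f := f) (μ := μ) (p := 2) (by norm_num)
  simpa using this

lemma le_of_sq_le_sq {a b : ℝ≥0∞} (h : a ^ 2 ≤ b ^ 2) : a ≤ b :=
  (ENNReal.pow_le_pow_left_iff (by norm_num)).mp h

/-- Cauchy-Schwarz for the measure `k dμ`, that is for the splitting `f k = (f √k) √k`. -/
lemma lintegral_mul_sq_le {X : Type*} [MeasurableSpace X] {μ : Measure X} {f k : X → ℝ≥0∞}
    (hf : AEMeasurable f μ) (hk : AEMeasurable k μ) :
    (∫⁻ x, f x * k x ∂μ) ^ 2 ≤ (∫⁻ x, f x ^ 2 * k x ∂μ) * ∫⁻ x, k x ∂μ := by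
  have h2 : (2 : ℝ).HolderConjugate 2 := Real.HolderConjugate.two_two
  have := ENNReal.lintegral_mul_le_Lp_mul_Lq μ h2 (f := fun x => f x * k x ^ (1 / 2 : ℝ))
    (g := fun x => k x ^ (1 / 2 : ℝ)) (hf.mul (hk.pow_const _)) (hk.pow_const _)
  have e0 : ∀ x, k x ^ (1 / 2 : ℝ) * k x ^ (1 / 2 : ℝ) = k x := by
    intro x
    rw [← ENNReal.rpow_add_of_nonneg _ _ (by norm_num) (by norm_num)]; norm_num
  have e1 : ∀ x, ((fun x => f x * k x ^ (1 / 2 : ℝ)) * fun x => k x ^ (1 / 2 : ℝ)) x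
      = f x * k x := by
    intro x
    simp only [Pi.mul_apply]
    rw [mul_assoc, e0]
  have e2 : ∀ x, (k x ^ (1 / 2 : ℝ)) ^ (2 : ℝ) = k x := by
    intro x; rw [← ENNReal.rpow_mul]; norm_num
  have e3 : ∀ x, (f x * k x ^ (1 / 2 : ℝ)) ^ (2 : ℝ) = f x ^ 2 * k x := by
    intro x; rw [ENNReal.mul_rpow_of_nonneg _ _ (by norm_num), e2]; norm_num
  simp only [e1, e2, e3] at this
  calc (∫⁻ x, f x * k x ∂μ) ^ 2
      ≤ ((∫⁻ x, f x ^ 2 * k x ∂μ) ^ (1 / 2 : ℝ) * (∫⁻ x, k x ∂μ) ^ (1 / 2 : ℝ)) ^ 2 := by gcongr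
    _ = _ := by
      rw [mul_pow, ← ENNReal.rpow_natCast, ← ENNReal.rpow_natCast, ← ENNReal.rpow_mul,
        ← ENNReal.rpow_mul]
      norm_num

/-- A nonnegative smooth kernel of integral one with support in the ball of radius `r`. -/
structure IsKernel (k : E3 → ℝ) (r : ℝ) : Prop where
  smooth : ContDiff ℝ smoothExp k
  compact : HasCompactSupport k
  nonneg : ∀ x, 0 ≤ k x
  integral_one : ∫ x, k x = 1
  supp : ∀ x, k x ≠ 0 → ‖x‖ ≤ r

/-- The convolution `k * F`. -/
def moll (k F : E3 → ℝ) (x : E3) : ℝ := ∫ t, F t * k (x - t)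

lemma moll_eq_convolution (k F : E3 → ℝ) :
    moll k F = convolution F k (ContinuousLinearMap.mul ℝ ℝ) volume := rfl

section Kernel

variable {k : E3 → ℝ} {r : ℝ} {F : E3 → ℝ}

lemma IsKernel.integrable (hk : IsKernel k r) : Integrable k :=
  hk.smooth.continuous.integrable_of_hasCompactSupport hk.compact

lemma IsKernel.lintegral (hk : IsKernel k r) : ∫⁻ x, ENNReal.ofReal (k x) = 1 := by
  rw [← ofReal_integral_eq_lintegral_ofReal hk.integrable (Eventually.of_forall hk.nonneg),
    hk.integral_one, ENNReal.ofReal_one]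

lemma IsKernel.contDiff_moll (hk : IsKernel k r) (hF : LocallyIntegrable F) :
    ContDiff ℝ smoothExp (moll k F) :=
  hk.compact.contDiff_convolution_right (n := ⊤) (ContinuousLinearMap.mul ℝ ℝ) hF hk.smooth

lemma IsKernel.integrable_mul (hk : IsKernel k r) (hF : LocallyIntegrable F) (x : E3) :
    Integrable fun t => F t * k (x - t) :=
  hk.compact.convolutionExists_right (ContinuousLinearMap.mul ℝ ℝ) hF hk.smooth.continuous x

lemma IsKernel.pd_moll (hk : IsKernel k r) (hF : LocallyIntegrable F) (i : Fin 3) (x : E3) :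
    pd i (moll k F) x = ∫ t, F t * pd i k (x - t) := by
  have h := hk.compact.hasFDerivAt_convolution_right (ContinuousLinearMap.mul ℝ ℝ) hF
    (hk.smooth.of_le (by norm_cast)) x
  rw [pd, moll_eq_convolution, h.fderiv,
    convolution_precompR_apply (ContinuousLinearMap.mul ℝ ℝ) hF (hk.compact.fderiv ℝ)
      (hk.smooth.continuous_fderiv (by simp))]
  rfl

lemma IsKernel.enorm_moll_le (hk : IsKernel k r) (F : E3 → ℝ) (x : E3) :
    ‖moll k F x‖ₑ ≤ ∫⁻ t, ‖F t‖ₑ * ENNReal.ofReal (k (x - t)) := by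
  refine (enorm_integral_le_lintegral_enorm _).trans_eq ?_
  refine lintegral_congr fun t => ?_
  rw [enorm_mul, Real.enorm_eq_ofReal (hk.nonneg _)]

lemma IsKernel.lintegral_sub_left (hk : IsKernel k r) (x : E3) :
    ∫⁻ t, ENNReal.ofReal (k (x - t)) = 1 := by
  rw [lintegral_sub_left_eq_self (fun t => ENNReal.ofReal (k t)) x, hk.lintegral]

lemma IsKernel.lintegral_sub_right (hk : IsKernel k r) (t : E3) :
    ∫⁻ x, ENNReal.ofReal (k (x - t)) = 1 := by
  rw [lintegral_sub_right_eq_self (fun t => ENNReal.ofReal (k t)) t, hk.lintegral]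

lemma IsKernel.abs_moll_le (hk : IsKernel k r) {A : ℝ} (hA : 0 ≤ A) (hF : ∀ᵐ x, |F x| ≤ A)
    (x : E3) : |moll k F x| ≤ A := by
  have h1 : ‖moll k F x‖ₑ ≤ ENNReal.ofReal A := by
    refine (hk.enorm_moll_le F x).trans ?_
    calc ∫⁻ t, ‖F t‖ₑ * ENNReal.ofReal (k (x - t))
        ≤ ∫⁻ t, ENNReal.ofReal A * ENNReal.ofReal (k (x - t)) := by
          refine lintegral_mono_ae ?_
          filter_upwards [hF] with t ht
          gcongr
          rw [← ofReal_norm]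
          exact ENNReal.ofReal_le_ofReal ht
      _ = ENNReal.ofReal A := by
          rw [lintegral_const_mul' _ _ ENNReal.ofReal_ne_top, hk.lintegral_sub_left, mul_one]
  rw [← ofReal_norm] at h1
  exact (ENNReal.ofReal_le_ofReal_iff hA).mp h1

/-- Cauchy-Schwarz for the probability density `k (x - ·)`, followed by Tonelli. -/
lemma IsKernel.eLpNorm_moll_le (hk : IsKernel k r) (hF : AEStronglyMeasurable F) :
    eLpNorm (moll k F) 2 volume ≤ eLpNorm F 2 volume := by
  apply le_of_sq_le_sq
  rw [eLpNorm_two_sq, eLpNorm_two_sq]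
  have hkm : Measurable fun x => ENNReal.ofReal (k x) :=
    hk.smooth.continuous.measurable.ennreal_ofReal
  calc ∫⁻ x, ‖moll k F x‖ₑ ^ 2
      ≤ ∫⁻ x, ∫⁻ t, ‖F t‖ₑ ^ 2 * ENNReal.ofReal (k (x - t)) := by
        refine lintegral_mono fun x => ?_
        calc ‖moll k F x‖ₑ ^ 2 ≤ (∫⁻ t, ‖F t‖ₑ * ENNReal.ofReal (k (x - t))) ^ 2 := by
              gcongr; exact hk.enorm_moll_le F x
          _ ≤ _ := lintegral_mul_sq_le hF.enorm
              (hkm.comp (measurable_const.sub measurable_id)).aemeasurable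
          _ = _ := by rw [hk.lintegral_sub_left, mul_one]
    _ = ∫⁻ t, ∫⁻ x, ‖F t‖ₑ ^ 2 * ENNReal.ofReal (k (x - t)) := by
        apply lintegral_lintegral_swap
        have h1 : AEMeasurable (fun p : E3 × E3 => ‖F p.2‖ₑ ^ 2) (volume.prod volume) :=
          (hF.comp_snd.enorm).pow_const 2
        have h2 : AEMeasurable (fun p : E3 × E3 => ENNReal.ofReal (k (p.1 - p.2)))
          (volume.prod volume) := (hkm.comp (measurable_fst.sub measurable_snd)).aemeasurable
        exact h1.mul h2
    _ = ∫⁻ t, ‖F t‖ₑ ^ 2 := by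
        refine lintegral_congr fun t => ?_
        rw [lintegral_const_mul' _ _ (by simp), hk.lintegral_sub_right, mul_one]

lemma moll_eq_zero {x : E3} (h : ∀ t, k (x - t) ≠ 0 → F t = 0) :
    moll k F x = 0 := by
  unfold moll
  rw [integral_congr_ae (g := fun _ => (0 : ℝ)) (Eventually.of_forall fun t => ?_)]
  · simp
  · by_cases ht : k (x - t) = 0
    · simp [ht]
    · simp [h t ht]

lemma IsKernel.abs_moll_sub_le (hk : IsKernel k r) (hF : LocallyIntegrable F) {δ : ℝ}
    {x : E3} {c : ℝ} (h : ∀ t, ‖x - t‖ ≤ r → |F t - c| ≤ δ) : |moll k F x - c| ≤ δ := by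
  have hki : Integrable fun t => k (x - t) := hk.integrable.comp_sub_left x
  have e : moll k F x - c = ∫ t, (F t - c) * k (x - t) := by
    simp only [sub_mul]
    rw [integral_sub (hk.integrable_mul hF x) (hki.const_mul c), integral_const_mul,
      integral_sub_left_eq_self k volume x, hk.integral_one, mul_one]
    rfl
  rw [e]
  calc |∫ t, (F t - c) * k (x - t)| ≤ ∫ t, |(F t - c) * k (x - t)| :=
        abs_integral_le_integral_abs
    _ ≤ ∫ t, δ * k (x - t) := by
        refine integral_mono_of_nonneg (Eventually.of_forall fun t => abs_nonneg _)
          (hki.const_mul δ) (Eventually.of_forall fun t => ?_)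
        simp only [abs_mul, abs_of_nonneg (hk.nonneg _)]
        by_cases ht : k (x - t) = 0
        · simp [ht]
        · exact mul_le_mul_of_nonneg_right (h t (hk.supp _ ht)) (hk.nonneg _)
    _ = δ := by
        rw [integral_const_mul, integral_sub_left_eq_self k volume x, hk.integral_one, mul_one]

lemma moll_sub (hk : IsKernel k r) {G : E3 → ℝ} (hF : LocallyIntegrable F)
    (hG : LocallyIntegrable G) : moll k (fun x => F x - G x) = fun x => moll k F x - moll k G x := by
  funext x
  unfold moll
  simp only [sub_mul]
  exact integral_sub (hk.integrable_mul hF x) (hk.integrable_mul hG x)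

end Kernel

lemma _root_.MeasureTheory.MemLp.locallyIntegrable_two {F : E3 → ℝ} (h : MemLp F 2 volume) :
    LocallyIntegrable F := h.locallyIntegrable (by norm_num)

/-- Density argument: `F` is within `ε'` of a continuous `g` with compact support. Mollification is
a contraction on `F - g`, and on `g` uniform continuity applies. -/
theorem tendsto_moll {k : ℕ → E3 → ℝ} {r : ℕ → ℝ} (hk : ∀ n, IsKernel (k n) (r n))
    (hr : Tendsto r atTop (𝓝 0)) {F : E3 → ℝ} (hF : MemLp F 2 volume) :
    Tendsto (fun n => eLpNorm (fun x => moll (k n) F x - F x) 2 volume) atTop (𝓝 0) := by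
  rw [ENNReal.tendsto_nhds_zero]
  intro ε hε
  obtain ⟨ε', hε', hε3⟩ : ∃ ε' : ℝ≥0∞, 0 < ε' ∧ ε' + ε' + ε' ≤ ε := by
    refine ⟨ε / 3, ENNReal.div_pos hε.ne' (by norm_num), ?_⟩
    rw [ENNReal.add_thirds]
  obtain ⟨g, hgc, hFg, hg, hg2⟩ :=
    hF.exists_hasCompactSupport_eLpNorm_sub_le (by norm_num) hε'.ne'
  have hgu : UniformContinuous g := hgc.uniformContinuous_of_continuous hg
  -- Once the kernel radius is below 1, the mollification of `g` lives in this compact set, so a sup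
  -- bound `δ` costs only the factor `|K|^{1/2}`.
  set K := Metric.cthickening 1 (tsupport g) with hKdef
  have hK : IsCompact K := hgc.cthickening
  obtain ⟨δ, hδ, hδ'⟩ : ∃ δ : ℝ, 0 < δ ∧
      volume K ^ (1 / 2 : ℝ) * ENNReal.ofReal δ ≤ ε' := by
    have hfin : volume K ^ (1 / 2 : ℝ) ≠ ∞ :=
      ENNReal.rpow_ne_top_of_nonneg (by norm_num) hK.measure_lt_top.ne
    obtain ⟨δ, hδ, hδ2⟩ := ENNReal.exists_nnreal_pos_mul_lt hfin hε'.ne'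
    exact ⟨δ, hδ, by rw [mul_comm]; simpa using hδ2.le⟩
  obtain ⟨η, hη, hη'⟩ := Metric.uniformContinuous_iff.mp hgu δ hδ
  have hr1 : ∀ᶠ n in atTop, r n < min η 1 :=
    hr.eventually (Iio_mem_nhds (lt_min hη one_pos))
  filter_upwards [hr1] with n hn
  have hgl : LocallyIntegrable g := hg2.locallyIntegrable_two
  have hsub : ∀ x, |moll (k n) g x - g x| ≤ δ := fun x =>
    (hk n).abs_moll_sub_le hgl fun t ht => by
      have := hη' (a := t) (b := x) (by
        rw [dist_comm, dist_eq_norm]; exact ht.trans_lt (hn.trans_le (min_le_left _ _)))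
      rw [Real.dist_eq] at this
      exact this.le
  have hzero : ∀ x, x ∉ K → moll (k n) g x - g x = 0 := by
    intro x hx
    have hfar : ∀ t, ‖x - t‖ ≤ r n → g t = 0 := by
      intro t ht
      by_contra h
      apply hx
      refine Metric.mem_cthickening_of_dist_le x t 1 _ (subset_tsupport g h) ?_
      rw [dist_eq_norm]
      exact ht.trans (hn.le.trans (min_le_right _ _))
    rw [moll_eq_zero fun t ht => hfar t ((hk n).supp _ ht)]
    rw [image_eq_zero_of_notMem_tsupport (f := g) fun h => hx
      (Metric.self_subset_cthickening _ h), sub_zero]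
  have h2 : eLpNorm (fun x => moll (k n) g x - g x) 2 volume ≤ ε' := by
    have : (fun x => moll (k n) g x - g x) = K.indicator fun x => moll (k n) g x - g x := by
      funext x
      by_cases hx : x ∈ K
      · rw [indicator_of_mem hx]
      · rw [indicator_of_notMem hx, hzero x hx]
    rw [this, eLpNorm_indicator_eq_eLpNorm_restrict hK.measurableSet]
    refine (eLpNorm_le_of_ae_bound (C := δ) (Eventually.of_forall hsub)).trans ?_
    simpa using hδ'
  have h3 : eLpNorm (fun x => moll (k n) (fun y => F y - g y) x) 2 volume ≤ ε' :=
    ((hk n).eLpNorm_moll_le (hF.sub hg2).1).trans hFg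
  have e : (fun x => moll (k n) F x - F x) = fun x => (moll (k n) (fun y => F y - g y) x
      + (moll (k n) g x - g x)) + (-(F x - g x)) := by
    funext x
    rw [moll_sub (hk n) hF.locallyIntegrable_two hgl]
    ring
  rw [e]
  have m1 : AEStronglyMeasurable (moll (k n) fun y => F y - g y) volume :=
    ((hk n).contDiff_moll (hF.sub hg2).locallyIntegrable_two).continuous.aestronglyMeasurable
  have m2 : AEStronglyMeasurable (fun x => moll (k n) g x - g x) volume :=
    (((hk n).contDiff_moll hgl).continuous.sub hg).aestronglyMeasurable
  have m3 : AEStronglyMeasurable (fun x => -(F x - g x)) volume := (hF.sub hg2).1.neg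
  have t1 := eLpNorm_add_le (m1.add m2) m3 (p := 2) (by norm_num)
  have t2 := eLpNorm_add_le m1 m2 (p := 2) (by norm_num)
  have t3 : eLpNorm (fun x => -(F x - g x)) 2 volume ≤ ε' := by
    refine le_trans (le_of_eq ?_) hFg
    exact eLpNorm_neg (F - g) 2 volume
  refine le_trans t1 (le_trans ?_ hε3)
  gcongr
  exact t2.trans (add_le_add h3 h2)

/-! ### Mollification that preserves vanishing at the boundary. -/

/-- The upward shifted mollification kernels. -/
def upKernel (n : ℕ) : E3 → ℝ :=
  (⟨1 / (2 * (n + 1)), 1 / (n + 1), by positivity, by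
    rw [div_lt_div_iff₀ (by positivity) (by positivity)]; nlinarith [n.cast_nonneg (α := ℝ)]⟩ :
    ContDiffBump ((2 / (n + 1) : ℝ) • basisVec 2)).normed volume

lemma upKernel_support {n : ℕ} {x : E3} (h : upKernel n x ≠ 0) :
    ‖x - (2 / (n + 1) : ℝ) • basisVec 2‖ < 1 / (n + 1) := by
  have : x ∈ Function.support (upKernel n) := h
  rw [upKernel, ContDiffBump.support_normed_eq] at this
  simpa [dist_eq_norm] using this

lemma isKernel_upKernel (n : ℕ) : IsKernel (upKernel n) (3 / (n + 1)) := by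
  refine ⟨ContDiffBump.contDiff_normed _, ContDiffBump.hasCompactSupport_normed _,
    ContDiffBump.nonneg_normed _, ContDiffBump.integral_normed _, fun x hx => ?_⟩
  have h1 := upKernel_support hx
  have h2 : ‖(2 / (n + 1) : ℝ) • basisVec 2‖ = 2 / (n + 1) := by
    rw [norm_smul, basisVec]
    rw [show ‖(EuclideanSpace.single 2 1 : E3)‖ = 1 by simp, mul_one]
    exact Real.norm_of_nonneg (by positivity)
  calc ‖x‖ = ‖(x - (2 / (n + 1) : ℝ) • basisVec 2) + (2 / (n + 1) : ℝ) • basisVec 2‖ := by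
        rw [sub_add_cancel]
    _ ≤ _ := norm_add_le _ _
    _ ≤ 1 / (n + 1) + 2 / (n + 1) := by rw [h2]; linarith
    _ = 3 / (n + 1) := by ring

lemma abs_coord_le (x : E3) (i : Fin 3) : |x i| ≤ ‖x‖ := by
  have := PiLp.norm_apply_le x i
  simpa using this

/-- The centre has height `2/(n+1)` and the radius is `1/(n+1)`. Hence the mollification at `x` only
sees points lower than `x` by more than `1/(n+1)`, and a function vanishing outside the half-space
is mollified to one vanishing for `z ≤ 1/(n+1)`. -/
lemma upKernel_coord {n : ℕ} {x : E3} (h : upKernel n x ≠ 0) : 1 / (n + 1) < x 2 := by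
  have h1 := (abs_coord_le _ 2).trans_lt (upKernel_support h)
  simp [basisVec] at h1
  rw [abs_lt] at h1
  have : (2 / (n + 1) : ℝ) = ((n : ℝ) + 1)⁻¹ + ((n : ℝ) + 1)⁻¹ := by field_simp; norm_num
  rw [one_div]
  linarith [h1.1]

lemma tendsto_upKernel_radius : Tendsto (fun n : ℕ => (3 / (n + 1) : ℝ)) atTop (𝓝 0) := by
  have := (tendsto_one_div_add_atTop_nhds_zero_nat (𝕜 := ℝ)).const_mul 3
  simpa [div_eq_mul_inv] using this

/-- `∂ᵢ F = F'` in the sense of distributions on the whole space. -/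
structure ES (i : Fin 3) (F F' : E3 → ℝ) : Prop where
  left : LocallyIntegrable F
  right : LocallyIntegrable F'
  eq : ∀ η : E3 → ℝ, ContDiff ℝ smoothExp η → HasCompactSupport η →
    ∫ x, F x * pd i η x = -∫ x, F' x * η x

lemma pd_comp_sub_left (k : E3 → ℝ) (hk : Differentiable ℝ k) (i : Fin 3) (x t : E3) :
    pd i (fun t => k (x - t)) t = -pd i k (x - t) := by
  have h1 : HasFDerivAt (fun t : E3 => x - t) (-ContinuousLinearMap.id ℝ E3) t :=
    (hasFDerivAt_id t).const_sub x
  have := ((hk (x - t)).hasFDerivAt.comp t h1).fderiv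
  rw [pd, show (fun t => k (x - t)) = k ∘ fun t => x - t from rfl, this]
  simp [pd]

lemma ES.pd_moll {i : Fin 3} {F F' : E3 → ℝ} (h : ES i F F') {k : E3 → ℝ} {r : ℝ}
    (hk : IsKernel k r) : pd i (moll k F) = moll k F' := by
  funext x
  rw [hk.pd_moll h.left]
  have hs : ContDiff ℝ smoothExp fun t => k (x - t) := hk.smooth.comp (contDiff_const.sub contDiff_id)
  have hc : HasCompactSupport fun t => k (x - t) :=
    hk.compact.comp_homeomorph (Homeomorph.subLeft x)
  have := h.eq _ hs hc
  simp only [pd_comp_sub_left k (hk.smooth.differentiable (by simp)), mul_neg, integral_neg,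
    neg_inj] at this
  exact this

end ConormalEuler

end

noncomputable section

namespace ConormalEuler

/-! ### Products and compositions of weakly differentiable functions -/

section Pairing

variable {X : Type*} [MeasurableSpace X] {μ : Measure X} {f g : X → ℝ}

lemma memLp_two_mul (hf : MemLp f 2 μ) (hg : MemLp g 2 μ) : Integrable (fun x => f x * g x) μ :=
  hf.integrable_mul hg

lemma enorm_integral_mul_le (hf : AEStronglyMeasurable f μ) (hg : AEStronglyMeasurable g μ) :
    ‖∫ x, f x * g x ∂μ‖ₑ ≤ eLpNorm f 2 μ * eLpNorm g 2 μ := by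
  refine (enorm_integral_le_lintegral_enorm _).trans ?_
  have := ENNReal.lintegral_mul_le_Lp_mul_Lq μ Real.HolderConjugate.two_two hf.enorm hg.enorm
  have e : ∀ h : X → ℝ, (∫⁻ x, ‖h x‖ₑ ^ (2 : ℝ) ∂μ) ^ (1 / 2 : ℝ) = eLpNorm h 2 μ := by
    intro h
    have h2 := eLpNorm_two_sq h μ
    simp only [ENNReal.rpow_two]
    rw [← h2, ← ENNReal.rpow_natCast, ← ENNReal.rpow_mul]
    norm_num
  rw [e, e] at this
  refine le_trans (le_of_eq ?_) this
  exact lintegral_congr fun x => by simp [enorm_mul]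

lemma tendsto_integral_mul {F : ℕ → X → ℝ} {h : X → ℝ} (hh : MemLp h 2 μ) (hf : MemLp f 2 μ)
    (hF : ∀ n, MemLp (F n) 2 μ)
    (hl : Tendsto (fun n => eLpNorm (fun x => F n x - f x) 2 μ) atTop (𝓝 0)) :
    Tendsto (fun n => ∫ x, h x * F n x ∂μ) atTop (𝓝 (∫ x, h x * f x ∂μ)) := by
  rw [tendsto_iff_edist_tendsto_0]
  have hb : ∀ n, edist (∫ x, h x * F n x ∂μ) (∫ x, h x * f x ∂μ)
      ≤ eLpNorm h 2 μ * eLpNorm (fun x => F n x - f x) 2 μ := by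
    intro n
    rw [edist_eq_enorm_sub, ← integral_sub (memLp_two_mul hh (hF n)) (memLp_two_mul hh hf)]
    have : ∀ x, h x * F n x - h x * f x = h x * (F n x - f x) := fun x => by ring
    simp only [this]
    exact enorm_integral_mul_le hh.1 ((hF n).sub hf).1
  have hl2 := ENNReal.Tendsto.const_mul hl (a := eLpNorm h 2 μ) (Or.inr hh.2.ne)
  rw [mul_zero] at hl2
  exact tendsto_of_tendsto_of_tendsto_of_le_of_le tendsto_const_nhds hl2 (fun _ => zero_le)
    hb

lemma exists_subseq_ae {F : ℕ → X → ℝ} (hF : ∀ n, AEStronglyMeasurable (F n) μ)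
    (hf : AEStronglyMeasurable f μ)
    (hl : Tendsto (fun n => eLpNorm (fun x => F n x - f x) 2 μ) atTop (𝓝 0)) :
    ∃ ns : ℕ → ℕ, StrictMono ns ∧
      ∀ᵐ x ∂μ, Tendsto (fun n => F (ns n) x) atTop (𝓝 (f x)) :=
  (tendstoInMeasure_of_tendsto_eLpNorm (p := 2) (by norm_num) hF hf hl).exists_seq_tendsto_ae

end Pairing

lemma exists_test_one_nhds {K : Set E3} (hK : IsCompact K) (hKs : K ⊆ halfSpace) :
    ∃ ζ : E3 → ℝ, IsTest ζ ∧ (∀ x ∈ K, ζ =ᶠ[𝓝 x] fun _ => 1) ∧ ∀ x, ζ x ∈ Icc 0 1 := by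
  obtain ⟨K', hK', h1, h2⟩ := exists_compact_between hK isOpen_hs hKs
  obtain ⟨ζ, h3, h4, h5⟩ := exists_contMDiffMap_one_nhds_of_subset_interior
    (modelWithCornersSelf ℝ E3) hK.isClosed h1 (n := ⊤)
  have hs : tsupport ζ ⊆ K' := closure_minimal (fun x hx => by
    by_contra hc; exact hx (h4 x hc)) hK'.isClosed
  refine ⟨ζ, ⟨ζ.contMDiff.contDiff, hK'.of_isClosed_subset (isClosed_tsupport _) hs,
    hs.trans h2⟩, fun x hx => ?_, h5⟩
  exact (eventually_nhdsSet_iff_forall.mp h3) x hx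

lemma integral_hs_eq {f : E3 → ℝ} (h : ∀ x, x ∉ (halfSpace : Set E3) → f x = 0) :
    ∫ x, f x ∂hsMeasure = ∫ x, f x := setIntegral_eq_integral_of_forall_compl_eq_zero h

lemma L2loc.memLp_mul_test {f ψ : E3 → ℝ} (h : L2loc f) (hψ : IsTest ψ) :
    MemLp (fun x => f x * ψ x) 2 volume := by
  have h1 : MemLp (fun x => f x * ψ x) 2 (volume.restrict (tsupport ψ)) :=
    (memLp_top_of_continuousOn hψ.compact hψ.continuous.continuousOn).mul'
      (h _ hψ.compact hψ.subset)
  have h2 := (memLp_indicator_iff_restrict hψ.compact.isClosed.measurableSet).mpr h1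
  refine h2.ae_eq (Eventually.of_forall fun x => ?_)
  by_cases hx : x ∈ tsupport ψ
  · rw [indicator_of_mem hx]
  · rw [indicator_of_notMem hx]
    simp [image_eq_zero_of_notMem_tsupport hx]

/-- A cutoff moves the problem to the whole space and to global `L²`, where mollification is
available. -/
lemma WD.localize {i : Fin 3} {f f' ζ : E3 → ℝ} (h : WD i f f') (hf : L2loc f) (hf' : L2loc f')
    (hζ : IsTest ζ) :
    ES i (fun x => f x * ζ x) (fun x => f' x * ζ x + f x * pd i ζ x) ∧
      MemLp (fun x => f x * ζ x) 2 volume ∧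
      MemLp (fun x => f' x * ζ x + f x * pd i ζ x) 2 volume := by
  have m1 := hf.memLp_mul_test hζ
  have m2 := (hf'.memLp_mul_test hζ).add (hf.memLp_mul_test (hζ.pd i))
  refine ⟨⟨m1.locallyIntegrable_two, m2.locallyIntegrable_two, fun η hη hηc => ?_⟩, m1, m2⟩
  have ht : IsTest fun x => η x * ζ x := hζ.mul hη
  have hp := (hζ.pd i).mul hη
  have key := h.eq _ ht
  have hpd : ∀ x, f x * pd i (fun y => η y * ζ y) x
      = f x * ζ x * pd i η x + f x * (η x * pd i ζ x) := by
    intro x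
    rw [hζ.pd_mul_smoothOn hη.contDiffOn i x]; ring
  simp only [hpd] at key
  have i1 : Integrable (fun x => f x * ζ x * pd i η x) hsMeasure := by
    have := h.left.integrable_mul (hζ.mul (contDiff_pd hη i))
    refine this.congr (Eventually.of_forall fun x => ?_)
    simp only; ring
  rw [integral_add i1 (h.left.integrable_mul hp)] at key
  rw [← integral_hs_eq (fun x hx => by simp [hζ.eq_zero hx]),
    ← integral_hs_eq (fun x hx => by simp [hζ.eq_zero hx, hζ.pd_eq_zero i hx])]
  have e : ∀ x, (f' x * ζ x + f x * pd i ζ x) * η x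
      = f' x * (η x * ζ x) + f x * (η x * pd i ζ x) := fun x => by ring
  simp only [e]
  rw [integral_add (h.right.integrable_mul ht) (h.left.integrable_mul hp)]
  linarith

/-- The approximating sequence obtained by mollification. -/
theorem ES.exists_approx {i : Fin 3} {F F' : E3 → ℝ} (h : ES i F F') (hF : MemLp F 2 volume)
    (hF' : MemLp F' 2 volume) : ∃ G : ℕ → E3 → ℝ, (∀ n, ContDiff ℝ smoothExp (G n)) ∧
      (∀ n, MemLp (G n) 2 volume) ∧ (∀ n, MemLp (pd i (G n)) 2 volume) ∧
      Tendsto (fun n => eLpNorm (fun x => G n x - F x) 2 volume) atTop (𝓝 0) ∧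
      Tendsto (fun n => eLpNorm (fun x => pd i (G n) x - F' x) 2 volume) atTop (𝓝 0) ∧
      (∀ᵐ x, Tendsto (fun n => G n x) atTop (𝓝 (F x))) ∧
      (∀ n, ∃ c > 0, ∀ x, (∀ t, t 2 < x 2 - c → F t = 0) → G n x = 0) ∧
      ∀ A, 0 ≤ A → (∀ᵐ x, |F' x| ≤ A) → ∀ n x, |pd i (G n) x| ≤ A := by
  have hk := isKernel_upKernel
  have h1 := tendsto_moll hk tendsto_upKernel_radius hF
  have h2 := tendsto_moll hk tendsto_upKernel_radius hF'
  have mem : ∀ {F : E3 → ℝ}, MemLp F 2 volume → ∀ n, MemLp (moll (upKernel n) F) 2 volume := by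
    intro F hF n
    exact ⟨((hk n).contDiff_moll hF.locallyIntegrable_two).continuous.aestronglyMeasurable,
      ((hk n).eLpNorm_moll_le hF.1).trans_lt hF.2⟩
  obtain ⟨ns, hns, hae⟩ := exists_subseq_ae (fun n => (mem hF n).1) hF.1 h1
  refine ⟨fun n => moll (upKernel (ns n)) F, fun n => (hk _).contDiff_moll hF.locallyIntegrable_two,
    fun n => mem hF _, fun n => ?_, h1.comp hns.tendsto_atTop, ?_, hae,
    fun n => ⟨1 / ((ns n : ℝ) + 1), by positivity, fun x hx => ?_⟩, fun A hA hF' n x => ?_⟩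
  · rw [h.pd_moll (hk _)]; exact mem hF' _
  · simp only [fun n => h.pd_moll (hk n)]
    exact h2.comp hns.tendsto_atTop
  · refine moll_eq_zero fun t ht => hx t ?_
    have := upKernel_coord ht
    rw [PiLp.sub_apply] at this
    linarith
  · rw [h.pd_moll (hk _)]; exact (hk _).abs_moll_le hA hF' x

/-- Only `f` is mollified, after localisation by a cutoff equal to one near the support of `ψ`. Then
`Gₙ ψ` is a test function for `g`, and in each of the three terms an `L²`-convergent sequence is
paired with a fixed `L²` function. -/
theorem WD.mul {i : Fin 3} {f f' g g' : E3 → ℝ} (hf : WD i f f') (hg : WD i g g')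
    (lf : L2loc f) (lf' : L2loc f') (lg : L2loc g) (lg' : L2loc g') :
    WD i (fun x => f x * g x) (fun x => f' x * g x + f x * g' x) := by
  refine ⟨lf.mul lg, (lf'.mul lg).add (lf.mul lg'), fun ψ hψ => ?_⟩
  obtain ⟨ζ, hζ, hζ1, -⟩ := exists_test_one_nhds hψ.compact hψ.subset
  obtain ⟨hE, m1, m2⟩ := hf.localize lf lf' hζ
  obtain ⟨G, hG, hG2, hG2', hl, hl', -⟩ := hE.exists_approx m1 m2
  have r1 : MemLp (fun x => g x * pd i ψ x) 2 volume := lg.memLp_mul_test (hψ.pd i)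
  have r2 : MemLp (fun x => g x * ψ x) 2 volume := lg.memLp_mul_test hψ
  have r3 : MemLp (fun x => g' x * ψ x) 2 volume := lg'.memLp_mul_test hψ
  have t1 := tendsto_integral_mul r1 m1 hG2 hl
  have t2 := tendsto_integral_mul r2 m2 hG2' hl'
  have t3 := tendsto_integral_mul r3 m1 hG2 hl
  have hn : ∀ n, (∫ x, g x * pd i ψ x * G n x) + ∫ x, g x * ψ x * pd i (G n) x
      = -∫ x, g' x * ψ x * G n x := by
    intro n
    have ht : IsTest fun x => G n x * ψ x := hψ.mul (hG n)
    have key := hg.eq _ ht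
    rw [integral_hs_eq (fun x hx => by rw [ht.pd_eq_zero i hx, mul_zero]),
      integral_hs_eq (fun x hx => by rw [ht.eq_zero hx, mul_zero])] at key
    have e1 : ∀ x, g x * pd i (fun x => G n x * ψ x) x
        = g x * pd i ψ x * G n x + g x * ψ x * pd i (G n) x := by
      intro x
      rw [pd_mul i ((hG n).differentiable (by simp) x) (hψ.differentiable x)]
      ring
    simp only [e1] at key
    rw [← integral_add (memLp_two_mul r1 (hG2 n)) (memLp_two_mul r2 (hG2' n)), key]
    congr 1
    exact integral_congr_ae (Eventually.of_forall fun x => by simp only; ring)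
  have hlim := tendsto_nhds_unique ((t1.add t2).congr hn) t3.neg
  have hpdζ : ∀ x ∈ tsupport ψ, pd i ζ x = 0 ∧ ζ x = 1 := by
    intro x hx
    refine ⟨?_, (hζ1 x hx).eq_of_nhds⟩
    rw [pd, (hζ1 x hx).fderiv_eq]; simp
  have i1 : Integrable (fun x => f' x * g x * ψ x) hsMeasure := (lf'.mul lg).integrable_mul hψ
  have i2 : Integrable (fun x => f x * g' x * ψ x) hsMeasure := (lf.mul lg').integrable_mul hψ
  simp only [add_mul]
  rw [integral_add i1 i2, integral_hs_eq (fun x hx => by rw [hψ.pd_eq_zero i hx, mul_zero]),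
    integral_hs_eq (fun x hx => by rw [hψ.eq_zero hx, mul_zero]),
    integral_hs_eq (fun x hx => by rw [hψ.eq_zero hx, mul_zero])]
  have c1 : ∫ x, g x * pd i ψ x * (f x * ζ x) = ∫ x, f x * g x * pd i ψ x := by
    refine integral_congr_ae (Eventually.of_forall fun x => ?_)
    by_cases hx : x ∈ tsupport ψ
    · simp only [(hpdζ x hx).2]; ring
    · simp [image_eq_zero_of_notMem_tsupport fun h => hx (tsupport_pd_subset ψ i h)]
  have c2 : ∫ x, g x * ψ x * (f' x * ζ x + f x * pd i ζ x) = ∫ x, f' x * g x * ψ x := by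
    refine integral_congr_ae (Eventually.of_forall fun x => ?_)
    by_cases hx : x ∈ tsupport ψ
    · simp only [(hpdζ x hx).2, (hpdζ x hx).1]; ring
    · simp [image_eq_zero_of_notMem_tsupport hx]
  have c3 : ∫ x, g' x * ψ x * (f x * ζ x) = ∫ x, f x * g' x * ψ x := by
    refine integral_congr_ae (Eventually.of_forall fun x => ?_)
    by_cases hx : x ∈ tsupport ψ
    · simp only [(hpdζ x hx).2]; ring
    · simp [image_eq_zero_of_notMem_tsupport hx]
  rw [c1, c2, c3] at hlim
  linarith

/-- The chain rule holds for the smooth approximants `Gₙ`. In the limit, `T'(Gₙ) ∂ᵢGₙ` is split into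
`T'(Gₙ)(∂ᵢGₙ - F')`, which is small since `T'` is bounded, and `T'(Gₙ) F'`, to which dominated
convergence applies because `Gₙ → F` almost everywhere. The condition `T 0 = 0` keeps `T ∘ F` in
`L²`. -/
theorem WD.comp_lipschitz {i : Fin 3} {f f' : E3 → ℝ} (hf : WD i f f') (lf : L2loc f)
    (lf' : L2loc f') {T T' : ℝ → ℝ} (hT : ∀ y, HasDerivAt T (T' y) y) (hT' : Continuous T')
    (hT0 : T 0 = 0) {L : ℝ≥0} (hL : ∀ y, |T' y| ≤ L) :
    WD i (fun x => T (f x)) (fun x => T' (f x) * f' x) := by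
  have hlip : ∀ a b, |T a - T b| ≤ L * |a - b| := by
    intro a b
    have := Convex.norm_image_sub_le_of_norm_hasDerivWithin_le (f := T) (f' := T') (s := univ)
      (C := L) (fun x _ => (hT x).hasDerivWithinAt) (fun x _ => hL x) convex_univ (mem_univ b)
      (mem_univ a)
    simpa using this
  have hTc : Continuous T := continuous_iff_continuousAt.mpr fun y => (hT y).continuousAt
  have hT0' : ∀ a, |T a| ≤ L * |a| := fun a => by simpa [hT0] using hlip a 0
  have lTf : L2loc fun x => T (f x) := fun K hK hKs => (lf K hK hKs).of_le_mul (c := L)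
    (hTc.comp_aestronglyMeasurable (lf K hK hKs).1) (Eventually.of_forall fun x => hT0' _)
  have lTf' : L2loc fun x => T' (f x) * f' x := fun K hK hKs => (lf' K hK hKs).of_le_mul (c := L)
    ((hT'.comp_aestronglyMeasurable (lf K hK hKs).1).mul (lf' K hK hKs).1)
    (Eventually.of_forall fun x => by
      rw [norm_mul]; exact mul_le_mul_of_nonneg_right (hL _) (norm_nonneg _))
  refine ⟨lTf.locInt, lTf'.locInt, fun ψ hψ => ?_⟩
  obtain ⟨ζ, hζ, hζ1, -⟩ := exists_test_one_nhds hψ.compact hψ.subset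
  obtain ⟨hE, m1, m2⟩ := hf.localize lf lf' hζ
  set F : E3 → ℝ := fun x => f x * ζ x with hF
  set F' : E3 → ℝ := fun x => f' x * ζ x + f x * pd i ζ x with hF'
  obtain ⟨G, hG, hG2, hG2', hl, hl', hae, -⟩ := hE.exists_approx m1 m2
  have mTG : ∀ {H : E3 → ℝ}, MemLp H 2 volume → MemLp (fun x => T (H x)) 2 volume := fun hH =>
    hH.of_le_mul (c := L) (hTc.comp_aestronglyMeasurable hH.1) (Eventually.of_forall fun x => hT0' _)
  have t1 : Tendsto (fun n => ∫ x, pd i ψ x * T (G n x)) atTop (𝓝 (∫ x, pd i ψ x * T (F x))) := by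
    refine tendsto_integral_mul ((hψ.pd i).continuous.memLp_of_hasCompactSupport (hψ.pd i).compact)
      (mTG m1) (fun n => mTG (hG2 n)) ?_
    have hb : ∀ n, eLpNorm (fun x => T (G n x) - T (F x)) 2 volume
        ≤ L • eLpNorm (fun x => G n x - F x) 2 volume := fun n =>
      eLpNorm_le_nnreal_smul_eLpNorm_of_ae_le_mul (Eventually.of_forall fun x => by
        have := hlip (G n x) (F x)
        rw [← NNReal.coe_le_coe]
        simpa using this) 2
    have := ENNReal.Tendsto.const_mul hl (a := L) (Or.inr ENNReal.coe_ne_top)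
    rw [mul_zero] at this
    exact tendsto_of_tendsto_of_tendsto_of_le_of_le tendsto_const_nhds this (fun _ => zero_le) hb
  have mψ : MemLp ψ 2 volume := hψ.continuous.memLp_of_hasCompactSupport hψ.compact
  have mT'ψ : ∀ n, AEStronglyMeasurable (fun x => T' (G n x) * ψ x) volume := fun n =>
    ((hT'.comp (hG n).continuous).mul hψ.continuous).aestronglyMeasurable
  have bT'ψ : ∀ n, MemLp (fun x => T' (G n x) * ψ x) 2 volume := fun n =>
    mψ.of_le_mul (c := L) (mT'ψ n) (Eventually.of_forall fun x => by
      rw [norm_mul]; exact mul_le_mul_of_nonneg_right (hL _) (norm_nonneg _))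
  have t2 : Tendsto (fun n => ∫ x, T' (G n x) * ψ x * (pd i (G n) x - F' x)) atTop (𝓝 0) := by
    rw [tendsto_zero_iff_norm_tendsto_zero]
    have hb : ∀ n, ‖∫ x, T' (G n x) * ψ x * (pd i (G n) x - F' x)‖ₑ
        ≤ L * eLpNorm ψ 2 volume * eLpNorm (fun x => pd i (G n) x - F' x) 2 volume := by
      intro n
      refine (enorm_integral_mul_le (mT'ψ n) ((hG2' n).sub m2).1).trans
        (mul_le_mul_left ?_ _)
      exact eLpNorm_le_nnreal_smul_eLpNorm_of_ae_le_mul (Eventually.of_forall fun x => by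
        rw [← NNReal.coe_le_coe]
        simpa using mul_le_mul_of_nonneg_right (hL (G n x)) (norm_nonneg (ψ x))) 2
    have := ENNReal.Tendsto.const_mul hl' (a := L * eLpNorm ψ 2 volume)
      (Or.inr (ENNReal.mul_ne_top ENNReal.coe_ne_top mψ.2.ne))
    rw [mul_zero] at this
    have h0 := tendsto_of_tendsto_of_tendsto_of_le_of_le tendsto_const_nhds this
      (fun _ => zero_le) hb
    have := (ENNReal.tendsto_toReal (by simp)).comp h0
    simpa [Function.comp_def] using this
  have t3 : Tendsto (fun n => ∫ x, T' (G n x) * ψ x * F' x) atTop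
      (𝓝 (∫ x, T' (F x) * ψ x * F' x)) := by
    refine tendsto_integral_of_dominated_convergence (fun x => L * |ψ x * F' x|)
      (fun n => (mT'ψ n).mul m2.1) ((mψ.integrable_mul m2).abs.const_mul _)
      (fun n => Eventually.of_forall fun x => ?_) ?_
    · rw [mul_assoc, norm_mul]
      exact mul_le_mul_of_nonneg_right (hL _) (abs_nonneg _)
    · filter_upwards [hae] with x hx
      exact (((hT'.tendsto _).comp hx).mul_const _).mul_const _
  have hn : ∀ n, ∫ x, pd i ψ x * T (G n x) = -((∫ x, T' (G n x) * ψ x * (pd i (G n) x - F' x))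
      + ∫ x, T' (G n x) * ψ x * F' x) := by
    intro n
    have hdG : Differentiable ℝ (G n) := (hG n).differentiable (by simp)
    have hfd : ∀ x, HasFDerivAt (fun x => T (G n x)) (T' (G n x) • fderiv ℝ (G n) x) x := fun x =>
      (hT (G n x)).comp_hasFDerivAt x (hdG x).hasFDerivAt
    have hpd : ∀ x, fderiv ℝ (fun x => T (G n x)) x (basisVec i) = T' (G n x) * pd i (G n) x := by
      intro x; rw [(hfd x).fderiv]; rfl
    have := integral_mul_fderiv_eq_neg_fderiv_mul_of_integrable (μ := (volume : Measure E3))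
      (f := fun x => T (G n x)) (g := ψ) (v := basisVec i) (by
        simp only [hpd]
        refine ((bT'ψ n).integrable_mul (hG2' n)).congr (Eventually.of_forall fun x => ?_)
        simp only [Pi.mul_apply]; ring)
      (memLp_two_mul (mTG (hG2 n))
        ((hψ.pd i).continuous.memLp_of_hasCompactSupport (hψ.pd i).compact))
      (memLp_two_mul (mTG (hG2 n)) mψ) (fun x _ => (hfd x).differentiableAt)
      (fun x _ => hψ.differentiable x)
    simp only [hpd] at this
    have m3 : MemLp (fun x => pd i (G n) x - F' x) 2 volume := (hG2' n).sub m2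
    rw [← integral_add (memLp_two_mul (bT'ψ n) m3)
      (memLp_two_mul (bT'ψ n) m2)]
    have e1 : ∫ x, pd i ψ x * T (G n x) = ∫ x, T (G n x) * fderiv ℝ ψ x (basisVec i) :=
      integral_congr_ae (Eventually.of_forall fun x => by simp only [pd]; ring)
    rw [e1, this]
    congr 1
    exact integral_congr_ae (Eventually.of_forall fun x => by simp; ring)
  have hlim := tendsto_nhds_unique (t1.congr hn) (t2.add t3).neg
  have hpdζ : ∀ x ∈ tsupport ψ, pd i ζ x = 0 ∧ ζ x = 1 := by
    intro x hx
    refine ⟨?_, (hζ1 x hx).eq_of_nhds⟩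
    rw [pd, (hζ1 x hx).fderiv_eq]; simp
  rw [integral_hs_eq (fun x hx => by rw [hψ.pd_eq_zero i hx, mul_zero]),
    integral_hs_eq (fun x hx => by rw [hψ.eq_zero hx, mul_zero])]
  have c1 : ∫ x, pd i ψ x * T (F x) = ∫ x, T (f x) * pd i ψ x := by
    refine integral_congr_ae (Eventually.of_forall fun x => ?_)
    by_cases hx : x ∈ tsupport ψ
    · simp only [hF, (hpdζ x hx).2]; ring_nf
    · simp [image_eq_zero_of_notMem_tsupport fun h => hx (tsupport_pd_subset ψ i h)]
  have c2 : ∫ x, T' (F x) * ψ x * F' x = ∫ x, T' (f x) * f' x * ψ x := by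
    refine integral_congr_ae (Eventually.of_forall fun x => ?_)
    by_cases hx : x ∈ tsupport ψ
    · simp only [hF, hF', (hpdζ x hx).2, (hpdζ x hx).1]; ring_nf
    · simp [image_eq_zero_of_notMem_tsupport hx]
  rw [c1, c2, zero_add] at hlim
  exact hlim

end ConormalEuler

end

noncomputable section

namespace ConormalEuler

/-! ### Cutoff functions -/

/-- A smooth cutoff vanishing for `n z ≤ 1` and equal to one for `n z ≥ 2`. -/
def zCut (n : ℕ) (x : E3) : ℝ := Real.smoothTransition (n * x 2 - 1)

lemma contDiff_zCut (n : ℕ) : ContDiff ℝ smoothExp (zCut n) :=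
  (Real.smoothTransition.contDiff (n := ⊤)).comp (by fun_prop)

lemma zCut_eq_zero {n : ℕ} {x : E3} (h : n * x 2 ≤ 1) : zCut n x = 0 :=
  Real.smoothTransition.zero_of_nonpos (by linarith)

lemma zCut_eq_one {n : ℕ} {x : E3} (h : 2 ≤ n * x 2) : zCut n x = 1 :=
  Real.smoothTransition.one_of_one_le (by linarith)

lemma abs_zCut_le (n : ℕ) (x : E3) : |zCut n x| ≤ 1 := by
  rw [zCut, abs_of_nonneg (Real.smoothTransition.nonneg _)]
  exact Real.smoothTransition.le_one _

lemma pd_zCut (n : ℕ) (i : Fin 3) (x : E3) : pd i (zCut n) x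
    = if i = 2 then deriv Real.smoothTransition (n * x 2 - 1) * n else 0 := by
  have h1 : HasDerivAt (fun t : ℝ => n * t - 1) (n : ℝ) (x 2) := by
    simpa using ((hasDerivAt_id (x 2)).const_mul (n : ℝ)).sub_const 1
  have h2 := ((Real.smoothTransition.contDiff (n := 1)).differentiable (by simp)
    (n * x 2 - 1)).hasDerivAt.comp (x 2) h1
  exact pd_comp_z h2 i

lemma deriv_smoothTransition_eq_zero {t : ℝ} (h : t < 0 ∨ 1 < t) :
    deriv Real.smoothTransition t = 0 := by
  rcases h with h | h
  · have : Real.smoothTransition =ᶠ[𝓝 t] fun _ => 0 := by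
      filter_upwards [Iio_mem_nhds h] with s hs
      exact Real.smoothTransition.zero_of_nonpos (le_of_lt hs)
    rw [this.deriv_eq, deriv_const]
  · have : Real.smoothTransition =ᶠ[𝓝 t] fun _ => 1 := by
      filter_upwards [Ioi_mem_nhds h] with s hs
      exact Real.smoothTransition.one_of_one_le (le_of_lt hs)
    rw [this.deriv_eq, deriv_const]

lemma exists_bound_deriv_smoothTransition :
    ∃ B : ℝ, 0 ≤ B ∧ ∀ t, |deriv Real.smoothTransition t| ≤ B := by
  have hc : Continuous (deriv Real.smoothTransition) :=
    (Real.smoothTransition.contDiff (n := 1)).continuous_deriv (by simp)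
  obtain ⟨B, hB⟩ := (isCompact_Icc (a := (0 : ℝ)) (b := 1)).exists_bound_of_continuousOn
    hc.continuousOn
  have hB0 : 0 ≤ B := (norm_nonneg _).trans (hB 0 ⟨le_rfl, zero_le_one⟩)
  refine ⟨B, hB0, fun t => ?_⟩
  by_cases ht : t ∈ Icc (0 : ℝ) 1
  · exact hB t ht
  · rw [deriv_smoothTransition_eq_zero, abs_zero]
    · exact hB0
    · by_contra! hc
      exact ht ⟨hc.1, hc.2⟩

lemma pd_zCut_eq_zero {n : ℕ} (i : Fin 3) {x : E3} (h : n * x 2 < 1 ∨ 2 < n * x 2) :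
    pd i (zCut n) x = 0 := by
  rw [pd_zCut]
  split_ifs
  · rw [deriv_smoothTransition_eq_zero, zero_mul]
    rcases h with h | h
    · left; linarith
    · right; linarith
  · rfl

/-- The normal derivative has size `n`, but it is supported where `1 ≤ n z ≤ 2`, so a factor `z`
makes it bounded uniformly in `n`. This is why conormal fields create no boundary terms. -/
lemma exists_bound_pd_zCut : ∃ B : ℝ, 0 ≤ B ∧ ∀ (n : ℕ) (i : Fin 3) (x : E3),
    |pd i (zCut n) x| ≤ B * n ∧ |x 2 * pd i (zCut n) x| ≤ B := by
  obtain ⟨B, hB0, hB⟩ := exists_bound_deriv_smoothTransition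
  have h1 : ∀ (n : ℕ) (i : Fin 3) (x : E3), |pd i (zCut n) x| ≤ B * n := by
    intro n i x
    rw [pd_zCut]
    split_ifs
    · rw [abs_mul, Nat.abs_cast]
      exact mul_le_mul_of_nonneg_right (hB _) n.cast_nonneg
    · simp; positivity
  refine ⟨2 * B, by positivity, fun n i x => ⟨?_, ?_⟩⟩
  · refine (h1 n i x).trans ?_
    have : 0 ≤ B * n := by positivity
    linarith
  · by_cases hx : n * x 2 < 1 ∨ 2 < n * x 2
    · rw [pd_zCut_eq_zero i hx]; simp; exact hB0
    · push Not at hx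
      have hn : (0 : ℝ) < n := by
        rcases n.eq_zero_or_pos with h | h
        · subst h; norm_num at hx
        · exact_mod_cast h
      have hx2 : 0 ≤ x 2 := by
        by_contra hc
        push Not at hc
        nlinarith [hx.1]
      rw [abs_mul, abs_of_nonneg hx2]
      calc x 2 * |pd i (zCut n) x| ≤ x 2 * (B * n) := mul_le_mul_of_nonneg_left (h1 n i x) hx2
        _ = B * (n * x 2) := by ring
        _ ≤ B * 2 := mul_le_mul_of_nonneg_left hx.2 hB0
        _ = 2 * B := by ring

lemma eventually_two_lt {x : E3} (hx : x ∈ (halfSpace : Set E3)) :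
    ∀ᶠ n : ℕ in atTop, 2 < n * x 2 := by
  have h : Tendsto (fun n : ℕ => (n : ℝ) * x 2) atTop atTop :=
    tendsto_natCast_atTop_atTop.atTop_mul_const (mem_hs.mp hx)
  exact h.eventually_gt_atTop 2

lemma tendsto_zCut {x : E3} (hx : x ∈ (halfSpace : Set E3)) :
    Tendsto (fun n => zCut n x) atTop (𝓝 1) := by
  refine tendsto_const_nhds.congr' ?_
  filter_upwards [eventually_two_lt hx] with n hn
  rw [zCut_eq_one hn.le]

lemma tendsto_pd_zCut (i : Fin 3) {x : E3} (hx : x ∈ (halfSpace : Set E3)) :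
    Tendsto (fun n => pd i (zCut n) x) atTop (𝓝 0) := by
  refine tendsto_const_nhds.congr' ?_
  filter_upwards [eventually_two_lt hx] with n hn
  rw [pd_zCut_eq_zero i (Or.inr hn)]

lemma isTest_mul_zCut {η : E3 → ℝ} (hη : ContDiff ℝ smoothExp η) (hc : HasCompactSupport η)
    (n : ℕ) : IsTest fun x => η x * zCut n x := by
  refine ⟨hη.mul (contDiff_zCut n), hc.mul_right, ?_⟩
  have h1 : tsupport (fun x => η x * zCut n x) ⊆ {x : E3 | 1 ≤ n * x 2} := by
    refine closure_minimal (fun x hx => ?_)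
      (isClosed_le continuous_const (by fun_prop))
    by_contra hc
    apply hx
    simp only [mem_ofPred_eq, not_le] at hc
    simp [zCut_eq_zero hc.le]
  intro x hx
  have h2 : (1 : ℝ) ≤ n * x 2 := h1 hx
  rw [mem_hs]
  by_contra hc
  push Not at hc
  nlinarith [n.cast_nonneg (α := ℝ)]

lemma pd_mul_zCut {η : E3 → ℝ} (hη : ContDiff ℝ smoothExp η) (n : ℕ) (i : Fin 3) (x : E3) :
    pd i (fun x => η x * zCut n x) x = pd i η x * zCut n x + η x * pd i (zCut n) x :=
  pd_mul i (hη.differentiable (by simp) x) ((contDiff_zCut n).differentiable (by simp) x)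

/-- A smooth cutoff equal to one in the ball of radius `n + 1`. -/
def radCut (n : ℕ) (x : E3) : ℝ :=
  (⟨1, 2, one_pos, one_lt_two⟩ : ContDiffBump (0 : E3)) ((1 / (n + 1) : ℝ) • x)

lemma contDiff_radCut (n : ℕ) : ContDiff ℝ smoothExp (radCut n) :=
  (ContDiffBump.contDiff _).comp (contDiff_const_smul _)

lemma hasCompactSupport_radCut (n : ℕ) : HasCompactSupport (radCut n) :=
  (ContDiffBump.hasCompactSupport (⟨1, 2, one_pos, one_lt_two⟩ : ContDiffBump (0 : E3))).comp_smul
    (by positivity)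

lemma abs_radCut_le (n : ℕ) (x : E3) : |radCut n x| ≤ 1 := by
  rw [radCut, abs_of_nonneg (ContDiffBump.nonneg _)]
  exact ContDiffBump.le_one _

lemma radCut_eq_one {n : ℕ} {x : E3} (h : ‖x‖ ≤ n + 1) : radCut n x = 1 := by
  apply ContDiffBump.one_of_mem_closedBall
  rw [mem_closedBall_zero_iff, norm_smul, Real.norm_of_nonneg (by positivity)]
  simp only
  rw [one_div, inv_mul_le_iff₀ (by positivity)]
  simpa using h

lemma tendsto_radCut (x : E3) : Tendsto (fun n => radCut n x) atTop (𝓝 1) := by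
  refine tendsto_const_nhds.congr' ?_
  filter_upwards [tendsto_natCast_atTop_atTop.eventually_ge_atTop ‖x‖] with n hn
  rw [radCut_eq_one (by linarith)]

lemma exists_bound_pd_radCut : ∃ B : ℝ, 0 ≤ B ∧ ∀ (n : ℕ) (i : Fin 3) (x : E3),
    |pd i (radCut n) x| ≤ B / (n + 1) := by
  set b : ContDiffBump (0 : E3) := ⟨1, 2, one_pos, one_lt_two⟩ with hb
  have hbc : ContDiff ℝ smoothExp b := b.contDiff
  have hcont : ∀ i, ∃ B, ∀ x, ‖pd i b x‖ ≤ B := fun i =>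
    (contDiff_pd hbc i).continuous.bounded_above_of_compact_support
      (hasCompactSupport_pd b.hasCompactSupport i)
  choose B hB using hcont
  have hB0 : ∀ i, 0 ≤ B i := fun i => (norm_nonneg _).trans (hB i 0)
  refine ⟨∑ i, B i, Finset.sum_nonneg fun i _ => hB0 i, fun n i x => ?_⟩
  have h1 : HasFDerivAt (fun y : E3 => (1 / ((n : ℝ) + 1)) • y)
      ((1 / ((n : ℝ) + 1)) • ContinuousLinearMap.id ℝ E3) x :=
    ((1 / ((n : ℝ) + 1)) • ContinuousLinearMap.id ℝ E3).hasFDerivAt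
  have h2 := (hbc.differentiable (by simp) ((1 / ((n : ℝ) + 1)) • x)).hasFDerivAt.comp x h1
  have h3 : pd i (radCut n) x = 1 / ((n : ℝ) + 1) * pd i b ((1 / ((n : ℝ) + 1)) • x) := by
    rw [pd, show radCut n = b ∘ fun y : E3 => (1 / ((n : ℝ) + 1)) • y from rfl, h2.fderiv]
    simp [pd]
  rw [h3, abs_mul, abs_of_nonneg (by positivity), one_div, inv_mul_eq_div]
  gcongr
  exact (hB i _).trans (Finset.single_le_sum (fun i _ => hB0 i) (Finset.mem_univ i))

lemma tendsto_pd_radCut (i : Fin 3) (x : E3) :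
    Tendsto (fun n => pd i (radCut n) x) atTop (𝓝 0) := by
  obtain ⟨B, hB0, hB⟩ := exists_bound_pd_radCut
  refine squeeze_zero_norm (fun n => hB n i x) ?_
  have := (tendsto_one_div_add_atTop_nhds_zero_nat (𝕜 := ℝ)).const_mul B
  simpa [div_eq_mul_inv] using this

/-! ### Conormal integration by parts on the half-space -/

/-- The divergence of the vector field `Zᵢ`. -/
def zDiv (i : Fin 3) (x : E3) : ℝ := if i = 2 then qf x ^ 2 else 0

lemma abs_zDiv_le (i : Fin 3) {x : E3} (hx : x ∈ (halfSpace : Set E3)) : |zDiv i x| ≤ 1 := by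
  unfold zDiv
  split_ifs
  · rw [abs_of_nonneg (by positivity)]
    exact pow_le_one₀ (qf_pos hx).le (qf_lt_one hx).le
  · simp

lemma smoothOn_zDiv (i : Fin 3) : ContDiffOn ℝ smoothExp (zDiv i) halfSpace := by
  unfold zDiv
  by_cases hi : i = 2
  · simp only [hi, if_true]; exact smoothOn_qf.pow 2
  · simp only [hi, if_false]; exact contDiffOn_const

lemma abs_conormalWeight_le (i : Fin 3) {x : E3} (hx : x ∈ (halfSpace : Set E3)) :
    |conormalWeight i x| ≤ 1 := by
  rw [abs_of_pos (conormalWeight_pos i hx)]; exact conormalWeight_le_one i hx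

lemma conormalWeight_two_le {x : E3} (hx : x ∈ (halfSpace : Set E3)) :
    conormalWeight 2 x ≤ x 2 := by
  have := mem_hs.mp hx
  simp only [conormalWeight]
  exact div_le_self this.le (by linarith)

/-- No boundary condition on `H` is needed: against the cutoffs, the derivative falling on the
cutoff carries the weight `wᵢ`, stays bounded by `B' + B`, and tends to zero pointwise. Dominated
convergence leaves only the divergence of `Zᵢ`. -/
theorem integral_conormal {i : Fin 3} {H H' : E3 → ℝ}
    (h : IsWeakDeriv conormalWeight (Pi.single i 1) H H') (hH : Integrable H hsMeasure)
    (hH' : Integrable H' hsMeasure) :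
    ∫ x, H' x ∂hsMeasure = -∫ x, zDiv i x * H x ∂hsMeasure := by
  obtain ⟨B, hB0, hB⟩ := exists_bound_pd_zCut
  obtain ⟨B', hB0', hB'⟩ := exists_bound_pd_radCut
  set ψ : ℕ → E3 → ℝ := fun n x => radCut n x * zCut n x with hψdef
  have hψ : ∀ n, IsTest (ψ n) := fun n =>
    isTest_mul_zCut (contDiff_radCut n) (hasCompactSupport_radCut n) n
  have hψ1 : ∀ n x, |ψ n x| ≤ 1 := fun n x => by
    rw [hψdef]; simp only; rw [abs_mul]
    exact mul_le_one₀ (abs_radCut_le n x) (abs_nonneg _) (abs_zCut_le n x)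
  have hψt : ∀ x ∈ (halfSpace : Set E3), Tendsto (fun n => ψ n x) atTop (𝓝 1) := fun x hx => by
    simpa using (tendsto_radCut x).mul (tendsto_zCut hx)
  have hpd : ∀ n x, pd i (ψ n) x = pd i (radCut n) x * zCut n x + radCut n x * pd i (zCut n) x :=
    fun n x => pd_mul_zCut (contDiff_radCut n) n i x
  have hpdb : ∀ n, ∀ x ∈ (halfSpace : Set E3), |conormalWeight i x * pd i (ψ n) x| ≤ B' + B := by
    intro n x hx
    rw [hpd, mul_add]
    have hx0 := mem_hs.mp hx
    refine (abs_add_le _ _).trans (add_le_add ?_ ?_)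
    · rw [abs_mul, abs_mul]
      have h1 : |pd i (radCut n) x| ≤ B' := (hB' n i x).trans (div_le_self hB0' (by
        have := n.cast_nonneg (α := ℝ); linarith))
      calc |conormalWeight i x| * (|pd i (radCut n) x| * |zCut n x|) ≤ 1 * (B' * 1) := by
            gcongr
            · exact abs_conormalWeight_le i hx
            · exact abs_zCut_le n x
        _ = B' := by ring
    · by_cases hi : i = 2
      · subst hi
        have h1 := (hB n 2 x).2
        have h2 : |conormalWeight 2 x * pd 2 (zCut n) x| ≤ B := by
          refine le_trans ?_ h1
          rw [abs_mul, abs_mul, abs_of_pos (conormalWeight_pos 2 hx), abs_of_pos hx0]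
          exact mul_le_mul_of_nonneg_right (conormalWeight_two_le hx) (abs_nonneg _)
        calc |conormalWeight 2 x * (radCut n x * pd 2 (zCut n) x)|
            = |radCut n x| * |conormalWeight 2 x * pd 2 (zCut n) x| := by
              rw [← abs_mul]; ring_nf
          _ ≤ 1 * B := by
              gcongr
              exact abs_radCut_le n x
          _ = B := one_mul B
      · rw [pd_zCut, if_neg hi]; simpa using hB0
  have hpdt : ∀ x ∈ (halfSpace : Set E3),
      Tendsto (fun n => pd i (ψ n) x) atTop (𝓝 0) := fun x hx => by
    simp only [hpd]
    simpa using ((tendsto_pd_radCut i x).mul (tendsto_zCut hx)).add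
      ((tendsto_radCut x).mul (tendsto_pd_zCut i hx))
  have hm : ∀ n, AEStronglyMeasurable (fun x => conormalWeight i x * pd i (ψ n) x
      + zDiv i x * ψ n x) hsMeasure := fun n => by
    have h1 := (smoothOn_conormalWeight i).continuousOn.aestronglyMeasurable (μ := volume)
      measurableSet_hs
    have h2 := (smoothOn_zDiv i).continuousOn.aestronglyMeasurable (μ := volume) measurableSet_hs
    exact (h1.mul ((hψ n).pd i).continuous.aestronglyMeasurable).add
      (h2.mul (hψ n).continuous.aestronglyMeasurable)
  have t1 : Tendsto (fun n => ∫ x, H' x * ψ n x ∂hsMeasure) atTop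
      (𝓝 (∫ x, H' x ∂hsMeasure)) := by
    refine tendsto_integral_of_dominated_convergence (fun x => |H' x|)
      (fun n => hH'.1.mul (hψ n).continuous.aestronglyMeasurable) hH'.abs
      (fun n => Eventually.of_forall fun x => ?_) (ae_hs_of_forall fun x hx => ?_)
    · rw [norm_mul]
      exact mul_le_of_le_one_right (norm_nonneg _) (hψ1 n x)
    · simpa using (hψt x hx).const_mul (H' x)
  have t2 : Tendsto (fun n => ∫ x, H x * (conormalWeight i x * pd i (ψ n) x
      + zDiv i x * ψ n x) ∂hsMeasure) atTop (𝓝 (∫ x, zDiv i x * H x ∂hsMeasure)) := by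
    refine tendsto_integral_of_dominated_convergence (fun x => |H x| * (B' + B + 1))
      (fun n => hH.1.mul (hm n)) (hH.abs.mul_const _)
      (fun n => ae_hs_of_forall fun x hx => ?_) (ae_hs_of_forall fun x hx => ?_)
    · rw [norm_mul]
      refine mul_le_mul_of_nonneg_left ((abs_add_le _ _).trans
        (add_le_add (hpdb n x hx) ?_)) (norm_nonneg _)
      rw [abs_mul]
      exact mul_le_one₀ (abs_zDiv_le i hx) (abs_nonneg _) (hψ1 n x)
    · have := (((hpdt x hx).const_mul (conormalWeight i x)).add
        ((hψt x hx).const_mul (zDiv i x))).const_mul (H x)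
      simpa [mul_comm] using this
  have hn : ∀ n, -∫ x, H x * (conormalWeight i x * pd i (ψ n) x + zDiv i x * ψ n x) ∂hsMeasure
      = ∫ x, H' x * ψ n x ∂hsMeasure := by
    intro n
    rw [← (isWeakDeriv_iff.mp h).2.2 (ψ n) (hψ n), transposeIter_single, ← integral_neg]
    refine setIntegral_hs_congr fun x hx => ?_
    rw [(hψ n).transposeField_apply i hx, zDiv]; ring
  exact tendsto_nhds_unique t1 (t2.neg.congr hn)

/-! ### Extension by zero -/

/-- Extension by zero outside the half-space. -/
def ext0 (f : E3 → ℝ) : E3 → ℝ := (halfSpace : Set E3).indicator f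

lemma memLp_ext0 {f : E3 → ℝ} {p : ℝ≥0∞} (h : MemLp f p hsMeasure) : MemLp (ext0 f) p volume :=
  (memLp_indicator_iff_restrict measurableSet_hs).mpr h

lemma integral_ext0_mul (f η : E3 → ℝ) : ∫ x, ext0 f x * η x = ∫ x, f x * η x ∂hsMeasure := by
  rw [← integral_indicator measurableSet_hs]
  refine integral_congr_ae (Eventually.of_forall fun x => ?_)
  by_cases hx : x ∈ (halfSpace : Set E3)
  · simp [ext0, indicator_of_mem hx]
  · simp [ext0, indicator_of_notMem hx]

/-- `∂ᵢ f = g` in the half-space, with vanishing trace if `i = 2`. -/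
def WD0 (i : Fin 3) (f g : E3 → ℝ) : Prop := ES i (ext0 f) (ext0 g)

lemma wd0_iff {i : Fin 3} {f g : E3 → ℝ} (hf : MemLp f 2 hsMeasure) (hg : MemLp g 2 hsMeasure) :
    WD0 i f g ↔ ∀ η : E3 → ℝ, ContDiff ℝ smoothExp η → HasCompactSupport η →
      ∫ x, f x * pd i η x ∂hsMeasure = -∫ x, g x * η x ∂hsMeasure := by
  constructor
  · rintro ⟨-, -, h⟩ η h1 h2
    have := h η h1 h2
    rwa [integral_ext0_mul, integral_ext0_mul] at this
  · intro h
    refine ⟨(memLp_ext0 hf).locallyIntegrable_two, (memLp_ext0 hg).locallyIntegrable_two,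
      fun η h1 h2 => ?_⟩
    rw [integral_ext0_mul, integral_ext0_mul]
    exact h η h1 h2

lemma WD0.congr {i : Fin 3} {f g f' g' : E3 → ℝ} (h : WD0 i f g) (hf : f =ᵐ[hsMeasure] f')
    (hg : g =ᵐ[hsMeasure] g') : WD0 i f' g' := by
  have key : ∀ {a b : E3 → ℝ}, a =ᵐ[hsMeasure] b → ext0 a =ᵐ[volume] ext0 b := by
    intro a b hab
    rw [EventuallyEq, ae_restrict_iff' measurableSet_hs] at hab
    filter_upwards [hab] with x hx
    by_cases hxs : x ∈ (halfSpace : Set E3)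
    · simp [ext0, indicator_of_mem hxs, hx hxs]
    · simp [ext0, indicator_of_notMem hxs]
  refine ⟨h.left.congr (key hf), h.right.congr (key hg), fun η h1 h2 => ?_⟩
  have e1 : ∫ x, ext0 f' x * pd i η x = ∫ x, ext0 f x * pd i η x :=
    integral_congr_ae ((key hf).symm.mul (EventuallyEq.refl _ (pd i η)))
  have e2 : ∫ x, ext0 g' x * η x = ∫ x, ext0 g x * η x :=
    integral_congr_ae ((key hg).symm.mul (EventuallyEq.refl _ η))
  rw [e1, e2]
  exact h.eq η h1 h2

lemma memLp_of_smooth {η : E3 → ℝ} (h1 : ContDiff ℝ smoothExp η) (h2 : HasCompactSupport η) :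
    MemLp η 2 hsMeasure :=
  (h1.continuous.memLp_of_hasCompactSupport h2).restrict _

/-- Testing with `η zCut n`, where `η` need not vanish at the boundary, produces a single extra
term; its convergence to zero is the weak form of a vanishing trace. -/
lemma WD.wd0_of_tendsto {i : Fin 3} {f g : E3 → ℝ} (h : WD i f g) (hf : MemLp f 2 hsMeasure)
    (hg : MemLp g 2 hsMeasure)
    (hz : ∀ η : E3 → ℝ, ContDiff ℝ smoothExp η → HasCompactSupport η →
      Tendsto (fun n => ∫ x, f x * (η x * pd i (zCut n) x) ∂hsMeasure) atTop (𝓝 0)) :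
    WD0 i f g := by
  rw [wd0_iff hf hg]
  intro η h1 h2
  have m1 := memLp_of_smooth h1 h2
  have m2 := memLp_of_smooth (contDiff_pd h1 i) (hasCompactSupport_pd h2 i)
  have key : ∀ {a b : E3 → ℝ}, MemLp a 2 hsMeasure → MemLp b 2 hsMeasure →
      Tendsto (fun n => ∫ x, a x * (b x * zCut n x) ∂hsMeasure) atTop
        (𝓝 (∫ x, a x * b x ∂hsMeasure)) := by
    intro a b ha hb
    refine tendsto_integral_of_dominated_convergence (fun x => |a x * b x|)
      (fun n => ha.1.mul (hb.1.mul (contDiff_zCut n).continuous.aestronglyMeasurable))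
      (memLp_two_mul ha hb).abs
      (fun n => Eventually.of_forall fun x => ?_) (ae_hs_of_forall fun x hx => ?_)
    · rw [← mul_assoc, norm_mul]
      exact mul_le_of_le_one_right (norm_nonneg _) (abs_zCut_le n x)
    · simpa using ((tendsto_zCut hx).const_mul (b x)).const_mul (a x)
  have hn : ∀ n, (∫ x, f x * (pd i η x * zCut n x) ∂hsMeasure)
      + ∫ x, f x * (η x * pd i (zCut n) x) ∂hsMeasure
      = -∫ x, g x * (η x * zCut n x) ∂hsMeasure := by
    intro n
    rw [← h.eq _ (isTest_mul_zCut h1 h2 n), ← integral_add]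
    · refine integral_congr_ae (Eventually.of_forall fun x => ?_)
      simp only
      rw [pd_mul_zCut h1]; ring
    · exact h.left.integrable_mul (isTest_mul_zCut (contDiff_pd h1 i) (hasCompactSupport_pd h2 i) n)
    · have hc : HasCompactSupport (fun x => η x * pd i (zCut n) x) := h2.mul_right
      exact memLp_two_mul hf (memLp_of_smooth (h1.mul (contDiff_pd (contDiff_zCut n) i)) hc)
  have := tendsto_nhds_unique (((key hf m2).add (hz η h1 h2)).congr hn) (key hg m1).neg
  rwa [add_zero] at this

lemma WD.wd0_of_ne {i : Fin 3} {f g : E3 → ℝ} (h : WD i f g) (hf : MemLp f 2 hsMeasure)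
    (hg : MemLp g 2 hsMeasure) (hi : i ≠ 2) : WD0 i f g :=
  h.wd0_of_tendsto hf hg fun η _ _ => by
    simp only [pd_zCut, if_neg hi, mul_zero, integral_zero]
    exact tendsto_const_nhds

/-- With `f = φ k`, the factor `φ` tames the derivative of the cutoff, and `|k η| B` dominates. The
criterion serves for functions of the form `Z₃ h`. -/
lemma WD.wd0_of_weight {f g k : E3 → ℝ} (h : WD 2 f g) (hf : MemLp f 2 hsMeasure)
    (hg : MemLp g 2 hsMeasure) (hk : MemLp k 2 hsMeasure)
    (hfk : f =ᵐ[hsMeasure] fun x => conormalWeight 2 x * k x) : WD0 2 f g :=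
  h.wd0_of_tendsto hf hg fun η h1 h2 => by
    obtain ⟨B, hB0, hB⟩ := exists_bound_pd_zCut
    have m1 := memLp_of_smooth h1 h2
    have : Tendsto (fun n => ∫ x, f x * (η x * pd 2 (zCut n) x) ∂hsMeasure) atTop
        (𝓝 (∫ x, (0 : ℝ) ∂hsMeasure)) := by
      refine tendsto_integral_of_dominated_convergence (fun x => |k x * η x| * B)
        (fun n => hf.1.mul (m1.1.mul
          (contDiff_pd (contDiff_zCut n) 2).continuous.aestronglyMeasurable))
        ((memLp_two_mul hk m1).abs.mul_const B) (fun n => ?_) (ae_hs_of_forall fun x hx => ?_)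
      · filter_upwards [hfk, ae_hs_of_forall fun x hx => hx] with x hx hxs
        rw [hx]
        have hx0 := mem_hs.mp hxs
        calc ‖conormalWeight 2 x * k x * (η x * pd 2 (zCut n) x)‖
            = |k x * η x| * (conormalWeight 2 x * |pd 2 (zCut n) x|) := by
              rw [Real.norm_eq_abs, abs_mul, abs_mul, abs_mul, abs_mul,
                abs_of_pos (conormalWeight_pos 2 hxs)]; ring
          _ ≤ |k x * η x| * B := by
              refine mul_le_mul_of_nonneg_left (le_trans ?_ (hB n 2 x).2) (abs_nonneg _)
              rw [abs_mul, abs_of_pos hx0]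
              exact mul_le_mul_of_nonneg_right (conormalWeight_two_le hxs) (abs_nonneg _)
      · simpa using ((tendsto_pd_zCut 2 hx).const_mul (η x)).const_mul (f x)
    simpa using this

/-- Tangential integration by parts never sees the boundary, so the identity for `f` may be tested
with `∂ⱼη`, and `∂ⱼ` commutes with `∂_z` on `η`. -/
lemma WD0.tangential {j : Fin 3} {f g f₁ g₁ : E3 → ℝ} (h : WD0 2 f g) (hf : WD j f f₁)
    (hg : WD j g g₁) (hj : j ≠ 2) (mf : MemLp f 2 hsMeasure) (mg : MemLp g 2 hsMeasure)
    (mf₁ : MemLp f₁ 2 hsMeasure) (mg₁ : MemLp g₁ 2 hsMeasure) : WD0 2 f₁ g₁ := by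
  have h1 := (wd0_iff mf mf₁).mp (hf.wd0_of_ne mf mf₁ hj)
  have h2 := (wd0_iff mg mg₁).mp (hg.wd0_of_ne mg mg₁ hj)
  rw [wd0_iff mf mg] at h
  rw [wd0_iff mf₁ mg₁]
  intro η hη hηc
  have e1 := h1 _ (contDiff_pd hη 2) (hasCompactSupport_pd hηc 2)
  have e2 := h _ (contDiff_pd hη j) (hasCompactSupport_pd hηc j)
  have e3 := h2 η hη hηc
  rw [pd_comm hη] at e1
  linarith

lemma WD0.wd {i : Fin 3} {f g : E3 → ℝ} (h : WD0 i f g) (mf : MemLp f 2 hsMeasure)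
    (mg : MemLp g 2 hsMeasure) : WD i f g :=
  ⟨mf.l2loc.locInt, mg.l2loc.locInt, fun ψ hψ => (wd0_iff mf mg).mp h ψ hψ.smooth hψ.compact⟩

lemma volume_slab_le (R δ : ℝ) (hR : 0 ≤ R) :
    volume {x : E3 | ‖x‖ ≤ R ∧ 0 < x 2 ∧ x 2 ≤ δ} ≤ ENNReal.ofReal ((2 * R) ^ 2 * δ) := by
  have hmp := EuclideanSpace.volume_preserving_symm_measurableEquiv_toLp (Fin 3)
  set a : Fin 3 → ℝ := ![-R, -R, 0]
  set b : Fin 3 → ℝ := ![R, R, δ]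
  have hsub : {x : E3 | ‖x‖ ≤ R ∧ 0 < x 2 ∧ x 2 ≤ δ}
      ⊆ (MeasurableEquiv.toLp 2 (Fin 3 → ℝ)).symm ⁻¹' Icc a b := by
    rintro x ⟨h1, h2, h3⟩
    have hx : ∀ i, -R ≤ x i ∧ x i ≤ R := fun i => abs_le.mp ((abs_coord_le x i).trans h1)
    constructor
    · intro i
      fin_cases i
      · exact (hx 0).1
      · exact (hx 1).1
      · exact h2.le
    · intro i
      fin_cases i
      · exact (hx 0).2
      · exact (hx 1).2
      · exact h3
  refine (measure_mono hsub).trans ?_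
  rw [hmp.measure_preimage measurableSet_Icc.nullMeasurableSet, Real.volume_Icc_pi,
    Fin.prod_univ_three]
  simp only [a, b]
  simp only [Matrix.cons_val_zero, Matrix.cons_val_one, Matrix.cons_val]
  rw [← ENNReal.ofReal_mul (by linarith), ← ENNReal.ofReal_mul (by nlinarith)]
  apply le_of_eq
  congr 1; ring

/-- The derivative of the cutoff is `O(n)` on a slab whose part inside the support of `η` has volume
`O(1/n)`. What remains is the supremum of `|f|` there, which tends to zero by continuity and `f = 0`
at `z = 0`. -/
lemma WD.wd0_of_continuousOn {f g : E3 → ℝ} (h : WD 2 f g) (hf : MemLp f 2 hsMeasure)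
    (hg : MemLp g 2 hsMeasure) (hc : ContinuousOn f (closure (halfSpace : Set E3)))
    (h0 : ∀ x : E3, x 2 = 0 → f x = 0) : WD0 2 f g :=
  h.wd0_of_tendsto hf hg fun η h1 h2 => by
    obtain ⟨B, hB0, hB⟩ := exists_bound_pd_zCut
    obtain ⟨M, hM⟩ := h1.continuous.bounded_above_of_compact_support h2
    have hM0 : 0 ≤ M := (norm_nonneg _).trans (hM 0)
    obtain ⟨R, hR0, hR⟩ : ∃ R : ℝ, 0 ≤ R ∧ ∀ x, η x ≠ 0 → ‖x‖ ≤ R := by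
      obtain ⟨R, hR⟩ := h2.isCompact.isBounded.subset_closedBall 0
      refine ⟨max R 0, le_max_right _ _, fun x hx => ?_⟩
      have := hR (subset_tsupport η hx)
      rw [mem_closedBall_zero_iff] at this
      exact this.trans (le_max_left _ _)
    have hcl : {x : E3 | 0 ≤ x 2} ⊆ closure (halfSpace : Set E3) := by
      intro x hx
      rw [mem_closure_iff_seq_limit]
      refine ⟨fun n => x + (1 / ((n : ℝ) + 1)) • basisVec 2, fun n => ?_, ?_⟩
      · have : (0 : ℝ) ≤ x 2 := hx
        show 0 < (x + (1 / ((n : ℝ) + 1)) • basisVec 2) 2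
        simp [basisVec]
        positivity
      · have := (tendsto_one_div_add_atTop_nhds_zero_nat (𝕜 := ℝ)).smul_const (basisVec 2)
        simpa using this.const_add x
    have hsmall : ∀ ε > 0, ∃ δ > 0, ∀ x : E3, ‖x‖ ≤ R → 0 < x 2 → x 2 < δ → |f x| < ε := by
      intro ε hε
      set K : Set E3 := Metric.closedBall 0 R ∩ {x | 0 ≤ x 2} with hK
      have hKc : IsCompact K := (isCompact_closedBall 0 R).inter_right
        (isClosed_le continuous_const (by fun_prop))
      have hfK : ContinuousOn (fun x => |f x|) K := (hc.mono (inter_subset_right.trans hcl)).abs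
      -- The points of `K` with `|f| ≥ ε` form a compact set that misses the boundary, so its least
      -- height is positive and serves as `δ`.
      set S : Set E3 := K ∩ (fun x => |f x|) ⁻¹' Ici ε with hS
      have hSc : IsCompact S := hKc.of_isClosed_subset
        (hfK.preimage_isClosed_of_isClosed hKc.isClosed isClosed_Ici) inter_subset_left
      rcases S.eq_empty_or_nonempty with he | hne
      · refine ⟨1, one_pos, fun x hx hx2 _ => ?_⟩
        by_contra hcon
        push Not at hcon
        have : x ∈ S := ⟨⟨by simpa using hx, hx2.le⟩, hcon⟩
        rw [he] at this
        exact this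
      · obtain ⟨y, hy, hmin⟩ := hSc.exists_isMinOn (f := fun x : E3 => x 2) hne
          (by fun_prop)
        have hy2 : 0 < y 2 := by
          refine lt_of_le_of_ne hy.1.2 fun heq => ?_
          have h3 : ε ≤ |f y| := hy.2
          rw [h0 y heq.symm, abs_zero] at h3
          linarith
        refine ⟨y 2, hy2, fun x hx hx2 hxy => ?_⟩
        by_contra hcon
        push Not at hcon
        have : x ∈ S := ⟨⟨by simpa using hx, hx2.le⟩, hcon⟩
        have h4 : y 2 ≤ x 2 := hmin this
        linarith
    rw [Metric.tendsto_atTop]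
    intro ε hε
    -- The product of the bounds on `η`, on the cutoff derivative and on the volume of the slab,
    -- after the powers of `n` cancel; the 1 makes it positive.
    set c : ℝ := M * B * ((2 * R) ^ 2 * 2) + 1 with hc'
    have hcpos : 0 < c := by positivity
    obtain ⟨δ, hδ, hδf⟩ := hsmall (ε / (2 * c)) (by positivity)
    obtain ⟨N, hN⟩ := exists_nat_gt (2 / δ)
    refine ⟨N + 1, fun n hn => ?_⟩
    have hn0 : (0 : ℝ) < n := by
      have : 0 < n := by omega
      exact_mod_cast this
    have hnδ : 2 / (n : ℝ) < δ := by
      have h5 : 2 / δ < n := hN.trans (by exact_mod_cast (by omega : N < n))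
      rw [div_lt_iff₀ hδ] at h5
      rw [div_lt_iff₀ hn0]
      linarith
    rw [dist_zero_right]
    set A : Set E3 := {x : E3 | ‖x‖ ≤ R ∧ 0 < x 2 ∧ x 2 ≤ 2 / n} with hA
    have hAm : MeasurableSet A := by
      refine ((isClosed_le continuous_norm continuous_const).measurableSet).inter ?_
      have hm2 : Measurable fun x : E3 => x 2 := Continuous.measurable (by fun_prop)
      exact (measurableSet_lt measurable_const hm2).inter (measurableSet_le hm2 measurable_const)
    have hint : ∫ x, f x * (η x * pd 2 (zCut n) x) ∂hsMeasure
        = ∫ x in A, f x * (η x * pd 2 (zCut n) x) := by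
      refine setIntegral_eq_of_subset_of_forall_sdiff_eq_zero measurableSet_hs
        (fun x hx => hx.2.1) fun x hx => ?_
      by_cases hη0 : η x = 0
      · simp [hη0]
      · rw [pd_zCut_eq_zero 2, mul_zero, mul_zero]
        right
        by_contra hcon
        push Not at hcon
        apply hx.2
        refine ⟨hR x hη0, hx.1, ?_⟩
        rw [le_div_iff₀ hn0]; linarith
    have hvol : volume A ≤ ENNReal.ofReal ((2 * R) ^ 2 * (2 / n)) := volume_slab_le R _ hR0
    have hvfin : volume A < ∞ := hvol.trans_lt ENNReal.ofReal_lt_top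
    rw [hint]
    have hbd : ∀ x ∈ A, ‖f x * (η x * pd 2 (zCut n) x)‖ ≤ ε / (2 * c) * (M * (B * n)) := by
      intro x hx
      rw [norm_mul, norm_mul]
      gcongr
      · exact (hδf x hx.1 hx.2.1 (hx.2.2.trans_lt hnδ)).le
      · exact hM x
      · exact (hB n 2 x).1
    refine (norm_setIntegral_le_of_norm_le_const hvfin hbd).trans_lt ?_
    have hvr : volume.real A ≤ (2 * R) ^ 2 * (2 / n) :=
      ENNReal.toReal_le_of_le_ofReal (by positivity) hvol
    calc ε / (2 * c) * (M * (B * n)) * volume.real A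
        ≤ ε / (2 * c) * (M * (B * n)) * ((2 * R) ^ 2 * (2 / n)) := by gcongr
      _ = ε / (2 * c) * (M * B * ((2 * R) ^ 2 * 2)) := by field_simp
      _ ≤ ε / (2 * c) * c := by gcongr; rw [hc']; linarith
      _ = ε / 2 := by field_simp
      _ < ε := by linarith

end ConormalEuler

end

noncomputable section

namespace ConormalEuler

/-! ### Density of test functions and Hardy inequalities -/

lemma tendsto_eLpNorm_mul_zero {X : Type*} [MeasurableSpace X] {μ : Measure X} {h : X → ℝ}
    (hh : MemLp h 2 μ) {a : ℕ → X → ℝ} (ha : ∀ n, AEStronglyMeasurable (a n) μ) {C : ℝ≥0}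
    (hC : ∀ n x, |a n x| ≤ C) (ht : ∀ᵐ x ∂μ, Tendsto (fun n => a n x) atTop (𝓝 0)) :
    Tendsto (fun n => eLpNorm (fun x => a n x * h x) 2 μ) atTop (𝓝 0) := by
  have key : Tendsto (fun n => ∫⁻ x, ‖a n x * h x‖ₑ ^ 2 ∂μ) atTop (𝓝 (∫⁻ _, 0 ∂μ)) := by
    refine tendsto_lintegral_of_dominated_convergence' (fun x => C ^ 2 * ‖h x‖ₑ ^ 2)
      (fun n => (((ha n).mul hh.1).enorm).pow_const 2)
      (fun n => Eventually.of_forall fun x => ?_) ?_ ?_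
    · simp only [enorm_mul, mul_pow]
      gcongr
      rw [← ofReal_norm, ← ENNReal.ofReal_coe_nnreal]
      exact ENNReal.ofReal_le_ofReal (hC n x)
    · rw [lintegral_const_mul' _ _ (by simp), ← eLpNorm_two_sq]
      exact ENNReal.mul_ne_top (by simp) (by simp [hh.2.ne])
    · filter_upwards [ht] with x hx
      have h1 := hx.mul_const (h x)
      rw [zero_mul] at h1
      have h2 := ((ENNReal.continuous_pow 2).tendsto _).comp h1.enorm
      simpa [Function.comp_def] using h2
  simp only [lintegral_zero, ← eLpNorm_two_sq] at key
  rw [ENNReal.tendsto_nhds_zero] at key ⊢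
  intro ε hε
  filter_upwards [key (ε ^ 2) (by positivity)] with n hn
  exact le_of_sq_le_sq hn

lemma eLpNorm_sub_lt_of {X : Type*} [MeasurableSpace X] {μ : Measure X} {f g h : X → ℝ}
    {ε : ℝ≥0∞} (hf : AEStronglyMeasurable (fun x => f x - g x) μ)
    (hg : AEStronglyMeasurable (fun x => g x - h x) μ)
    (h1 : eLpNorm (fun x => f x - g x) 2 μ < ε / 2)
    (h2 : eLpNorm (fun x => g x - h x) 2 μ < ε / 2) : eLpNorm (fun x => f x - h x) 2 μ < ε := by
  have e : (fun x => f x - h x) = (fun x => f x - g x) + fun x => g x - h x := by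
    funext x; simp
  rw [e]
  calc _ ≤ _ := eLpNorm_add_le hf hg (by norm_num)
    _ < ε / 2 + ε / 2 := ENNReal.add_lt_add h1 h2
    _ = ε := ENNReal.add_halves ε

/-- The zero extension is mollified upwards, so the approximant vanishes near the boundary; a radial
cutoff then makes the support compact. -/
theorem WD0.exists_test {i : Fin 3} {f g : E3 → ℝ} (h : WD0 i f g) (hf : MemLp f 2 hsMeasure)
    (hg : MemLp g 2 hsMeasure) {ε : ℝ≥0∞} (hε : 0 < ε) : ∃ ψ, IsTest ψ ∧
      eLpNorm (fun x => ψ x - f x) 2 hsMeasure < ε ∧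
      eLpNorm (fun x => pd i ψ x - g x) 2 hsMeasure < ε := by
  obtain ⟨G, hG, hG2, hG2', hl, hl', -, hz, -⟩ := h.exists_approx (memLp_ext0 hf) (memLp_ext0 hg)
  have hε2 : 0 < ε / 2 := ENNReal.div_pos hε.ne' (by norm_num)
  have hε4 : 0 < ε / 2 / 2 := ENNReal.div_pos hε2.ne' (by norm_num)
  obtain ⟨n, hn1, hn2⟩ := ((hl.eventually_lt_const hε2).and (hl'.eventually_lt_const hε2)).exists
  obtain ⟨c, hc, hz⟩ := hz n
  obtain ⟨B, hB0, hB⟩ := exists_bound_pd_radCut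
  have r1 : Tendsto (fun m => eLpNorm (fun x => (radCut m x - 1) * G n x) 2 volume) atTop
      (𝓝 0) := tendsto_eLpNorm_mul_zero (hG2 n)
    (fun m => ((contDiff_radCut m).continuous.sub continuous_const).aestronglyMeasurable)
    (C := 2) (fun m x => by
      have := abs_le.mp (abs_radCut_le m x)
      rw [abs_le]; constructor <;> norm_num <;> linarith)
    (Eventually.of_forall fun x => by simpa using (tendsto_radCut x).sub_const 1)
  have r2 : Tendsto (fun m => eLpNorm (fun x => (radCut m x - 1) * pd i (G n) x) 2 volume) atTop
      (𝓝 0) := tendsto_eLpNorm_mul_zero (hG2' n)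
    (fun m => ((contDiff_radCut m).continuous.sub continuous_const).aestronglyMeasurable)
    (C := 2) (fun m x => by
      have := abs_le.mp (abs_radCut_le m x)
      rw [abs_le]; constructor <;> norm_num <;> linarith)
    (Eventually.of_forall fun x => by simpa using (tendsto_radCut x).sub_const 1)
  have r3 : Tendsto (fun m => eLpNorm (fun x => pd i (radCut m) x * G n x) 2 volume) atTop
      (𝓝 0) := tendsto_eLpNorm_mul_zero (hG2 n)
    (fun m => (contDiff_pd (contDiff_radCut m) i).continuous.aestronglyMeasurable)
    (C := B.toNNReal) (fun m x => ((hB m i x).trans (div_le_self hB0 (by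
        have := m.cast_nonneg (α := ℝ); linarith))).trans (Real.le_coe_toNNReal B))
    (Eventually.of_forall fun x => tendsto_pd_radCut i x)
  obtain ⟨m, ⟨hm1, hm2⟩, hm3⟩ := (((r1.eventually_lt_const hε2).and
    (r2.eventually_lt_const hε4)).and (r3.eventually_lt_const hε4)).exists
  set ψ : E3 → ℝ := fun x => radCut m x * G n x with hψ
  have hψs : ContDiff ℝ smoothExp ψ := (contDiff_radCut m).mul (hG n)
  have hpd : ∀ x, pd i ψ x = pd i (radCut m) x * G n x + radCut m x * pd i (G n) x := fun x =>
    pd_mul i ((contDiff_radCut m).differentiable (by simp) x) ((hG n).differentiable (by simp) x)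
  have hres : ∀ {a : E3 → ℝ}, eLpNorm a 2 hsMeasure ≤ eLpNorm a 2 volume := fun {a} =>
    eLpNorm_mono_measure a Measure.restrict_le_self
  have hres2 : ∀ {a b : E3 → ℝ}, eLpNorm (fun x => a x - b x) 2 hsMeasure
      ≤ eLpNorm (fun x => a x - ext0 b x) 2 volume := fun {a b} => by
    refine le_trans (le_of_eq ?_) hres
    refine eLpNorm_congr_ae (ae_hs_of_forall fun x hx => ?_)
    simp [ext0, indicator_of_mem hx]
  refine ⟨ψ, ⟨hψs, (hasCompactSupport_radCut m).mul_right, ?_⟩, ?_, ?_⟩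
  · have hsub : tsupport ψ ⊆ {x : E3 | c ≤ x 2} := by
      refine closure_minimal (fun x hx => ?_) (isClosed_le continuous_const (by fun_prop))
      by_contra hcon
      simp only [mem_ofPred_eq, not_le] at hcon
      apply hx
      simp only [hψ]
      rw [hz x fun t ht => indicator_of_notMem (fun h' => ?_) f, mul_zero]
      have := mem_hs.mp h'
      linarith
    intro x hx
    exact mem_hs.mpr (hc.trans_le (hsub hx))
  · refine eLpNorm_sub_lt_of (g := G n)
      (hψs.continuous.sub (hG n).continuous).aestronglyMeasurable
      ((hG n).continuous.aestronglyMeasurable.sub hf.1) ?_ (hres2.trans_lt hn1)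
    refine lt_of_le_of_lt (le_trans (le_of_eq ?_) hres) hm1
    congr 1; funext x; simp only [hψ]; ring
  · have c1 := contDiff_pd hψs i
    have c2 := contDiff_pd (hG n) i
    refine eLpNorm_sub_lt_of (g := pd i (G n))
      (c1.continuous.sub c2.continuous).aestronglyMeasurable
      (c2.continuous.aestronglyMeasurable.sub hg.1) ?_ (hres2.trans_lt hn2)
    have c3 := ((contDiff_radCut m).sub (contDiff_const (c := (1 : ℝ)))).mul c2
    have e : (fun x => pd i ψ x - pd i (G n) x) = fun x =>
        pd i (radCut m) x * G n x - (-((radCut m x - 1) * pd i (G n) x)) := by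
      funext x; rw [hpd]; ring
    rw [e]
    have c4 := (contDiff_pd (contDiff_radCut m) i).mul (hG n)
    refine eLpNorm_sub_lt_of (f := fun x => pd i (radCut m) x * G n x) (g := fun _ => 0)
      ?_ ?_ ?_ ?_
    · simpa using c4.continuous.aestronglyMeasurable
    · simpa using c3.continuous.aestronglyMeasurable
    · simpa using hres.trans_lt hm3
    · simpa using hres.trans_lt hm2

/-! ### Hardy inequalities in `L²` and `L^∞`. -/

lemma IsTest.memLp {ψ : E3 → ℝ} (h : IsTest ψ) : MemLp ψ 2 hsMeasure :=
  memLp_of_smooth h.smooth h.compact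

lemma smoothOn_inv_z : ContDiffOn ℝ smoothExp (fun x : E3 => 1 / x 2) halfSpace :=
  contDiffOn_const.div (by fun_prop) fun _ hx => (mem_hs.mp hx).ne'

lemma pd_inv_z {x : E3} (hx : x ∈ (halfSpace : Set E3)) :
    pd 2 (fun x : E3 => 1 / x 2) x = -(1 / x 2) ^ 2 := by
  have h0 := (mem_hs.mp hx).ne'
  have h1 : HasDerivAt (fun t : ℝ => 1 / t) (-(1 / x 2) ^ 2) (x 2) := by
    have := hasDerivAt_inv h0
    simp only [one_div]
    exact this.congr_deriv (by rw [inv_pow])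
  rw [pd_comp_z h1, if_pos rfl]

lemma le_two_mul_of_sq_le {X Y : ℝ≥0∞} (hX : X ≠ ∞) (h : X ^ 2 ≤ 2 * Y * X) : X ≤ 2 * Y := by
  rcases eq_or_ne X 0 with h0 | h0
  · rw [h0]; exact zero_le
  · rw [sq] at h
    exact (ENNReal.mul_le_mul_iff_left h0 hX).mp h

lemma enorm_integral_sq {X : Type*} [MeasurableSpace X] {μ : Measure X} {f : X → ℝ}
    (hf : MemLp f 2 μ) : ‖∫ x, f x ^ 2 ∂μ‖ₑ = eLpNorm f 2 μ ^ 2 := by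
  rw [eLpNorm_two_sq, Real.enorm_eq_ofReal (integral_nonneg fun x => sq_nonneg _),
    ofReal_integral_eq_lintegral_ofReal hf.integrable_sq (Eventually.of_forall fun x => sq_nonneg _)]
  refine lintegral_congr fun x => ?_
  rw [← sq_abs, ENNReal.ofReal_pow (abs_nonneg _), ← Real.norm_eq_abs, ofReal_norm]

/-- Integrating `ψ ∂_z(ψ/z)` by parts gives `‖ψ/z‖² = 2 ∫ (ψ/z) ∂_z ψ`. Cauchy-Schwarz and division
by the finite norm `‖ψ/z‖` finish the proof. -/
lemma IsTest.hardy {ψ : E3 → ℝ} (h : IsTest ψ) :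
    eLpNorm (fun x => 1 / x 2 * ψ x) 2 hsMeasure
      ≤ 2 * eLpNorm (ConormalEuler.pd 2 ψ) 2 hsMeasure := by
  have ht := h.mul_smoothOn smoothOn_inv_z
  apply le_two_mul_of_sq_le ht.memLp.2.ne
  have key := integral_mul_fderiv_eq_neg_fderiv_mul_of_integrable (μ := (volume : Measure E3))
    (f := ψ) (g := fun x => 1 / x 2 * ψ x) (v := basisVec 2)
    ((((h.pd 2).continuous.mul ht.continuous)).integrable_of_hasCompactSupport ht.compact.mul_left)
    ((h.continuous.mul (ht.pd 2).continuous).integrable_of_hasCompactSupport h.compact.mul_right)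
    ((h.continuous.mul ht.continuous).integrable_of_hasCompactSupport h.compact.mul_right)
    (fun x _ => h.differentiable x) (fun x _ => ht.differentiable x)
  have e1 : ∫ x, ψ x * fderiv ℝ (fun x => 1 / x 2 * ψ x) x (basisVec 2)
      = ∫ x, (1 / x 2 * ψ x * ConormalEuler.pd 2 ψ x - (1 / x 2 * ψ x) ^ 2) ∂hsMeasure := by
    rw [← integral_hs_eq fun x hx => by rw [h.eq_zero hx, zero_mul]]
    refine setIntegral_hs_congr fun x hx => ?_
    change ψ x * ConormalEuler.pd 2 (fun x => 1 / x 2 * ψ x) x = _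
    rw [h.pd_mul_smoothOn smoothOn_inv_z 2 x, pd_inv_z hx]; ring
  have e2 : ∫ x, fderiv ℝ ψ x (basisVec 2) * (1 / x 2 * ψ x)
      = ∫ x, 1 / x 2 * ψ x * ConormalEuler.pd 2 ψ x ∂hsMeasure := by
    rw [← integral_hs_eq fun x hx => by rw [ht.eq_zero hx, mul_zero]]
    refine integral_congr_ae (Eventually.of_forall fun x => ?_)
    simp only [ConormalEuler.pd]; ring
  rw [e1, e2, integral_sub (memLp_two_mul ht.memLp (h.pd 2).memLp) ht.memLp.integrable_sq] at key
  have e3 : ∫ x, (1 / x 2 * ψ x) ^ 2 ∂hsMeasure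
      = 2 * ∫ x, 1 / x 2 * ψ x * ConormalEuler.pd 2 ψ x ∂hsMeasure := by linarith
  rw [← enorm_integral_sq ht.memLp, e3, enorm_mul]
  calc _ ≤ ‖(2 : ℝ)‖ₑ * (eLpNorm (fun x => 1 / x 2 * ψ x) 2 hsMeasure
        * eLpNorm (ConormalEuler.pd 2 ψ) 2 hsMeasure) := by
        gcongr
        exact enorm_integral_mul_le ht.memLp.1 (h.pd 2).memLp.1
    _ = _ := by
        rw [show ‖(2 : ℝ)‖ₑ = 2 by simp [Real.enorm_eq_ofReal]]; ring

/-- Density of test functions, and Fatou along an almost everywhere convergent subsequence. -/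
theorem WD0.hardy {f g : E3 → ℝ} (h : WD0 2 f g) (hf : MemLp f 2 hsMeasure)
    (hg : MemLp g 2 hsMeasure) :
    eLpNorm (fun x => 1 / x 2 * f x) 2 hsMeasure ≤ 2 * eLpNorm g 2 hsMeasure := by
  have hseq : ∀ n : ℕ, ∃ ψ, IsTest ψ ∧
      eLpNorm (fun x => ψ x - f x) 2 hsMeasure < ((n : ℝ≥0∞) + 1)⁻¹ ∧
      eLpNorm (fun x => pd 2 ψ x - g x) 2 hsMeasure < ((n : ℝ≥0∞) + 1)⁻¹ := fun n =>
    h.exists_test hf hg (by simp)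
  choose ψ hψ h1 h2 using hseq
  have hinv : Tendsto (fun n : ℕ => ((n : ℝ≥0∞) + 1)⁻¹) atTop (𝓝 0) := by
    have := ENNReal.tendsto_inv_nat_nhds_zero.comp (tendsto_add_atTop_nat 1)
    simpa [Function.comp_def] using this
  have t1 : Tendsto (fun n => eLpNorm (fun x => ψ n x - f x) 2 hsMeasure) atTop (𝓝 0) :=
    tendsto_of_tendsto_of_tendsto_of_le_of_le tendsto_const_nhds hinv (fun _ => zero_le)
      fun n => (h1 n).le
  have t2 : Tendsto (fun n => eLpNorm (fun x => pd 2 (ψ n) x - g x) 2 hsMeasure) atTop (𝓝 0) :=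
    tendsto_of_tendsto_of_tendsto_of_le_of_le tendsto_const_nhds hinv (fun _ => zero_le)
      fun n => (h2 n).le
  obtain ⟨ns, hns, hae⟩ := exists_subseq_ae (fun n => (hψ n).memLp.1) hf.1 t1
  refine ENNReal.le_of_forall_pos_le_add fun ε hε _ => ?_
  have hε2 : (0 : ℝ≥0∞) < ε / 2 := ENNReal.div_pos (by simpa using hε.ne') (by norm_num)
  refine Lp.eLpNorm_le_of_ae_tendsto (u := atTop) (f := fun n x => 1 / x 2 * ψ (ns n) x) ?_
    (fun n => ((hψ _).mul_smoothOn smoothOn_inv_z).memLp.1) ?_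
  · filter_upwards [(t2.comp hns.tendsto_atTop).eventually_lt_const hε2] with n hn
    refine (hψ (ns n)).hardy.trans ?_
    have : eLpNorm (pd 2 (ψ (ns n))) 2 hsMeasure ≤ ε / 2 + eLpNorm g 2 hsMeasure := by
      have e : pd 2 (ψ (ns n)) = (fun x => pd 2 (ψ (ns n)) x - g x) + g := by
        funext x; simp
      rw [e]
      refine (eLpNorm_add_le (((hψ _).pd 2).memLp.1.sub hg.1) hg.1 (by norm_num)).trans ?_
      gcongr
      exact hn.le
    calc 2 * eLpNorm (pd 2 (ψ (ns n))) 2 hsMeasure ≤ 2 * (ε / 2 + eLpNorm g 2 hsMeasure) := by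
          gcongr
      _ = 2 * eLpNorm g 2 hsMeasure + ε := by
          rw [mul_add, ENNReal.mul_div_cancel (by norm_num) (by norm_num), add_comm]
  · filter_upwards [hae] with x hx
    exact hx.const_mul _

/-- The mollified functions vanish on the boundary, and averaging does not increase the bound on the
normal derivative. The mean value inequality along vertical lines gives `|Gₙ| ≤ A z`, which passes
to the limit. -/
theorem WD0.hardy_top {f g : E3 → ℝ} (h : WD0 2 f g) (hf : MemLp f 2 hsMeasure)
    (hg : MemLp g 2 hsMeasure) {A : ℝ} (hA0 : 0 ≤ A) (hA : ∀ᵐ x ∂hsMeasure, |g x| ≤ A) :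
    ∀ᵐ x ∂hsMeasure, |1 / x 2 * f x| ≤ A := by
  obtain ⟨G, hG, -, -, -, -, hae, hz, hb⟩ := h.exists_approx (memLp_ext0 hf) (memLp_ext0 hg)
  have hA' : ∀ᵐ x, |ext0 g x| ≤ A := by
    rw [ae_restrict_iff' measurableSet_hs] at hA
    filter_upwards [hA] with x hx
    by_cases hxs : x ∈ (halfSpace : Set E3)
    · simpa [ext0, indicator_of_mem hxs] using hx hxs
    · simpa [ext0, indicator_of_notMem hxs] using hA0
  have hbd := hb A hA0 hA'
  have hG' : ∀ n x, x ∈ (halfSpace : Set E3) → |G n x| ≤ A * x 2 := by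
    intro n x hx
    have hx0 := mem_hs.mp hx
    obtain ⟨c, hc, hz⟩ := hz n
    -- The foot of `x` on the boundary plane.
    set y : E3 := x - (x 2) • basisVec 2 with hy
    have hder : ∀ t : ℝ, HasDerivAt (fun t : ℝ => G n (y + t • basisVec 2))
        (pd 2 (G n) (y + t • basisVec 2)) t := by
      intro t
      have h1 : HasDerivAt (fun t : ℝ => y + t • basisVec 2) (basisVec 2) t := by
        simpa using ((hasDerivAt_id t).smul_const (basisVec 2)).const_add y
      exact ((hG n).differentiable (by simp) _).hasFDerivAt.comp_hasDerivAt t h1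
    have := Convex.norm_image_sub_le_of_norm_hasDerivWithin_le (s := univ) (C := A)
      (fun t _ => (hder t).hasDerivWithinAt) (fun t _ => hbd n _) convex_univ (mem_univ 0)
      (mem_univ (x 2))
    have e0 : G n (y + (0 : ℝ) • basisVec 2) = 0 := by
      apply hz
      intro t ht
      refine indicator_of_notMem (fun h' => ?_) f
      have := mem_hs.mp h'
      simp [hy, basisVec] at ht
      linarith
    rw [e0] at this
    simpa [hy, abs_of_pos hx0] using this
  have hae' : ∀ᵐ x ∂hsMeasure, Tendsto (fun n => G n x) atTop (𝓝 (ext0 f x)) :=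
    ae_restrict_of_ae hae
  filter_upwards [hae', ae_hs_of_forall fun x hx => hx] with x hx hxs
  have hx0 := mem_hs.mp hxs
  have h1 : |f x| ≤ A * x 2 := by
    have := le_of_tendsto hx.abs (Eventually.of_forall fun n => hG' n x hxs)
    simpa [ext0, indicator_of_mem hxs] using this
  rw [abs_mul, abs_of_pos (by positivity), one_div, inv_mul_le_iff₀ hx0]
  linarith

end ConormalEuler

end

noncomputable section

namespace ConormalEuler

/-! ### First-order conormal calculus and a Gagliardo-Nirenberg inequality -/

/-- `g = Zᵢ f` in the sense of distributions. -/
abbrev CD (i : Fin 3) (f g : E3 → ℝ) : Prop := IsWeakDeriv conormalWeight (Pi.single i 1) f g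

variable {i : Fin 3} {f f' g g' : E3 → ℝ}

lemma continuousOn_conormalWeight (i : Fin 3) : ContinuousOn (conormalWeight i) halfSpace :=
  (smoothOn_conormalWeight i).continuousOn

lemma continuousOn_inv_conormalWeight (i : Fin 3) :
    ContinuousOn (fun x => 1 / conormalWeight i x) halfSpace :=
  (smoothOn_inv_conormalWeight i).continuousOn

lemma CD.congr_right (h : CD i f g) (hg : g =ᵐ[hsMeasure] g') : CD i f g' :=
  IsWeakDeriv.congr h EventuallyEq.rfl hg

lemma CD.mul (hf : CD i f f') (hg : CD i g g') (lf : L2loc f) (lf' : L2loc f') (lg : L2loc g)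
    (lg' : L2loc g') : CD i (fun x => f x * g x) (fun x => f' x * g x + f x * g' x) := by
  have h := ((wd_of_conormal hf).mul (wd_of_conormal hg) lf
    (lf'.mul_continuousOn (continuousOn_inv_conormalWeight i)) lg
    (lg'.mul_continuousOn (continuousOn_inv_conormalWeight i))).conormal
  refine CD.congr_right h (ae_hs_of_forall fun x hx => ?_)
  have := (conormalWeight_pos i hx).ne'
  field_simp

lemma CD.comp_lipschitz (hf : CD i f f') (lf : L2loc f)
    (lf' : L2loc f') {T T' : ℝ → ℝ} (hT : ∀ y, HasDerivAt T (T' y) y) (hT' : Continuous T')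
    (hT0 : T 0 = 0) {L : ℝ≥0} (hL : ∀ y, |T' y| ≤ L) :
    CD i (fun x => T (f x)) (fun x => T' (f x) * f' x) := by
  have h := ((wd_of_conormal hf).comp_lipschitz lf
    (lf'.mul_continuousOn (continuousOn_inv_conormalWeight i)) hT hT' hT0 hL).conormal
  refine CD.congr_right h (ae_hs_of_forall fun x hx => ?_)
  have := (conormalWeight_pos i hx).ne'
  field_simp

lemma CD.mul_smooth {a : E3 → ℝ} (h : CD i f f') (ha : ContDiffOn ℝ smoothExp a halfSpace) :
    CD i (fun x => a x * f x) (fun x => a x * f' x + conormalWeight i x * pd i a x * f x) := by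
  refine CD.congr_right ((wd_of_conormal h).mul_smooth ha).conormal
    (ae_hs_of_forall fun x hx => ?_)
  have := (conormalWeight_pos i hx).ne'
  field_simp

lemma WD.of_conormal (hg : CD i f (fun x => conormalWeight i x * g x)) : WD i f g :=
  (wd_of_conormal hg).congr EventuallyEq.rfl (ae_hs_of_forall fun x hx => by
    have := (conormalWeight_pos i hx).ne'
    field_simp)

/-! ### Gagliardo-Nirenberg by truncation. -/

/-- The truncated cube `t ↦ t³ / (1 + ε² t²)`. -/
def cubeTrunc (ε t : ℝ) : ℝ := t ^ 3 / (1 + ε ^ 2 * t ^ 2)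

/-- The derivative of `cubeTrunc`. -/
def cubeTruncDeriv (ε t : ℝ) : ℝ := (3 * t ^ 2 + ε ^ 2 * t ^ 4) / (1 + ε ^ 2 * t ^ 2) ^ 2

lemma one_add_sq_pos (ε t : ℝ) : 0 < 1 + ε ^ 2 * t ^ 2 := by positivity

lemma hasDerivAt_cubeTrunc (ε t : ℝ) : HasDerivAt (cubeTrunc ε) (cubeTruncDeriv ε t) t := by
  have h := (hasDerivAt_pow 3 t).div (((hasDerivAt_pow 2 t).const_mul (ε ^ 2)).const_add 1)
    (one_add_sq_pos ε t).ne'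
  refine h.congr_deriv ?_
  unfold cubeTruncDeriv
  congr 1
  push_cast
  ring

/-- The square root of `t * cubeTrunc ε t`. -/
def sqTrunc (ε t : ℝ) : ℝ := t ^ 2 / √(1 + ε ^ 2 * t ^ 2)

lemma sq_sqTrunc (ε t : ℝ) : sqTrunc ε t ^ 2 = t * cubeTrunc ε t := by
  unfold sqTrunc cubeTrunc
  rw [div_pow, Real.sq_sqrt (one_add_sq_pos ε t).le]
  ring

lemma one_le_sqrt_one_add (ε t : ℝ) : 1 ≤ √(1 + ε ^ 2 * t ^ 2) :=
  Real.one_le_sqrt.mpr (by nlinarith [sq_nonneg (ε * t)])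

lemma sqTrunc_nonneg (ε t : ℝ) : 0 ≤ sqTrunc ε t := by unfold sqTrunc; positivity

lemma div_one_add_le_sqTrunc (ε t : ℝ) : t ^ 2 / (1 + ε ^ 2 * t ^ 2) ≤ sqTrunc ε t := by
  unfold sqTrunc
  have h1 := one_le_sqrt_one_add ε t
  have h2 := Real.mul_self_sqrt (one_add_sq_pos ε t).le
  gcongr
  nlinarith

lemma abs_cubeTrunc_le (ε t : ℝ) : |cubeTrunc ε t| ≤ |t| * sqTrunc ε t := by
  have h : cubeTrunc ε t = t * (t ^ 2 / (1 + ε ^ 2 * t ^ 2)) := by unfold cubeTrunc; ring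
  rw [h, abs_mul, abs_of_nonneg (a := t ^ 2 / _) (by positivity)]
  exact mul_le_mul_of_nonneg_left (div_one_add_le_sqTrunc ε t) (abs_nonneg t)

lemma abs_cubeTruncDeriv_le (ε t : ℝ) : |cubeTruncDeriv ε t| ≤ 3 * sqTrunc ε t := by
  unfold cubeTruncDeriv
  rw [abs_of_nonneg (by positivity)]
  refine le_trans ?_ (mul_le_mul_of_nonneg_left (div_one_add_le_sqTrunc ε t) (by norm_num))
  rw [← mul_div_assoc, div_le_div_iff₀ (by positivity) (one_add_sq_pos ε t)]
  have : 0 ≤ ε ^ 2 * t ^ 4 := by positivity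
  have := mul_nonneg this (one_add_sq_pos ε t).le
  nlinarith

lemma sqTrunc_le {ε : ℝ} (hε : 0 < ε) (t : ℝ) : sqTrunc ε t ≤ |t| / ε := by
  unfold sqTrunc
  have h : ε * |t| ≤ √(1 + ε ^ 2 * t ^ 2) := by
    apply Real.le_sqrt_of_sq_le
    rw [mul_pow, sq_abs]; linarith
  rw [div_le_div_iff₀ (by positivity) hε]
  calc t ^ 2 * ε = |t| * (ε * |t|) := by rw [← sq_abs]; ring
    _ ≤ _ := by gcongr

lemma cubeTruncDeriv_le {ε : ℝ} (hε : 0 < ε) (t : ℝ) :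
    |cubeTruncDeriv ε t| ≤ (3 / ε ^ 2 : ℝ) := by
  unfold cubeTruncDeriv
  rw [abs_of_nonneg (by positivity), div_le_div_iff₀ (by positivity) (by positivity)]
  have : 0 ≤ ε ^ 2 * t ^ 2 := by positivity
  nlinarith [sq_nonneg (ε ^ 2 * t ^ 2)]

lemma continuous_cubeTruncDeriv (ε : ℝ) : Continuous (cubeTruncDeriv ε) := by
  unfold cubeTruncDeriv
  exact Continuous.div (by fun_prop) (by fun_prop) fun t => by
    have := one_add_sq_pos ε t; positivity

lemma continuous_sqTrunc (ε : ℝ) : Continuous (sqTrunc ε) := by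
  unfold sqTrunc
  exact Continuous.div (by fun_prop) (by fun_prop) fun t => by
    have := one_le_sqrt_one_add ε t; positivity

lemma tendsto_sqTrunc (t : ℝ) : Tendsto (fun n : ℕ => sqTrunc (1 / ((n : ℝ) + 1)) t) atTop
    (𝓝 (t ^ 2)) := by
  have h0 := tendsto_one_div_add_atTop_nhds_zero_nat (𝕜 := ℝ)
  have h1 : Continuous fun ε : ℝ => sqTrunc ε t := by
    unfold sqTrunc
    exact Continuous.div (by fun_prop) (by fun_prop) fun ε => by
      have := one_le_sqrt_one_add ε t; positivity
  have := (h1.tendsto 0).comp h0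
  simpa [sqTrunc, Function.comp_def] using this

lemma le_of_sq_le_mul {X Y : ℝ≥0∞} (hX : X ≠ ∞) (h : X ^ 2 ≤ Y * X) : X ≤ Y := by
  rcases eq_or_ne X 0 with h0 | h0
  · rw [h0]; exact zero_le
  · rw [sq] at h
    exact (ENNReal.mul_le_mul_iff_left h0 hX).mp h

/-- Formally, with `y = Zg` and `z = Zy`, integration by parts gives `∫ y⁴ = -∫ 3 g y² z - ∫ (div Z)
g y³ ≤ A ‖y²‖ (3‖z‖ + ‖y‖)`, to be divided by `‖y²‖`. That norm is not known to be finite, so the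
cube is replaced by `T = cubeTrunc ε`. For `S = sqTrunc ε` one has `y T(y) = S(y)²`, `|T| ≤ |y| S`
and `|T'| ≤ 3S`, so the computation persists with `S` in the place of `y²`, and `S ≤ |y|/ε` makes
`‖S(y)‖` finite. -/
lemma CD.eLpNorm_sqTrunc_le {y z : E3 → ℝ} (h1 : CD i g y) (h2 : CD i y z) {A : ℝ≥0}
    (hA : ∀ᵐ x ∂hsMeasure, |g x| ≤ A) (hy : MemLp y 2 hsMeasure) (hz : MemLp z 2 hsMeasure)
    {ε : ℝ} (hε : 0 < ε) : eLpNorm (fun x => sqTrunc ε (y x)) 2 hsMeasure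
      ≤ A * (3 * eLpNorm z 2 hsMeasure + eLpNorm y 2 hsMeasure) := by
  have mg : AEStronglyMeasurable g hsMeasure := h1.locallyIntegrable_fun.aestronglyMeasurable
  have gtop : MemLp g ∞ hsMeasure := memLp_top_of_bound mg A hA
  have mR : AEStronglyMeasurable (fun x => sqTrunc ε (y x)) hsMeasure :=
    (continuous_sqTrunc ε).comp_aestronglyMeasurable hy.1
  have R2 : MemLp (fun x => sqTrunc ε (y x)) 2 hsMeasure := by
    refine (hy.const_mul (1 / ε)).mono mR (Eventually.of_forall fun x => ?_)
    rw [Real.norm_of_nonneg (sqTrunc_nonneg _ _), norm_mul, Real.norm_eq_abs, Real.norm_eq_abs,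
      abs_of_pos (by positivity)]
    exact (sqTrunc_le hε _).trans (le_of_eq (by ring))
  have hcomp := h2.comp_lipschitz hy.l2loc hz.l2loc (hasDerivAt_cubeTrunc ε)
    (continuous_cubeTruncDeriv ε) (by simp [cubeTrunc]) (L := ⟨3 / ε ^ 2, by positivity⟩)
    (cubeTruncDeriv_le hε)
  have mT : AEStronglyMeasurable (fun x => cubeTrunc ε (y x)) hsMeasure :=
    hcomp.locallyIntegrable_fun.aestronglyMeasurable
  have mT' : AEStronglyMeasurable (fun x => cubeTruncDeriv ε (y x)) hsMeasure :=
    (continuous_cubeTruncDeriv ε).comp_aestronglyMeasurable hy.1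
  have T'2 : MemLp (fun x => cubeTruncDeriv ε (y x)) 2 hsMeasure := by
    refine (R2.const_mul 3).mono mT' (Eventually.of_forall fun x => ?_)
    rw [norm_mul, Real.norm_of_nonneg (sqTrunc_nonneg _ _), Real.norm_eq_abs]
    simpa using abs_cubeTruncDeriv_le ε (y x)
  have T2 : MemLp (fun x => cubeTrunc ε (y x)) 2 hsMeasure := by
    have hlip : ∀ t, |cubeTrunc ε t| ≤ 1 / ε ^ 2 * |t| := by
      intro t
      unfold cubeTrunc
      rw [abs_div, abs_of_pos (one_add_sq_pos ε t), div_le_iff₀ (one_add_sq_pos ε t), abs_pow]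
      have e : t ^ 2 = |t| ^ 2 := (sq_abs t).symm
      rw [e]
      field_simp
      have := abs_nonneg t
      nlinarith
    refine (hy.const_mul (1 / ε ^ 2)).mono mT (Eventually.of_forall fun x => ?_)
    rw [norm_mul, Real.norm_eq_abs, Real.norm_eq_abs, Real.norm_eq_abs,
      abs_of_pos (a := 1 / ε ^ 2) (by positivity)]
    exact hlip _
  have T'z2 : MemLp (fun x => cubeTruncDeriv ε (y x) * z x) 2 hsMeasure := by
    refine (hz.const_mul (3 / ε ^ 2)).mono (mT'.mul hz.1) (Eventually.of_forall fun x => ?_)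
    rw [norm_mul, norm_mul, Real.norm_of_nonneg (r := 3 / ε ^ 2) (by positivity)]
    exact mul_le_mul_of_nonneg_right (cubeTruncDeriv_le hε _) (norm_nonneg _)
  have hH := h1.mul hcomp (l2loc_of_top gtop) hy.l2loc T2.l2loc T'z2.l2loc
  have iyT : Integrable (fun x => y x * cubeTrunc ε (y x)) hsMeasure := memLp_two_mul hy T2
  have iT : Integrable (fun x => cubeTrunc ε (y x)) hsMeasure := by
    refine (memLp_two_mul hy R2).mono mT (Eventually.of_forall fun x => ?_)
    rw [norm_mul, Real.norm_of_nonneg (sqTrunc_nonneg _ _)]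
    exact abs_cubeTrunc_le ε (y x)
  have igT : Integrable (fun x => g x * cubeTrunc ε (y x)) hsMeasure :=
    iT.bdd_mul mg hA
  have igTz : Integrable (fun x => g x * (cubeTruncDeriv ε (y x) * z x)) hsMeasure :=
    (memLp_two_mul T'2 hz).bdd_mul mg hA
  have key := integral_conormal hH igT (iyT.add igTz)
  rw [integral_add iyT igTz] at key
  have eI : ∫ x, sqTrunc ε (y x) ^ 2 ∂hsMeasure = ∫ x, y x * cubeTrunc ε (y x) ∂hsMeasure := by
    simp_rw [sq_sqTrunc]
  have X1 : ‖∫ x, g x * (cubeTruncDeriv ε (y x) * z x) ∂hsMeasure‖ₑ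
      ≤ A * 3 * (eLpNorm (fun x => sqTrunc ε (y x)) 2 hsMeasure * eLpNorm z 2 hsMeasure) := by
    rw [show (fun x => g x * (cubeTruncDeriv ε (y x) * z x))
      = fun x => (g x * cubeTruncDeriv ε (y x)) * z x by funext x; ring]
    refine (enorm_integral_mul_le (mg.mul mT') hz.1).trans ?_
    rw [← mul_assoc]
    gcongr
    have := eLpNorm_le_mul_eLpNorm_of_ae_le_mul (p := 2) (μ := hsMeasure) (c := A * 3)
      (f := fun x => g x * cubeTruncDeriv ε (y x)) (g := fun x => sqTrunc ε (y x)) (by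
        filter_upwards [hA] with x hx
        rw [norm_mul, Real.norm_of_nonneg (sqTrunc_nonneg _ _), mul_assoc]
        exact mul_le_mul hx (abs_cubeTruncDeriv_le ε (y x)) (abs_nonneg _) A.2)
    refine this.trans (le_of_eq ?_)
    rw [ENNReal.ofReal_mul A.coe_nonneg]; simp
  have X2 : ‖∫ x, zDiv i x * (g x * cubeTrunc ε (y x)) ∂hsMeasure‖ₑ
      ≤ A * (eLpNorm (fun x => sqTrunc ε (y x)) 2 hsMeasure * eLpNorm y 2 hsMeasure) := by
    have cS : Continuous fun t : ℝ => t ^ 2 / (1 + ε ^ 2 * t ^ 2) :=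
      Continuous.div (by fun_prop) (by fun_prop) fun t => (one_add_sq_pos ε t).ne'
    have mS := cS.comp_aestronglyMeasurable hy.1
    have mD : AEStronglyMeasurable (zDiv i) hsMeasure :=
      (smoothOn_zDiv i).continuousOn.aestronglyMeasurable measurableSet_hs
    -- One factor `y` is kept for Cauchy-Schwarz; the remaining quotient `y²/(1 + ε²y²)` is at most
    -- `sqTrunc ε y`.
    rw [show (fun x => zDiv i x * (g x * cubeTrunc ε (y x)))
      = fun x => (zDiv i x * g x * (y x ^ 2 / (1 + ε ^ 2 * y x ^ 2))) * y x by
        funext x; unfold cubeTrunc; ring]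
    refine (enorm_integral_mul_le ((mD.mul mg).mul mS) hy.1).trans ?_
    rw [← mul_assoc]
    gcongr
    have := eLpNorm_le_mul_eLpNorm_of_ae_le_mul (p := 2) (μ := hsMeasure) (c := A)
      (f := fun x => zDiv i x * g x * (y x ^ 2 / (1 + ε ^ 2 * y x ^ 2)))
      (g := fun x => sqTrunc ε (y x)) (by
        filter_upwards [hA, ae_hs_of_forall fun x hx => abs_zDiv_le i hx] with x hx hx2
        rw [norm_mul, norm_mul, Real.norm_of_nonneg (sqTrunc_nonneg _ _),
          Real.norm_of_nonneg (r := _ / _) (by positivity)]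
        refine mul_le_mul ?_ (div_one_add_le_sqTrunc ε (y x)) (by positivity) A.2
        calc _ ≤ 1 * (A : ℝ) := mul_le_mul hx2 hx (abs_nonneg _) zero_le_one
          _ = _ := one_mul _)
    exact this.trans (by simp)
  refine le_of_sq_le_mul R2.2.ne ?_
  rw [← enorm_integral_sq R2, eI, eq_sub_of_add_eq key, sub_eq_add_neg, ← neg_add, enorm_neg]
  refine (enorm_add_le _ _).trans ((add_le_add X2 X1).trans (le_of_eq ?_))
  ring

/-- The truncated bound does not depend on `ε`; Fatou's lemma along `ε = 1/(n+1)` removes the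
truncation. -/
theorem CD.eLpNorm_sq_le {y z : E3 → ℝ} (h1 : CD i g y) (h2 : CD i y z) {A : ℝ≥0}
    (hA : ∀ᵐ x ∂hsMeasure, |g x| ≤ A) (hy : MemLp y 2 hsMeasure) (hz : MemLp z 2 hsMeasure) :
    eLpNorm (fun x => y x ^ 2) 2 hsMeasure
      ≤ A * (3 * eLpNorm z 2 hsMeasure + eLpNorm y 2 hsMeasure) :=
  Lp.eLpNorm_le_of_ae_tendsto (u := atTop)
    (f := fun (n : ℕ) x => sqTrunc (1 / ((n : ℝ) + 1)) (y x))
    (Eventually.of_forall fun n => h1.eLpNorm_sqTrunc_le h2 hA hy hz (by positivity))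
    (fun n => (continuous_sqTrunc _).comp_aestronglyMeasurable hy.1)
    (Eventually.of_forall fun x => tendsto_sqTrunc (y x))

end ConormalEuler

end

noncomputable section

namespace ConormalEuler

/-! ### Iterated conormal derivatives -/

/-- The order `|α|` of a multi-index. -/
def ord (α : Fin 3 → ℕ) : ℕ := ∑ i, α i

@[simp] lemma ord_add (α β : Fin 3 → ℕ) : ord (α + β) = ord α + ord β := Finset.sum_add_distrib

@[simp] lemma ord_zero : ord 0 = 0 := by simp [ord]

@[simp] lemma ord_single (i : Fin 3) : ord (Pi.single i 1) = 1 := by simp [ord]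

lemma ord_eq_zero {α : Fin 3 → ℕ} (h : ord α = 0) : α = 0 := by
  funext i
  exact Finset.sum_eq_zero_iff.mp h i (Finset.mem_univ i)

lemma exists_single_add {α : Fin 3 → ℕ} {n : ℕ} (h : ord α = n + 1) :
    ∃ (β : Fin 3 → ℕ) (i : Fin 3), α = Pi.single i 1 + β ∧ ord β = n := by
  obtain ⟨β, i, h1, h2⟩ := exists_add_single h
  exact ⟨β, i, by rw [h1, add_comm], h2⟩

/-- A chosen representative of the distribution `Z^α f`. -/
def Zd (α : Fin 3 → ℕ) (f : E3 → ℝ) : E3 → ℝ :=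
  open Classical in
  if h : ∃ g, IsWeakDeriv conormalWeight α f g then h.choose else 0

/-- `f` has conormal derivatives up to order `m`, bounded in `L^p` by `B`. -/
def ZReg (p : ℝ≥0∞) (m : ℕ) (B : ℝ≥0∞) (f : E3 → ℝ) : Prop :=
  ∀ α, ord α ≤ m → ∃ g, IsWeakDeriv conormalWeight α f g ∧ L2loc g ∧ eLpNorm g p hsMeasure ≤ B

variable {p B B' : ℝ≥0∞} {m n : ℕ} {f g h : E3 → ℝ} {α β : Fin 3 → ℕ}

lemma IsWeakDeriv.zd (h : IsWeakDeriv conormalWeight α f g) :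
    IsWeakDeriv conormalWeight α f (Zd α f) := by
  have h' : ∃ g, IsWeakDeriv conormalWeight α f g := ⟨g, h⟩
  rw [Zd, dif_pos h']
  exact h'.choose_spec

lemma IsWeakDeriv.zd_ae (h : IsWeakDeriv conormalWeight α f g) : Zd α f =ᵐ[hsMeasure] g :=
  h.zd.unique h

lemma IsWeakDeriv.aesm {w : Fin 3 → E3 → ℝ} (h : IsWeakDeriv w α f g) :
    AEStronglyMeasurable g hsMeasure := h.locallyIntegrable_deriv.aestronglyMeasurable

lemma L2loc.aesm (h : L2loc f) : AEStronglyMeasurable f hsMeasure :=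
  h.locInt.aestronglyMeasurable

lemma ZReg.deriv (h : ZReg p m B f) (hα : ord α ≤ m) :
    IsWeakDeriv conormalWeight α f (Zd α f) := by
  obtain ⟨g, hg, -⟩ := h α hα
  exact hg.zd

lemma ZReg.l2loc (h : ZReg p m B f) (hα : ord α ≤ m) : L2loc (Zd α f) := by
  obtain ⟨g, hg, hg2, -⟩ := h α hα
  exact hg2.congr hg.zd_ae.symm

lemma ZReg.norm_le (h : ZReg p m B f) (hα : ord α ≤ m) : eLpNorm (Zd α f) p hsMeasure ≤ B := by
  obtain ⟨g, hg, -, hg3⟩ := h α hα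
  rwa [eLpNorm_congr_ae hg.zd_ae]

lemma ZReg.memLp (h : ZReg p m B f) (hB : B ≠ ∞) (hα : ord α ≤ m) : MemLp (Zd α f) p hsMeasure :=
  ⟨(h.l2loc hα).aesm, (h.norm_le hα).trans_lt hB.lt_top⟩

lemma Zd_zero (hf : LocInt f) : Zd 0 f =ᵐ[hsMeasure] f := (IsWeakDeriv.refl hf).zd_ae

lemma ZReg.locInt (h : ZReg p m B f) : LocInt f :=
  (h.deriv (α := 0) (by simp)).locallyIntegrable_fun

lemma ZReg.zd_zero (h : ZReg p m B f) : Zd 0 f =ᵐ[hsMeasure] f := Zd_zero h.locInt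

lemma ZReg.l2loc_self (h : ZReg p m B f) : L2loc f :=
  (h.l2loc (α := 0) (by simp)).congr h.zd_zero

lemma ZReg.norm_self_le (h : ZReg p m B f) : eLpNorm f p hsMeasure ≤ B :=
  (eLpNorm_congr_ae h.zd_zero).symm.trans_le (h.norm_le (by simp))

lemma ZReg.memLp_self (h : ZReg p m B f) (hB : B ≠ ∞) : MemLp f p hsMeasure :=
  ⟨h.l2loc_self.aesm, h.norm_self_le.trans_lt hB.lt_top⟩

lemma ZReg.cd (h : ZReg p (m + 1) B f) (i : Fin 3) : CD i f (Zd (Pi.single i 1) f) :=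
  h.deriv (by simp)

lemma ZReg.zd_zd (h : ZReg p m B f) (hα : ord (α + β) ≤ m) :
    IsWeakDeriv conormalWeight β (Zd α f) (Zd (α + β) f) := by
  rw [ord_add] at hα
  exact (h.deriv (by lia)).of_comp goodWeight_conormal (h.deriv (by rw [ord_add]; exact hα))

lemma ZReg.zd_zd_ae (h : ZReg p m B f) (hα : ord (α + β) ≤ m) :
    Zd β (Zd α f) =ᵐ[hsMeasure] Zd (α + β) f := (h.zd_zd hα).zd_ae

lemma ZReg.zd (h : ZReg p m B f) (hα : ord α + n ≤ m) : ZReg p n B (Zd α f) := fun β hβ =>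
  have hh : ord (α + β) ≤ m := by rw [ord_add]; lia
  ⟨_, h.zd_zd hh, h.l2loc hh, h.norm_le hh⟩

lemma ZReg.mono (h : ZReg p m B f) (hn : n ≤ m) (hB : B ≤ B') : ZReg p n B' f := fun α hα => by
  obtain ⟨g, h1, h2, h3⟩ := h α (hα.trans hn)
  exact ⟨g, h1, h2, h3.trans hB⟩

lemma ZReg.congr (h : ZReg p m B f) (hfg : f =ᵐ[hsMeasure] g) : ZReg p m B g := fun α hα => by
  obtain ⟨g, h1, h2⟩ := h α hα
  exact ⟨g, h1.congr hfg EventuallyEq.rfl, h2⟩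

lemma ZReg.zero (hf : L2loc f) (hB : eLpNorm f p hsMeasure ≤ B) : ZReg p 0 B f := fun α hα => by
  rw [ord_eq_zero (Nat.le_zero.mp hα)]
  exact ⟨f, IsWeakDeriv.refl hf.locInt, hf, hB⟩

lemma ZReg.succ (hf : L2loc f) (hB : eLpNorm f p hsMeasure ≤ B)
    (h : ∀ i, ∃ g, CD i f g ∧ ZReg p m B g) : ZReg p (m + 1) B f := fun α hα => by
  rcases Nat.eq_zero_or_pos (ord α) with h0 | h0
  · exact ZReg.zero hf hB α h0.le
  · obtain ⟨k, hk⟩ := Nat.exists_eq_succ_of_ne_zero h0.ne'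
    obtain ⟨β, i, rfl, hβ⟩ := exists_single_add hk
    obtain ⟨g, hg, hr⟩ := h i
    obtain ⟨g', h1, h2⟩ := hr β (by lia)
    exact ⟨g', hg.comp goodWeight_conormal h1, h2⟩

lemma ZReg.add (hp : 1 ≤ p) (hf : ZReg p m B f) (hg : ZReg p m B' g) :
    ZReg p m (B + B') (fun x => f x + g x) := fun α hα => by
  obtain ⟨f', h1, h2, h3⟩ := hf α hα
  obtain ⟨g', k1, k2, k3⟩ := hg α hα
  exact ⟨_, h1.add goodWeight_conormal k1, h2.add k2,
    (eLpNorm_add_le h1.aesm k1.aesm hp).trans (add_le_add h3 k3)⟩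

lemma ZReg.neg (hf : ZReg p m B f) : ZReg p m B (fun x => -f x) := fun α hα => by
  obtain ⟨f', h1, h2, h3⟩ := hf α hα
  exact ⟨_, h1.neg, h2.neg, (eLpNorm_neg (f := f') ..).trans_le h3⟩

lemma ZReg.sub (hp : 1 ≤ p) (hf : ZReg p m B f) (hg : ZReg p m B' g) :
    ZReg p m (B + B') (fun x => f x - g x) := by
  simpa [sub_eq_add_neg] using hf.add hp hg.neg

lemma eLpNorm_mul_bounded_le {a : E3 → ℝ} {C : ℝ≥0} (ha : ∀ x ∈ (halfSpace : Set E3), |a x| ≤ C)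
    (f : E3 → ℝ) : eLpNorm (fun x => a x * f x) p hsMeasure ≤ C * eLpNorm f p hsMeasure := by
  have := eLpNorm_le_mul_eLpNorm_of_ae_le_mul (p := p) (μ := hsMeasure) (c := C)
    (f := fun x => a x * f x) (g := f) (ae_hs_of_forall fun x hx => by
      rw [norm_mul]
      exact mul_le_mul_of_nonneg_right (ha x hx) (norm_nonneg _))
  simpa using this

/-! ### Multiplication by smooth coefficients. -/

/-- The polynomial `Q` with `Zᵢ (P(q)) = Q(q)`. -/
def polyZ (i : Fin 3) (P : Polynomial ℝ) : Polynomial ℝ :=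
  if i = 2 then (1 - Polynomial.X) * -(Polynomial.X ^ 2 * Polynomial.derivative P) else 0

lemma polyQ_mul (P Q : Polynomial ℝ) (x : E3) : polyQ (P * Q) x = polyQ P x * polyQ Q x :=
  Polynomial.eval_mul

lemma weight_mul_pd_polyQ (i : Fin 3) (P : Polynomial ℝ) {x : E3} (hx : x ∈ (halfSpace : Set E3)) :
    conormalWeight i x * pd i (polyQ P) x = polyQ (polyZ i P) x := by
  rw [conormalWeight_eq i hx, pd_polyQ P hx, polyZ]
  split_ifs
  · rw [polyQ_mul]
  · simp [polyQ]

/-- Differentiating the coefficient gives another polynomial in `q`, so the induction on the order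
runs over all polynomials simultaneously. -/
theorem ZReg.polyQ_mul (m : ℕ) : ∀ P : Polynomial ℝ, ∃ C : ℝ≥0, ∀ {p B : ℝ≥0∞} {f : E3 → ℝ},
    1 ≤ p → ZReg p m B f → ZReg p m (C * B) (fun x => polyQ P x * f x) := by
  induction m with
  | zero =>
    intro P
    obtain ⟨C, hC⟩ := polyQ_bound P
    refine ⟨C, fun {p B f} hp hf => ?_⟩
    refine ZReg.zero (hf.l2loc_self.mul_continuousOn (smoothOn_polyQ P).continuousOn) ?_
    exact (eLpNorm_mul_bounded_le hC f).trans (by gcongr; exact hf.norm_self_le)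
  | succ m ih =>
    intro P
    obtain ⟨C, hC⟩ := polyQ_bound P
    obtain ⟨C0, hC0⟩ := ih P
    choose D hD using fun i : Fin 3 => ih (polyZ i P)
    refine ⟨C + C0 + ∑ i, D i, fun {p B f} hp hf => ?_⟩
    have hDi : ∀ i, D i ≤ ∑ i, D i := fun i =>
      Finset.single_le_sum (f := D) (fun _ _ => zero_le) (Finset.mem_univ i)
    refine ZReg.succ (hf.l2loc_self.mul_continuousOn (smoothOn_polyQ P).continuousOn) ?_ fun i => ?_
    · refine (eLpNorm_mul_bounded_le hC f).trans ?_
      gcongr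
      · exact le_add_right (le_add_right le_rfl)
      · exact hf.norm_self_le
    · refine ⟨fun x => polyQ P x * Zd (Pi.single i 1) f x + polyQ (polyZ i P) x * f x, ?_, ?_⟩
      · refine CD.congr_right ((hf.cd i).mul_smooth (smoothOn_polyQ P))
          (ae_hs_of_forall fun x hx => ?_)
        simp only [weight_mul_pd_polyQ i P hx]
      · have h1 := hC0 hp (hf.zd (α := Pi.single i 1) (n := m) (by simp; lia))
        have h2 := hD i hp (hf.mono (Nat.le_succ m) le_rfl)
        refine (h1.add hp h2).mono le_rfl ?_
        rw [← add_mul]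
        gcongr
        rw [← ENNReal.coe_add]
        refine ENNReal.coe_le_coe.mpr ?_
        rw [add_assoc]
        exact le_add_left (add_le_add le_rfl (hDi i))

lemma polyQ_X_sq (x : E3) : polyQ (Polynomial.X ^ 2) x = qf x ^ 2 := by simp [polyQ]

lemma ZReg.qf_sq_mul (m : ℕ) : ∃ C : ℝ≥0, ∀ {p B : ℝ≥0∞} {f : E3 → ℝ},
    1 ≤ p → ZReg p m B f → ZReg p m (C * B) (fun x => qf x ^ 2 * f x) := by
  obtain ⟨C, hC⟩ := ZReg.polyQ_mul m (Polynomial.X ^ 2)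
  exact ⟨C, fun hp hf => by simpa [polyQ_X_sq] using hC hp hf⟩

/-- Purely qualitative, hence the bound `∞`: the coefficient may be unbounded near the boundary. It
ensures that the derivatives of `u₃/φ` exist as locally square integrable functions before any of
them is estimated. -/
lemma ZReg.smooth_mul (hp : 1 ≤ p) : ∀ {m : ℕ} {a f : E3 → ℝ}, ContDiffOn ℝ smoothExp a halfSpace →
    ZReg p m B f → ZReg p m ∞ (fun x => a x * f x) := by
  intro m
  induction m with
  | zero => exact fun ha hf => ZReg.zero (hf.l2loc_self.mul_continuousOn ha.continuousOn) le_top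
  | succ m ih =>
    intro a f ha hf
    refine ZReg.succ (hf.l2loc_self.mul_continuousOn ha.continuousOn) le_top fun i => ?_
    refine ⟨_, (hf.cd i).mul_smooth ha, ?_⟩
    have h1 := ih ha (hf.zd (α := Pi.single i 1) (n := m) (by simp; lia))
    have h2 := ih ((smoothOn_conormalWeight i).mul (smoothOn_pd ha i))
      (hf.mono (Nat.le_succ m) le_rfl)
    exact (h1.add hp h2).mono le_rfl le_top

/-! ### The Leibniz rule -/

/-- Instead of binomial coefficients, one common bound `B` for all products is used; each derivative
doubles the number of terms, whence `2ⁿ`. The regularity of the factors only enters qualitatively,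
and their exponent `P` may differ from that of the products. -/
theorem exists_leibniz (hp : 1 ≤ p) {P : ℝ≥0∞} : ∀ (n : ℕ) {Bf Bg : ℝ≥0∞} {f g : E3 → ℝ}
    {α : Fin 3 → ℕ}, ord α = n → ZReg P n Bf f → ZReg P n Bg g →
    (∀ β γ, β + γ = α → eLpNorm (fun x => Zd β f x * Zd γ g x) p hsMeasure ≤ B) →
    ∃ R, IsWeakDeriv conormalWeight α (fun x => f x * g x) R ∧
      eLpNorm R p hsMeasure ≤ 2 ^ n * B := by
  intro n
  induction n with
  | zero =>
    intro Bf Bg f g α hα hf hg hB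
    rw [ord_eq_zero hα] at hB ⊢
    refine ⟨_, IsWeakDeriv.refl (hf.l2loc_self.mul hg.l2loc_self), ?_⟩
    rw [pow_zero, one_mul]
    refine le_trans (le_of_eq (eLpNorm_congr_ae ?_)) (hB 0 0 (by simp))
    filter_upwards [hf.zd_zero, hg.zd_zero] with x h1 h2
    rw [h1, h2]
  | succ n ih =>
    intro Bf Bg f g α hα hf hg hB
    obtain ⟨β, i, rfl, hβ⟩ := exists_single_add hα
    have e1 : ord (Pi.single i 1) + n ≤ n + 1 := by simp; lia
    obtain ⟨R1, h1, b1⟩ := ih (f := Zd (Pi.single i 1) f) (g := g) hβ (hf.zd e1)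
      (hg.mono (Nat.le_succ n) le_rfl) (fun γ δ hh => by
        have hle : ord (Pi.single i 1 + γ) ≤ n + 1 := by
          have := congrArg ord hh; simp at this ⊢; lia
        refine le_trans (le_of_eq (eLpNorm_congr_ae ?_)) (hB (Pi.single i 1 + γ) δ (by
          rw [← hh]; abel))
        filter_upwards [hf.zd_zd_ae hle] with x hx
        rw [hx])
    obtain ⟨R2, h2, b2⟩ := ih (f := f) (g := Zd (Pi.single i 1) g) hβ
      (hf.mono (Nat.le_succ n) le_rfl) (hg.zd e1) (fun γ δ hh => by
        have hle : ord (Pi.single i 1 + δ) ≤ n + 1 := by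
          have := congrArg ord hh; simp at this ⊢; lia
        refine le_trans (le_of_eq (eLpNorm_congr_ae ?_)) (hB γ (Pi.single i 1 + δ) (by
          rw [← hh]; abel))
        filter_upwards [hg.zd_zd_ae hle] with x hx
        rw [hx])
    refine ⟨_, ((hf.cd i).mul (hg.cd i) hf.l2loc_self (hf.l2loc (by simp)) hg.l2loc_self
      (hg.l2loc (by simp))).comp goodWeight_conormal (h1.add goodWeight_conormal h2), ?_⟩
    refine (eLpNorm_add_le h1.aesm h2.aesm hp).trans ((add_le_add b1 b2).trans (le_of_eq ?_))
    ring

/-- The term with all derivatives on `g` is kept explicitly. For the transport operator it carries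
one derivative too many to be estimated, and it will cancel. -/
theorem exists_leibniz_rest (hp : 1 ≤ p) {P : ℝ≥0∞} : ∀ (n : ℕ) {Bf Bg : ℝ≥0∞} {f g : E3 → ℝ}
    {α : Fin 3 → ℕ}, ord α = n → ZReg P n Bf f → ZReg P n Bg g →
    (∀ β γ, β + γ = α → β ≠ 0 → eLpNorm (fun x => Zd β f x * Zd γ g x) p hsMeasure ≤ B) →
    ∃ R, IsWeakDeriv conormalWeight α (fun x => f x * g x) (fun x => f x * Zd α g x + R x) ∧
      AEStronglyMeasurable R hsMeasure ∧ eLpNorm R p hsMeasure ≤ 2 ^ n * B := by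
  intro n
  induction n with
  | zero =>
    intro Bf Bg f g α hα hf hg hB
    rw [ord_eq_zero hα] at hB ⊢
    refine ⟨fun _ => 0, (IsWeakDeriv.refl (hf.l2loc_self.mul hg.l2loc_self)).congr
      EventuallyEq.rfl ?_, aestronglyMeasurable_const, by simp⟩
    filter_upwards [hg.zd_zero] with x h2
    rw [h2, add_zero]
  | succ n ih =>
    intro Bf Bg f g α hα hf hg hB
    obtain ⟨β, i, rfl, hβ⟩ := exists_single_add hα
    have e1 : ord (Pi.single i 1) + n ≤ n + 1 := by simp; lia
    obtain ⟨R1, h1, b1⟩ := exists_leibniz (B := B) hp n (f := Zd (Pi.single i 1) f) (g := g) hβ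
      (hf.zd e1) (hg.mono (Nat.le_succ n) le_rfl) (fun γ δ hh => by
        have hle : ord (Pi.single i 1 + γ) ≤ n + 1 := by
          have := congrArg ord hh; simp at this ⊢; lia
        refine le_trans (le_of_eq (eLpNorm_congr_ae ?_)) (hB (Pi.single i 1 + γ) δ (by
          rw [← hh]; abel) (fun h0 => by
            have := congrArg ord h0
            simp at this))
        filter_upwards [hf.zd_zd_ae hle] with x hx
        rw [hx])
    obtain ⟨R2, h2, m2, b2⟩ := ih (f := f) (g := Zd (Pi.single i 1) g) hβ
      (hf.mono (Nat.le_succ n) le_rfl) (hg.zd e1) (fun γ δ hh h0 => by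
        have hle : ord (Pi.single i 1 + δ) ≤ n + 1 := by
          have := congrArg ord hh; simp at this ⊢; lia
        refine le_trans (le_of_eq (eLpNorm_congr_ae ?_)) (hB γ (Pi.single i 1 + δ) (by
          rw [← hh]; abel) h0)
        filter_upwards [hg.zd_zd_ae hle] with x hx
        rw [hx])
    refine ⟨fun x => R1 x + R2 x, (((hf.cd i).mul (hg.cd i) hf.l2loc_self (hf.l2loc (by simp))
      hg.l2loc_self (hg.l2loc (by simp))).comp goodWeight_conormal
      (h1.add goodWeight_conormal h2)).congr EventuallyEq.rfl ?_, h1.aesm.add m2, ?_⟩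
    · filter_upwards [hg.zd_zd_ae (α := Pi.single i 1) (β := β) (by simp; lia)] with x hx
      rw [hx]; ring
    · refine (eLpNorm_add_le h1.aesm m2 hp).trans ((add_le_add b1 b2).trans (le_of_eq ?_))
      ring

/-! ### Conormal regularity of Sobolev functions -/

/-- `f` has Euclidean weak derivatives up to order `m`, bounded in `L²` by `B`. -/
def HReg : ℕ → ℝ≥0∞ → (E3 → ℝ) → Prop
  | 0, B, f => MemLp f 2 hsMeasure ∧ eLpNorm f 2 hsMeasure ≤ B
  | m + 1, B, f => (MemLp f 2 hsMeasure ∧ eLpNorm f 2 hsMeasure ≤ B) ∧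
      ∀ i, ∃ g, WD i f g ∧ HReg m B g

lemma HReg.base : ∀ {m : ℕ} {B : ℝ≥0∞} {f : E3 → ℝ}, HReg m B f →
    MemLp f 2 hsMeasure ∧ eLpNorm f 2 hsMeasure ≤ B
  | 0, _, _, h => h
  | _ + 1, _, _, h => h.1

lemma HReg.mono : ∀ {m : ℕ} {B B' : ℝ≥0∞} {f : E3 → ℝ}, HReg m B f → B ≤ B' → HReg m B' f
  | 0, _, _, _, h, hB => ⟨h.1, h.2.trans hB⟩
  | _ + 1, _, _, _, h, hB => ⟨⟨h.1.1, h.1.2.trans hB⟩, fun i => by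
      obtain ⟨g, h1, h2⟩ := h.2 i
      exact ⟨g, h1, h2.mono hB⟩⟩

lemma HReg.pred : ∀ {m : ℕ} {B : ℝ≥0∞} {f : E3 → ℝ}, HReg (m + 1) B f → HReg m B f
  | 0, _, _, h => h.1
  | _ + 1, _, _, h => ⟨h.1, fun i => by
      obtain ⟨g, h1, h2⟩ := h.2 i
      exact ⟨g, h1, h2.pred⟩⟩

lemma HReg.add : ∀ {m : ℕ} {B B' : ℝ≥0∞} {f g : E3 → ℝ}, HReg m B f → HReg m B' g →
    HReg m (B + B') (fun x => f x + g x)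
  | 0, _, _, _, _, h, h' => ⟨h.1.add h'.1,
      (eLpNorm_add_le h.1.1 h'.1.1 (by norm_num)).trans (add_le_add h.2 h'.2)⟩
  | _ + 1, _, _, _, _, h, h' => ⟨⟨h.1.1.add h'.1.1,
      (eLpNorm_add_le h.1.1.1 h'.1.1.1 (by norm_num)).trans (add_le_add h.1.2 h'.1.2)⟩, fun i => by
      obtain ⟨f', h1, h2⟩ := h.2 i
      obtain ⟨g', k1, k2⟩ := h'.2 i
      exact ⟨_, h1.add k1, h2.add k2⟩⟩

lemma memLp_mul_bounded {a : E3 → ℝ} {C : ℝ≥0} (ha : ∀ x ∈ (halfSpace : Set E3), |a x| ≤ C)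
    (ma : ContinuousOn a halfSpace) (hf : MemLp f p hsMeasure) :
    MemLp (fun x => a x * f x) p hsMeasure :=
  ⟨(ma.aestronglyMeasurable measurableSet_hs).mul hf.1, (eLpNorm_mul_bounded_le ha f).trans_lt
    (ENNReal.mul_lt_top (by simp) hf.2)⟩

theorem HReg.polyQ_mul (m : ℕ) : ∀ P : Polynomial ℝ, ∃ C : ℝ≥0, ∀ {B : ℝ≥0∞} {f : E3 → ℝ},
    HReg m B f → HReg m (C * B) (fun x => polyQ P x * f x) := by
  have base : ∀ P : Polynomial ℝ, ∃ C : ℝ≥0, ∀ {B : ℝ≥0∞} {f : E3 → ℝ},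
      MemLp f 2 hsMeasure ∧ eLpNorm f 2 hsMeasure ≤ B → ∀ C' ≥ C,
      MemLp (fun x => polyQ P x * f x) 2 hsMeasure ∧
        eLpNorm (fun x => polyQ P x * f x) 2 hsMeasure ≤ C' * B := by
    intro P
    obtain ⟨C, hC⟩ := polyQ_bound P
    refine ⟨C, fun {B f} hf C' hC' =>
      ⟨memLp_mul_bounded hC (smoothOn_polyQ P).continuousOn hf.1, ?_⟩⟩
    exact (eLpNorm_mul_bounded_le hC f).trans (by gcongr; exact hf.2)
  induction m with
  | zero =>
    intro P
    obtain ⟨C, hC⟩ := base P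
    exact ⟨C, fun hf => hC hf C le_rfl⟩
  | succ m ih =>
    intro P
    obtain ⟨C, hC⟩ := base P
    obtain ⟨C0, hC0⟩ := ih P
    choose D hD using fun i : Fin 3 => ih
      (if i = 2 then -(Polynomial.X ^ 2 * Polynomial.derivative P) else 0)
    have hDi : ∀ i, D i ≤ ∑ i, D i := fun i =>
      Finset.single_le_sum (f := D) (fun _ _ => zero_le) (Finset.mem_univ i)
    refine ⟨C + C0 + ∑ i, D i, fun {B f} hf => ⟨hC hf.base _ ?_, fun i => ?_⟩⟩
    · exact le_add_right (le_add_right le_rfl)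
    · obtain ⟨g, h1, h2⟩ := hf.2 i
      refine ⟨_, (h1.mul_smooth (smoothOn_polyQ P)).congr EventuallyEq.rfl
        (ae_hs_of_forall fun x hx => ?_), ((hC0 h2).add (hD i hf.pred)).mono ?_⟩
      · beta_reduce
        rw [pd_polyQ P hx]
        congr 2
        split_ifs <;> simp [polyQ]
      · rw [← add_mul]
        gcongr
        rw [← ENNReal.coe_add]
        refine ENNReal.coe_le_coe.mpr ?_
        rw [add_assoc]
        exact le_add_left (add_le_add le_rfl (hDi i))

/-- Each `Zᵢ` is `∂ᵢ` times a polynomial in `q`, namely 1 or `1 - q`. -/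
theorem HReg.zReg (m : ℕ) : ∃ C : ℝ≥0, ∀ {B : ℝ≥0∞} {f : E3 → ℝ},
    HReg m B f → ZReg 2 m (C * B) f := by
  induction m with
  | zero => exact ⟨1, fun hf => ZReg.zero hf.1.l2loc (by simpa using hf.2)⟩
  | succ m ih =>
    obtain ⟨C, hC⟩ := ih
    choose D hD using fun i : Fin 3 => HReg.polyQ_mul m (if i = 2 then 1 - Polynomial.X else 1)
    have hDi : ∀ i, D i ≤ ∑ i, D i := fun i =>
      Finset.single_le_sum (f := D) (fun _ _ => zero_le) (Finset.mem_univ i)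
    refine ⟨1 + C * ∑ i, D i, fun {B f} hf => ZReg.succ hf.1.1.l2loc ?_ fun i => ?_⟩
    · refine hf.1.2.trans ?_
      push_cast
      rw [add_mul, one_mul]
      exact le_add_right le_rfl
    · obtain ⟨g, h1, h2⟩ := hf.2 i
      refine ⟨_, CD.congr_right h1.conormal (ae_hs_of_forall fun x hx => by
        simp only [conormalWeight_eq i hx]), (hC (hD i h2)).mono le_rfl ?_⟩
      rw [← mul_assoc, ← ENNReal.coe_mul]
      gcongr
      exact le_add_left (mul_le_mul_right (hDi i) C)

end ConormalEuler

end

noncomputable section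

namespace ConormalEuler

/-! ### Commutation of partial and conormal derivatives -/

variable {i j : Fin 3} {f f' D D' : E3 → ℝ}

lemma IsTest.qf_sq_mul {ψ : E3 → ℝ} (hψ : IsTest ψ) : IsTest fun x => qf x ^ 2 * ψ x :=
  hψ.mul_smoothOn (smoothOn_qf.pow 2)

/-- The commutator relation `[∂_z, Z₃] = φ' ∂_z` with `φ' = q²`, in transposed form; all other pairs
commute. -/
lemma IsTest.transposeField_pd {ψ : E3 → ℝ} (hψ : IsTest ψ) (i j : Fin 3) (x : E3) :
    ConormalEuler.transposeField conormalWeight j (ConormalEuler.pd i ψ) x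
      = ConormalEuler.pd i (ConormalEuler.transposeField conormalWeight j ψ) x
        + (if i = 2 ∧ j = 2 then ConormalEuler.pd 2 (fun x => qf x ^ 2 * ψ x) x else 0) := by
  have hs := smoothOn_conormalWeight j
  have ht := hψ.mul_smoothOn hs
  have e1 : ConormalEuler.pd i (ConormalEuler.transposeField conormalWeight j ψ)
      = fun x => -ConormalEuler.pd j (ConormalEuler.pd i (fun y => conormalWeight j y * ψ y)) x := by
    funext x
    rw [pd_comm ht.smooth j i, transposeField_eq, pd_neg]
  have e2 : ConormalEuler.pd i (fun y => conormalWeight j y * ψ y)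
      = fun y => (if i = 2 ∧ j = 2 then qf y ^ 2 * ψ y else 0)
          + conormalWeight j y * ConormalEuler.pd i ψ y := by
    funext y
    rw [hψ.pd_mul_smoothOn hs]
    by_cases hy : y ∈ (halfSpace : Set E3)
    · rw [pd_conormalWeight j i hy]
      by_cases h : i = 2 ∧ j = 2
      · rw [if_pos h, if_pos ⟨h.2, h.1⟩]
      · rw [if_neg h, if_neg fun h' => h ⟨h'.2, h'.1⟩, zero_mul]
    · rw [hψ.eq_zero hy]; simp
  rw [e1, e2, transposeField_eq]
  by_cases h : i = 2 ∧ j = 2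
  · simp only [h, and_self, if_true]
    rw [pd_add 2 hψ.qf_sq_mul.differentiable.differentiableAt
      ((hψ.pd 2).mul_smoothOn (smoothOn_conormalWeight 2)).differentiable.differentiableAt]
    ring
  · simp only [h, if_false, zero_add, add_zero]

/-- `∂ᵢ Zⱼ f = Zⱼ ∂ᵢ f + [i = j = 3] φ' ∂₃ f`. -/
theorem WD.zd_comm (h : WD i f D) (hf : CD j f f') (hD : CD j D D') :
    WD i f' (fun x => D' x + if i = 2 ∧ j = 2 then qf x ^ 2 * D x else 0) := by
  obtain ⟨lf, lf', ef⟩ := isWeakDeriv_iff.mp hf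
  obtain ⟨lD, lD', eD⟩ := isWeakDeriv_iff.mp hD
  have lq : LocInt (fun x => qf x ^ 2 * D x) :=
    lD.mul_continuousOn (smoothOn_qf.pow 2).continuousOn
  have lc : LocInt (fun x => if i = 2 ∧ j = 2 then qf x ^ 2 * D x else 0) := by
    split_ifs
    · exact lq
    · exact locInt_of_forall_compact fun K _ _ => integrableOn_zero
  refine ⟨lf', lD'.add lc, fun ψ hψ => ?_⟩
  have e1 := ef _ (hψ.pd i)
  have e2 := eD _ hψ
  simp only [transposeIter_single] at e1 e2
  rw [← e1]
  have e3 : ∀ x, f x * transposeField conormalWeight j (pd i ψ) x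
      = f x * pd i (transposeField conormalWeight j ψ) x
        + f x * (if i = 2 ∧ j = 2 then pd 2 (fun x => qf x ^ 2 * ψ x) x else 0) := fun x => by
    rw [hψ.transposeField_pd i j, mul_add]
  have ht := hψ.transposeField goodWeight_conormal j
  have i1 := lf.integrable_mul (ht.pd i)
  have hc : ∫ x, f x * (if i = 2 ∧ j = 2 then pd 2 (fun x => qf x ^ 2 * ψ x) x else 0) ∂hsMeasure
      = -∫ x, (if i = 2 ∧ j = 2 then qf x ^ 2 * D x else 0) * ψ x ∂hsMeasure := by
    by_cases hij : i = 2 ∧ j = 2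
    · simp only [hij, and_self, if_true]
      rw [hij.1] at h
      rw [h.eq _ hψ.qf_sq_mul]
      congr 1
      refine integral_congr_ae (Eventually.of_forall fun x => ?_)
      simp only; ring
    · simp [hij]
  have i2 : Integrable (fun x => f x *
      (if i = 2 ∧ j = 2 then pd 2 (fun x => qf x ^ 2 * ψ x) x else 0)) hsMeasure := by
    by_cases hij : i = 2 ∧ j = 2
    · simp only [hij, and_self, if_true]
      exact lf.integrable_mul (hψ.qf_sq_mul.pd 2)
    · simp [hij]
  simp_rw [e3]
  rw [integral_add i1 i2, h.eq _ ht, e2, hc]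
  simp_rw [add_mul]
  rw [integral_add (lD'.integrable_mul hψ) (lc.integrable_mul hψ)]
  ring

lemma ZReg.ite_qf_sq (m : ℕ) : ∃ C : ℝ≥0, ∀ {p B : ℝ≥0∞} {f : E3 → ℝ} (c : Prop) [Decidable c],
    1 ≤ p → ZReg p m B f → ZReg p m (C * B) (fun x => if c then qf x ^ 2 * f x else 0) := by
  obtain ⟨C, hC⟩ := ZReg.qf_sq_mul m
  obtain ⟨C', hC'⟩ := ZReg.polyQ_mul m 0
  refine ⟨C + C', fun {p B f} c _ hp hf => ?_⟩
  by_cases hc : c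
  · simp only [hc, if_true]
    refine (hC hp hf).mono le_rfl ?_
    gcongr
    exact le_add_right le_rfl
  · simp only [hc, if_false]
    have := (hC' hp hf).mono le_rfl (B' := ((C + C' : ℝ≥0) : ℝ≥0∞) * B) (by
      gcongr; exact le_add_left le_rfl)
    simpa [polyQ] using this

/-- The divergence of `Z^α v` is of lower order. -/
theorem exists_div_zd (n : ℕ) : ∃ C : ℝ≥0, ∀ {A B B' : ℝ≥0∞} {v D : Fin 3 → E3 → ℝ} {h : E3 → ℝ},
    (∀ i, WD i (v i) (D i)) → h =ᵐ[hsMeasure] (fun x => ∑ i, D i x) →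
    (∀ i, ZReg 2 n A (v i)) → (∀ i, ZReg 2 n B' (D i)) → (∀ k, k + 1 = n → ZReg 2 k B (D 2)) →
    ZReg 2 n B h → ∀ α, ord α = n → ∃ D' : Fin 3 → E3 → ℝ, (∀ i, WD i (Zd α (v i)) (D' i)) ∧
      eLpNorm (fun x => ∑ i, D' i x) 2 hsMeasure ≤ C * B := by
  induction n with
  | zero =>
    refine ⟨1, fun {A B B' v D h} h1 h2 h3 h4 h5 h6 α hα => ⟨D, fun i => ?_, ?_⟩⟩
    · rw [ord_eq_zero hα]
      exact (h1 i).congr (h3 i).zd_zero.symm EventuallyEq.rfl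
    · rw [← eLpNorm_congr_ae h2]
      simpa using h6.norm_self_le
  | succ n ih =>
    obtain ⟨C, hC⟩ := ih
    obtain ⟨Q, hQ⟩ := ZReg.ite_qf_sq n
    obtain ⟨Q', hQ'⟩ := ZReg.ite_qf_sq (n - 1)
    refine ⟨C * (1 + Q + Q'), fun {A B B' v D h} h1 h2 h3 h4 h5 h6 α hα => ?_⟩
    obtain ⟨β, j, rfl, hβ⟩ := exists_single_add hα
    have hle : ord (Pi.single j 1) + n ≤ n + 1 := by simp; lia
    have hD2 := h5 n rfl
    -- The field `Zⱼ v` has divergence `Zⱼ h`, plus `q² D 2` if `j = 2`. The commutator therefore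
    -- involves only `D 2`, and this is the only derivative for which a quantitative bound is
    -- required; `B'` just records that the others are regular.
    obtain ⟨D', hD', hb⟩ := hC (A := A) (B := (1 + Q + Q') * B) (B' := B' + Q * B')
      (v := fun i => Zd (Pi.single j 1) (v i))
      (D := fun i x => Zd (Pi.single j 1) (D i) x + if i = 2 ∧ j = 2 then qf x ^ 2 * D i x else 0)
      (h := fun x => Zd (Pi.single j 1) h x + if j = 2 then qf x ^ 2 * D 2 x else 0)
      (fun i => (h1 i).zd_comm ((h3 i).cd j) ((h4 i).cd j)) (by
        have hs : CD j h (fun x => ∑ i, Zd (Pi.single j 1) (D i) x) := by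
          have := (((h4 0).cd j).add goodWeight_conormal ((h4 1).cd j)).add goodWeight_conormal
            ((h4 2).cd j)
          refine this.congr ?_ (Eventually.of_forall fun x => by simp [Fin.sum_univ_three])
          refine EventuallyEq.trans (Eventually.of_forall fun x => ?_) h2.symm
          simp [Fin.sum_univ_three]
        filter_upwards [hs.zd_ae] with x hx
        rw [hx, Finset.sum_add_distrib]
        congr 1
        by_cases hj : j = 2 <;> simp [hj])
      (fun i => (h3 i).zd hle)
      (fun i => ((h4 i).zd hle).add (by norm_num)
        (hQ _ (by norm_num) ((h4 i).mono (Nat.le_succ n) le_rfl)))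
      (fun k hk => by
        subst hk
        have e1 := hD2.zd (α := Pi.single j 1) (n := k) (by simp; lia)
        have e2 := hQ' (2 = (2 : Fin 3) ∧ j = 2) (p := 2) (by norm_num)
          (hD2.mono (Nat.le_succ k) le_rfl)
        refine (e1.add (by norm_num) e2).mono le_rfl ?_
        rw [← one_add_mul]
        refine mul_le_mul' ?_ le_rfl
        rw [add_assoc]
        exact add_le_add le_rfl le_add_self)
      (by
        refine (((h6.zd hle).add (by norm_num) (hQ (j = 2) (by norm_num) hD2))).mono le_rfl ?_
        rw [← one_add_mul]
        exact mul_le_mul' le_self_add le_rfl) β hβ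
    · refine ⟨D', fun i => (hD' i).congr ((h3 i).zd_zd_ae (by simp; lia)) EventuallyEq.rfl, ?_⟩
      refine hb.trans (le_of_eq ?_)
      push_cast; ring

/-- Pairing a gradient with `T^α ψ`, where `T^α` is the transpose of `Z^α`: up to terms of lower
order, only the divergence of `ψ` enters. -/
theorem exists_pressure_pairing (n : ℕ) : ∃ C : ℝ≥0, ∀ {N : ℝ≥0∞} {p : E3 → ℝ}
    {G : Fin 3 → E3 → ℝ}, (∀ i, WD i p (G i)) → (∀ i, ZReg 2 n N (G i)) → ∀ α, ord α = n + 1 →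
    ∃ P R, L2loc P ∧ L2loc R ∧ eLpNorm P 2 hsMeasure ≤ C * N ∧ eLpNorm R 2 hsMeasure ≤ C * N ∧
      ∀ ψ : Fin 3 → E3 → ℝ, (∀ i, IsTest (ψ i)) →
        ∑ i, ∫ x, G i x * transposeIter conormalWeight α (ψ i) x ∂hsMeasure
          = -∫ x, P x * (∑ i, pd i (ψ i) x) ∂hsMeasure + ∫ x, R x * ψ 2 x ∂hsMeasure := by
  induction n with
  | zero =>
    obtain ⟨Q, hQ⟩ := ZReg.ite_qf_sq 0
    refine ⟨1 + Q, fun {N p G} h1 h2 α hα => ?_⟩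
    obtain ⟨β, j, rfl, hβ⟩ := exists_single_add hα
    rw [ord_eq_zero hβ, add_zero]
    have hR := (hQ (j = 2) (p := 2) (by norm_num) (h2 2)).neg
    have hP : L2loc (fun x => conormalWeight j x * G j x) :=
      (h2 j).l2loc_self.mul_continuousOn (continuousOn_conormalWeight j)
    -- Here `P = Zⱼ p` is expressed through the gradient, and moving `Zⱼ` past `∂ᵢ` leaves `-∫ P
    -- ∂ᵢψᵢ`. The commutator, present only for `i = j = 2`, is `R`.
    refine ⟨fun x => conormalWeight j x * G j x, fun x => -if j = 2 then qf x ^ 2 * G 2 x else 0,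
      hP, hR.l2loc_self, ?_, hR.norm_self_le.trans (by gcongr; exact le_add_left le_rfl),
      fun ψ hψ => ?_⟩
    · refine (eLpNorm_mul_bounded_le (C := 1) (fun x hx => by
        simpa using abs_conormalWeight_le j hx) _).trans ?_
      push_cast
      gcongr
      · exact le_self_add
      · exact (h2 j).norm_self_le
    · have lp : LocInt p := (h1 0).left
      have hgj : CD j p (fun x => conormalWeight j x * G j x) := (h1 j).conormal
      have e1 : ∀ i, ∫ x, G i x * transposeIter conormalWeight (Pi.single j 1) (ψ i) x ∂hsMeasure
          = -∫ x, conormalWeight j x * G j x * pd i (ψ i) x ∂hsMeasure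
            + if i = 2 then ∫ x, (-if j = 2 then qf x ^ 2 * G 2 x else 0) * ψ 2 x ∂hsMeasure
              else 0 := by
        intro i
        have ht := (hψ i).transposeField goodWeight_conormal j
        have f1 := (h1 i).eq _ ht
        have f2 := (isWeakDeriv_iff.mp hgj).2.2 _ ((hψ i).pd i)
        simp only [transposeIter_single] at f2 ⊢
        have f3 : ∀ x, p x * transposeField conormalWeight j (pd i (ψ i)) x
            = p x * pd i (transposeField conormalWeight j (ψ i)) x
            + p x * (if i = 2 ∧ j = 2 then pd 2 (fun x => qf x ^ 2 * ψ i x) x else 0) := fun x => by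
          rw [(hψ i).transposeField_pd i j, mul_add]
        simp_rw [f3] at f2
        by_cases hij : i = 2 ∧ j = 2
        · obtain ⟨rfl, rfl⟩ := hij
          simp only [and_self, if_true] at f2 ⊢
          rw [integral_add (lp.integrable_mul (ht.pd 2))
            (lp.integrable_mul ((hψ 2).qf_sq_mul.pd 2)), (h1 2).eq _ (hψ 2).qf_sq_mul, f1] at f2
          have f4 : ∫ x, -(qf x ^ 2 * G 2 x) * ψ 2 x ∂hsMeasure
              = -∫ x, G 2 x * (qf x ^ 2 * ψ 2 x) ∂hsMeasure := by
            rw [← integral_neg]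
            refine integral_congr_ae (Eventually.of_forall fun x => ?_)
            simp only; ring
          rw [f4]; linarith
        · simp only [hij, if_false, mul_zero, add_zero] at f2
          rw [f1] at f2
          by_cases hi : i = 2
          · have hj : j ≠ 2 := fun hj => hij ⟨hi, hj⟩
            simp [hj]; linarith
          · simp [hi]; linarith
      simp_rw [e1, Finset.sum_add_distrib, Finset.mul_sum]
      rw [integral_finsetSum _ fun i _ => hP.locInt.integrable_mul ((hψ i).pd i)]
      simp
  | succ n ih =>
    obtain ⟨C, hC⟩ := ih
    obtain ⟨Q, hQ⟩ := ZReg.ite_qf_sq n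
    obtain ⟨Q1, hQ1⟩ := ZReg.ite_qf_sq (n + 1)
    refine ⟨C * (1 + Q) + Q1, fun {N p G} h1 h2 α hα => ?_⟩
    obtain ⟨β, j, hα', hβ⟩ := exists_add_single hα
    change ord β = n + 1 at hβ
    have hgj : CD j p (fun x => conormalWeight j x * G j x) := (h1 j).conormal
    have hle : ord (Pi.single j 1) + n ≤ n + 1 := by simp; lia
    -- The induction is applied to the function `Zⱼ p`, whose gradient is `Zⱼ G` plus the
    -- commutator. The commutator is then taken out again by `β` further derivatives, which go into
    -- the new `R`.
    obtain ⟨P, R, lP, lR, bP, bR, hPR⟩ := hC (N := (1 + Q) * N)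
      (p := fun x => conormalWeight j x * G j x)
      (G := fun i x => Zd (Pi.single j 1) (G i) x + if i = 2 ∧ j = 2 then qf x ^ 2 * G i x else 0)
      (fun i => (h1 i).zd_comm hgj ((h2 i).cd j))
      (fun i => by
        refine (((h2 i).zd hle).add (by norm_num) (hQ (i = 2 ∧ j = 2) (by norm_num)
          ((h2 i).mono (Nat.le_succ n) le_rfl))).mono le_rfl ?_
        rw [← one_add_mul]) β hβ
    have hS := (hQ1 (j = 2) (p := 2) (by norm_num) (h2 2))
    have hSb := hS.deriv hβ.le
    refine ⟨P, fun x => R x + -Zd β (fun x => if j = 2 then qf x ^ 2 * G 2 x else 0) x, lP,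
      lR.add (hS.l2loc hβ.le).neg, bP.trans ?_, ?_, fun ψ hψ => ?_⟩
    · rw [← mul_assoc]; push_cast; gcongr; exact le_self_add
    · refine (eLpNorm_add_le lR.aesm (hS.l2loc hβ.le).aesm.neg (by norm_num)).trans ?_
      push_cast
      rw [add_mul, mul_assoc]
      refine add_le_add bR ?_
      exact (eLpNorm_neg ..).trans_le (hS.norm_le hβ.le)
    · have hT := fun i => (hψ i).transposeIter goodWeight_conormal β
      have e1 : ∀ i, ∫ x, G i x * transposeIter conormalWeight α (ψ i) x ∂hsMeasure
          = ∫ x, (Zd (Pi.single j 1) (G i) x + if i = 2 ∧ j = 2 then qf x ^ 2 * G i x else 0)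
              * transposeIter conormalWeight β (ψ i) x ∂hsMeasure
            - if i = 2 then ∫ x, Zd β (fun x => if j = 2 then qf x ^ 2 * G 2 x else 0) x * ψ 2 x
                ∂hsMeasure else 0 := by
        intro i
        have f1 := (isWeakDeriv_iff.mp ((h2 i).cd j)).2.2 _ (hT i)
        rw [transposeIter_single, ← transposeIter_transposeField goodWeight_conormal (hψ i),
          ← transposeIter_add_single goodWeight_conormal (hψ i), ← hα'] at f1
        rw [f1]
        have f2 := (isWeakDeriv_iff.mp hSb).2.2 _ (hψ 2)
        have lq : LocInt (fun x => if i = 2 ∧ j = 2 then qf x ^ 2 * G i x else 0) :=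
          (hQ1 (i = 2 ∧ j = 2) (p := 2) (by norm_num) (h2 i)).locInt
        have lz : LocInt (Zd (Pi.single j 1) (G i)) := ((h2 i).cd j).locallyIntegrable_deriv
        simp_rw [add_mul]
        rw [integral_add (lz.integrable_mul (hT i)) (lq.integrable_mul (hT i))]
        by_cases hi : i = 2
        · subst hi
          simp only [true_and, if_true]
          rw [f2]; ring
        · simp [hi]
      simp_rw [e1, Finset.sum_sub_distrib]
      rw [hPR ψ hψ, Finset.sum_ite_eq' Finset.univ (2 : Fin 3), if_pos (Finset.mem_univ _)]
      simp_rw [add_mul]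
      rw [integral_add (lR.locInt.integrable_mul (hψ 2))
        ((hS.l2loc hβ.le).neg.locInt.integrable_mul (hψ 2))]
      simp_rw [neg_mul]
      rw [integral_neg]
      ring

end ConormalEuler

end

noncomputable section

namespace ConormalEuler

/-! ### The quotient of the normal component by the weight -/

/-- The multi-index `eᵢ`. -/
abbrev ei (i : Fin 3) : Fin 3 → ℕ := Pi.single i 1

/-- Regularity and bounds of a divergence-free velocity field `u` tangential to the boundary;
`D = ∂_z u`. -/
structure Flow (X M K : ℝ≥0∞) (u D : Fin 3 → E3 → ℝ) : Prop where
  reg : ∀ i, ZReg 2 4 X (u i)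
  reg5 : ∀ i, ZReg 2 5 K (u i)
  reg_top : ∀ i, ZReg ∞ 2 M (u i)
  wd : ∀ i, WD 2 (u i) (D i)
  memLp : ∀ i, MemLp (D i) 2 hsMeasure
  top : ∀ i, eLpNorm (D i) ∞ hsMeasure ≤ M
  div : D 2 =ᵐ[hsMeasure] fun x => -(Zd (ei 0) (u 0) x + Zd (ei 1) (u 1) x)
  slip : WD0 2 (u 2) (D 2)
  ne_top : M ≠ ∞
  ne_top' : K ≠ ∞

/-- The quotient `u₃ / φ`. -/
def wq (u : Fin 3 → E3 → ℝ) (x : E3) : ℝ := 1 / conormalWeight 2 x * u 2 x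

variable {X M K : ℝ≥0∞} {u D : Fin 3 → E3 → ℝ} {p B B' : ℝ≥0∞} {m n : ℕ} {f g : E3 → ℝ}
  {α β γ : Fin 3 → ℕ}

lemma weight_mul_wq {x : E3} (hx : x ∈ (halfSpace : Set E3)) :
    conormalWeight 2 x * wq u x = u 2 x := by
  have := (conormalWeight_pos 2 hx).ne'
  rw [wq]; field_simp

lemma ZReg.wq (hf : ZReg p m B (u 2)) (hp : 1 ≤ p) : ZReg p m ∞ (ConormalEuler.wq u) :=
  ZReg.smooth_mul hp (smoothOn_inv_conormalWeight 2) hf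

/-- Apply `Z₃` to `u₃ = φ (u₃/φ)` and divide by `φ`. -/
lemma zd_wq_normal (hw : ZReg p (m + 1) B (ConormalEuler.wq u))
    (hu : CD 2 (u 2) (fun x => conormalWeight 2 x * g x)) :
    Zd (ei 2) (wq u) =ᵐ[hsMeasure] fun x => g x - qf x ^ 2 * wq u x := by
  have h1 := (hw.cd 2).mul_smooth (smoothOn_conormalWeight 2)
  have h2 := h1.congr (ae_hs_of_forall fun x hx => weight_mul_wq hx) EventuallyEq.rfl
  filter_upwards [h2.unique hu, ae_hs_of_forall fun x hx => hx] with x h hx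
  rw [pd_conormalWeight 2 2 hx, if_pos ⟨rfl, rfl⟩] at h
  have hpos := (conormalWeight_pos 2 hx).ne'
  apply mul_left_cancel₀ hpos
  linarith

/-- The weight `φ` depends only on `z`, so tangential derivatives pass through it. -/
lemma isWeakDeriv_weight_mul : ∀ {n : ℕ} {p B : ℝ≥0∞} {f : E3 → ℝ} {α : Fin 3 → ℕ}, ord α = n →
    α 2 = 0 → ZReg p n B f → IsWeakDeriv conormalWeight α (fun x => conormalWeight 2 x * f x)
      (fun x => conormalWeight 2 x * Zd α f x) := by
  intro n
  induction n with
  | zero =>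
    intro p B f α hα h2 hf
    rw [ord_eq_zero hα]
    refine (IsWeakDeriv.refl (hf.locInt.mul_continuousOn (continuousOn_conormalWeight 2))).congr
      EventuallyEq.rfl ?_
    filter_upwards [hf.zd_zero] with x hx
    rw [hx]
  | succ n ih =>
    intro p B f α hα h2 hf
    obtain ⟨β, i, rfl, hβ⟩ := exists_single_add hα
    have hi : i ≠ 2 := by
      rintro rfl
      simp at h2
    have hβ2 : β 2 = 0 := by
      simp only [Pi.add_apply] at h2; lia
    have h1 := (hf.cd i).mul_smooth (smoothOn_conormalWeight 2)
    have h3 := ih hβ hβ2 (hf.zd (α := ei i) (n := n) (by simp; lia))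
    refine (CD.congr_right h1 (g' := fun x => conormalWeight 2 x * Zd (ei i) f x)
      (ae_hs_of_forall fun x hx => ?_)).comp goodWeight_conormal
      (h3.congr EventuallyEq.rfl ?_)
    · simp only [pd_conormalWeight 2 i hx]
      simp [hi]
    · filter_upwards [hf.zd_zd_ae (α := ei i) (β := β) (by simp; lia)] with x hx
      rw [hx]

lemma weight_mul_zd_wq (hw : ZReg p m B (wq u)) (hα : ord α ≤ m) (h2 : α 2 = 0) :
    (fun x => conormalWeight 2 x * Zd α (wq u) x) =ᵐ[hsMeasure] Zd α (u 2) := by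
  have := isWeakDeriv_weight_mul rfl h2 (hw.mono hα le_rfl)
  exact (this.congr (ae_hs_of_forall fun x hx => weight_mul_wq hx) EventuallyEq.rfl).zd_ae.symm

/-- The identity `1/φ = 1 + 1/z` isolates the part of `u₃/φ` that calls for Hardy's inequality. -/
lemma inv_weight_eq {x : E3} (hx : x ∈ (halfSpace : Set E3)) (t : ℝ) :
    1 / conormalWeight 2 x * t = t + 1 / x 2 * t := by
  have h := mem_hs.mp hx
  have e : conormalWeight 2 x = x 2 / (1 + x 2) := rfl
  rw [e]
  field_simp
  ring

lemma zd_wq_tangential (hw : ZReg p m B (wq u)) (hα : ord α ≤ m) (h2 : α 2 = 0) :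
    Zd α (wq u) =ᵐ[hsMeasure] fun x => Zd α (u 2) x + 1 / x 2 * Zd α (u 2) x := by
  filter_upwards [weight_mul_zd_wq hw hα h2, ae_hs_of_forall fun x hx => hx] with x h hx
  rw [← inv_weight_eq hx, ← h]
  have := (conormalWeight_pos 2 hx).ne'
  field_simp

lemma WD0.zd_tangential : ∀ {n : ℕ} {f g : E3 → ℝ} {α : Fin 3 → ℕ}, ord α = n →
    α 2 = 0 → B ≠ ∞ → B' ≠ ∞ → ZReg 2 n B f → ZReg 2 n B' g → WD0 2 f g →
    WD0 2 (Zd α f) (Zd α g) := by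
  intro n
  induction n with
  | zero =>
    intro f g α hα h2 hB hB' hf hg h
    rw [ord_eq_zero hα]
    exact h.congr hf.zd_zero.symm hg.zd_zero.symm
  | succ n ih =>
    intro f g α hα h2 hB hB' hf hg h
    obtain ⟨β, i, rfl, hβ⟩ := exists_single_add hα
    have hi : i ≠ 2 := by
      rintro rfl
      simp at h2
    have hβ2 : β 2 = 0 := by
      simp only [Pi.add_apply] at h2; lia
    have hle : ord (ei i) + n ≤ n + 1 := by simp; lia
    have hwd : ∀ {f : E3 → ℝ} {B : ℝ≥0∞}, ZReg 2 (n + 1) B f → WD i f (Zd (ei i) f) :=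
      fun {f B} hf => WD.of_conormal (CD.congr_right (hf.cd i) (ae_hs_of_forall fun x hx => by
        simp [conormalWeight_eq i hx, hi, polyQ]))
    have := h.tangential (hwd hf) (hwd hg) hi (hf.memLp_self hB) (hg.memLp_self hB')
      (hf.memLp hB (by simp)) (hg.memLp hB' (by simp))
    exact (ih hβ hβ2 hB hB' (hf.zd hle) (hg.zd hle) this).congr
      (hf.zd_zd_ae (by simp; lia)) (hg.zd_zd_ae (by simp; lia))

/-- Incompressibility replaces `∂_z u₃` by tangential derivatives, so it costs one conormal
derivative instead of a true normal one. -/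
lemma Flow.zReg_div (h : Flow X M K u D) (hp : 1 ≤ p) (hu : ∀ i, ZReg p (m + 1) B (u i)) :
    ZReg p m (2 * B) (D 2) := by
  have h0 := (hu 0).zd (α := ei 0) (n := m) (by simp; lia)
  have h1 := (hu 1).zd (α := ei 1) (n := m) (by simp; lia)
  rw [two_mul]
  exact (h0.add hp h1).neg.congr h.div.symm

lemma Flow.zReg_wq (h : Flow X M K u D) : ZReg 2 5 ∞ (wq u) := ZReg.wq (h.reg5 2) (by norm_num)

lemma Flow.zd_wq_normal (h : Flow X M K u D) :
    Zd (ei 2) (wq u) =ᵐ[hsMeasure] fun x => D 2 x - qf x ^ 2 * wq u x :=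
  ConormalEuler.zd_wq_normal h.zReg_wq (h.wd 2).conormal

/-- Normal derivatives of `u₃ / φ` are controlled by those of lower order. -/
lemma exists_norm_zd_wq_normal_le (m : ℕ) (hm : m ≤ 4) : ∃ C : ℝ≥0,
    ∀ {X M K p B B' : ℝ≥0∞} {u D : Fin 3 → E3 → ℝ} {α : Fin 3 → ℕ}, Flow X M K u D →
    1 ≤ p → ZReg p m B' (D 2) → ZReg p m B (wq u) → ord α ≤ m + 1 → α 2 ≠ 0 →
    eLpNorm (Zd α (wq u)) p hsMeasure ≤ B' + C * B := by
  obtain ⟨C, hC⟩ := ZReg.qf_sq_mul m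
  refine ⟨C, fun {X M K p B B' u D α} h hp hD hw hα h2 => ?_⟩
  obtain ⟨β, rfl⟩ : ∃ β, α = ei 2 + β := by
    refine ⟨α - ei 2, (add_tsub_cancel_of_le fun i => ?_).symm⟩
    by_cases hi : i = 2
    · subst hi; simp; lia
    · simp [hi]
  have hβ : ord β ≤ m := by simp at hα; lia
  have key := (hD.sub hp (hC hp hw)).congr h.zd_wq_normal.symm
  have h5 := h.zReg_wq.zd_zd_ae (α := ei 2) (β := β) (by simp; lia)
  rw [← eLpNorm_congr_ae h5]
  exact key.norm_le hβ

lemma eLpNorm_add_inv_z_le (f : E3 → ℝ) (hf : AEStronglyMeasurable f hsMeasure) (hp : 1 ≤ p)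
    (hb : eLpNorm (fun x => 1 / x 2 * f x) p hsMeasure ≤ B) :
    eLpNorm (fun x => f x + 1 / x 2 * f x) p hsMeasure ≤ eLpNorm f p hsMeasure + B := by
  refine (eLpNorm_add_le hf ?_ hp).trans (add_le_add le_rfl hb)
  exact (smoothOn_inv_z.continuousOn.aestronglyMeasurable measurableSet_hs).mul hf

/-- Tangential derivatives keep the zero trace of `u₃`, so Hardy applies to `Z^α u₃`. The constant
is `5 = 1 + 2·2`: the 1 in `1/φ = 1 + 1/z`, the Hardy constant, and the two terms of `∂_z u₃ =
-(∂₁u₁ + ∂₂u₂)`. -/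
lemma Flow.norm_zd_wq_tangential_le (h : Flow X M K u D) (hα : ord α ≤ 3) (h2 : α 2 = 0) :
    eLpNorm (Zd α (wq u)) 2 hsMeasure ≤ 5 * X := by
  have hw := zd_wq_tangential h.zReg_wq (α := α) (by lia) h2
  have hD := h.zReg_div (p := 2) (by norm_num) h.reg
  have hK : 2 * K ≠ ∞ := ENNReal.mul_ne_top (by norm_num) h.ne_top'
  have hD5 := h.zReg_div (p := 2) (by norm_num) h.reg5
  have u5 := h.reg5 2
  have h0 : WD0 2 (Zd α (u 2)) (Zd α (D 2)) := WD0.zd_tangential rfl h2 h.ne_top' hK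
    (u5.mono (by lia) le_rfl) (hD5.mono (by lia) le_rfl) h.slip
  have hardy := h0.hardy (u5.memLp h.ne_top' (by lia)) (hD5.memLp hK (by lia))
  rw [eLpNorm_congr_ae hw]
  refine (eLpNorm_add_inv_z_le _ (u5.l2loc (by lia)).aesm (by norm_num) hardy).trans ?_
  calc _ ≤ X + 2 * (2 * X) := by
        gcongr
        · exact (h.reg 2).norm_le (by lia)
        · exact hD.norm_le hα
    _ = 5 * X := by ring

lemma ae_abs_le_of_eLpNorm_top {A : ℝ≥0} (h : eLpNorm f ∞ hsMeasure ≤ A) :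
    ∀ᵐ x ∂hsMeasure, |f x| ≤ A := by
  rw [eLpNorm_exponent_top] at h
  filter_upwards [ae_le_eLpNormEssSup (f := f) (μ := hsMeasure)] with x hx
  have := hx.trans h
  rw [← enorm_norm, Real.enorm_eq_ofReal (norm_nonneg _)] at this
  exact (ENNReal.ofReal_le_coe).mp this

lemma eLpNorm_top_le_of_ae {A : ℝ≥0} (h : ∀ᵐ x ∂hsMeasure, |f x| ≤ A) :
    eLpNorm f ∞ hsMeasure ≤ A := by
  rw [eLpNorm_exponent_top]
  refine (eLpNormEssSup_le_of_ae_bound (C := A) h).trans (by simp)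

/-- The same argument in `L^∞`, where Hardy has constant 1; hence `3 = 1 + 2`. -/
lemma Flow.top_zd_wq_tangential_le (h : Flow X M K u D) (hα : ord α ≤ 1) (h2 : α 2 = 0) :
    eLpNorm (Zd α (wq u)) ∞ hsMeasure ≤ 3 * M := by
  have hw := zd_wq_tangential h.zReg_wq (α := α) (by lia) h2
  have hD := h.zReg_div (p := ∞) le_top h.reg_top
  have hK : 2 * K ≠ ∞ := ENNReal.mul_ne_top (by norm_num) h.ne_top'
  have hD5 := h.zReg_div (p := 2) (by norm_num) h.reg5
  have u5 := h.reg5 2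
  have h0 : WD0 2 (Zd α (u 2)) (Zd α (D 2)) := WD0.zd_tangential rfl h2 h.ne_top' hK
    (u5.mono (by lia) le_rfl) (hD5.mono (by lia) le_rfl) h.slip
  have e : ((2 * M.toNNReal : ℝ≥0) : ℝ≥0∞) = 2 * M := by
    push_cast; rw [ENNReal.coe_toNNReal h.ne_top]
  have hardy := h0.hardy_top (u5.memLp h.ne_top' (by lia)) (hD5.memLp hK (by lia))
    (A := (2 * M.toNNReal : ℝ≥0)) (NNReal.coe_nonneg _)
    (ae_abs_le_of_eLpNorm_top (by rw [e]; exact hD.norm_le hα))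
  rw [eLpNorm_congr_ae hw]
  refine (eLpNorm_add_inv_z_le _ (u5.l2loc (by lia)).aesm le_top
    ((eLpNorm_top_le_of_ae hardy).trans_eq e)).trans ?_
  calc _ ≤ M + 2 * M := by
        gcongr
        exact (h.reg_top 2).norm_le (by lia)
    _ = 3 * M := by ring

lemma ZReg.of_le' {q : ℝ≥0∞} (hf : ZReg q m B f)
    (h : ∀ α, ord α ≤ m → eLpNorm (Zd α f) p hsMeasure ≤ B') :
    ZReg p m B' f := fun α hα => ⟨_, hf.deriv hα, hf.l2loc hα, h α hα⟩

/-- Tangential derivatives come from Hardy, and a normal derivative reduces the order by `Z₃(u₃/φ) =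
∂_z u₃ - q² u₃/φ`. Since Hardy costs one derivative, order 4 is reached only if at least one
derivative is normal. -/
theorem exists_zReg_wq : ∃ C : ℝ≥0, ∀ {X M K : ℝ≥0∞} {u D : Fin 3 → E3 → ℝ}, Flow X M K u D →
    ZReg 2 3 (C * X) (wq u) ∧ ZReg ∞ 1 (C * M) (wq u) ∧
      ∀ α, ord α = 4 → α 2 ≠ 0 → eLpNorm (Zd α (wq u)) 2 hsMeasure ≤ C * X := by
  have hL2 : ∀ m ≤ 3, ∃ C : ℝ≥0, ∀ {X M K : ℝ≥0∞} {u D : Fin 3 → E3 → ℝ}, Flow X M K u D →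
      ZReg 2 m (C * X) (wq u) := by
    intro m
    induction m with
    | zero =>
      refine fun _ => ⟨5, fun {X M K u D} h => (h.zReg_wq.mono (Nat.zero_le 5) le_rfl).of_le'
        fun α hα => ?_⟩
      rw [ord_eq_zero (Nat.le_zero.mp hα)]
      exact h.norm_zd_wq_tangential_le (by simp) rfl
    | succ m ih =>
      intro hm
      obtain ⟨C, hC⟩ := ih (by lia)
      obtain ⟨C', hC'⟩ := exists_norm_zd_wq_normal_le m (by lia)
      refine ⟨5 + (2 + C' * C), fun {X M K u D} h =>
        (h.zReg_wq.mono (by lia : m + 1 ≤ 5) le_rfl).of_le' fun α hα => ?_⟩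
      push_cast
      rw [add_mul]
      by_cases h2 : α 2 = 0
      · exact (h.norm_zd_wq_tangential_le (by lia) h2).trans le_self_add
      · have := hC' h (p := 2) (by norm_num) ((h.zReg_div (by norm_num) h.reg).mono (by lia) le_rfl)
          (hC h) hα h2
        refine (this.trans (le_of_eq ?_)).trans le_add_self
        ring
  obtain ⟨C, hC⟩ := hL2 3 le_rfl
  obtain ⟨C', hC'⟩ := exists_norm_zd_wq_normal_le 3 (by norm_num)
  obtain ⟨C'', hC''⟩ := exists_norm_zd_wq_normal_le 0 (by norm_num)
  refine ⟨C + (2 + C' * C) + (3 + (2 + C'' * 3)), fun {X M K u D} h => ⟨?_, ?_, fun α hα h2 => ?_⟩⟩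
  · refine (hC h).mono le_rfl ?_
    gcongr
    exact le_add_right le_self_add
  · have h0 : ZReg ∞ 0 (3 * M) (wq u) := (h.zReg_wq.mono (Nat.zero_le 5) le_rfl).of_le'
      fun α hα => by
        rw [ord_eq_zero (Nat.le_zero.mp hα)]
        exact h.top_zd_wq_tangential_le (by simp) rfl
    have hb : ZReg ∞ 1 ((3 + (2 + C'' * 3)) * M) (wq u) :=
      (h.zReg_wq.mono (by lia : 1 ≤ 5) le_rfl).of_le' fun α hα => by
        rw [add_mul]
        by_cases h2 : α 2 = 0
        · exact (h.top_zd_wq_tangential_le hα h2).trans le_self_add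
        · have := hC'' h (p := ∞) le_top ((h.zReg_div le_top h.reg_top).mono (by lia) le_rfl)
            h0 hα h2
          refine (this.trans (le_of_eq ?_)).trans le_add_self
          ring
    refine hb.mono le_rfl ?_
    push_cast
    exact mul_le_mul' le_add_self le_rfl
  · have := hC' h (p := 2) (by norm_num) (h.zReg_div (by norm_num) h.reg) (hC h) hα.le h2
    refine this.trans ?_
    rw [← mul_assoc, ← add_mul]
    push_cast
    exact mul_le_mul' (le_add_right le_add_self) le_rfl

end ConormalEuler

end

noncomputable section

namespace ConormalEuler

/-! ### The transport operator and its commutators -/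

/-- The coefficients `(u₁, u₂, u₃ / φ)` of `u · ∇` in terms of `Z₁, Z₂, Z₃`. -/
def transp (u : Fin 3 → E3 → ℝ) : Fin 3 → E3 → ℝ := ![u 0, u 1, wq u]

/-- The components of `u · ∇ u`. -/
def adv (u : Fin 3 → E3 → ℝ) (i : Fin 3) (x : E3) : ℝ :=
  ∑ k, transp u k x * Zd (ei k) (u i) x

variable {X M K : ℝ≥0∞} {u D : Fin 3 → E3 → ℝ} {p B B' : ℝ≥0∞} {m n : ℕ} {f g : E3 → ℝ}
  {α β γ : Fin 3 → ℕ} {i : Fin 3}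

lemma eLpNorm_mul_top_two_le (hg : AEStronglyMeasurable g hsMeasure)
    (h1 : eLpNorm f ∞ hsMeasure ≤ B) (h2 : eLpNorm g 2 hsMeasure ≤ B') :
    eLpNorm (fun x => f x * g x) 2 hsMeasure ≤ B * B' :=
  (eLpNorm_smul_le_eLpNorm_top_mul_eLpNorm 2 hg f).trans (mul_le_mul' h1 h2)

lemma eLpNorm_mul_two_top_le (hg : AEStronglyMeasurable f hsMeasure)
    (h1 : eLpNorm f 2 hsMeasure ≤ B) (h2 : eLpNorm g ∞ hsMeasure ≤ B') :
    eLpNorm (fun x => f x * g x) 2 hsMeasure ≤ B' * B := by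
  simp_rw [mul_comm (f _)]
  exact eLpNorm_mul_top_two_le hg h2 h1

lemma eLpNorm_mul_le_of_sq (hf : AEStronglyMeasurable f hsMeasure)
    (hg : AEStronglyMeasurable g hsMeasure)
    (h1 : eLpNorm (fun x => f x ^ 2) 2 hsMeasure ≤ B)
    (h2 : eLpNorm (fun x => g x ^ 2) 2 hsMeasure ≤ B') :
    eLpNorm (fun x => f x * g x) 2 hsMeasure ≤ B + B' := by
  have mf : AEStronglyMeasurable (fun x => f x ^ 2) hsMeasure := hf.pow 2
  have mg : AEStronglyMeasurable (fun x => g x ^ 2) hsMeasure := hg.pow 2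
  have hm : eLpNorm (fun x => f x * g x) 2 hsMeasure
      ≤ eLpNorm ((fun x => f x ^ 2) + fun x => g x ^ 2) 2 hsMeasure := by
    refine eLpNorm_mono fun x => ?_
    simp only [Pi.add_apply, Real.norm_eq_abs, abs_mul]
    rw [abs_of_nonneg (a := _ + _) (by positivity), ← sq_abs (f x), ← sq_abs (g x)]
    nlinarith [sq_nonneg (|f x| - |g x|), sq_nonneg (|f x|), sq_nonneg (|g x|)]
  exact hm.trans ((eLpNorm_add_le mf mg (by norm_num)).trans (add_le_add h1 h2))

/-- Gagliardo-Nirenberg for a derivative of order `n`, one step up; `4 = 3 + 1` collects the orders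
`n + 2` and `n + 1`. -/
lemma eLpNorm_sq_zd_le {A : ℝ≥0} (hr : ZReg 2 (n + 2) B f) (hB : B ≠ ∞)
    (ht : ∀ β, ord β = n → eLpNorm (Zd β f) ∞ hsMeasure ≤ A) (hα : ord α = n + 1) :
    eLpNorm (fun x => Zd α f x ^ 2) 2 hsMeasure ≤ A * (4 * B) := by
  obtain ⟨β, j, rfl, hβ⟩ := exists_add_single hα
  change ord β = n at hβ
  have h1 : CD j (Zd β f) (Zd (β + ei j) f) := hr.zd_zd (by simp; lia)
  have h2 : CD j (Zd (β + ei j) f) (Zd (β + ei j + ei j) f) := hr.zd_zd (by simp; lia)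
  refine (h1.eLpNorm_sq_le h2 (ae_abs_le_of_eLpNorm_top (ht β hβ)) (hr.memLp hB (by simp; lia))
    (hr.memLp hB (by simp; lia))).trans ?_
  gcongr
  calc _ ≤ 3 * B + B := by
        gcongr
        · exact hr.norm_le (by simp; lia)
        · exact hr.norm_le (by simp; lia)
    _ = 4 * B := by ring

/-- With total order at most 5, one factor has order at most 2 and is placed in `L^∞`. -/
lemma norm_zd_mul_zd_le (hf : ZReg 2 4 X f) (hf' : ZReg ∞ 2 M f) (hg : ZReg 2 4 X g)
    (hg' : ZReg ∞ 2 M g) (h2 : ord β + ord γ ≤ 5) (h3 : ord γ ≤ 4)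
    (h4 : ord β ≤ 4) :
    eLpNorm (fun x => Zd β f x * Zd γ g x) 2 hsMeasure ≤ M * X := by
  by_cases hβ : ord β ≤ 2
  · exact eLpNorm_mul_top_two_le (hg.l2loc h3).aesm (hf'.norm_le hβ) (hg.norm_le h3)
  · exact eLpNorm_mul_two_top_le (hf.l2loc h4).aesm (hf.norm_le h4) (hg'.norm_le (by lia))

/-- The derivatives of `u₃/φ` are bounded only up to order 1, and those of `u` up to order 2. Either
one factor is bounded and the other lies in `L²`, or one is in one of two exceptional cases: `(|β|,
|γ|) = (2, 2)`, and four tangential derivatives on `u₃/φ`. -/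
theorem exists_norm_zd_wq_mul_le : ∃ C : ℝ≥0, ∀ {X M K : ℝ≥0∞} {u D : Fin 3 → E3 → ℝ}
    {β γ : Fin 3 → ℕ} (i : Fin 3), Flow X M K u D → X ≠ ∞ → β ≠ 0 → ord β + ord γ ≤ 4 →
    eLpNorm (fun x => Zd β (wq u) x * Zd (γ + ei 2) (u i) x) 2 hsMeasure ≤ C * (M * X) := by
  obtain ⟨C, hC⟩ := exists_zReg_wq
  refine ⟨1 + 4 * C * C + 4 + C, fun {X M K u D β γ} i h hX hβ hle => ?_⟩
  obtain ⟨w2, wt, w4⟩ := hC h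
  have hCX : C * X ≠ ∞ := ENNReal.mul_ne_top (by simp) hX
  have eM : ((M.toNNReal : ℝ≥0) : ℝ≥0∞) = M := ENNReal.coe_toNNReal h.ne_top
  have hβ0 : 1 ≤ ord β := Nat.one_le_iff_ne_zero.mpr fun h0 => hβ (ord_eq_zero h0)
  have hw5 := h.zReg_wq
  have hγ : ord (γ + ei 2) = ord γ + 1 := by simp
  have b1 : (1 : ℝ≥0∞) * (M * X) ≤ (1 + 4 * C * C + 4 + C) * (M * X) :=
    mul_le_mul' (le_add_right (le_add_right le_self_add)) le_rfl
  have b2 : (C : ℝ≥0∞) * (M * X) ≤ (1 + 4 * C * C + 4 + C) * (M * X) :=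
    mul_le_mul' le_add_self le_rfl
  have b3 : (4 * C * C + 4 : ℝ≥0∞) * (M * X) ≤ (1 + 4 * C * C + 4 + C) * (M * X) := by
    refine mul_le_mul' (le_add_right ?_) le_rfl
    rw [add_assoc]
    exact le_add_self
  push_cast
  by_cases c1 : ord β = 1
  · refine (eLpNorm_mul_top_two_le ((h.reg i).l2loc (by lia)).aesm (wt.norm_le c1.le)
      ((h.reg i).norm_le (by lia))).trans (le_trans (le_of_eq ?_) b2)
    ring
  by_cases c2 : ord β = 2 ∧ ord γ = 2
  -- Orders 2 and 3: neither factor is known to be bounded. Their squares lie in `L²` by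
  -- interpolating the sup bounds at orders 1 and 2 with `L²` bounds up to orders 3 and 4.
  · have s1 := eLpNorm_sq_zd_le (A := C * M.toNNReal) (n := 1) w2 hCX (fun δ hδ => by
      push_cast; rw [eM]; exact wt.norm_le hδ.le) (α := β) c2.1
    have s2 := eLpNorm_sq_zd_le (A := M.toNNReal) (n := 2) (h.reg i) hX (fun δ hδ => by
      rw [eM]; exact (h.reg_top i).norm_le hδ.le) (α := γ + ei 2) (by lia)
    refine (eLpNorm_mul_le_of_sq (hw5.l2loc (by lia)).aesm ((h.reg i).l2loc (by lia)).aesm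
      s1 s2).trans (le_trans (le_of_eq ?_) b3)
    push_cast
    rw [eM]
    ring
  by_cases c3 : ord β = 4
  · obtain rfl : γ = 0 := ord_eq_zero (by lia)
    by_cases hβ2 : β 2 = 0
    -- The uncontrolled derivative is avoided by moving the weight: `Z₃uᵢ = φ ∂_z uᵢ` and `φ
    -- Z^β(u₃/φ) = Z^β u₃`. This is where the Lipschitz norm of `u` is used.
    · have e : (fun x => Zd β (wq u) x * Zd (0 + ei 2) (u i) x) =ᵐ[hsMeasure]
          fun x => Zd β (u 2) x * D i x := by
        rw [zero_add]
        filter_upwards [weight_mul_zd_wq hw5 (by lia) hβ2, (h.wd i).conormal.zd_ae] with x e1 e2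
        rw [← e1, e2]; ring
      rw [eLpNorm_congr_ae e]
      refine le_trans ?_ b1
      rw [one_mul]
      exact eLpNorm_mul_two_top_le ((h.reg 2).l2loc c3.le).aesm ((h.reg 2).norm_le c3.le) (h.top i)
    · refine (eLpNorm_mul_two_top_le (hw5.l2loc (by lia)).aesm (w4 β c3 hβ2)
        ((h.reg_top i).norm_le (by lia))).trans (le_trans (le_of_eq ?_) b2)
      ring
  · refine (eLpNorm_mul_two_top_le (hw5.l2loc (by lia)).aesm (w2.norm_le (by lia))
        ((h.reg_top i).norm_le (by lia))).trans (le_trans (le_of_eq ?_) b2)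
    ring

lemma Flow.zReg_transp (h : Flow X M K u D) (k : Fin 3) : ZReg 2 5 ∞ (transp u k) := by
  fin_cases k
  · exact (h.reg5 0).mono le_rfl le_top
  · exact (h.reg5 1).mono le_rfl le_top
  · exact h.zReg_wq

/-- Every Leibniz term with a derivative on the coefficient is bounded by a multiple of `M X`; there
are three coefficients and at most `2⁴` terms for each. The derivative of order 5 appears only in
the transport term, which is left exact. -/
theorem exists_commutator : ∃ C : ℝ≥0, ∀ {X M K : ℝ≥0∞} {u D : Fin 3 → E3 → ℝ}
    {α : Fin 3 → ℕ} (i : Fin 3), Flow X M K u D → X ≠ ∞ → ord α ≤ 4 →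
    ∃ R, AEStronglyMeasurable R hsMeasure ∧ eLpNorm R 2 hsMeasure ≤ C * (M * X) ∧
      IsWeakDeriv conormalWeight α (adv u i)
        (fun x => ∑ k, transp u k x * Zd (α + ei k) (u i) x + R x) := by
  obtain ⟨C, hC⟩ := exists_norm_zd_wq_mul_le
  refine ⟨3 * (2 ^ 4 * (1 + C)), fun {X M K u D α} i h hX hα => ?_⟩
  have key : ∀ k, ∃ R, IsWeakDeriv conormalWeight α
      (fun x => transp u k x * Zd (ei k) (u i) x)
      (fun x => transp u k x * Zd (α + ei k) (u i) x + R x) ∧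
      AEStronglyMeasurable R hsMeasure ∧
      eLpNorm R 2 hsMeasure ≤ 2 ^ 4 * ((1 + C) * (M * X)) := by
    intro k
    have hg : ZReg 2 4 ∞ (Zd (ei k) (u i)) :=
      ((h.reg5 i).mono le_rfl le_top).zd (by simp)
    obtain ⟨R, h1, h2, h3⟩ := exists_leibniz_rest (p := 2) (B := (1 + C) * (M * X)) (by norm_num)
      (ord α) rfl ((h.zReg_transp k).mono (by lia) le_rfl) (hg.mono hα le_rfl)
      (fun β γ hβγ hβ => by
        have ho := congrArg ord hβγ
        rw [ord_add] at ho
        have hβ0 : 1 ≤ ord β := Nat.one_le_iff_ne_zero.mpr fun h0 => hβ (ord_eq_zero h0)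
        have e : (fun x => Zd β (transp u k) x * Zd γ (Zd (ei k) (u i)) x) =ᵐ[hsMeasure]
            fun x => Zd β (transp u k) x * Zd (γ + ei k) (u i) x := by
          rw [add_comm γ]
          filter_upwards [(h.reg5 i).zd_zd_ae (α := ei k) (β := γ) (by simp; lia)] with x hx
          rw [hx]
        rw [eLpNorm_congr_ae e, add_mul]
        have hu : ∀ j, eLpNorm (fun x => Zd β (u j) x * Zd (γ + ei k) (u i) x) 2 hsMeasure
            ≤ 1 * (M * X) + C * (M * X) := fun j => by
          refine le_trans ?_ le_self_add
          rw [one_mul]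
          exact norm_zd_mul_zd_le (h.reg j) (h.reg_top j) (h.reg i) (h.reg_top i)
            (by simp; lia) (by simp; lia) (by lia)
        fin_cases k
        · exact hu 0
        · exact hu 1
        · exact (hC i h hX hβ (by lia)).trans le_add_self)
    refine ⟨R, h1.congr EventuallyEq.rfl ?_, h2, h3.trans ?_⟩
    · filter_upwards [(h.reg5 i).zd_zd_ae (α := ei k) (β := α) (by simp; lia)] with x hx
      rw [hx, add_comm α]
    · gcongr
      norm_num
  choose R h1 h2 h3 using key
  refine ⟨fun x => R 0 x + R 1 x + R 2 x, ((h2 0).add (h2 1)).add (h2 2), ?_, ?_⟩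
  · refine (eLpNorm_add_le ((h2 0).add (h2 1)) (h2 2) (by norm_num)).trans
      ((add_le_add ((eLpNorm_add_le (h2 0) (h2 1) (by norm_num)).trans
        (add_le_add (h3 0) (h3 1))) (h3 2)).trans (le_of_eq ?_))
    push_cast
    ring
  · refine (((h1 0).add goodWeight_conormal (h1 1)).add goodWeight_conormal (h1 2)).congr
      (Eventually.of_forall fun x => ?_) (Eventually.of_forall fun x => ?_)
    · simp [adv, Fin.sum_univ_three]
    · simp only [Fin.sum_univ_three]; ring

lemma memLp_mul_top {p : ℝ≥0∞} {a : E3 → ℝ} (hf : MemLp f p hsMeasure)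
    (ha : MemLp a ∞ hsMeasure) : MemLp (fun x => a x * f x) p hsMeasure :=
  hf.smul (r := p) ha

lemma integrable_mul_bounded {a : E3 → ℝ} (hf : Integrable f hsMeasure)
    (ha : MemLp a ∞ hsMeasure) : Integrable (fun x => a x * f x) hsMeasure :=
  memLp_one_iff_integrable.mp (memLp_mul_top (memLp_one_iff_integrable.mpr hf) ha)

lemma Flow.top_transp (h : Flow X M K u D) (k : Fin 3) : MemLp (transp u k) ∞ hsMeasure := by
  obtain ⟨C, hC⟩ := exists_zReg_wq
  fin_cases k
  · exact (h.reg_top 0).memLp_self h.ne_top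
  · exact (h.reg_top 1).memLp_self h.ne_top
  · exact (hC h).2.1.memLp_self (ENNReal.mul_ne_top (by simp) h.ne_top)

lemma Flow.top_zd_transp (h : Flow X M K u D) (k : Fin 3) :
    MemLp (Zd (ei k) (transp u k)) ∞ hsMeasure := by
  obtain ⟨C, hC⟩ := exists_zReg_wq
  fin_cases k
  · exact (h.reg_top 0).memLp h.ne_top (by simp)
  · exact (h.reg_top 1).memLp h.ne_top (by simp)
  · exact (hC h).2.1.memLp (ENNReal.mul_ne_top (by simp) h.ne_top) (by simp)

/-- Since `Z₃(u₃/φ) + φ' u₃/φ = ∂_z u₃`, the sum is the divergence of `u` written in conormal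
fields. -/
lemma Flow.div_transp (h : Flow X M K u D) :
    ∀ᵐ x ∂hsMeasure, ∑ k, (Zd (ei k) (transp u k) x + zDiv k x * transp u k x) = 0 := by
  filter_upwards [h.div, h.zd_wq_normal] with x h1 h2
  simp only [Fin.sum_univ_three]
  simp only [transp, Matrix.cons_val_zero, Matrix.cons_val_one, Matrix.cons_val]
  rw [h2, h1]
  simp [zDiv]

/-- The transport operator is antisymmetric. -/
theorem Flow.integral_transp (h : Flow X M K u D) {v : E3 → ℝ} {v' : Fin 3 → E3 → ℝ}
    (hv : MemLp v 2 hsMeasure) (hv' : ∀ k, MemLp (v' k) 2 hsMeasure) (hd : ∀ k, CD k v (v' k)) :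
    ∫ x, (∑ k, transp u k x * v' k x) * v x ∂hsMeasure = 0 := by
  have ia : ∀ k, Integrable (fun x => transp u k x * (v x * v x)) hsMeasure := fun k =>
    integrable_mul_bounded (memLp_two_mul hv hv) (h.top_transp k)
  have iz : ∀ k, Integrable (fun x => zDiv k x * (transp u k x * (v x * v x))) hsMeasure := fun k =>
    integrable_mul_bounded (ia k) (memLp_top_of_bound
      ((smoothOn_zDiv k).continuousOn.aestronglyMeasurable measurableSet_hs) 1
      (ae_hs_of_forall fun x hx => abs_zDiv_le k hx))
  have id : ∀ k, Integrable (fun x => Zd (ei k) (transp u k) x * (v x * v x)) hsMeasure :=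
    fun k => integrable_mul_bounded (memLp_two_mul hv hv) (h.top_zd_transp k)
  have it : ∀ k, Integrable (fun x => transp u k x * (v' k x * v x)) hsMeasure := fun k =>
    integrable_mul_bounded (memLp_two_mul (hv' k) hv) (h.top_transp k)
  have key : ∀ k, ∫ x, (Zd (ei k) (transp u k) x + zDiv k x * transp u k x) * (v x * v x) ∂hsMeasure
      + 2 * ∫ x, transp u k x * (v' k x * v x) ∂hsMeasure = 0 := by
    intro k
    have ht := h.top_transp k
    have hz := h.top_zd_transp k
    have c0 : CD k (transp u k) (Zd (ei k) (transp u k)) := (h.zReg_transp k).cd k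
    -- The derivative of `aₖ v²` is computed for the product `(aₖ v) · v`, so that every factor
    -- stays locally square integrable; `v²` itself need not be.
    have c1 := c0.mul (hd k) (l2loc_of_top ht) (l2loc_of_top hz) hv.l2loc (hv' k).l2loc
    have c2 := c1.mul (hd k) (memLp_mul_top hv ht).l2loc
      ((memLp_mul_top hv hz).add (memLp_mul_top (hv' k) ht)).l2loc hv.l2loc (hv' k).l2loc
    have e1 : (fun x => (Zd (ei k) (transp u k) x * v x + transp u k x * v' k x) * v x
        + transp u k x * v x * v' k x) = fun x => Zd (ei k) (transp u k) x * (v x * v x)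
          + 2 * (transp u k x * (v' k x * v x)) := by funext x; ring
    have e2 : (fun x => transp u k x * v x * v x) = fun x => transp u k x * (v x * v x) := by
      funext x; ring
    rw [e1, e2] at c2
    have c3 := integral_conormal c2 (ia k) ((id k).add ((it k).const_mul 2))
    rw [integral_add (id k) ((it k).const_mul 2), integral_const_mul] at c3
    have e3 : ∀ x, (Zd (ei k) (transp u k) x + zDiv k x * transp u k x) * (v x * v x)
        = Zd (ei k) (transp u k) x * (v x * v x) + zDiv k x * (transp u k x * (v x * v x)) :=
      fun x => by ring
    simp_rw [e3]
    rw [integral_add (id k) (iz k)]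
    linarith
  have hs := Finset.sum_eq_zero fun k (_ : k ∈ Finset.univ) => key k
  rw [Finset.sum_add_distrib, ← integral_finsetSum _ fun k _ => ?_, ← Finset.mul_sum] at hs
  · have z : ∫ x, ∑ k, (Zd (ei k) (transp u k) x + zDiv k x * transp u k x) * (v x * v x)
        ∂hsMeasure = 0 := by
      refine integral_eq_zero_of_ae ?_
      filter_upwards [h.div_transp] with x hx
      rw [← Finset.sum_mul, hx]; simp
    rw [z, zero_add, ← integral_finsetSum _ fun k _ => it k] at hs
    have := (mul_eq_zero.mp hs).resolve_left (by norm_num)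
    rw [← this]
    refine integral_congr_ae (Eventually.of_forall fun x => ?_)
    simp only [Finset.sum_mul, mul_assoc]
  · refine ((id k).add (iz k)).congr (Eventually.of_forall fun x => ?_)
    simp only [Pi.add_apply]; ring

/-- The convective term in weak form. -/
theorem Flow.integral_convective (h : Flow X M K u D) (i : Fin 3) {ψ : E3 → ℝ} (hψ : IsTest ψ) :
    ∑ j, ∫ x, u i x * u j x * pd j ψ x ∂hsMeasure = -∫ x, adv u i x * ψ x ∂hsMeasure := by
  have hd : ∀ k j, WD j (u k) (fun x => 1 / conormalWeight j x * Zd (ei j) (u k) x) := fun k j =>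
    wd_of_conormal ((h.reg5 k).cd j)
  have ll : ∀ k, L2loc (u k) := fun k => (h.reg5 k).l2loc_self
  have ld : ∀ k j, L2loc (fun x => 1 / conormalWeight j x * Zd (ei j) (u k) x) := fun k j =>
    ((h.reg5 k).l2loc (by simp)).mul_continuousOn (continuousOn_inv_conormalWeight j)
  have hm : ∀ j, WD j (fun x => u i x * u j x) _ := fun j =>
    (hd i j).mul (hd j j) (ll i) (ld i j) (ll j) (ld j j)
  have e1 : ∀ j, _ := fun j => (hm j).eq ψ hψ
  simp_rw [e1, Finset.sum_neg_distrib]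
  rw [← integral_finsetSum _ fun j _ => (hm j).right.integrable_mul hψ]
  congr 1
  refine integral_congr_ae ?_
  have hD : (fun x => 1 / conormalWeight 2 x * Zd (ei 2) (u 2) x) =ᵐ[hsMeasure] D 2 :=
    (hd 2 2).unique (h.wd 2)
  filter_upwards [hD, h.div, ae_hs_of_forall fun x hx => hx] with x h1 h2 hx
  have w0 : conormalWeight 0 x = 1 := rfl
  have w1 : conormalWeight 1 x = 1 := rfl
  rw [← h1] at h2
  simp only [Fin.sum_univ_three, adv, transp, Matrix.cons_val_zero, Matrix.cons_val_one,
    Matrix.cons_val, wq, w0, w1, div_one, one_mul]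
  linear_combination (u i x * ψ x) * h2

end ConormalEuler

end

noncomputable section

namespace ConormalEuler

/-! ### The flux at a fixed time -/

variable {X M K N : ℝ≥0∞} {u D : Fin 3 → E3 → ℝ} {p B B' : ℝ≥0∞} {m n : ℕ} {f g : E3 → ℝ}
  {α β γ : Fin 3 → ℕ} {i : Fin 3}

lemma enorm_integral_mul_le_of (hf : AEStronglyMeasurable f hsMeasure)
    (hg : AEStronglyMeasurable g hsMeasure) (h : eLpNorm f 2 hsMeasure ≤ B) :
    ‖∫ x, f x * g x ∂hsMeasure‖ₑ ≤ B * eLpNorm g 2 hsMeasure :=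
  (enorm_integral_mul_le hf hg).trans (mul_le_mul' h le_rfl)

/-- A crude bound that spends the fifth derivative through `K`. It will only be paired with a
function that can be made small. -/
theorem exists_norm_transport_le : ∃ C : ℝ≥0, ∀ {X M K : ℝ≥0∞} {u D : Fin 3 → E3 → ℝ}
    {α : Fin 3 → ℕ} (i : Fin 3), Flow X M K u D → ord α ≤ 4 →
    MemLp (fun x => ∑ k, transp u k x * Zd (α + ei k) (u i) x) 2 hsMeasure ∧
    eLpNorm (fun x => ∑ k, transp u k x * Zd (α + ei k) (u i) x) 2 hsMeasure
      ≤ C * (M * K) := by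
  obtain ⟨C, hC⟩ := exists_zReg_wq
  refine ⟨3 * (1 + C), fun {X M K u D α} i h hα => ?_⟩
  have ht : ∀ k, eLpNorm (transp u k) ∞ hsMeasure ≤ (1 + C) * M := by
    intro k
    rw [add_mul, one_mul]
    fin_cases k
    · exact (h.reg_top 0).norm_self_le.trans le_self_add
    · exact (h.reg_top 1).norm_self_le.trans le_self_add
    · exact (hC h).2.1.norm_self_le.trans le_add_self
  have hz : ∀ k, MemLp (Zd (α + ei k) (u i)) 2 hsMeasure := fun k =>
    (h.reg5 i).memLp h.ne_top' (by simp; lia)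
  have hm : ∀ k, MemLp (fun x => transp u k x * Zd (α + ei k) (u i) x) 2 hsMeasure := fun k =>
    memLp_mul_top (hz k) (h.top_transp k)
  have hb : ∀ k, eLpNorm (fun x => transp u k x * Zd (α + ei k) (u i) x) 2 hsMeasure
      ≤ (1 + C) * M * K := fun k =>
    eLpNorm_mul_top_two_le (hz k).1 (ht k) ((h.reg5 i).norm_le (by simp; lia))
  refine ⟨memLp_finsetSum _ fun k _ => hm k, ?_⟩
  have e : (fun x => ∑ k, transp u k x * Zd (α + ei k) (u i) x)
      = ∑ k, fun x => transp u k x * Zd (α + ei k) (u i) x := by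
    funext x; simp
  rw [e]
  refine (eLpNorm_sum_le (fun k _ => (hm k).1) (by norm_num)).trans ?_
  refine (Finset.sum_le_sum fun k _ => hb k).trans (le_of_eq ?_)
  simp
  ring

/-- The transport term is orthogonal to `Z^α uᵢ`, so `2 Z^α uᵢ` may be subtracted from `ψ` at no
cost and `K` only multiplies the difference. The factor 2 is there because `ψ` will approximate a
sum of values at two nearby times. -/
theorem exists_convective_le : ∃ C : ℝ≥0, ∀ {X M K : ℝ≥0∞} {u D : Fin 3 → E3 → ℝ}
    {α : Fin 3 → ℕ} (i : Fin 3), Flow X M K u D → X ≠ ∞ → ord α ≤ 4 → ∀ ψ, IsTest ψ →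
    ‖∫ x, adv u i x * transposeIter conormalWeight α ψ x ∂hsMeasure‖ₑ
      ≤ C * (M * K) * eLpNorm (fun x => ψ x - 2 * Zd α (u i) x) 2 hsMeasure
        + C * (M * X) * eLpNorm ψ 2 hsMeasure := by
  obtain ⟨C, hC⟩ := exists_commutator
  obtain ⟨C', hC'⟩ := exists_norm_transport_le
  refine ⟨C + C', fun {X M K u D α} i h hX hα ψ hψ => ?_⟩
  obtain ⟨R, mR, bR, hR⟩ := hC i h hX hα
  obtain ⟨mT, bT⟩ := hC' i h hα
  have mz : MemLp (Zd α (u i)) 2 hsMeasure := (h.reg5 i).memLp h.ne_top' (by lia)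
  have h0 := h.integral_transp (v := Zd α (u i)) (v' := fun k => Zd (α + ei k) (u i)) mz
    (fun k => (h.reg5 i).memLp h.ne_top' (by simp; lia))
    (fun k => (h.reg5 i).zd_zd (by simp; lia))
  have lR : LocInt R := by
    have := hR.locallyIntegrable_deriv.add (mT.l2loc.neg.locInt)
    refine LocInt.congr this (Eventually.of_forall fun x => ?_)
    simp only [Pi.add_apply]; ring
  rw [(isWeakDeriv_iff.mp hR).2.2 ψ hψ]
  have e : ∫ x, (∑ k, transp u k x * Zd (α + ei k) (u i) x + R x) * ψ x ∂hsMeasure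
      = ∫ x, (∑ k, transp u k x * Zd (α + ei k) (u i) x) * (ψ x - 2 * Zd α (u i) x) ∂hsMeasure
        + ∫ x, R x * ψ x ∂hsMeasure := by
    have e1 : ∀ x, (∑ k, transp u k x * Zd (α + ei k) (u i) x + R x) * ψ x
        = (∑ k, transp u k x * Zd (α + ei k) (u i) x) * (ψ x - 2 * Zd α (u i) x)
          + 2 * ((∑ k, transp u k x * Zd (α + ei k) (u i) x) * Zd α (u i) x) + R x * ψ x :=
      fun x => by ring
    have i1 : Integrable (fun x => (∑ k, transp u k x * Zd (α + ei k) (u i) x)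
        * (ψ x - 2 * Zd α (u i) x)) hsMeasure :=
      memLp_two_mul mT (hψ.memLp.sub (mz.const_mul 2))
    have i12 : Integrable (fun x => (∑ k, transp u k x * Zd (α + ei k) (u i) x)
        * (ψ x - 2 * Zd α (u i) x)
          + 2 * ((∑ k, transp u k x * Zd (α + ei k) (u i) x) * Zd α (u i) x)) hsMeasure :=
      i1.add ((memLp_two_mul mT mz).const_mul 2)
    have i2 := (memLp_two_mul mT mz).const_mul 2
    have i3 := lR.integrable_mul hψ
    simp_rw [e1]
    rw [integral_add i12 i3, integral_add i1 i2, integral_const_mul, h0]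
    ring
  rw [e]
  refine (enorm_add_le _ _).trans (add_le_add ?_ ?_)
  · refine (enorm_integral_mul_le_of mT.1 (hψ.memLp.sub (mz.const_mul 2)).1 bT).trans ?_
    push_cast
    refine mul_le_mul' (mul_le_mul' le_add_self le_rfl) (le_of_eq rfl)
  · refine (enorm_integral_mul_le_of mR hψ.memLp.1 bR).trans ?_
    push_cast
    exact mul_le_mul' (mul_le_mul' le_self_add le_rfl) le_rfl

/-- Up to order 3 the derivatives are put back on the gradient. At order 4 one derivative is
missing, and `exists_pressure_pairing` trades it for the divergence of `ψ`. -/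
theorem exists_pressure_le : ∃ C : ℝ≥0, ∀ {N : ℝ≥0∞} {p : E3 → ℝ} {G : Fin 3 → E3 → ℝ}
    {α : Fin 3 → ℕ}, (∀ i, WD i p (G i)) → (∀ i, ZReg 2 3 N (G i)) → ord α ≤ 4 →
    ∀ ψ : Fin 3 → E3 → ℝ, (∀ i, IsTest (ψ i)) →
    ‖∑ i, ∫ x, G i x * transposeIter conormalWeight α (ψ i) x ∂hsMeasure‖ₑ
      ≤ C * N * (∑ i, eLpNorm (ψ i) 2 hsMeasure
        + eLpNorm (fun x => ∑ i, pd i (ψ i) x) 2 hsMeasure) := by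
  obtain ⟨C, hC⟩ := exists_pressure_pairing 3
  refine ⟨1 + C, fun {N p G α} h1 h2 hα ψ hψ => ?_⟩
  by_cases h4 : ord α = 4
  · obtain ⟨P, R, lP, lR, bP, bR, hPR⟩ := hC h1 h2 α h4
    rw [hPR ψ hψ]
    have hdiv : IsTest fun x => ∑ i, pd i (ψ i) x := IsTest.sum _ fun i _ => (hψ i).pd i
    refine (enorm_add_le _ _).trans ?_
    rw [enorm_neg, mul_add, add_comm (_ * ∑ i, _)]
    have hc : (C : ℝ≥0∞) * N ≤ ((1 + C : ℝ≥0) : ℝ≥0∞) * N := by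
      push_cast; exact mul_le_mul' le_add_self le_rfl
    refine add_le_add ?_ ?_
    · exact (enorm_integral_mul_le_of lP.aesm hdiv.memLp.1 bP).trans (mul_le_mul' hc le_rfl)
    · refine (enorm_integral_mul_le_of lR.aesm (hψ 2).memLp.1 bR).trans (mul_le_mul' hc ?_)
      exact Finset.single_le_sum (f := fun i => eLpNorm (ψ i) 2 hsMeasure) (fun _ _ => zero_le)
        (Finset.mem_univ 2)
  · refine (enorm_sum_le _ _).trans ?_
    rw [mul_add, Finset.mul_sum]
    refine le_trans (Finset.sum_le_sum fun i _ => ?_) le_self_add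
    rw [(isWeakDeriv_iff.mp ((h2 i).deriv (α := α) (by lia))).2.2 _ (hψ i)]
    refine (enorm_integral_mul_le_of ((h2 i).l2loc (by lia)).aesm (hψ i).memLp.1
      ((h2 i).norm_le (by lia))).trans ?_
    push_cast
    refine mul_le_mul' ?_ le_rfl
    rw [add_mul, one_mul]
    exact le_self_add

/-- The test field `∑_{|α| ≤ 4} T^α ψ_α`. -/
def testField (ψ : (Fin 3 → ℕ) → Fin 3 → E3 → ℝ) (i : Fin 3) (x : E3) : ℝ :=
  ∑ α ∈ multiIndices 4, transposeIter conormalWeight α (ψ α i) x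

lemma isTest_testField {ψ : (Fin 3 → ℕ) → Fin 3 → E3 → ℝ} (hψ : ∀ α i, IsTest (ψ α i))
    (i : Fin 3) : IsTest (testField ψ i) :=
  IsTest.sum _ fun α _ => (hψ α i).transposeIter goodWeight_conormal α

lemma mem_multiIndices {m : ℕ} {α : Fin 3 → ℕ} : α ∈ multiIndices m ↔ ord α ≤ m := by
  unfold multiIndices ord
  rw [Finset.mem_filter, and_iff_right_iff_imp, Fintype.mem_piFinset]
  intro h i
  rw [Finset.mem_range]
  have := Finset.single_le_sum (f := α) (fun _ _ => Nat.zero_le _) (Finset.mem_univ i)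
  lia

lemma integral_mul_testField {f : E3 → ℝ} (hf : LocInt f) {ψ : (Fin 3 → ℕ) → Fin 3 → E3 → ℝ}
    (hψ : ∀ α i, IsTest (ψ α i)) (i : Fin 3) :
    ∫ x, f x * testField ψ i x ∂hsMeasure = ∑ α ∈ multiIndices 4,
      ∫ x, f x * transposeIter conormalWeight α (ψ α i) x ∂hsMeasure := by
  simp only [testField, Finset.mul_sum]
  exact integral_finsetSum _ fun α _ =>
    hf.integrable_mul ((hψ α i).transposeIter goodWeight_conormal α)

/-- The spatial part of the weak momentum equation. -/
def flux (u : Fin 3 → E3 → ℝ) (q : E3 → ℝ) (Ψ : Fin 3 → E3 → ℝ) : ℝ :=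
  ∑ i, ∑ j, ∫ x, u i x * u j x * pd j (Ψ i) x ∂hsMeasure
    + ∑ i, ∫ x, q x * pd i (Ψ i) x ∂hsMeasure

theorem exists_flux_le : ∃ C : ℝ≥0, ∀ {X M K N : ℝ≥0∞} {u D : Fin 3 → E3 → ℝ}
    {q : E3 → ℝ} {G : Fin 3 → E3 → ℝ}, Flow X M K u D → X ≠ ∞ → (∀ i, WD i q (G i)) →
    (∀ i, ZReg 2 3 N (G i)) → ∀ ψ : (Fin 3 → ℕ) → Fin 3 → E3 → ℝ, (∀ α i, IsTest (ψ α i)) →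
    ‖flux u q (testField ψ)‖ₑ ≤ C * ∑ α ∈ multiIndices 4,
      (∑ i, (M * K * eLpNorm (fun x => ψ α i x - 2 * Zd α (u i) x) 2 hsMeasure
        + M * X * eLpNorm (ψ α i) 2 hsMeasure)
        + N * (∑ i, eLpNorm (ψ α i) 2 hsMeasure
          + eLpNorm (fun x => ∑ i, pd i (ψ α i) x) 2 hsMeasure)) := by
  obtain ⟨C, hC⟩ := exists_convective_le
  obtain ⟨C', hC'⟩ := exists_pressure_le
  refine ⟨C + C', fun {X M K N u D q G} h hX hG hGr ψ hψ => ?_⟩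
  have hΨ := isTest_testField hψ
  have lA : ∀ i, LocInt (adv u i) := fun i => by
    obtain ⟨Cc, hc⟩ := exists_commutator
    obtain ⟨R, -, -, hR⟩ := hc i h hX (α := 0) (by simp)
    exact hR.locallyIntegrable_fun
  have e : flux u q (testField ψ) = -∑ α ∈ multiIndices 4,
      (∑ i, ∫ x, adv u i x * transposeIter conormalWeight α (ψ α i) x ∂hsMeasure
        + ∑ i, ∫ x, G i x * transposeIter conormalWeight α (ψ α i) x ∂hsMeasure) := by
    unfold flux
    simp_rw [h.integral_convective _ (hΨ _), (hG _).eq _ (hΨ _), integral_mul_testField (lA _) hψ,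
      integral_mul_testField (hG _).right hψ, Finset.sum_neg_distrib, Finset.sum_add_distrib]
    rw [Finset.sum_comm, Finset.sum_comm (s := Finset.univ), neg_add]
  rw [e, enorm_neg, Finset.mul_sum]
  refine (enorm_sum_le _ _).trans (Finset.sum_le_sum fun α hα => ?_)
  have hα4 := mem_multiIndices.mp hα
  refine (enorm_add_le _ _).trans ?_
  rw [mul_add]
  push_cast
  refine add_le_add ?_ ?_
  · refine (enorm_sum_le _ _).trans ?_
    rw [Finset.mul_sum]
    refine Finset.sum_le_sum fun i _ => (hC i h hX hα4 _ (hψ α i)).trans ?_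
    rw [mul_assoc (C : ℝ≥0∞) (M * K), mul_assoc (C : ℝ≥0∞) (M * X), ← mul_add]
    exact mul_le_mul' le_self_add le_rfl
  · refine (hC' hG hGr hα4 _ (hψ α)).trans ?_
    rw [mul_assoc]
    exact mul_le_mul' le_add_self le_rfl

end ConormalEuler

end

noncomputable section

namespace ConormalEuler

/-! ### Vector fields and their components -/

variable {w : Fin 3 → E3 → ℝ} {α : Fin 3 → ℕ} {m : ℕ} {q B : ℝ≥0∞}

lemma locallyIntegrableOn_vec_iff {f : E3 → E3} :
    LocallyIntegrableOn f (halfSpace : Set E3) ↔ ∀ i, LocInt (fun x => f x i) := by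
  have hlc : IsLocallyClosed (halfSpace : Set E3) := isOpen_hs.isLocallyClosed
  constructor
  · intro h i
    refine locInt_of_forall_compact fun K hK hKs => ?_
    exact integrable_piLp_iff.mp ((locallyIntegrableOn_iff hlc).mp h K hKs hK) i
  · intro h
    refine (locallyIntegrableOn_iff hlc).mpr fun K hKs hK => ?_
    exact integrable_piLp_iff.mpr fun i => (h i).integrableOn hK hKs

lemma isWeakDeriv_vec_iff (hw : GoodWeight w) {f g : E3 → E3} :
    IsWeakDeriv w α f g ↔ ∀ i, IsWeakDeriv w α (fun x => f x i) (fun x => g x i) := by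
  have key : ∀ {f : E3 → E3}, LocallyIntegrableOn f (halfSpace : Set E3) → ∀ {χ : E3 → ℝ},
      IsTest χ → ∀ i, (∫ x, χ x • f x ∂hsMeasure) i = ∫ x, f x i * χ x ∂hsMeasure := by
    intro f hf χ hχ i
    have h := locallyIntegrableOn_vec_iff.mp hf
    rw [eval_integral_piLp fun j => ?_]
    · refine integral_congr_ae (Eventually.of_forall fun x => ?_)
      simp [mul_comm]
    · refine ((h j).integrable_mul hχ).congr (Eventually.of_forall fun x => ?_)
      simp [mul_comm]
  constructor
  · rintro ⟨h1, h2, h3⟩ i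
    refine isWeakDeriv_iff.mpr ⟨locallyIntegrableOn_vec_iff.mp h1 i,
      locallyIntegrableOn_vec_iff.mp h2 i, fun ψ hψ => ?_⟩
    rw [← key h1 (hψ.transposeIter hw α), ← key h2 hψ]
    exact congrArg (fun v : E3 => v i) (h3 hψ.toTestFunction)
  · intro h
    have h1 := locallyIntegrableOn_vec_iff.mpr fun i => (h i).locallyIntegrable_fun
    have h2 := locallyIntegrableOn_vec_iff.mpr fun i => (h i).locallyIntegrable_deriv
    refine ⟨h1, h2, fun ψ => ?_⟩
    have hψ := isTest_coe ψ
    ext i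
    rw [key h1 (hψ.transposeIter hw α), key h2 hψ]
    exact (isWeakDeriv_iff.mp (h i)).2.2 ψ hψ

lemma weakDerivNorm_eq (hw : GoodWeight w) {f g : E3 → E3} (h : IsWeakDeriv w α f g) :
    weakDerivNorm w q α f = eLpNorm g q hsMeasure := by
  refine le_antisymm (iInf₂_le g h) (le_iInf₂ fun g' h' => le_of_eq (eLpNorm_congr_ae ?_))
  have := ae_all_iff.mpr fun i =>
    ((isWeakDeriv_vec_iff hw).mp h i).unique ((isWeakDeriv_vec_iff hw).mp h' i)
  filter_upwards [this] with x hx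
  ext i
  exact hx i

lemma eLpNorm_component_le (g : E3 → E3) (i : Fin 3) :
    eLpNorm (fun x => g x i) q hsMeasure ≤ eLpNorm g q hsMeasure :=
  eLpNorm_mono fun x => PiLp.norm_apply_le (g x) i

lemma eLpNorm_vec_two_sq {g : E3 → E3} (hg : ∀ i, AEStronglyMeasurable (fun x => g x i) hsMeasure) :
    eLpNorm g 2 hsMeasure ^ 2 = ∑ i, eLpNorm (fun x => g x i) 2 hsMeasure ^ 2 := by
  simp_rw [eLpNorm_two_sq]
  rw [← lintegral_finsetSum' _ fun i _ => (hg i).enorm.pow_const 2]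
  refine lintegral_congr fun x => ?_
  have e : ∀ r : E3, ‖r‖ₑ ^ 2 = ENNReal.ofReal (‖r‖ ^ 2) := fun r => by
    rw [ENNReal.ofReal_pow (norm_nonneg _), ofReal_norm]
  have e' : ∀ r : ℝ, ‖r‖ₑ ^ 2 = ENNReal.ofReal (‖r‖ ^ 2) := fun r => by
    rw [ENNReal.ofReal_pow (norm_nonneg _), ofReal_norm]
  simp_rw [e, e']
  rw [EuclideanSpace.norm_sq_eq, ENNReal.ofReal_sum_of_nonneg fun i _ => sq_nonneg _]

lemma exists_of_weakDerivNorm_lt (hw : GoodWeight w) {f : E3 → E3}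
    (h : weakDerivNorm w q α f < ∞) :
    ∃ g, IsWeakDeriv w α f g ∧ eLpNorm g q hsMeasure = weakDerivNorm w q α f := by
  obtain ⟨g, hg⟩ := iInf_lt_iff.mp h
  obtain ⟨hg, -⟩ := iInf_lt_iff.mp hg
  exact ⟨g, hg, (weakDerivNorm_eq hw hg).symm⟩

lemma l2Norm_sq {f : E3 → E3} :
    l2Norm w m f ^ 2 = ∑ α ∈ multiIndices m, weakDerivNorm w 2 α f ^ 2 := by
  unfold l2Norm
  rw [← ENNReal.rpow_natCast, ← ENNReal.rpow_mul]
  norm_num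

lemma weakDerivNorm_le_l2Norm {f : E3 → E3} (hα : ord α ≤ m) :
    weakDerivNorm w 2 α f ≤ l2Norm w m f := by
  apply le_of_sq_le_sq
  rw [l2Norm_sq]
  exact Finset.single_le_sum (f := fun α => weakDerivNorm w 2 α f ^ 2) (fun _ _ => zero_le)
    (mem_multiIndices.mpr hα)

lemma weakDerivNorm_le_lInftyNorm {f : E3 → E3} (hα : ord α ≤ m) :
    weakDerivNorm w ∞ α f ≤ lInftyNorm w m f :=
  Finset.single_le_sum (f := fun α => weakDerivNorm w ∞ α f) (fun _ _ => zero_le)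
    (mem_multiIndices.mpr hα)

lemma exists_component_deriv (hw : GoodWeight w) {f : E3 → E3}
    (h : weakDerivNorm w q α f ≤ B) (hB : B < ∞) : ∃ g : E3 → E3, ∀ i,
      IsWeakDeriv w α (fun x => f x i) (fun x => g x i) ∧
        MemLp (fun x => g x i) q hsMeasure ∧ eLpNorm (fun x => g x i) q hsMeasure ≤ B := by
  obtain ⟨g, hg, hg'⟩ := exists_of_weakDerivNorm_lt hw (h.trans_lt hB)
  refine ⟨g, fun i => ?_⟩
  have hi := (isWeakDeriv_vec_iff hw).mp hg i
  have hb : eLpNorm (fun x => g x i) q hsMeasure ≤ B :=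
    (eLpNorm_component_le g i).trans (hg'.trans_le h)
  exact ⟨hi, ⟨hi.aesm, hb.trans_lt hB⟩, hb⟩

lemma zReg_top_of_conormalInftyNorm {f : E3 → E3} (h : conormalInftyNorm m f ≤ B) (hB : B < ∞)
    (i : Fin 3) : ZReg ∞ m B (fun x => f x i) := fun α hα => by
  obtain ⟨g, hg⟩ := exists_component_deriv goodWeight_conormal
    ((weakDerivNorm_le_lInftyNorm hα).trans h) hB
  exact ⟨_, (hg i).1, l2loc_of_top (hg i).2.1, (hg i).2.2⟩

lemma zReg_of_conormalNorm {f : E3 → E3} (h : conormalNorm m f ≤ B) (hB : B < ∞)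
    (i : Fin 3) : ZReg 2 m B (fun x => f x i) := fun α hα => by
  obtain ⟨g, hg⟩ := exists_component_deriv goodWeight_conormal
    ((weakDerivNorm_le_l2Norm hα).trans h) hB
  exact ⟨_, (hg i).1, (hg i).2.1.l2loc, (hg i).2.2⟩

lemma conormalNorm_sq {f : E3 → E3} (h : ∀ i, ZReg 2 m B (fun x => f x i)) :
    conormalNorm m f ^ 2
      = ∑ α ∈ multiIndices m, ∑ i, eLpNorm (Zd α (fun x => f x i)) 2 hsMeasure ^ 2 := by
  unfold conormalNorm
  rw [l2Norm_sq]
  refine Finset.sum_congr rfl fun α hα => ?_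
  have hα' := mem_multiIndices.mp hα
  have hd : IsWeakDeriv conormalWeight α f
      (fun x => WithLp.toLp 2 fun i => Zd α (fun x => f x i) x) :=
    (isWeakDeriv_vec_iff goodWeight_conormal).mpr fun i => (h i).deriv hα'
  rw [weakDerivNorm_eq goodWeight_conormal hd, eLpNorm_vec_two_sq fun i =>
    ((h i).deriv hα').aesm]

lemma norm_zd_le_conormalNorm {f : E3 → E3} (h : ∀ i, ZReg 2 m B (fun x => f x i))
    (hα : ord α ≤ m) (i : Fin 3) :
    eLpNorm (Zd α (fun x => f x i)) 2 hsMeasure ≤ conormalNorm m f := by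
  apply le_of_sq_le_sq
  rw [conormalNorm_sq h]
  refine le_trans ?_ (Finset.single_le_sum
    (f := fun α => ∑ i, eLpNorm (Zd α (fun x => f x i)) 2 hsMeasure ^ 2) (fun _ _ => zero_le)
    (mem_multiIndices.mpr hα))
  exact Finset.single_le_sum (f := fun i => eLpNorm (Zd α (fun x => f x i)) 2 hsMeasure ^ 2)
    (fun _ _ => zero_le) (Finset.mem_univ i)

lemma hReg_of_forall : ∀ {m : ℕ} {f : E3 → ℝ}, (∀ α, ord α ≤ m → ∃ g,
    IsWeakDeriv euclideanWeight α f g ∧ MemLp g 2 hsMeasure ∧ eLpNorm g 2 hsMeasure ≤ B) →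
    HReg m B f := by
  have base : ∀ {m : ℕ} {f : E3 → ℝ}, (∀ α, ord α ≤ m → ∃ g,
      IsWeakDeriv euclideanWeight α f g ∧ MemLp g 2 hsMeasure ∧ eLpNorm g 2 hsMeasure ≤ B) →
      MemLp f 2 hsMeasure ∧ eLpNorm f 2 hsMeasure ≤ B := by
    intro m f h
    obtain ⟨g, h1, h2, h3⟩ := h 0 (by simp)
    have e : f =ᵐ[hsMeasure] g := (IsWeakDeriv.refl h1.locallyIntegrable_fun).unique h1
    exact ⟨h2.ae_eq e.symm, (eLpNorm_congr_ae e).trans_le h3⟩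
  intro m
  induction m with
  | zero => exact fun h => base h
  | succ m ih =>
    refine fun {f} h => ⟨base h, fun i => ?_⟩
    obtain ⟨g, h1, -⟩ := h (Pi.single i 1) (by simp)
    refine ⟨g, WD.comm_euclidean.mpr h1, ih fun α hα => ?_⟩
    obtain ⟨g', k1, k2⟩ := h (Pi.single i 1 + α) (by simp; lia)
    exact ⟨g', h1.of_comp goodWeight_euclidean k1, k2⟩

lemma hReg_of_sobolevNorm {f : E3 → E3} (h : sobolevNorm m f ≤ B) (hB : B < ∞)
    (i : Fin 3) : HReg m B (fun x => f x i) := hReg_of_forall fun α hα => by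
  obtain ⟨g, hg⟩ := exists_component_deriv goodWeight_euclidean
    ((weakDerivNorm_le_l2Norm hα).trans h) hB
  exact ⟨_, hg i⟩

lemma top_of_sobolevInftyNorm {f : E3 → E3} (h : sobolevInftyNorm 1 f ≤ B) (hB : B < ∞)
    {g : E3 → ℝ} {i j : Fin 3} (hg : WD j (fun x => f x i) g) : eLpNorm g ∞ hsMeasure ≤ B := by
  obtain ⟨g', hg'⟩ := exists_component_deriv goodWeight_euclidean
    ((weakDerivNorm_le_lInftyNorm (α := ei j) (by simp)).trans h) hB
  rw [eLpNorm_congr_ae (hg.unique (WD.comm_euclidean.mpr (hg' i).1))]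
  exact (hg' i).2.2

/-- Stated with strict inequality because the norm is an infimum over weak gradients. -/
lemma exists_gradient {p : E3 → ℝ} (h : gradConormalNorm m p < B) :
    ∃ G : Fin 3 → E3 → ℝ, (∀ i, WD i p (G i)) ∧ ∀ i, ZReg 2 m B (G i) := by
  obtain ⟨G, hG⟩ := iInf_lt_iff.mp h
  obtain ⟨hG, hb⟩ := iInf_lt_iff.mp hG
  exact ⟨fun i x => G x i, fun i => WD.comm_euclidean.mpr (hG i), fun i =>
    (zReg_of_conormalNorm le_rfl (hb.trans_le le_top) i).mono le_rfl hb.le⟩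

/-! ### The flow at a fixed time -/

theorem HReg.deriv_zd : ∀ {n m : ℕ} {f : E3 → ℝ} {α : Fin 3 → ℕ}, B < ∞ → HReg (n + m) B f →
    ord α = n → ∃ B' < ∞, HReg m B' (Zd α f) := by
  have hcongr : ∀ {m : ℕ} {B : ℝ≥0∞} {f g : E3 → ℝ}, HReg m B f → f =ᵐ[hsMeasure] g →
      HReg m B g := by
    intro m B f g hf hfg
    cases m with
    | zero => exact ⟨hf.1.ae_eq hfg, (eLpNorm_congr_ae hfg).symm.trans_le hf.2⟩
    | succ m =>
      refine ⟨⟨hf.1.1.ae_eq hfg, (eLpNorm_congr_ae hfg).symm.trans_le hf.1.2⟩, fun i => ?_⟩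
      obtain ⟨g', h1, h2⟩ := hf.2 i
      exact ⟨g', h1.congr hfg EventuallyEq.rfl, h2⟩
  intro n
  induction n generalizing B with
  | zero =>
    intro m f α hB hf hα
    rw [ord_eq_zero hα]
    rw [zero_add] at hf
    exact ⟨B, hB, hcongr hf (Zd_zero hf.base.1.l2loc.locInt).symm⟩
  | succ n ih =>
    intro m f α hB hf hα
    obtain ⟨β, i, rfl, hβ⟩ := exists_single_add hα
    obtain ⟨C0, hC0⟩ := HReg.zReg (n + 1 + m)
    have hz := hC0 hf
    rw [show n + 1 + m = (n + m) + 1 by ring] at hf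
    obtain ⟨g, h1, h2⟩ := hf.2 i
    obtain ⟨C, hC⟩ := HReg.polyQ_mul (n + m) (if i = 2 then 1 - Polynomial.X else 1)
    have e : (fun x => polyQ (if i = 2 then 1 - Polynomial.X else 1) x * g x)
        =ᵐ[hsMeasure] Zd (ei i) f := by
      refine EventuallyEq.trans (ae_hs_of_forall fun x hx => ?_) h1.conormal.zd_ae.symm
      simp only [conormalWeight_eq i hx]
    obtain ⟨B', hB', h3⟩ := ih (ENNReal.mul_lt_top (by simp) hB) (hcongr (hC h2) e) hβ
    exact ⟨B', hB', hcongr h3 (hz.zd_zd_ae (by simp; lia))⟩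

end ConormalEuler

end

noncomputable section

namespace ConormalEuler

/-! ### Solutions at a fixed time -/

/-- The components of a time-dependent vector field. -/
abbrev comp (u : ℝ → E3 → E3) (t : ℝ) (i : Fin 3) : E3 → ℝ := fun x => u t x i

variable {T : ℝ} {u : ℝ → E3 → E3} {p : ℝ → E3 → ℝ} {t : ℝ}

lemma fderiv_apply_eq_sum {ψ : E3 → ℝ} {x : E3} (v : E3) :
    fderiv ℝ ψ x v = ∑ j, v j * pd j ψ x := by
  have e : v = ∑ j, v j • basisVec j := by
    ext k
    simp [basisVec_apply]
  conv_lhs => rw [e]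
  rw [map_sum]
  simp [pd]

lemma IsEulerSolution.hReg (h : IsEulerSolution T u p) (ht : t ∈ Icc 0 T) (i : Fin 3) :
    HReg 5 (sobolevNorm 5 (u t)) (comp u t i) :=
  hReg_of_sobolevNorm le_rfl (h.regular.1 t ht) i

lemma IsEulerSolution.div_eq_zero (h : IsEulerSolution T u p) (ht : t ∈ Ioo 0 T)
    {d : Fin 3 → E3 → ℝ} (hd : ∀ j, WD j (comp u t j) (d j)) :
    (fun x => ∑ j, d j x) =ᵐ[hsMeasure] fun _ => 0 := by
  refine ae_eq_of_forall_test ?_ ?_ fun ψ hψ => ?_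
  · have := ((hd 0).right.add (hd 1).right).add (hd 2).right
    exact this.congr (Eventually.of_forall fun x => by simp [Fin.sum_univ_three])
  · exact locInt_of_forall_compact fun K _ _ => integrableOn_zero
  · have h1 := h.incompressible t ht hψ.toTestFunction
    simp only [hψ.coe_toTestFunction, fderiv_apply_eq_sum] at h1
    rw [integral_finsetSum _ fun j _ => (hd j).left.integrable_mul (hψ.pd j)] at h1
    simp_rw [fun j => (hd j).eq ψ hψ, Finset.sum_neg_distrib] at h1
    simp_rw [Finset.sum_mul, zero_mul, integral_zero]
    rw [integral_finsetSum _ fun j _ => (hd j).right.integrable_mul hψ]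
    linarith

/-- Continuity up to the boundary and the slip condition provide the zero trace of `u₃`; the
Lipschitz and the conormal sup norm are merged into the single bound `M`. -/
theorem IsEulerSolution.exists_flow (h : IsEulerSolution T u p) (ht : t ∈ Ioo 0 T) {K : ℝ≥0∞}
    (hK : K < ∞) (hr : ∀ i, ZReg 2 5 K (comp u t i))
    (hM : sobolevInftyNorm 1 (u t) + conormalInftyNorm 2 (u t) < ∞) :
    ∃ D, Flow (conormalNorm 4 (u t)) (sobolevInftyNorm 1 (u t) + conormalInftyNorm 2 (u t)) K
      (comp u t) D := by
  have ht' := Ioo_subset_Icc_self ht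
  have hd : ∀ i j, ∃ g, WD j (comp u t i) g ∧ HReg 4 (sobolevNorm 5 (u t)) g := fun i j =>
    (h.hReg ht' i).2 j
  choose d hd1 hd2 using hd
  have r4 : ∀ i, ZReg 2 4 K (comp u t i) := fun i => (hr i).mono (by lia) le_rfl
  have hw : ∀ j, j ≠ 2 → d j j =ᵐ[hsMeasure] Zd (ei j) (comp u t j) := fun j hj => by
    refine EventuallyEq.trans (ae_hs_of_forall fun x hx => ?_) (hd1 j j).conormal.zd_ae.symm
    simp [conormalWeight_eq j hx, hj, polyQ]
  refine ⟨fun i => d i 2, ?_, hr, ?_, fun i => hd1 i 2, fun i => (hd2 i 2).base.1, fun i => ?_,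
    ?_, ?_, hM.ne, hK.ne⟩
  · intro i α hα
    exact ⟨_, (hr i).deriv (by lia), (hr i).l2loc (by lia), norm_zd_le_conormalNorm r4 hα i⟩
  · intro i
    exact zReg_top_of_conormalInftyNorm le_add_self hM i
  · exact (top_of_sobolevInftyNorm le_rfl (le_self_add.trans_lt hM) (hd1 i 2)).trans le_self_add
  · filter_upwards [h.div_eq_zero ht fun j => hd1 j j, hw 0 (by decide), hw 1 (by decide)]
      with x h1 h2 h3
    rw [← h2, ← h3]
    rw [Fin.sum_univ_three] at h1
    linarith
  · refine (hd1 2 2).wd0_of_continuousOn (h.hReg ht' 2).base.1 (hd2 2 2).base.1 ?_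
      fun x hx => h.slip t ht x hx
    exact (EuclideanSpace.proj (2 : Fin 3) : E3 →L[ℝ] ℝ).continuous.comp_continuousOn
      (h.continuousOn t ht')

/-! ### Uniform bounds and continuity in time -/

/-- Continuity into `H⁵` bounds `u` near each time, where `u s - u t` has norm below 1; compactness
of `[0, T]` makes the bound uniform. -/
lemma IsEulerSolution.exists_bound (h : IsEulerSolution T u p) :
    ∃ K : ℝ≥0, ∀ t ∈ Icc 0 T, ∀ i, ZReg 2 5 K (comp u t i) := by
  obtain ⟨C, hC⟩ := HReg.zReg 5
  have hloc : ∀ t ∈ Icc 0 T, ∃ U ∈ 𝓝[Icc 0 T] t, ∃ K : ℝ≥0, ∀ s ∈ U, s ∈ Icc 0 T → ∀ i,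
      ZReg 2 5 K (comp u s i) := by
    intro t ht
    refine ⟨_, (h.regular.2 t ht).eventually_lt_const one_pos, C * (1 + (sobolevNorm 5 (u t)).toNNReal),
      fun s hs hsT i => ?_⟩
    have h1 := hReg_of_sobolevNorm (le_of_lt hs) (by simp) i
    have h2 := h.hReg ht i
    have h3 := hC (h1.add h2)
    push_cast
    rw [ENNReal.coe_toNNReal (h.regular.1 t ht).ne]
    refine h3.congr (Eventually.of_forall fun x => ?_)
    simp [comp]
  choose! U hU K hK using hloc
  obtain ⟨S, hS, hcov⟩ := isCompact_Icc.elim_nhdsWithin_subcover U hU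
  refine ⟨∑ t ∈ S, K t, fun s hs i => ?_⟩
  obtain ⟨t, htS, hst⟩ := mem_iUnion₂.mp (hcov hs)
  refine (hK t (hS t htS) s hst hs i).mono le_rfl (ENNReal.coe_le_coe.mpr ?_)
  exact Finset.single_le_sum (f := K) (fun _ _ => zero_le) htS

lemma IsEulerSolution.tendsto_zd (h : IsEulerSolution T u p) (ht : t ∈ Icc 0 T) {ε : ℝ≥0∞}
    (hε : 0 < ε) : ∀ᶠ s in 𝓝[Icc 0 T] t, ∀ i, ∀ α, ord α ≤ 5 →
      eLpNorm (fun x => Zd α (comp u s i) x - Zd α (comp u t i) x) 2 hsMeasure < ε := by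
  obtain ⟨C, hC⟩ := HReg.zReg 5
  have h1 : Tendsto (fun s => (C : ℝ≥0∞) * sobolevNorm 5 (u s - u t)) (𝓝[Icc 0 T] t) (𝓝 0) := by
    have := ENNReal.Tendsto.const_mul (a := (C : ℝ≥0∞)) (h.regular.2 t ht) (Or.inr (by simp))
    simpa using this
  filter_upwards [h1.eventually_lt_const hε, self_mem_nhdsWithin,
    (h.regular.2 t ht).eventually_lt_const one_pos] with s hs hsT hs1 i α hα
  have z1 := hC (hReg_of_sobolevNorm (le_refl (sobolevNorm 5 (u s - u t)))
    (hs1.trans (by simp)) i)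
  have z2 := hC (h.hReg hsT i)
  have z3 := hC (h.hReg ht i)
  have e := ((z2.deriv hα).sub goodWeight_conormal (z3.deriv hα)).zd_ae
  rw [← eLpNorm_congr_ae e]
  exact (z1.norm_le hα).trans_lt hs

lemma eLpNorm_sub_le_of {X : Type*} [MeasurableSpace X] {μ : Measure X} {f g h : X → ℝ}
    (hf : AEStronglyMeasurable f μ) (hg : AEStronglyMeasurable g μ)
    (hh : AEStronglyMeasurable h μ) : eLpNorm (fun x => f x - h x) 2 μ
      ≤ eLpNorm (fun x => f x - g x) 2 μ + eLpNorm (fun x => g x - h x) 2 μ := by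
  have e : (fun x => f x - h x) = (fun x => f x - g x) + fun x => g x - h x := by
    funext x; simp
  rw [e]
  exact eLpNorm_add_le (hf.sub hg) (hg.sub hh) (by norm_num)

lemma eLpNorm_sub_comm_two {X : Type*} [MeasurableSpace X] {μ : Measure X} (f g : X → ℝ) :
    eLpNorm (fun x => f x - g x) 2 μ = eLpNorm (fun x => g x - f x) 2 μ :=
  eLpNorm_sub_comm f g 2 μ

/-- Heine's theorem on `[0, T]`, by way of a Lebesgue number. -/
theorem IsEulerSolution.exists_modulus (h : IsEulerSolution T u p) {ε : ℝ≥0∞} (hε : 0 < ε) :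
    ∃ δ > 0, ∀ s ∈ Icc 0 T, ∀ t ∈ Icc 0 T, |s - t| < δ → ∀ i, ∀ α, ord α ≤ 5 →
      eLpNorm (fun x => Zd α (comp u s i) x - Zd α (comp u t i) x) 2 hsMeasure ≤ ε := by
  obtain ⟨K, hK⟩ := h.exists_bound
  have hε2 : 0 < ε / 2 := ENNReal.div_pos hε.ne' (by norm_num)
  have hloc : ∀ t ∈ Icc 0 T, ∃ r > 0, ∀ s ∈ Icc 0 T, |s - t| < r → ∀ i, ∀ α, ord α ≤ 5 →
      eLpNorm (fun x => Zd α (comp u s i) x - Zd α (comp u t i) x) 2 hsMeasure < ε / 2 := by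
    intro t ht
    obtain ⟨r, hr, hsub⟩ := Metric.mem_nhdsWithin_iff.mp (h.tendsto_zd ht hε2)
    exact ⟨r, hr, fun s hs hst => hsub ⟨by simpa [Real.dist_eq] using hst, hs⟩⟩
  choose! r hr hrb using hloc
  obtain ⟨δ, hδ, hb⟩ := lebesgue_number_lemma_of_metric (s := Icc 0 T)
    (c := fun t : Icc (0 : ℝ) T => Metric.ball (t : ℝ) (r t)) isCompact_Icc
    (fun _ => Metric.isOpen_ball)
    (fun t ht => mem_iUnion.mpr ⟨⟨t, ht⟩, Metric.mem_ball_self (hr t ht)⟩)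
  refine ⟨δ, hδ, fun s hs t ht hst i α hα => ?_⟩
  obtain ⟨⟨t0, ht0⟩, hb⟩ := hb t ht
  have m : ∀ {s}, s ∈ Icc 0 T → AEStronglyMeasurable (Zd α (comp u s i)) hsMeasure := fun hs =>
    ((hK _ hs i).deriv hα).aesm
  have e1 := hrb t0 ht0 s hs (by
    have := hb (show s ∈ Metric.ball t δ by simpa [Real.dist_eq] using hst)
    simpa [Real.dist_eq] using this) i α hα
  have e2 := hrb t0 ht0 t ht (by
    have := hb (Metric.mem_ball_self hδ)
    simpa [Real.dist_eq] using this) i α hα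
  refine (eLpNorm_sub_le_of (m hs) (m ht0) (m ht)).trans ?_
  rw [eLpNorm_sub_comm_two (Zd α (comp u t0 i))]
  exact (add_le_add e1.le e2.le).trans (ENNReal.add_halves ε).le

/-- The squared conormal norm `‖u(t)‖₄²`, as a real number. -/
def energy (u : ℝ → E3 → E3) (t : ℝ) : ℝ :=
  ∑ α ∈ multiIndices 4, ∑ i, ∫ x, Zd α (comp u t i) x ^ 2 ∂hsMeasure

lemma energy_nonneg (u : ℝ → E3 → E3) (t : ℝ) : 0 ≤ energy u t :=
  Finset.sum_nonneg fun _ _ => Finset.sum_nonneg fun _ _ => integral_nonneg fun _ => sq_nonneg _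

lemma IsEulerSolution.memLp_zd (h : IsEulerSolution T u p) (ht : t ∈ Icc 0 T) {α : Fin 3 → ℕ}
    (hα : ord α ≤ 5) (i : Fin 3) : MemLp (Zd α (comp u t i)) 2 hsMeasure := by
  obtain ⟨K, hK⟩ := h.exists_bound
  exact (hK t ht i).memLp (by simp) hα

lemma IsEulerSolution.conormalNorm_sq (h : IsEulerSolution T u p) (ht : t ∈ Icc 0 T) :
    conormalNorm 4 (u t) ^ 2 = ENNReal.ofReal (energy u t) := by
  obtain ⟨K, hK⟩ := h.exists_bound
  rw [ConormalEuler.conormalNorm_sq (B := K) fun i => (hK t ht i).mono (by lia) le_rfl, energy,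
    ENNReal.ofReal_sum_of_nonneg fun _ _ => Finset.sum_nonneg fun _ _ =>
      integral_nonneg fun _ => sq_nonneg _]
  refine Finset.sum_congr rfl fun α hα => ?_
  rw [ENNReal.ofReal_sum_of_nonneg fun _ _ => integral_nonneg fun _ => sq_nonneg _]
  refine Finset.sum_congr rfl fun i _ => ?_
  have hm := h.memLp_zd ht (α := α) (by have := mem_multiIndices.mp hα; lia) i
  rw [← enorm_integral_sq hm, Real.enorm_eq_ofReal (integral_nonneg fun x => sq_nonneg _)]

lemma integral_sq_sub_sq {f g : E3 → ℝ} (hf : MemLp f 2 hsMeasure) (hg : MemLp g 2 hsMeasure) :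
    ∫ x, f x ^ 2 ∂hsMeasure - ∫ x, g x ^ 2 ∂hsMeasure
      = ∫ x, (f x - g x) * (f x + g x) ∂hsMeasure := by
  rw [← integral_sub hf.integrable_sq hg.integrable_sq]
  refine integral_congr_ae (Eventually.of_forall fun x => ?_)
  simp only; ring

theorem IsEulerSolution.continuousOn_energy (h : IsEulerSolution T u p) :
    ContinuousOn (energy u) (Icc 0 T) := by
  obtain ⟨K, hK⟩ := h.exists_bound
  refine continuousOn_finsetSum _ fun α hα => continuousOn_finsetSum _ fun i _ => ?_
  have hα5 : ord α ≤ 5 := by have := mem_multiIndices.mp hα; lia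
  intro t ht
  have hm : ∀ s ∈ Icc 0 T, MemLp (Zd α (comp u s i)) 2 hsMeasure := fun s hs => h.memLp_zd hs hα5 i
  refine EMetric.tendsto_nhds.mpr fun ε hε => ?_
  obtain ⟨ε', hε0, hεε⟩ := exists_between hε
  refine Eventually.mono ?_ fun s hs => lt_of_le_of_lt hs hεε
  have hε' : 0 < ε' / (2 * (K + 1)) := ENNReal.div_pos hε0.ne' (ENNReal.mul_ne_top (by simp) (by simp))
  filter_upwards [h.tendsto_zd ht hε', self_mem_nhdsWithin] with s hs hsT
  rw [edist_eq_enorm_sub, integral_sq_sub_sq (hm s hsT) (hm t ht)]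
  refine (enorm_integral_mul_le ((hm s hsT).sub (hm t ht)).1 ((hm s hsT).add (hm t ht)).1).trans ?_
  calc _ ≤ ε' / (2 * (K + 1)) * (K + K) := by
        refine mul_le_mul' (hs i α hα5).le ?_
        exact (eLpNorm_add_le (hm s hsT).1 (hm t ht).1 (by norm_num)).trans
          (add_le_add ((hK s hsT i).norm_le hα5) ((hK t ht i).norm_le hα5))
    _ ≤ ε' / (2 * (K + 1)) * (2 * (K + 1)) := by
        refine mul_le_mul' le_rfl ?_
        rw [← two_mul]
        exact mul_le_mul' le_rfl le_self_add
    _ = ε' := ENNReal.div_mul_cancel (by simp) (ENNReal.mul_ne_top (by simp) (by simp))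

end ConormalEuler

end

noncomputable section

namespace ConormalEuler

/-! ### Joint measurability -/

variable {T : ℝ} {u : ℝ → E3 → E3} {p : ℝ → E3 → ℝ} {t c d : ℝ}

lemma IsEulerSolution.tendsto_comp (h : IsEulerSolution T u p) (ht : t ∈ Icc 0 T) {ε : ℝ≥0∞}
    (hε : 0 < ε) : ∀ᶠ s in 𝓝[Icc 0 T] t, ∀ i,
      eLpNorm (fun x => comp u s i x - comp u t i x) 2 hsMeasure < ε := by
  filter_upwards [h.tendsto_zd ht hε, self_mem_nhdsWithin] with s hs hsT i
  refine lt_of_le_of_lt (le_of_eq (eLpNorm_congr_ae ?_)) (hs i 0 (by simp))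
  filter_upwards [Zd_zero (h.hReg hsT i).base.1.l2loc.locInt,
    Zd_zero (h.hReg ht i).base.1.l2loc.locInt] with x h1 h2
  rw [h1, h2]

lemma IsEulerSolution.memLp_comp (h : IsEulerSolution T u p) (ht : t ∈ Icc 0 T) (i : Fin 3) :
    MemLp (comp u t i) 2 hsMeasure := (h.hReg ht i).base.1

/-- Pairings with a fixed `L²` function are continuous in time. -/
lemma IsEulerSolution.continuousOn_pairing (h : IsEulerSolution T u p) (i : Fin 3) {g : E3 → ℝ}
    (hg : MemLp g 2 hsMeasure) :
    ContinuousOn (fun t => ∫ x, comp u t i x * g x ∂hsMeasure) (Icc 0 T) := by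
  intro t ht
  refine EMetric.tendsto_nhds.mpr fun ε hε => ?_
  obtain ⟨ε', hε0, hεε⟩ := exists_between hε
  have hb : eLpNorm g 2 hsMeasure + 1 ≠ ∞ := ENNReal.add_ne_top.mpr ⟨hg.2.ne, by simp⟩
  have hε' : 0 < ε' / (eLpNorm g 2 hsMeasure + 1) := ENNReal.div_pos hε0.ne' hb
  filter_upwards [h.tendsto_comp ht hε', self_mem_nhdsWithin] with s hs hsT
  refine lt_of_le_of_lt ?_ hεε
  have hm := h.memLp_comp hsT i
  have hm' := h.memLp_comp ht i
  rw [edist_eq_enorm_sub, ← integral_sub (memLp_two_mul hm hg) (memLp_two_mul hm' hg)]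
  simp_rw [← sub_mul]
  refine (enorm_integral_mul_le (hm.sub hm').1 hg.1).trans ?_
  refine (mul_le_mul' (hs i).le (le_self_add : eLpNorm g 2 hsMeasure ≤ eLpNorm g 2 hsMeasure + 1)).trans
    (le_of_eq ?_)
  exact ENNReal.div_mul_cancel (by simp) hb

lemma prod_hsMeasure (c d : ℝ) : (volume.restrict (Icc c d)).prod hsMeasure
    = (volume : Measure (ℝ × E3)).restrict (Icc c d ×ˢ (halfSpace : Set E3)) :=
  Measure.prod_restrict _ _

/-- Fubini needs joint measurability, while the hypotheses give only continuity in `x` at each time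
and `L²` continuity in time. The mollifications in `x` are continuous in each variable separately,
being pairings with fixed kernels, hence jointly measurable. They converge to `u` at every point of
the open half-space. -/
theorem IsEulerSolution.aestronglyMeasurable (h : IsEulerSolution T u p) (hc : 0 ≤ c) (hd : d ≤ T)
    (i : Fin 3) : AEStronglyMeasurable (fun z : ℝ × E3 => u z.1 z.2 i)
      ((volume.restrict (Icc c d)).prod hsMeasure) := by
  rcases lt_or_ge T 0 with hT | hT
  · rw [Icc_eq_empty (fun hcd => by linarith)]
    simp
  set V : ℕ → ℝ → E3 → ℝ := fun n s x => IccExtend hT (fun t : Icc 0 T =>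
    moll (upKernel n) (ext0 (comp u t i)) x) s with hV
  have hVs : ∀ n s, ∃ t ∈ Icc 0 T, V n s = moll (upKernel n) (ext0 (comp u t i)) := fun n s =>
    ⟨projIcc 0 T hT s, (projIcc 0 T hT s).2, rfl⟩
  have hm : ∀ n, StronglyMeasurable (Function.uncurry (V n)) := by
    intro n
    refine stronglyMeasurable_uncurry_of_continuous_of_stronglyMeasurable (fun x => ?_) fun s => ?_
    · refine Continuous.Icc_extend' (f := fun t : Icc 0 T =>
        moll (upKernel n) (ext0 (comp u t i)) x) ?_
      have e : ∀ t, moll (upKernel n) (ext0 (comp u t i)) x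
          = ∫ y, comp u t i y * upKernel n (x - y) ∂hsMeasure := fun t => integral_ext0_mul _ _
      simp_rw [e]
      refine continuousOn_iff_continuous_domRestrict.mp
        (h.continuousOn_pairing i (memLp_of_smooth ?_ ?_))
      · exact (isKernel_upKernel n).smooth.comp (contDiff_const.sub contDiff_id)
      · exact (isKernel_upKernel n).compact.comp_homeomorph (Homeomorph.subLeft x)
    · obtain ⟨t, ht, e⟩ := hVs n s
      rw [e]
      exact ((isKernel_upKernel n).contDiff_moll
        (memLp_ext0 (h.memLp_comp ht i)).locallyIntegrable_two).continuous.stronglyMeasurable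
  refine aestronglyMeasurable_of_tendsto_ae atTop (f := fun n => Function.uncurry (V n))
    (fun n => (hm n).aestronglyMeasurable) ?_
  rw [prod_hsMeasure]
  refine (ae_restrict_iff' (measurableSet_Icc.prod measurableSet_hs)).mpr
    (Eventually.of_forall ?_)
  rintro ⟨s, x⟩ ⟨hs, hx⟩
  have hsT : s ∈ Icc 0 T := ⟨hc.trans hs.1, hs.2.trans hd⟩
  simp only [Function.uncurry, hV, IccExtend_of_mem hT _ hsT]
  have hcx : ContinuousAt (ext0 (comp u s i)) x := by
    have h1 : ContinuousAt (comp u s i) x :=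
      ((EuclideanSpace.proj i : E3 →L[ℝ] ℝ).continuous.comp_continuousOn
        ((h.continuousOn s hsT).mono subset_closure)).continuousAt (isOpen_hs.mem_nhds hx)
    refine h1.congr ?_
    filter_upwards [isOpen_hs.mem_nhds hx] with y hy
    simp [ext0, indicator_of_mem hy]
  have hx' : ext0 (comp u s i) x = u s x i := by simp [ext0, indicator_of_mem hx]
  rw [Metric.tendsto_atTop]
  intro ε hε
  obtain ⟨r, hr, hball⟩ := Metric.continuousAt_iff.mp hcx (ε / 2) (by positivity)
  obtain ⟨N, hN⟩ := eventually_atTop.mp (tendsto_upKernel_radius.eventually_lt_const hr)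
  refine ⟨N, fun n hn => ?_⟩
  rw [Real.dist_eq, ← hx']
  refine lt_of_le_of_lt ((isKernel_upKernel n).abs_moll_sub_le
    (memLp_ext0 (h.memLp_comp hsT i)).locallyIntegrable_two (δ := ε / 2) fun y hy => ?_)
    (by linarith)
  have := hball (x := y) (by rw [dist_comm, dist_eq_norm]; exact hy.trans_lt (hN n hn))
  rw [Real.dist_eq] at this
  exact this.le

/-! ### The momentum equation in time -/

lemma integrable_prod_of_bound {f : ℝ × E3 → ℝ}
    (hf : AEStronglyMeasurable f ((volume.restrict (Icc c d)).prod hsMeasure)) {B : ℝ≥0∞}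
    (hB : B ≠ ∞) (h : ∀ t ∈ Icc c d, ∫⁻ x, ‖f (t, x)‖ₑ ∂hsMeasure ≤ B) :
    Integrable f ((volume.restrict (Icc c d)).prod hsMeasure) := by
  refine ⟨hf, ?_⟩
  rw [HasFiniteIntegral, lintegral_prod _ hf.enorm]
  calc _ ≤ ∫⁻ _ in Icc c d, B := setLIntegral_mono' measurableSet_Icc h
    _ < ∞ := by
        rw [setLIntegral_const]
        exact ENNReal.mul_lt_top hB.lt_top (by simp)

lemma lintegral_enorm_mul_le {f g : E3 → ℝ} (hf : AEStronglyMeasurable f hsMeasure)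
    (hg : AEStronglyMeasurable g hsMeasure) :
    ∫⁻ x, ‖f x * g x‖ₑ ∂hsMeasure ≤ eLpNorm f 2 hsMeasure * eLpNorm g 2 hsMeasure := by
  have := ENNReal.lintegral_mul_le_Lp_mul_Lq hsMeasure Real.HolderConjugate.two_two hf.enorm
    hg.enorm
  have e : ∀ h : E3 → ℝ, (∫⁻ x, ‖h x‖ₑ ^ (2 : ℝ) ∂hsMeasure) ^ (1 / 2 : ℝ)
      = eLpNorm h 2 hsMeasure := by
    intro h
    have h2 := eLpNorm_two_sq h hsMeasure
    simp only [ENNReal.rpow_two]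
    rw [← h2, ← ENNReal.rpow_natCast, ← ENNReal.rpow_mul]
    norm_num
  rw [e, e] at this
  refine le_trans (le_of_eq ?_) this
  exact lintegral_congr fun x => by simp [enorm_mul]

lemma IsTest.exists_bound {χ : E3 → ℝ} (hχ : IsTest χ) : ∃ C : ℝ≥0, ∀ x, |χ x| ≤ C := by
  obtain ⟨C, hC⟩ := hχ.compact.exists_bound_of_continuous hχ.continuous
  exact ⟨C.toNNReal, fun x => (hC x).trans (Real.le_coe_toNNReal C)⟩

lemma aesm_snd {g : E3 → ℝ} (hg : Continuous g) : AEStronglyMeasurable (fun z : ℝ × E3 => g z.2)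
    ((volume.restrict (Icc c d)).prod hsMeasure) :=
  (hg.comp continuous_snd).aestronglyMeasurable

lemma IsEulerSolution.integrable_comp_mul (h : IsEulerSolution T u p) (hc : 0 ≤ c) (hd : d ≤ T)
    (i : Fin 3) {χ : E3 → ℝ} (hχ : IsTest χ) : Integrable (fun z : ℝ × E3 => u z.1 z.2 i * χ z.2)
      ((volume.restrict (Icc c d)).prod hsMeasure) := by
  obtain ⟨K, hK⟩ := h.exists_bound
  refine integrable_prod_of_bound ((h.aestronglyMeasurable hc hd i).mul (aesm_snd hχ.continuous))
    (B := K * eLpNorm χ 2 hsMeasure) (ENNReal.mul_ne_top (by simp) hχ.memLp.2.ne) fun t ht => ?_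
  have hT : t ∈ Icc 0 T := ⟨hc.trans ht.1, ht.2.trans hd⟩
  exact (lintegral_enorm_mul_le (h.memLp_comp hT i).1 hχ.memLp.1).trans
    (mul_le_mul' (hK t hT i).norm_self_le le_rfl)

lemma IsEulerSolution.integrable_comp_mul_comp (h : IsEulerSolution T u p) (hc : 0 ≤ c)
    (hd : d ≤ T) (i j : Fin 3) {χ : E3 → ℝ} (hχ : IsTest χ) :
    Integrable (fun z : ℝ × E3 => u z.1 z.2 i * u z.1 z.2 j * χ z.2)
      ((volume.restrict (Icc c d)).prod hsMeasure) := by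
  obtain ⟨K, hK⟩ := h.exists_bound
  obtain ⟨C, hC⟩ := hχ.exists_bound
  refine integrable_prod_of_bound (((h.aestronglyMeasurable hc hd i).mul
    (h.aestronglyMeasurable hc hd j)).mul (aesm_snd hχ.continuous))
    (B := K * (C * K)) (ENNReal.mul_ne_top (by simp) (ENNReal.mul_ne_top (by simp) (by simp)))
    fun t ht => ?_
  have hT : t ∈ Icc 0 T := ⟨hc.trans ht.1, ht.2.trans hd⟩
  have hb := eLpNorm_mul_bounded_le (p := 2) (fun x (_ : x ∈ (halfSpace : Set E3)) => hC x)
    (comp u t j)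
  have e : ∀ x, u t x i * u t x j * χ x = comp u t i x * (χ x * comp u t j x) := fun x => by
    simp only [comp]; ring
  simp_rw [e]
  exact (lintegral_enorm_mul_le (h.memLp_comp hT i).1
    (hχ.continuous.aestronglyMeasurable.mul (h.memLp_comp hT j).1)).trans
    (mul_le_mul' (hK t hT i).norm_self_le
      (hb.trans (mul_le_mul' le_rfl (hK t hT j).norm_self_le)))

/-- The pressure is locally integrable only in the open cylinder, which forces the time interval to
stay strictly inside `(0, T)`. -/
lemma IsEulerSolution.integrable_pressure_mul (h : IsEulerSolution T u p) (hc : 0 < c)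
    (hd : d < T) {χ : E3 → ℝ} (hχ : IsTest χ) :
    Integrable (fun z : ℝ × E3 => p z.1 z.2 * χ z.2)
      ((volume.restrict (Icc c d)).prod hsMeasure) := by
  rw [prod_hsMeasure]
  have hK : IsCompact (Icc c d ×ˢ tsupport χ) := isCompact_Icc.prod hχ.compact
  have hsub : Icc c d ×ˢ tsupport χ ⊆ (spaceTime T : Set (ℝ × E3)) := fun z hz =>
    ⟨⟨hc.trans_le hz.1.1, hz.1.2.trans_lt hd⟩, hχ.subset hz.2⟩
  have h1 : IntegrableOn (fun z : ℝ × E3 => p z.1 z.2) (Icc c d ×ˢ tsupport χ) :=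
    (locallyIntegrableOn_iff (spaceTime T).isOpen.isLocallyClosed).mp
      h.pressure_locallyIntegrable _ hsub hK
  have h2 := h1.mul_continuousOn (hχ.continuous.comp continuous_snd).continuousOn hK
  refine IntegrableOn.of_forall_sdiff_eq_zero h2 (measurableSet_Icc.prod measurableSet_hs) ?_
  rintro ⟨s, x⟩ ⟨hz, hz'⟩
  have : x ∉ tsupport χ := fun hx => hz' ⟨hz.1, hx⟩
  simp [image_eq_zero_of_notMem_tsupport this]

lemma integrable_time_mul {f : ℝ × E3 → ℝ} {θ : ℝ → ℝ} (hθ : Continuous θ)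
    (hf : Integrable f ((volume.restrict (Icc c d)).prod hsMeasure)) :
    Integrable (fun z => θ z.1 * f z) ((volume.restrict (Icc c d)).prod hsMeasure) := by
  obtain ⟨C, hC⟩ := isCompact_Icc.exists_bound_of_continuousOn (s := Icc c d) hθ.continuousOn
  refine hf.bdd_mul (c := C) (hθ.comp continuous_fst).aestronglyMeasurable ?_
  rw [prod_hsMeasure]
  exact (ae_restrict_iff' (measurableSet_Icc.prod measurableSet_hs)).mpr
    (Eventually.of_forall fun z hz => hC z.1 hz.1)

lemma integral_time_mul {f : ℝ × E3 → ℝ} {θ : ℝ → ℝ} (hθ : Continuous θ)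
    (hf : Integrable f ((volume.restrict (Icc c d)).prod hsMeasure)) :
    ∫ z, θ z.1 * f z ∂((volume.restrict (Icc c d)).prod hsMeasure)
      = ∫ t in Icc c d, θ t * ∫ x, f (t, x) ∂hsMeasure := by
  rw [integral_prod _ (integrable_time_mul hθ hf)]
  simp_rw [integral_const_mul]

/-! ### Test fields that separate time and space. -/

/-- The test field `θ(t) Ψ(x)`. -/
def prodField (θ : ℝ → ℝ) (Ψ : Fin 3 → E3 → ℝ) (z : ℝ × E3) : E3 :=
  WithLp.toLp 2 fun i => θ z.1 * Ψ i z.2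

lemma contDiff_prodField {θ : ℝ → ℝ} {Ψ : Fin 3 → E3 → ℝ} (hθ : ContDiff ℝ smoothExp θ)
    (hΨ : ∀ i, IsTest (Ψ i)) : ContDiff ℝ smoothExp (prodField θ Ψ) := by
  refine contDiff_euclidean.mpr fun i => ?_
  exact (hθ.comp contDiff_fst).mul ((hΨ i).smooth.comp contDiff_snd)

lemma fderiv_prodField {θ : ℝ → ℝ} {Ψ : Fin 3 → E3 → ℝ} (hθ : ContDiff ℝ smoothExp θ)
    (hΨ : ∀ i, IsTest (Ψ i)) (z : ℝ × E3) (a : ℝ) (v : E3) (i : Fin 3) :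
    fderiv ℝ (prodField θ Ψ) z (a, v) i
      = a * deriv θ z.1 * Ψ i z.2 + θ z.1 * ∑ j, v j * pd j (Ψ i) z.2 := by
  have h1 := ((contDiff_prodField hθ hΨ).differentiable (by simp) z).hasFDerivAt
  have h2 := (EuclideanSpace.proj i : E3 →L[ℝ] ℝ).hasFDerivAt.comp z h1
  have k1 : HasFDerivAt (fun z : ℝ × E3 => θ z.1) _ z :=
    ((hθ.differentiable (by simp) z.1).hasDerivAt.hasFDerivAt).comp z hasFDerivAt_fst
  have k2 : HasFDerivAt (fun z : ℝ × E3 => Ψ i z.2) _ z :=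
    ((hΨ i).differentiable z.2).hasFDerivAt.comp z hasFDerivAt_snd
  have e := congrArg (fun L => L (a, v)) (h2.unique (k1.mul k2))
  have e' : fderiv ℝ (prodField θ Ψ) z (a, v) i = _ := e
  rw [e', ← fderiv_apply_eq_sum]
  simp
  ring

/-- The space-time test field `θ(t) Ψ(x)`. -/
def prodTest {θ : ℝ → ℝ} {Ψ : Fin 3 → E3 → ℝ} (hθ : ContDiff ℝ smoothExp θ)
    (hΨ : ∀ i, IsTest (Ψ i)) (hc : 0 < c) (hd : d < T) (hs : tsupport θ ⊆ Icc c d) :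
    𝓓(spaceTime T, E3) :=
  have hsub : tsupport (prodField θ Ψ) ⊆ tsupport θ ×ˢ ⋃ i, tsupport (Ψ i) := by
    refine closure_minimal (fun z hz => ?_)
      ((isClosed_tsupport θ).prod (isClosed_iUnion_of_finite fun i => isClosed_tsupport _))
    rw [Function.mem_support] at hz
    obtain ⟨i, hi⟩ : ∃ i, θ z.1 * Ψ i z.2 ≠ 0 := by
      by_contra hcon
      push Not at hcon
      apply hz
      ext i
      exact hcon i
    exact ⟨subset_tsupport _ (left_ne_zero_of_mul hi),
      mem_iUnion.mpr ⟨i, subset_tsupport _ (right_ne_zero_of_mul hi)⟩⟩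
  ⟨prodField θ Ψ, contDiff_prodField hθ hΨ,
    HasCompactSupport.of_support_subset_isCompact
      ((isCompact_Icc.of_isClosed_subset (isClosed_tsupport θ) hs).prod
        (isCompact_iUnion fun i => (hΨ i).compact)) ((subset_tsupport _).trans hsub),
    hsub.trans fun z hz => by
      obtain ⟨i, hi⟩ := mem_iUnion.mp hz.2
      have := hs hz.1
      exact ⟨⟨hc.trans_le this.1, this.2.trans_lt hd⟩, (hΨ i).subset hi⟩⟩

/-- Fubini for the test field `θ(t) Ψ(x)`: the momentum equation becomes a scalar distributional
equation in time. -/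
theorem IsEulerSolution.momentum_time (h : IsEulerSolution T u p) {θ : ℝ → ℝ}
    {Ψ : Fin 3 → E3 → ℝ} (hθ : ContDiff ℝ smoothExp θ) (hΨ : ∀ i, IsTest (Ψ i)) (hc : 0 < c)
    (hd : d < T) (hs : tsupport θ ⊆ Icc c d) :
    (∫ t in Icc c d, deriv θ t * ∑ i, ∫ x, comp u t i x * Ψ i x ∂hsMeasure)
      + ∫ t in Icc c d, θ t * flux (comp u t) (p t) Ψ = 0 := by
  have key := h.momentum (prodTest hθ hΨ hc hd hs)
  have e0 : (prodTest (T := T) hθ hΨ hc hd hs : ℝ × E3 → E3) = prodField θ Ψ := rfl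
  simp only [e0] at key
  set F : ℝ × E3 → ℝ := fun z => deriv θ z.1 * (∑ i, u z.1 z.2 i * Ψ i z.2)
    + θ z.1 * (∑ i, ∑ j, u z.1 z.2 i * u z.1 z.2 j * pd j (Ψ i) z.2
      + ∑ i, p z.1 z.2 * pd i (Ψ i) z.2) with hF
  have e1 : ∀ z : ℝ × E3, inner ℝ (u z.1 z.2) (fderiv ℝ (prodField θ Ψ) z (1, 0))
      + inner ℝ (u z.1 z.2) (fderiv ℝ (prodField θ Ψ) z (0, u z.1 z.2))
      + p z.1 z.2 * ∑ i, (fderiv ℝ (prodField θ Ψ) z (0, basisVec i)) i = F z := by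
    intro z
    simp only [PiLp.inner_apply, fderiv_prodField hθ hΨ, hF]
    simp [basisVec_apply, Fin.sum_univ_three]
    ring
  simp_rw [e1] at key
  have hsub : Icc c d ×ˢ (halfSpace : Set E3) ⊆ (spaceTime T : Set (ℝ × E3)) := fun z hz =>
    ⟨⟨hc.trans_le hz.1.1, hz.1.2.trans_lt hd⟩, hz.2⟩
  rw [setIntegral_eq_of_subset_of_forall_sdiff_eq_zero (spaceTime T).isOpen.measurableSet hsub
    ?_, ← prod_hsMeasure] at key
  swap
  · rintro ⟨s, x⟩ ⟨hz, hz'⟩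
    have hst : s ∉ tsupport θ := fun hst => hz' ⟨hs hst, hz.2⟩
    have h0 : θ s = 0 := image_eq_zero_of_notMem_tsupport hst
    have h1 : deriv θ s = 0 :=
      image_eq_zero_of_notMem_tsupport fun hh => hst (tsupport_deriv_subset hh)
    simp [hF, h0, h1]
  have i1 := fun i => h.integrable_comp_mul hc.le hd.le i (hΨ i)
  have i2 := fun i j => h.integrable_comp_mul_comp hc.le hd.le i j ((hΨ i).pd j)
  have i3 := fun i => h.integrable_pressure_mul hc hd ((hΨ i).pd i)
  have cθ' : Continuous (deriv θ) := hθ.continuous_deriv (by simp)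
  have I1 := integrable_finsetSum Finset.univ fun i _ => integrable_time_mul cθ' (i1 i)
  have I2 := integrable_finsetSum Finset.univ fun i _ =>
    integrable_finsetSum Finset.univ fun j _ => integrable_time_mul hθ.continuous (i2 i j)
  have I3 := integrable_finsetSum Finset.univ fun i _ => integrable_time_mul hθ.continuous (i3 i)
  have hF' : F = fun z => ∑ i, deriv θ z.1 * (u z.1 z.2 i * Ψ i z.2)
      + (∑ i, ∑ j, θ z.1 * (u z.1 z.2 i * u z.1 z.2 j * pd j (Ψ i) z.2)
        + ∑ i, θ z.1 * (p z.1 z.2 * pd i (Ψ i) z.2)) := by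
    funext z
    simp only [hF, mul_add, Finset.mul_sum]
  have J : ∀ {f : ℝ × E3 → ℝ}, Integrable f ((volume.restrict (Icc c d)).prod hsMeasure) →
      Integrable (fun t => ∫ x, f (t, x) ∂hsMeasure) (volume.restrict (Icc c d)) :=
    fun hf => hf.integral_prod_left
  have J' : ∀ {f : ℝ × E3 → ℝ} {η : ℝ → ℝ}, Continuous η →
      Integrable f ((volume.restrict (Icc c d)).prod hsMeasure) →
      Integrable (fun t => η t * ∫ x, f (t, x) ∂hsMeasure) (volume.restrict (Icc c d)) := by
    intro f η hη hf
    have := J (integrable_time_mul hη hf)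
    simpa only [integral_const_mul] using this
  have K1 := integrable_finsetSum Finset.univ fun i _ => J' cθ' (i1 i)
  have K2 := integrable_finsetSum Finset.univ fun i _ =>
    integrable_finsetSum Finset.univ fun j _ => J' hθ.continuous (i2 i j)
  have K3 := integrable_finsetSum Finset.univ fun i _ => J' hθ.continuous (i3 i)
  have A1 := integral_add I1 (I2.add I3)
  have A2 := integral_add I2 I3
  simp only [Pi.add_apply] at A1
  rw [hF', A1, A2,
    integral_finsetSum _ fun i _ => integrable_time_mul cθ' (i1 i),
    integral_finsetSum _ fun i _ => integrable_finsetSum Finset.univ fun j _ =>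
      integrable_time_mul hθ.continuous (i2 i j),
    integral_finsetSum _ fun i _ => integrable_time_mul hθ.continuous (i3 i)] at key
  simp_rw [integral_finsetSum _ fun j _ => integrable_time_mul hθ.continuous (i2 _ j),
    integral_time_mul cθ' (i1 _), integral_time_mul hθ.continuous (i2 _ _),
    integral_time_mul hθ.continuous (i3 _)] at key
  rw [← key]
  congr 1
  · simp_rw [Finset.mul_sum]
    exact integral_finsetSum _ fun i _ => J' cθ' (i1 i)
  · simp only [flux, mul_add, Finset.mul_sum]
    have A3 := integral_add K2 K3
    refine Eq.trans ?_ (A3.trans ?_)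
    · rfl
    rw [integral_finsetSum _ fun i _ => integrable_finsetSum Finset.univ
        fun j _ => J' hθ.continuous (i2 i j), integral_finsetSum _ fun i _ =>
        J' hθ.continuous (i3 i)]
    simp_rw [integral_finsetSum _ fun j _ => J' hθ.continuous (i2 _ j)]

theorem IsEulerSolution.integrableOn_flux (h : IsEulerSolution T u p)
    {Ψ : Fin 3 → E3 → ℝ} (hΨ : ∀ i, IsTest (Ψ i)) (hc : 0 < c)
    (hd : d < T) : IntegrableOn (fun t => flux (comp u t) (p t) Ψ) (Icc c d) := by
  refine Integrable.add (integrable_finsetSum _ fun i _ => integrable_finsetSum _ fun j _ => ?_)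
    (integrable_finsetSum _ fun i _ => ?_)
  · exact (h.integrable_comp_mul_comp hc.le hd.le i j ((hΨ i).pd j)).integral_prod_left
  · exact (h.integrable_pressure_mul hc hd ((hΨ i).pd i)).integral_prod_left

end ConormalEuler

end

noncomputable section

namespace ConormalEuler

/-! ### From weak to integrated evolution equations -/

lemma deriv_smoothTransition_nonneg (x : ℝ) : 0 ≤ deriv Real.smoothTransition x :=
  Real.smoothTransition.monotone.deriv_nonneg

lemma hasDerivAt_step (n s t : ℝ) : HasDerivAt (fun t => Real.smoothTransition (n * (t - s)))
    (n * deriv Real.smoothTransition (n * (t - s))) t := by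
  have h1 : HasDerivAt (fun t => n * (t - s)) n t := by
    simpa using ((hasDerivAt_id t).sub_const s).const_mul n
  have h2 := (Real.smoothTransition.contDiff.differentiable (n := 1) (by simp)
    (n * (t - s))).hasDerivAt
  have h3 := h2.comp t h1
  rwa [mul_comm] at h3

lemma continuous_step_deriv (n s : ℝ) :
    Continuous fun t => n * deriv Real.smoothTransition (n * (t - s)) :=
  continuous_const.mul (((Real.smoothTransition.contDiff (n := 1)).continuous_deriv le_rfl).comp
    (by fun_prop))

lemma deriv_smoothTransition_of_lt {x : ℝ} (h : x < 0 ∨ 1 < x) :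
    deriv Real.smoothTransition x = 0 := by
  rcases h with h | h
  · have : Real.smoothTransition =ᶠ[𝓝 x] fun _ => 0 := by
      filter_upwards [Iio_mem_nhds h] with y hy
      exact Real.smoothTransition.zero_of_nonpos (le_of_lt hy)
    rw [this.deriv_eq, deriv_const]
  · have : Real.smoothTransition =ᶠ[𝓝 x] fun _ => 1 := by
      filter_upwards [Ioi_mem_nhds h] with y hy
      exact Real.smoothTransition.one_of_one_le (le_of_lt hy)
    rw [this.deriv_eq, deriv_const]

/-- The derivative of the rescaled step is nonnegative, supported in `[s, s + 1/n]`, and of mass one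
on `[c, d]` as soon as `n (d - s) > 1`. -/
lemma tendsto_integral_step {b : ℝ → ℝ} {c d s : ℝ} (hb : ContinuousOn b (Icc c d))
    (hs : s ∈ Ico c d) : Tendsto (fun n : ℕ => ∫ t in Icc c d,
      (n * deriv Real.smoothTransition (n * (t - s))) * b t) atTop (𝓝 (b s)) := by
  rw [Metric.tendsto_atTop]
  intro ε hε
  obtain ⟨δ, hδ, hδb⟩ := Metric.continuousOn_iff.mp hb s ⟨hs.1, hs.2.le⟩ (ε / 2) (by positivity)
  obtain ⟨N, hN⟩ := exists_nat_gt (max (1 / δ) (1 / (d - s)))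
  refine ⟨N, fun n hn => ?_⟩
  have hds : 0 < d - s := sub_pos.mpr hs.2
  have hnN : (N : ℝ) ≤ n := by exact_mod_cast hn
  have hn1 : 1 / δ < n := (le_max_left _ _).trans_lt (hN.trans_le hnN)
  have hn2 : 1 / (d - s) < n := (le_max_right _ _).trans_lt (hN.trans_le hnN)
  have hn0 : (0 : ℝ) < n := lt_trans (by positivity) hn1
  rw [div_lt_iff₀ hδ] at hn1
  rw [div_lt_iff₀ hds] at hn2
  set w : ℝ → ℝ := fun t => n * deriv Real.smoothTransition (n * (t - s)) with hw
  have hwc : Continuous w := continuous_step_deriv n s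
  have hw0 : ∀ t, 0 ≤ w t := fun t => mul_nonneg hn0.le (deriv_smoothTransition_nonneg _)
  have hcd : c ≤ d := hs.1.trans hs.2.le
  have hI : ∀ f : ℝ → ℝ, ∫ t in Icc c d, f t = ∫ t in c..d, f t := fun f => by
    rw [intervalIntegral.integral_of_le hcd, integral_Icc_eq_integral_Ioc]
  have hw1 : ∫ t in Icc c d, w t = 1 := by
    rw [hI, intervalIntegral.integral_eq_sub_of_hasDerivAt
      (fun t _ => hasDerivAt_step n s t) (hwc.intervalIntegrable _ _),
      Real.smoothTransition.one_of_one_le hn2.le,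
      Real.smoothTransition.zero_of_nonpos (mul_nonpos_of_nonneg_of_nonpos hn0.le
        (by linarith [hs.1])), sub_zero]
  have hwi : IntegrableOn w (Icc c d) := hwc.continuousOn.integrableOn_Icc
  have hwb : IntegrableOn (fun t => w t * b t) (Icc c d) :=
    (hwc.continuousOn.mul hb).integrableOn_Icc
  have e : (∫ t in Icc c d, w t * b t) - b s = ∫ t in Icc c d, w t * (b t - b s) := by
    simp_rw [mul_sub]
    rw [integral_sub hwb (hwi.mul_const _), integral_mul_const, hw1, one_mul]
  rw [Real.dist_eq, e, ← Real.norm_eq_abs]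
  refine lt_of_le_of_lt (norm_integral_le_of_norm_le (g := fun t => w t * (ε / 2))
    (hwi.mul_const _) ((ae_restrict_iff' measurableSet_Icc).mpr
      (Eventually.of_forall fun t ht => ?_))) ?_
  · rw [norm_mul, Real.norm_of_nonneg (hw0 t)]
    by_cases hts : |t - s| < δ
    · refine mul_le_mul_of_nonneg_left ?_ (hw0 t)
      have := hδb t ht (by rwa [Real.dist_eq])
      rw [Real.dist_eq] at this
      exact this.le
    · have h0 : w t = 0 := by
        rw [hw]
        beta_reduce
        rw [deriv_smoothTransition_of_lt, mul_zero]
        rcases le_abs.mp (not_lt.mp hts) with h | h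
        · right
          nlinarith
        · left
          nlinarith
      simp [h0]
  · rw [integral_mul_const, hw1]
    linarith

/-- A weak solution of `b' = a` satisfies the integrated equation. -/
theorem sub_eq_integral_of_weak {a b : ℝ → ℝ} {c d s : ℝ} (hcs : c < s) (hsd : s < d)
    (hb : ContinuousOn b (Icc c d)) (ha : IntegrableOn a (Icc c d))
    (h : ∀ θ : ℝ → ℝ, ContDiff ℝ smoothExp θ → tsupport θ ⊆ Icc c d →
      (∫ t in Icc c d, deriv θ t * b t) + ∫ t in Icc c d, θ t * a t = 0) :
    b s - b c = ∫ t in Ioc c s, a t := by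
  set S := Real.smoothTransition with hS
  -- A smooth version of the indicator of `(c, s]`: it rises just after `c` and falls just after
  -- `s`, hence is supported in `[c, d]` for large `n`.
  set θ : ℕ → ℝ → ℝ := fun n t => S (n * (t - c)) - S (n * (t - s)) with hθ
  have hd : ∀ n : ℕ, ∀ t, deriv (θ n) t = n * deriv S (n * (t - c)) - n * deriv S (n * (t - s)) :=
    fun n t => ((hasDerivAt_step n c t).sub (hasDerivAt_step n s t)).deriv
  have hsm : ∀ n, ContDiff ℝ smoothExp (θ n) := fun n =>
    (Real.smoothTransition.contDiff.comp (by fun_prop)).sub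
      (Real.smoothTransition.contDiff.comp (by fun_prop))
  have hcI : c ∈ Ico c d := ⟨le_rfl, hcs.trans hsd⟩
  have hsI : s ∈ Ico c d := ⟨hcs.le, hsd⟩
  have l1 := (tendsto_integral_step hb hcI).sub (tendsto_integral_step hb hsI)
  have l1' : Tendsto (fun n => ∫ t in Icc c d, deriv (θ n) t * b t) atTop (𝓝 (b c - b s)) := by
    refine l1.congr fun n => ?_
    simp_rw [hd, sub_mul]
    exact (integral_sub (((continuous_step_deriv n c).continuousOn.mul hb).integrableOn_Icc)
      (((continuous_step_deriv n s).continuousOn.mul hb).integrableOn_Icc)).symm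
  have hθ1 : ∀ n t, |θ n t| ≤ 1 := fun n t => by
    have := Real.smoothTransition.nonneg (n * (t - c))
    have := Real.smoothTransition.nonneg (n * (t - s))
    have := Real.smoothTransition.le_one (n * (t - c))
    have := Real.smoothTransition.le_one (n * (t - s))
    rw [abs_le]
    constructor <;> simp only [hθ, hS] <;> linarith
  have hone : ∀ {r : ℝ}, 0 < r → Tendsto (fun n : ℕ => S (n * r)) atTop (𝓝 1) := by
    intro r hr
    refine tendsto_const_nhds.congr' ?_
    filter_upwards [(tendsto_natCast_atTop_atTop.atTop_mul_const hr).eventually_ge_atTop 1]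
      with n hn
    exact (Real.smoothTransition.one_of_one_le hn).symm
  have hzero : ∀ {r : ℝ}, r ≤ 0 → Tendsto (fun n : ℕ => S (n * r)) atTop (𝓝 0) := by
    intro r hr
    refine tendsto_const_nhds.congr fun n => ?_
    exact (Real.smoothTransition.zero_of_nonpos
      (mul_nonpos_of_nonneg_of_nonpos n.cast_nonneg hr)).symm
  have l2 : Tendsto (fun n => ∫ t in Icc c d, θ n t * a t) atTop
      (𝓝 (∫ t in Icc c d, (Ioc c s).indicator a t)) := by
    refine tendsto_integral_of_dominated_convergence (fun t => ‖a t‖)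
      (fun n => (hsm n).continuous.aestronglyMeasurable.mul ha.1) ha.norm
      (fun n => Eventually.of_forall fun t => ?_)
      ((ae_restrict_iff' measurableSet_Icc).mpr (Eventually.of_forall fun t ht => ?_))
    · rw [norm_mul]
      exact mul_le_of_le_one_left (norm_nonneg _) (hθ1 n t)
    · have key : Tendsto (fun n => θ n t) atTop (𝓝 ((Ioc c s).indicator (fun _ => 1) t)) := by
        by_cases h1 : c < t
        · by_cases h2 : t ≤ s
          · rw [indicator_of_mem (show t ∈ Ioc c s from ⟨h1, h2⟩)]
            simpa using (hone (sub_pos.mpr h1)).sub (hzero (sub_nonpos.mpr h2))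
          · rw [indicator_of_notMem fun hh => h2 hh.2]
            simpa using (hone (sub_pos.mpr h1)).sub (hone (sub_pos.mpr (not_le.mp h2)))
        · rw [indicator_of_notMem fun hh => h1 hh.1]
          have : t ≤ c := not_lt.mp h1
          simpa using (hzero (sub_nonpos.mpr this)).sub
            (hzero (sub_nonpos.mpr (this.trans hcs.le)))
      have := key.mul_const (a t)
      rw [← indicator_mul_left] at this
      simpa using this
  have l3 : Tendsto (fun n => (∫ t in Icc c d, deriv (θ n) t * b t) + ∫ t in Icc c d, θ n t * a t)
      atTop (𝓝 0) := by
    refine tendsto_const_nhds.congr' ?_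
    filter_upwards [(tendsto_natCast_atTop_atTop.atTop_mul_const
      (sub_pos.mpr hsd)).eventually_ge_atTop 1] with n hn
    refine (h (θ n) (hsm n) (closure_minimal (fun t ht => ?_) isClosed_Icc)).symm
    by_contra hcon
    apply ht
    have hn0 : (0 : ℝ) ≤ n := n.cast_nonneg
    by_cases h1 : c ≤ t
    · have h2 : d < t := not_le.mp fun h2 => hcon ⟨h1, h2⟩
      have e1 : 1 ≤ n * (t - s) := hn.trans (mul_le_mul_of_nonneg_left (by linarith) hn0)
      have e2 : 1 ≤ n * (t - c) := hn.trans (mul_le_mul_of_nonneg_left (by linarith) hn0)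
      simp only [hθ, hS]
      rw [Real.smoothTransition.one_of_one_le e1, Real.smoothTransition.one_of_one_le e2, sub_self]
    · have h1' : t < c := not_le.mp h1
      simp only [hθ, hS]
      rw [Real.smoothTransition.zero_of_nonpos (mul_nonpos_of_nonneg_of_nonpos hn0 (by linarith)),
        Real.smoothTransition.zero_of_nonpos (mul_nonpos_of_nonneg_of_nonpos hn0 (by linarith)),
        sub_self]
  have e := tendsto_nhds_unique l3 (l1'.add l2)
  have hsub : Ioc c s ⊆ Icc c d := fun t ht => ⟨ht.1.le, ht.2.trans hsd.le⟩
  rw [setIntegral_indicator measurableSet_Ioc, inter_eq_self_of_subset_right hsub] at e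
  linarith

theorem IsEulerSolution.sub_eq_integral_flux {T : ℝ} {u : ℝ → E3 → E3} {p : ℝ → E3 → ℝ}
    (h : IsEulerSolution T u p) {Ψ : Fin 3 → E3 → ℝ} (hΨ : ∀ i, IsTest (Ψ i)) {s₀ s₁ : ℝ}
    (h0 : 0 < s₀) (h1 : s₀ < s₁) (h2 : s₁ < T) :
    (∑ i, ∫ x, (comp u s₁ i x - comp u s₀ i x) * Ψ i x ∂hsMeasure)
      = ∫ t in Ioc s₀ s₁, flux (comp u t) (p t) Ψ := by
  -- Room to the right of `s₁` is needed because the time cutoff falls after `s₁`.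
  obtain ⟨d, hd1, hd2⟩ := exists_between h2
  have hI : Icc s₀ d ⊆ Icc 0 T := Icc_subset_Icc h0.le hd2.le
  have hm : ∀ i, ∀ t ∈ Icc 0 T, Integrable (fun x => comp u t i x * Ψ i x) hsMeasure :=
    fun i t ht => memLp_two_mul (h.memLp_comp ht i) (hΨ i).memLp
  rw [← sub_eq_integral_of_weak h1 hd1
    ((continuousOn_finsetSum _ fun i _ => h.continuousOn_pairing i (hΨ i).memLp).mono hI)
    (h.integrableOn_flux hΨ h0 hd2) fun θ hθ hs => h.momentum_time hθ hΨ h0 hd2 hs]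
  rw [← Finset.sum_sub_distrib]
  refine Finset.sum_congr rfl fun i _ => ?_
  rw [← integral_sub (hm i _ ⟨(h0.trans h1).le, h2.le⟩) (hm i _ ⟨h0.le, (h1.trans h2).le⟩)]
  exact integral_congr_ae (Eventually.of_forall fun x => sub_mul _ _ _)

end ConormalEuler

end

noncomputable section

namespace ConormalEuler

/-! ### Divergence-controlled test fields approximating the conormal derivatives -/

variable {B : ℝ≥0∞} {f d : E3 → ℝ} {α : Fin 3 → ℕ}

lemma HReg.of_le {m n : ℕ} (h : HReg m B f) (hn : n ≤ m) : HReg n B f := by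
  induction m, hn using Nat.le_induction with
  | base => exact h
  | succ m _ ih => exact ih h.pred

/-- Conormal derivatives preserve the boundary condition `f = 0`. -/
lemma WD0.exists_zd (h : WD0 2 f d) (hB : B < ∞) (hf : HReg 5 B f) (hd : HReg 4 B d)
    (hα : ord α ≤ 4) :
    ∃ g, WD 2 (Zd α f) g ∧ MemLp g 2 hsMeasure ∧ WD0 2 (Zd α f) g := by
  obtain ⟨C, hC⟩ := HReg.zReg 5
  obtain ⟨C', hC'⟩ := HReg.zReg 4
  have zf := hC hf
  have zd := hC' hd
  have hCB : (C : ℝ≥0∞) * B ≠ ∞ := ENNReal.mul_ne_top (by simp) hB.ne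
  have hCB' : (C' : ℝ≥0∞) * B ≠ ∞ := ENNReal.mul_ne_top (by simp) hB.ne
  by_cases h2 : α 2 = 0
  · have m1 : MemLp (Zd α f) 2 hsMeasure := zf.memLp hCB (by lia)
    have m2 : MemLp (Zd α d) 2 hsMeasure := zd.memLp hCB' hα
    have := WD0.zd_tangential rfl h2 hCB hCB' (zf.mono (by lia) le_rfl) (zd.mono hα le_rfl) h
    exact ⟨_, this.wd m1 m2, m2, this⟩
  -- With a normal factor, `Z^α f = φ ∂_z Z^β f` with `∂_z Z^β f` in `L²`, which forces the trace to
  -- vanish.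
  · obtain ⟨β, rfl⟩ : ∃ β : Fin 3 → ℕ, α = β + ei 2 := by
      refine ⟨fun i => α i - ei 2 i, funext fun i => ?_⟩
      fin_cases i <;> simp
      lia
    have hβ : ord β + 1 ≤ 4 := by simpa using hα
    obtain ⟨B₁, hB₁, r1⟩ := (hf.of_le (n := ord (β + ei 2) + 1) (by lia)).deriv_zd hB rfl
    obtain ⟨B₂, hB₂, r2⟩ := (hf.of_le (n := ord β + 1) (by lia)).deriv_zd hB rfl
    obtain ⟨g, hg, hg'⟩ := r1.2 2
    obtain ⟨k, hk, hk'⟩ := r2.2 2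
    refine ⟨g, hg, hg'.base.1, hg.wd0_of_weight r1.base.1 hg'.base.1 hk'.base.1 ?_⟩
    exact (zf.zd_zd (α := β) (β := ei 2) (by lia)).unique hk.conormal

/-- For the divergence it suffices that `∂ᵢψᵢ` approximates `∂ᵢ Z^α vᵢ` for each `i`. This needs a
boundary condition only for the normal component, where `Z^α v₃` inherits it from `v₃`. So `div ψ`
is within `3ω` of `div Z^α v`, which is of lower order. The bound `A` is qualitative and does not
enter the estimate. -/
theorem exists_tests : ∃ C : ℝ≥0, ∀ {A B : ℝ≥0∞} {v D : Fin 3 → E3 → ℝ}, A < ∞ →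
    (∀ i, HReg 5 A (v i)) → (∀ i, HReg 4 A (D i)) → (∀ i, WD i (v i) (D i)) →
    ((fun x => ∑ i, D i x) =ᵐ[hsMeasure] fun _ => 0) → WD0 2 (v 2) (D 2) →
    (∀ i, ZReg 2 4 B (v i)) → ∀ ω : ℝ≥0∞, 0 < ω →
    ∃ ψ : (Fin 3 → ℕ) → Fin 3 → E3 → ℝ, (∀ α i, IsTest (ψ α i)) ∧ ∀ α ∈ multiIndices 4,
      (∀ i, eLpNorm (fun x => ψ α i x - Zd α (v i) x) 2 hsMeasure ≤ ω) ∧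
      eLpNorm (fun x => ∑ i, pd i (ψ α i) x) 2 hsMeasure ≤ C * B + 3 * ω := by
  choose C hC using exists_div_zd
  obtain ⟨C₄, hC₄⟩ := HReg.zReg 4
  refine ⟨(∑ n ∈ Finset.range 5, C n) * 2, fun {A B v D} hA hv hD hvD hdiv hslip hB ω hω => ?_⟩
  have key : ∀ α : Fin 3 → ℕ, ∃ ψ : Fin 3 → E3 → ℝ, (∀ i, IsTest (ψ i)) ∧ (α ∈ multiIndices 4 →
      (∀ i, eLpNorm (fun x => ψ i x - Zd α (v i) x) 2 hsMeasure ≤ ω) ∧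
      eLpNorm (fun x => ∑ i, pd i (ψ i) x) 2 hsMeasure
        ≤ ((∑ n ∈ Finset.range 5, C n) * 2 : ℝ≥0) * B + 3 * ω) := by
    intro α
    by_cases hα : α ∈ multiIndices 4
    swap
    · obtain ⟨ζ, hζ, -⟩ := exists_test_one_nhds (K := ∅) isCompact_empty (empty_subset _)
      exact ⟨fun _ => ζ, fun _ => hζ, fun h => absurd h hα⟩
    have hα4 := mem_multiIndices.mp hα
    -- The only Euclidean derivative that must be bounded in terms of `B`; the divergence condition
    -- expresses it by tangential derivatives.
    have hD2 : ZReg 2 3 (2 * B) (D 2) := by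
      have e : ∀ i : Fin 3, i ≠ 2 → Zd (ei i) (v i) =ᵐ[hsMeasure] D i := fun i hi => by
        filter_upwards [(hvD i).conormal.zd_ae] with x hx
        rw [hx]
        fin_cases i <;> simp [conormalWeight] at hi ⊢
      have h0 := ((hB 0).zd (α := ei 0) (n := 3) (by simp)).congr (e 0 (by decide))
      have h1 := ((hB 1).zd (α := ei 1) (n := 3) (by simp)).congr (e 1 (by decide))
      rw [two_mul]
      refine (h0.add (by norm_num) h1).neg.congr ?_
      filter_upwards [hdiv] with x hx
      rw [Fin.sum_univ_three] at hx
      linarith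
    have h0 : ZReg 2 4 (2 * B) (fun _ => 0) := by
      have := (hB 0).sub (by norm_num) (hB 0)
      simpa [two_mul] using this
    obtain ⟨D', hD', hn⟩ := hC (ord α) (B := 2 * B) hvD hdiv.symm
      (fun i => (hB i).mono hα4 le_rfl) (fun i => (hC₄ (hD i)).mono hα4 le_rfl)
      (fun k hk => hD2.mono (by lia) le_rfl) (h0.mono hα4 le_rfl) α rfl
    have hψ : ∀ i, ∃ ψ, IsTest ψ ∧ eLpNorm (fun x => ψ x - Zd α (v i) x) 2 hsMeasure < ω ∧
        eLpNorm (fun x => pd i ψ x - D' i x) 2 hsMeasure < ω := by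
      intro i
      have hreg : ∃ B' < ∞, HReg 1 B' (Zd α (v i)) :=
        ((hv i).of_le (by lia)).deriv_zd hA rfl
      obtain ⟨B', -, hB'⟩ := hreg
      have h0 : ∃ g, WD i (Zd α (v i)) g ∧ MemLp g 2 hsMeasure ∧ WD0 i (Zd α (v i)) g := by
        by_cases hi : i = 2
        · subst hi
          exact hslip.exists_zd hA (hv 2) (hD 2) hα4
        · obtain ⟨g, hg, hg'⟩ := hB'.2 i
          exact ⟨g, hg, hg'.base.1, hg.wd0_of_ne hB'.base.1 hg'.base.1 hi⟩
      obtain ⟨g, h1, h2, h3⟩ := h0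
      have e := h1.unique (hD' i)
      exact (h3.congr EventuallyEq.rfl e).exists_test hB'.base.1 (h2.ae_eq e) hω
    choose ψ h1 h2 h3 using hψ
    have hm : ∀ i, AEStronglyMeasurable (D' i) hsMeasure := fun i =>
      (hD' i).right.aestronglyMeasurable
    refine ⟨ψ, h1, fun _ => ⟨fun i => (h2 i).le, ?_⟩⟩
    have e : (fun x => ∑ i, pd i (ψ i) x) = (fun x => ∑ i, (pd i (ψ i) x - D' i x))
        + fun x => ∑ i, D' i x := by
      funext x
      simp
    rw [e, add_comm]
    have hs : ∀ i, AEStronglyMeasurable (fun x => pd i (ψ i) x - D' i x) hsMeasure := fun i =>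
      ((h1 i).pd i).continuous.aestronglyMeasurable.sub (hm i)
    refine (eLpNorm_add_le (Finset.aestronglyMeasurable_fun_sum _ fun i _ => hm i)
      (Finset.aestronglyMeasurable_fun_sum _ fun i _ => hs i) (by norm_num)).trans (add_le_add ?_ ?_)
    · refine hn.trans ?_
      push_cast
      rw [mul_assoc]
      refine mul_le_mul' ?_ le_rfl
      exact Finset.single_le_sum (f := fun n => (C n : ℝ≥0∞)) (fun _ _ => zero_le)
        (Finset.mem_range.mpr (by lia))
    · have := eLpNorm_sum_le (s := Finset.univ) (fun i _ => hs i) (p := 2) (by norm_num)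
      have e2 : (∑ i, fun x => pd i (ψ i) x - D' i x) = fun x => ∑ i, (pd i (ψ i) x - D' i x) := by
        funext x
        simp
      rw [e2] at this
      refine this.trans ?_
      refine (Finset.sum_le_sum fun i _ => (h3 i).le).trans (le_of_eq ?_)
      simp
  choose ψ h1 h2 using key
  exact ⟨ψ, h1, h2⟩

end ConormalEuler

end

noncomputable section

namespace ConormalEuler

/-! ### The local energy estimate -/

variable {T : ℝ} {u : ℝ → E3 → E3} {p : ℝ → E3 → ℝ} {t : ℝ}

/-- The integrand on the right-hand side of the energy estimate. -/
def rate (u : ℝ → E3 → E3) (p : ℝ → E3 → ℝ) (s : ℝ) : ℝ≥0∞ :=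
  conormalNorm 4 (u s) ^ 2 * (sobolevInftyNorm 1 (u s) + conormalInftyNorm 2 (u s) + 1)
    + conormalNorm 4 (u s) * gradConormalNorm 3 (p s)

lemma IsEulerSolution.conormalNorm_ne_top (h : IsEulerSolution T u p) (ht : t ∈ Icc 0 T) :
    conormalNorm 4 (u t) ≠ ∞ := fun e => by
  have := h.conormalNorm_sq ht
  rw [e] at this
  simp at this

/-- Write `X`, `M`, `N` for the norms entering `rate`. By `ε ≤ X` the test field has size `O(X)`,
and by `K ε ≤ X²` the term with the lost derivative is at most `M X²`. The condition `X ≠ 0` makes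
the right-hand side infinite when `M` or `N` is. -/
theorem exists_flux_le_rate (C₁ : ℝ≥0) : ∃ C : ℝ≥0, ∀ {T t : ℝ} {u : ℝ → E3 → E3}
    {p : ℝ → E3 → ℝ} {K : ℝ≥0} {ε : ℝ≥0∞}, IsEulerSolution T u p → t ∈ Ioo 0 T →
    conormalNorm 4 (u t) ≠ 0 → (∀ i, ZReg 2 5 K (comp u t i)) → ε ≤ conormalNorm 4 (u t) →
    K * ε ≤ conormalNorm 4 (u t) ^ 2 →
    ∀ ψ : (Fin 3 → ℕ) → Fin 3 → E3 → ℝ, (∀ α i, IsTest (ψ α i)) → (∀ α ∈ multiIndices 4,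
      (∀ i, eLpNorm (fun x => ψ α i x - 2 * Zd α (comp u t i) x) 2 hsMeasure ≤ ε) ∧
      eLpNorm (fun x => ∑ i, pd i (ψ α i) x) 2 hsMeasure ≤ C₁ * conormalNorm 4 (u t)) →
    ‖flux (comp u t) (p t) (testField ψ)‖ₑ ≤ C * rate u p t := by
  obtain ⟨C, hC⟩ := exists_flux_le
  -- Here `21 = 12 + 9`: three components with `X² M + 3 X² M`, and three test norms `3X` against
  -- the pressure. The final 1 makes the constant nonzero, so that its product with `∞` is `∞`.
  refine ⟨C * (multiIndices 4).card * (21 + C₁) + 1,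
    fun {T t u p K ε} h ht hX0 hK hε hKε ψ hψ hb => ?_⟩
  have ht' := Ioo_subset_Icc_self ht
  set X := conormalNorm 4 (u t) with hX
  set M := sobolevInftyNorm 1 (u t) + conormalInftyNorm 2 (u t) with hM
  set N := gradConormalNorm 3 (p t) with hN
  have hXt : X ≠ ∞ := h.conormalNorm_ne_top ht'
  have hrate : rate u p t = X ^ 2 * (M + 1) + X * N := rfl
  have hc : ((C * (multiIndices 4).card * (21 + C₁) + 1 : ℝ≥0) : ℝ≥0∞) ≠ 0 := by
    norm_cast
    positivity
  by_cases hMt : M = ∞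
  · rw [hrate, hMt, top_add, ENNReal.mul_top (pow_ne_zero 2 hX0), top_add, ENNReal.mul_top hc]
    exact le_top
  by_cases hNt : N = ∞
  · rw [hrate, hNt, ENNReal.mul_top hX0, add_top, ENNReal.mul_top hc]
    exact le_top
  obtain ⟨D, hflow⟩ := h.exists_flow ht ENNReal.coe_lt_top hK (lt_top_iff_ne_top.mpr hMt)
  -- The infimum is met up to the slack `X`, which contributes only `X²`; the summand 1 in `rate`
  -- pays for it.
  obtain ⟨G, hG, hG'⟩ := exists_gradient (ENNReal.lt_add_right hNt hX0)
  refine (hC hflow hXt hG hG' ψ hψ).trans ?_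
  have hψn : ∀ α ∈ multiIndices 4, ∀ i, eLpNorm (ψ α i) 2 hsMeasure ≤ 3 * X := by
    intro α hα i
    have hα4 := mem_multiIndices.mp hα
    have m := h.memLp_zd ht' (α := α) (by lia) i
    have e : ψ α i = (fun x => ψ α i x - 2 * Zd α (comp u t i) x)
        + (2 : ℝ) • Zd α (comp u t i) := by
      funext x
      simp
    have h1 : eLpNorm ((2 : ℝ) • Zd α (comp u t i)) 2 hsMeasure ≤ 2 * X := by
      rw [eLpNorm_const_smul]
      refine mul_le_mul' (by simp [enorm_eq_nnnorm]) (hflow.reg i |>.norm_le hα4)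
    rw [e]
    refine (eLpNorm_add_le ((hψ α i).continuous.aestronglyMeasurable.sub
      (m.1.const_mul 2)) (m.1.const_smul 2) (by norm_num)).trans
      ((add_le_add (((hb α hα).1 i).trans hε) h1).trans (le_of_eq ?_))
    ring
  have hα : ∀ α ∈ multiIndices 4,
      (∑ i, (M * K * eLpNorm (fun x => ψ α i x - 2 * Zd α (comp u t i) x) 2 hsMeasure
        + M * X * eLpNorm (ψ α i) 2 hsMeasure)
        + (N + X) * (∑ i, eLpNorm (ψ α i) 2 hsMeasure
          + eLpNorm (fun x => ∑ i, pd i (ψ α i) x) 2 hsMeasure)) ≤ (21 + C₁) * rate u p t := by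
    intro α hα
    have k1 : ∀ i, M * K * eLpNorm (fun x => ψ α i x - 2 * Zd α (comp u t i) x) 2 hsMeasure
        + M * X * eLpNorm (ψ α i) 2 hsMeasure ≤ M * X ^ 2 + M * X * (3 * X) := fun i => by
      rw [mul_assoc M]
      exact add_le_add (mul_le_mul' le_rfl ((mul_le_mul' le_rfl ((hb α hα).1 i)).trans hKε))
        (mul_le_mul' le_rfl (hψn α hα i))
    calc _ ≤ ∑ _ : Fin 3, (M * X ^ 2 + M * X * (3 * X))
          + (N + X) * (∑ _ : Fin 3, 3 * X + C₁ * X) :=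
          add_le_add (Finset.sum_le_sum fun i _ => k1 i) (mul_le_mul' le_rfl
            (add_le_add (Finset.sum_le_sum fun i _ => hψn α hα i) (hb α hα).2))
      _ = 12 * (X ^ 2 * M) + (9 + C₁) * (X ^ 2 + X * N) := by
          simp only [Fin.sum_univ_three]
          ring
      _ ≤ (21 + C₁) * (X ^ 2 * M) + (21 + C₁) * (X ^ 2 + X * N) := by
          gcongr
          · exact le_add_right (by norm_num)
          · norm_num
      _ = (21 + C₁) * rate u p t := by
          rw [hrate]
          ring
  refine (mul_le_mul' le_rfl (Finset.sum_le_sum hα)).trans ?_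
  rw [Finset.sum_const, nsmul_eq_mul]
  push_cast
  rw [← mul_assoc, ← mul_assoc]
  exact mul_le_mul' le_self_add le_rfl

lemma IsEulerSolution.exists_deriv (h : IsEulerSolution T u p) (ht : t ∈ Ioo 0 T) :
    ∃ D : Fin 3 → E3 → ℝ, (∀ i, HReg 4 (sobolevNorm 5 (u t)) (D i)) ∧
      (∀ i, WD i (comp u t i) (D i)) ∧ ((fun x => ∑ i, D i x) =ᵐ[hsMeasure] fun _ => 0) ∧
      WD0 2 (comp u t 2) (D 2) := by
  have ht' := Ioo_subset_Icc_self ht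
  choose D hD1 hD2 using fun i => (h.hReg ht' i).2 i
  refine ⟨D, hD2, hD1, h.div_eq_zero ht hD1,
    (hD1 2).wd0_of_continuousOn (h.hReg ht' 2).base.1 (hD2 2).base.1 ?_
      fun x hx => h.slip t ht x hx⟩
  exact (EuclideanSpace.proj (2 : Fin 3) : E3 →L[ℝ] ℝ).continuous.comp_continuousOn
    (h.continuousOn t ht')

lemma IsEulerSolution.zReg_conormalNorm (h : IsEulerSolution T u p) (ht : t ∈ Icc 0 T) (i : Fin 3) :
    ZReg 2 4 (conormalNorm 4 (u t)) (comp u t i) :=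
  zReg_of_conormalNorm le_rfl (lt_top_iff_ne_top.mpr (h.conormalNorm_ne_top ht)) i

/-- The energy increment, tested. -/
lemma IsEulerSolution.enorm_energy_sub_le (h : IsEulerSolution T u p) {s₀ s₁ : ℝ}
    (h0 : s₀ ∈ Icc 0 T) (h1 : s₁ ∈ Icc 0 T) {K : ℝ≥0}
    (hK : ∀ t ∈ Icc 0 T, ∀ i, ZReg 2 5 K (comp u t i)) {ψ : (Fin 3 → ℕ) → Fin 3 → E3 → ℝ}
    (hψ : ∀ α i, IsTest (ψ α i)) {ω : ℝ≥0∞} (hb : ∀ α ∈ multiIndices 4, ∀ i,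
      eLpNorm (fun x => ψ α i x - (Zd α (comp u s₀ i) x + Zd α (comp u s₁ i) x)) 2 hsMeasure ≤ ω) :
    ‖energy u s₁ - energy u s₀‖ₑ
      ≤ ‖∑ i, ∫ x, (comp u s₁ i x - comp u s₀ i x) * testField ψ i x ∂hsMeasure‖ₑ
        + (multiIndices 4).card * (3 * (2 * K * ω)) := by
  have hm : ∀ α ∈ multiIndices 4, ∀ i, ∀ t ∈ Icc 0 T, MemLp (Zd α (comp u t i)) 2 hsMeasure :=
    fun α hα i t ht => h.memLp_zd ht (by have := mem_multiIndices.mp hα; lia) i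
  have e1 : ∑ i, ∫ x, (comp u s₁ i x - comp u s₀ i x) * testField ψ i x ∂hsMeasure
      = ∑ α ∈ multiIndices 4, ∑ i, ∫ x,
        (Zd α (comp u s₁ i) x - Zd α (comp u s₀ i) x) * ψ α i x ∂hsMeasure := by
    rw [Finset.sum_comm]
    refine Finset.sum_congr rfl fun i _ => ?_
    refine (integral_mul_testField
      (((h.memLp_comp h1 i).sub (h.memLp_comp h0 i)).l2loc.locInt) hψ i).trans ?_
    refine Finset.sum_congr rfl fun α hα => ?_
    have hα5 : ord α ≤ 5 := by have := mem_multiIndices.mp hα; lia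
    exact (isWeakDeriv_iff.mp (((hK s₁ h1 i).deriv hα5).sub goodWeight_conormal
      ((hK s₀ h0 i).deriv hα5))).2.2 _ (hψ α i)
  -- With `a`, `b` the derivatives at the two times, `a² - b² = (a - b) ψ - (a - b)(ψ - (a + b))`;
  -- the last term is the approximation error.
  have e2 : energy u s₁ - energy u s₀
      = (∑ i, ∫ x, (comp u s₁ i x - comp u s₀ i x) * testField ψ i x ∂hsMeasure)
        - ∑ α ∈ multiIndices 4, ∑ i, ∫ x, (Zd α (comp u s₁ i) x - Zd α (comp u s₀ i) x)
          * (ψ α i x - (Zd α (comp u s₀ i) x + Zd α (comp u s₁ i) x)) ∂hsMeasure := by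
    rw [e1, energy, energy]
    simp_rw [← Finset.sum_sub_distrib]
    refine Finset.sum_congr rfl fun α hα => Finset.sum_congr rfl fun i _ => ?_
    have m0 := hm α hα i s₀ h0
    have m1 := hm α hα i s₁ h1
    rw [integral_sq_sub_sq m1 m0]
    refine Eq.trans ?_ (integral_sub (memLp_two_mul (m1.sub m0) (hψ α i).memLp)
      (memLp_two_mul (m1.sub m0) ((hψ α i).memLp.sub (m0.add m1))))
    refine integral_congr_ae (Eventually.of_forall fun x => ?_)
    beta_reduce
    ring
  rw [e2]
  refine enorm_sub_le.trans (add_le_add le_rfl ?_)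
  refine (enorm_sum_le _ _).trans ?_
  rw [← nsmul_eq_mul, ← Finset.sum_const]
  refine Finset.sum_le_sum fun α hα => (enorm_sum_le _ _).trans ?_
  rw [show (3 : ℝ≥0∞) * (2 * K * ω) = ∑ _ : Fin 3, 2 * K * ω by simp]
  refine Finset.sum_le_sum fun i _ => ?_
  have hα5 : ord α ≤ 5 := by have := mem_multiIndices.mp hα; lia
  have m0 := hm α hα i s₀ h0
  have m1 := hm α hα i s₁ h1
  refine (enorm_integral_mul_le (m1.sub m0).1 ((hψ α i).memLp.sub (m0.add m1)).1).trans
    (mul_le_mul' ?_ (hb α hα i))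
  rw [two_mul]
  exact (eLpNorm_sub_le m1.1 m0.1 (by norm_num)).trans
    (add_le_add ((hK s₁ h1 i).norm_le hα5) ((hK s₀ h0 i).norm_le hα5))

end ConormalEuler

end

noncomputable section

namespace ConormalEuler

/-! ### The energy estimate -/

/-- The energy at `s` is at most twice that at `t`, a fortiori at most four times. -/
lemma le_two_mul_conormalNorm {T s t c : ℝ} {u : ℝ → E3 → E3} {p : ℝ → E3 → ℝ}
    (h : IsEulerSolution T u p) (hs : s ∈ Icc 0 T) (ht : t ∈ Icc 0 T) (hc : c ≤ energy u t)
    (hst : |energy u s - energy u t| ≤ c) : conormalNorm 4 (u s) ≤ 2 * conormalNorm 4 (u t) := by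
  apply le_of_sq_le_sq
  rw [mul_pow, h.conormalNorm_sq hs, h.conormalNorm_sq ht]
  have e : ((2 : ℝ≥0∞) ^ 2) = ENNReal.ofReal 4 := by norm_num
  rw [e, ← ENNReal.ofReal_mul (by norm_num)]
  refine ENNReal.ofReal_le_ofReal ?_
  have := (abs_le.mp hst).2
  have := energy_nonneg u t
  linarith

/-- The admissible step length may depend on the solution, through `K`, `c` and the modulus of
continuity, but the constant does not. The test field is fixed on the short interval, so the
equation is used only in its time-integrated form, and the flux is bounded by `rate` at every single
time. -/
theorem exists_energy_step : ∃ C : ℝ≥0, ∀ {T t₀ t₁ c : ℝ} {u : ℝ → E3 → E3} {p : ℝ → E3 → ℝ},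
    IsEulerSolution T u p → 0 < t₀ → t₁ < T → 0 < c → (∀ s ∈ Icc t₀ t₁, c ≤ energy u s) →
    ∃ δ > 0, ∀ s₀ s₁, t₀ ≤ s₀ → s₀ < s₁ → s₁ ≤ t₁ → s₁ - s₀ < δ →
      ENNReal.ofReal (energy u s₁) ≤ ENNReal.ofReal (energy u s₀)
        + C * ∫⁻ s in Ioc s₀ s₁, rate u p s := by
  obtain ⟨C₀, hC₀⟩ := exists_tests
  -- Two test fields, one for each endpoint, each with divergence at most `C₀ · 2X + 3X`.
  obtain ⟨C, hC⟩ := exists_flux_le_rate (4 * C₀ + 6)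
  refine ⟨C, fun {T t₀ t₁ c u p} h ht₀ ht₁ hc hE => ?_⟩
  obtain ⟨K, hK⟩ := h.exists_bound
  -- Chosen so that `ε = 4η` satisfies `ε ≤ √c ≤ X` and `K ε ≤ c ≤ X²`. The 4 counts two
  -- approximation errors of the test fields and the distances from the intermediate time to the two
  -- endpoints.
  set η : ℝ := min (√c / 4) (c / (4 * (K + 1))) with hη
  have hK0 : (0 : ℝ) ≤ K := K.2
  have hη0 : 0 < η := lt_min (by positivity) (by positivity)
  have hη1 : 4 * η ≤ √c := by
    have := min_le_left (√c / 4) (c / (4 * (K + 1)))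
    rw [← hη] at this
    linarith
  have hη2 : K * (4 * η) ≤ c := by
    have h1 := min_le_right (√c / 4) (c / (4 * (K + 1)))
    rw [← hη, le_div_iff₀ (by positivity)] at h1
    nlinarith
  obtain ⟨δ₁, hδ₁, hmod⟩ := h.exists_modulus (ε := ENNReal.ofReal η) (by simpa using hη0)
  obtain ⟨δ₂, hδ₂, hunif⟩ := Metric.uniformContinuousOn_iff.mp
    (isCompact_Icc.uniformContinuousOn_of_continuous h.continuousOn_energy) c hc
  refine ⟨min δ₁ δ₂, lt_min hδ₁ hδ₂, fun s₀ s₁ h0 h01 h1 hd => ?_⟩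
  have hIoo : ∀ t ∈ Icc s₀ s₁, t ∈ Ioo 0 T := fun t ht =>
    ⟨ht₀.trans_le (h0.trans ht.1), (ht.2.trans h1).trans_lt ht₁⟩
  have hIcc : ∀ t ∈ Icc s₀ s₁, t ∈ Icc 0 T := fun t ht => Ioo_subset_Icc_self (hIoo t ht)
  have hEt : ∀ t ∈ Icc s₀ s₁, c ≤ energy u t := fun t ht => hE t ⟨h0.trans ht.1, ht.2.trans h1⟩
  have m0 : s₀ ∈ Icc s₀ s₁ := ⟨le_rfl, h01.le⟩
  have m1 : s₁ ∈ Icc s₀ s₁ := ⟨h01.le, le_rfl⟩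
  have hdist : ∀ s ∈ Icc s₀ s₁, ∀ t ∈ Icc s₀ s₁, |s - t| < min δ₁ δ₂ := fun s hs t ht => by
    refine lt_of_le_of_lt (abs_le.mpr ⟨?_, ?_⟩) hd <;> linarith [hs.1, hs.2, ht.1, ht.2]
  have hX : ∀ s ∈ Icc s₀ s₁, ∀ t ∈ Icc s₀ s₁,
      conormalNorm 4 (u s) ≤ 2 * conormalNorm 4 (u t) := fun s hs t ht =>
    le_two_mul_conormalNorm h (hIcc s hs) (hIcc t ht) (hEt t ht)
      (hunif s (hIcc s hs) t (hIcc t ht) ((hdist s hs t ht).trans_le (min_le_right _ _))).le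
  have hXc : ∀ t ∈ Icc s₀ s₁, ENNReal.ofReal c ≤ conormalNorm 4 (u t) ^ 2 := fun t ht => by
    rw [h.conormalNorm_sq (hIcc t ht)]
    exact ENNReal.ofReal_le_ofReal (hEt t ht)
  have hXη : ∀ t ∈ Icc s₀ s₁, ENNReal.ofReal (4 * η) ≤ conormalNorm 4 (u t) := fun t ht => by
    apply le_of_sq_le_sq
    refine le_trans ?_ (hXc t ht)
    rw [← ENNReal.ofReal_pow (by positivity)]
    refine ENNReal.ofReal_le_ofReal ?_
    calc (4 * η) ^ 2 ≤ √c ^ 2 := by gcongr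
      _ = c := Real.sq_sqrt hc.le
  have hX0 : ∀ t ∈ Icc s₀ s₁, conormalNorm 4 (u t) ≠ 0 := fun t ht e => by
    have := hXη t ht
    rw [e, nonpos_iff_eq_zero, ENNReal.ofReal_eq_zero] at this
    linarith
  refine ENNReal.le_of_forall_pos_le_add fun e he _ => ?_
  -- The factor in front of `ω` in the error of the tested energy increment, plus 1 to allow
  -- division; `ω ≤ e / A` makes that error at most `e`.
  set A : ℝ≥0 := (multiIndices 4).card * (3 * (2 * K * 2)) + 1 with hA
  have hA0 : 0 < A := by positivity
  set ω : ℝ≥0∞ := min (ENNReal.ofReal η) (e / A : ℝ≥0) with hω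
  have hω0 : 0 < ω := lt_min (by simpa using hη0) (by
    rw [ENNReal.coe_pos]
    exact div_pos he hA0)
  have hωη : ω ≤ ENNReal.ofReal η := min_le_left _ _
  obtain ⟨D₀, a1, a2, a3, a4⟩ := h.exists_deriv (hIoo s₀ m0)
  obtain ⟨ψ₀, p1, p2⟩ := hC₀ (h.regular.1 s₀ (hIcc s₀ m0)) (h.hReg (hIcc s₀ m0)) a1 a2 a3 a4
    (h.zReg_conormalNorm (hIcc s₀ m0)) ω hω0
  obtain ⟨D₁, b1, b2, b3, b4⟩ := h.exists_deriv (hIoo s₁ m1)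
  obtain ⟨ψ₁, q1, q2⟩ := hC₀ (h.regular.1 s₁ (hIcc s₁ m1)) (h.hReg (hIcc s₁ m1)) b1 b2 b3 b4
    (h.zReg_conormalNorm (hIcc s₁ m1)) ω hω0
  -- Close to `Z^α u(s₀) + Z^α u(s₁)`, the second factor of the difference of squares, and thus to
  -- `2 Z^α u(t)` for every `t` in between.
  set ψ : (Fin 3 → ℕ) → Fin 3 → E3 → ℝ := fun α i x => ψ₀ α i x + ψ₁ α i x with hψdef
  have hψ : ∀ α i, IsTest (ψ α i) := fun α i => (p1 α i).add (q1 α i)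
  have hm : ∀ α ∈ multiIndices 4, ∀ i, ∀ t ∈ Icc s₀ s₁,
      AEStronglyMeasurable (Zd α (comp u t i)) hsMeasure := fun α hα i t ht =>
    (h.memLp_zd (hIcc t ht) (by have := mem_multiIndices.mp hα; lia) i).1
  have hcp : ∀ α i, AEStronglyMeasurable (ψ₀ α i) hsMeasure := fun α i =>
    (p1 α i).continuous.aestronglyMeasurable
  have hcq : ∀ α i, AEStronglyMeasurable (ψ₁ α i) hsMeasure := fun α i =>
    (q1 α i).continuous.aestronglyMeasurable
  have hb1 : ∀ α ∈ multiIndices 4, ∀ i,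
      eLpNorm (fun x => ψ α i x - (Zd α (comp u s₀ i) x + Zd α (comp u s₁ i) x)) 2 hsMeasure
        ≤ 2 * ω := fun α hα i => by
    have e : (fun x => ψ α i x - (Zd α (comp u s₀ i) x + Zd α (comp u s₁ i) x))
        = (fun x => ψ₀ α i x - Zd α (comp u s₀ i) x)
          + fun x => ψ₁ α i x - Zd α (comp u s₁ i) x := by
      funext x
      simp only [hψdef, Pi.add_apply]
      ring
    rw [e, two_mul]
    exact (eLpNorm_add_le ((hcp α i).sub (hm α hα i s₀ m0)) ((hcq α i).sub (hm α hα i s₁ m1))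
      (by norm_num)).trans (add_le_add ((p2 α hα).1 i) ((q2 α hα).1 i))
  have hmod' : ∀ s ∈ Icc s₀ s₁, ∀ t ∈ Icc s₀ s₁, ∀ α ∈ multiIndices 4, ∀ i,
      eLpNorm (fun x => Zd α (comp u s i) x - Zd α (comp u t i) x) 2 hsMeasure
        ≤ ENNReal.ofReal η := fun s hs t ht α hα i =>
    hmod s (hIcc s hs) t (hIcc t ht) ((hdist s hs t ht).trans_le (min_le_left _ _)) i α
      (by have := mem_multiIndices.mp hα; lia)
  have hη4 : ENNReal.ofReal (4 * η) = 4 * ENNReal.ofReal η := by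
    rw [ENNReal.ofReal_mul (by norm_num)]
    norm_num
  have hflux : ∀ t ∈ Ioc s₀ s₁, ‖flux (comp u t) (p t) (testField ψ)‖ₑ ≤ C * rate u p t := by
    intro t ht
    have ht' := Ioc_subset_Icc_self ht
    refine hC (ε := ENNReal.ofReal (4 * η)) h (hIoo t ht') (hX0 t ht') (hK t (hIcc t ht'))
      (hXη t ht') ?_ ψ hψ fun α hα => ⟨fun i => ?_, ?_⟩
    · refine le_trans ?_ (hXc t ht')
      rw [← ENNReal.ofReal_coe_nnreal, ← ENNReal.ofReal_mul hK0]
      exact ENNReal.ofReal_le_ofReal hη2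
    · have e : (fun x => ψ α i x - 2 * Zd α (comp u t i) x)
          = (fun x => ψ α i x - (Zd α (comp u s₀ i) x + Zd α (comp u s₁ i) x))
            + ((fun x => Zd α (comp u s₀ i) x - Zd α (comp u t i) x)
              + fun x => Zd α (comp u s₁ i) x - Zd α (comp u t i) x) := by
        funext x
        simp only [Pi.add_apply]
        ring
      have n0 := hm α hα i s₀ m0
      have n1 := hm α hα i s₁ m1
      have nt := hm α hα i t ht'
      rw [e, hη4]
      calc _ ≤ 2 * ω + (ENNReal.ofReal η + ENNReal.ofReal η) :=
            (eLpNorm_add_le ((hψ α i).continuous.aestronglyMeasurable.sub (n0.add n1))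
              ((n0.sub nt).add (n1.sub nt)) (by norm_num)).trans (add_le_add (hb1 α hα i)
              ((eLpNorm_add_le (n0.sub nt) (n1.sub nt) (by norm_num)).trans
                (add_le_add (hmod' s₀ m0 t ht' α hα i) (hmod' s₁ m1 t ht' α hα i))))
        _ ≤ 2 * ENNReal.ofReal η + (ENNReal.ofReal η + ENNReal.ofReal η) :=
            add_le_add (mul_le_mul' le_rfl hωη) le_rfl
        _ = 4 * ENNReal.ofReal η := by ring
    · have e : (fun x => ∑ i, pd i (ψ α i) x)
          = (fun x => ∑ i, pd i (ψ₀ α i) x) + fun x => ∑ i, pd i (ψ₁ α i) x := by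
        funext x
        simp only [Pi.add_apply, hψdef, ← Finset.sum_add_distrib]
        exact Finset.sum_congr rfl fun i _ =>
          pd_add i ((p1 α i).differentiable x) ((q1 α i).differentiable x)
      have hωX : ω ≤ conormalNorm 4 (u t) := by
        refine (hωη.trans (ENNReal.ofReal_le_ofReal ?_)).trans (hXη t ht')
        linarith
      rw [e]
      calc _ ≤ (C₀ * conormalNorm 4 (u s₀) + 3 * ω) + (C₀ * conormalNorm 4 (u s₁) + 3 * ω) :=
            (eLpNorm_add_le
              (Finset.aestronglyMeasurable_fun_sum _ fun i _ =>
                ((p1 α i).pd i).continuous.aestronglyMeasurable)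
              (Finset.aestronglyMeasurable_fun_sum _ fun i _ =>
                ((q1 α i).pd i).continuous.aestronglyMeasurable) (by norm_num)).trans
              (add_le_add (p2 α hα).2 (q2 α hα).2)
        _ ≤ (C₀ * (2 * conormalNorm 4 (u t)) + 3 * conormalNorm 4 (u t))
            + (C₀ * (2 * conormalNorm 4 (u t)) + 3 * conormalNorm 4 (u t)) := by
            gcongr
            · exact hX s₀ m0 t ht'
            · exact hX s₁ m1 t ht'
        _ = ((4 * C₀ + 6 : ℝ≥0) : ℝ≥0∞) * conormalNorm 4 (u t) := by
            push_cast
            ring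
  have key := h.enorm_energy_sub_le (hIcc s₀ m0) (hIcc s₁ m1) hK hψ hb1
  rw [h.sub_eq_integral_flux (isTest_testField hψ) (hIoo s₀ m0).1 h01 (hIoo s₁ m1).2] at key
  have hint : ‖∫ t in Ioc s₀ s₁, flux (comp u t) (p t) (testField ψ)‖ₑ
      ≤ C * ∫⁻ s in Ioc s₀ s₁, rate u p s := by
    rw [← lintegral_const_mul' _ _ ENNReal.coe_ne_top]
    exact (enorm_integral_le_lintegral_enorm _).trans (setLIntegral_mono' measurableSet_Ioc hflux)
  have herr : ((multiIndices 4).card : ℝ≥0∞) * (3 * (2 * K * (2 * ω))) ≤ e := by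
    calc ((multiIndices 4).card : ℝ≥0∞) * (3 * (2 * K * (2 * ω)))
        = ((multiIndices 4).card * (3 * (2 * K * 2))) * ω := by ring
      _ ≤ A * (e / A : ℝ≥0) := by
          refine mul_le_mul' ?_ (min_le_right _ _)
          rw [hA]
          push_cast
          exact le_self_add
      _ = e := by
          rw [← ENNReal.coe_mul, mul_div_cancel₀ _ hA0.ne']
  have hfin : ENNReal.ofReal (energy u s₁)
      ≤ ENNReal.ofReal (energy u s₀) + ‖energy u s₁ - energy u s₀‖ₑ := by
    rw [Real.enorm_eq_ofReal_abs, ← ENNReal.ofReal_add (energy_nonneg u _) (abs_nonneg _)]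
    refine ENNReal.ofReal_le_ofReal ?_
    have := le_abs_self (energy u s₁ - energy u s₀)
    linarith
  rw [add_assoc]
  exact hfin.trans (add_le_add le_rfl (key.trans (add_le_add hint herr)))

/-- Local increment bounds on a compact interval add up. -/
lemma le_add_lintegral_of_local {E : ℝ → ℝ≥0∞} {F : ℝ → ℝ≥0∞} {t₀ t₁ δ : ℝ} {C : ℝ≥0∞}
    (hδ : 0 < δ) (h : ∀ s₀ s₁, t₀ ≤ s₀ → s₀ < s₁ → s₁ ≤ t₁ → s₁ - s₀ < δ →
      E s₁ ≤ E s₀ + C * ∫⁻ s in Ioc s₀ s₁, F s) (h01 : t₀ ≤ t₁) :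
    E t₁ ≤ E t₀ + C * ∫⁻ s in Ioc t₀ t₁, F s := by
  have key : ∀ n : ℕ, ∀ t, t₀ ≤ t → t ≤ t₁ → t - t₀ ≤ n * (δ / 2) →
      E t ≤ E t₀ + C * ∫⁻ s in Ioc t₀ t, F s := by
    intro n
    induction n with
    | zero =>
      intro t h1 h2 h3
      rw [show t = t₀ by simp at h3; linarith]
      exact le_self_add
    | succ n ih =>
      intro t h1 h2 h3
      push_cast at h3
      by_cases hh : t - t₀ < δ
      · rcases h1.eq_or_lt with rfl | h1
        · exact le_self_add
        · exact h t₀ t le_rfl h1 h2 hh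
      · have a1 := ih (t - δ / 2) (by linarith) (by linarith) (by linarith)
        have a2 := h (t - δ / 2) t (by linarith) (by linarith) h2 (by linarith)
        rw [← Ioc_union_Ioc_eq_Ioc (show t₀ ≤ t - δ / 2 by linarith)
          (show t - δ / 2 ≤ t by linarith), lintegral_union measurableSet_Ioc
          (Ioc_disjoint_Ioc_of_le le_rfl), mul_add, ← add_assoc]
        exact a2.trans (add_le_add a1 le_rfl)
  obtain ⟨n, hn⟩ := exists_nat_ge ((t₁ - t₀) / (δ / 2))
  exact key n t₁ h01 le_rfl (by rwa [div_le_iff₀ (by positivity)] at hn)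

/-- If the energy at `t` exceeds the initial one, let `τ` be the last time before `t` at which it
does not. On `(τ, t]` the energy is positive, so the local steps apply on compact subintervals of
`(τ, t)`. The endpoints, where the equation itself may not be available, are reached by continuity
of the energy. -/
theorem exists_energy_le : ∃ C : ℝ≥0, ∀ {T t : ℝ} {u : ℝ → E3 → E3} {p : ℝ → E3 → ℝ},
    IsEulerSolution T u p → t ∈ Icc 0 T → ENNReal.ofReal (energy u t)
      ≤ ENNReal.ofReal (energy u 0) + C * ∫⁻ s in Icc 0 t, rate u p s := by
  obtain ⟨C, hC⟩ := exists_energy_step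
  refine ⟨C, fun {T t u p} h ht => ?_⟩
  rcases le_or_gt (energy u t) (energy u 0) with hle | hlt
  · exact (ENNReal.ofReal_le_ofReal hle).trans le_self_add
  have hcont : ContinuousOn (energy u) (Icc 0 t) :=
    h.continuousOn_energy.mono (Icc_subset_Icc_right ht.2)
  have hcl : IsClosed (Icc 0 t ∩ energy u ⁻¹' Iic (energy u 0)) :=
    hcont.preimage_isClosed_of_isClosed isClosed_Icc isClosed_Iic
  have hcpt : IsCompact (Icc 0 t ∩ energy u ⁻¹' Iic (energy u 0)) :=
    isCompact_Icc.of_isClosed_subset hcl inter_subset_left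
  obtain ⟨τ, ⟨hτ, hτE⟩, hτmax⟩ := hcpt.exists_isGreatest ⟨0, ⟨le_rfl, ht.1⟩, le_refl (energy u 0)⟩
  have hτt : τ < t := hτ.2.lt_of_ne fun e => by
    subst e
    exact absurd hτE (not_le.mpr hlt)
  have hpos : ∀ s ∈ Ioc τ t, energy u 0 < energy u s := fun s hs => by
    by_contra hcon
    exact absurd (hτmax ⟨⟨hτ.1.trans hs.1.le, hs.2⟩, not_lt.mp hcon⟩) (not_le.mpr hs.1)
  have hin : ∀ t₀ t₁, τ < t₀ → t₀ ≤ t₁ → t₁ < t → ENNReal.ofReal (energy u t₁)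
      ≤ ENNReal.ofReal (energy u t₀) + C * ∫⁻ s in Icc 0 t, rate u p s := by
    intro t₀ t₁ h0 h01 h1
    -- The positive minimum on the compact subinterval is the lower bound `c` required by the local
    -- step.
    obtain ⟨m, hm, hmin⟩ := isCompact_Icc.exists_isMinOn (nonempty_Icc.mpr h01)
      (hcont.mono (Icc_subset_Icc (hτ.1.trans h0.le) h1.le))
    have hc : 0 < energy u m := (energy_nonneg u 0).trans_lt
      (hpos m ⟨h0.trans_le hm.1, hm.2.trans h1.le⟩)
    obtain ⟨δ, hδ, hstep⟩ := hC h (hτ.1.trans_lt h0) (h1.trans_le ht.2) hc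
      (fun s hs => isMinOn_iff.mp hmin s hs)
    refine (le_add_lintegral_of_local (E := fun s => ENNReal.ofReal (energy u s)) hδ hstep
      h01).trans (add_le_add le_rfl (mul_le_mul' le_rfl (lintegral_mono_set ?_)))
    exact Ioc_subset_Icc_self.trans (Icc_subset_Icc (hτ.1.trans h0.le) h1.le)
  have hcτ : Tendsto (fun s => ENNReal.ofReal (energy u s)) (𝓝[>] τ)
      (𝓝 (ENNReal.ofReal (energy u τ))) := by
    refine (ENNReal.continuous_ofReal.tendsto _).comp ((hcont τ hτ).mono_left ?_)
    rw [← nhdsWithin_Ioc_eq_nhdsGT hτt]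
    exact nhdsWithin_mono _ fun s hs => ⟨hτ.1.trans hs.1.le, hs.2⟩
  have hct : Tendsto (fun s => ENNReal.ofReal (energy u s)) (𝓝[<] t)
      (𝓝 (ENNReal.ofReal (energy u t))) := by
    refine (ENNReal.continuous_ofReal.tendsto _).comp ((hcont t ⟨ht.1, le_rfl⟩).mono_left ?_)
    rw [← nhdsWithin_Ico_eq_nhdsLT hτt]
    exact nhdsWithin_mono _ fun s hs => ⟨hτ.1.trans hs.1, hs.2.le⟩
  have h2 : ∀ t₁, τ < t₁ → t₁ < t → ENNReal.ofReal (energy u t₁)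
      ≤ ENNReal.ofReal (energy u τ) + C * ∫⁻ s in Icc 0 t, rate u p s := by
    intro t₁ h0 h1
    refine ge_of_tendsto (hcτ.add_const _) ?_
    filter_upwards [Ioc_mem_nhdsGT h0] with t₀ ht₀
    exact hin t₀ t₁ ht₀.1 ht₀.2 h1
  have h3 : ENNReal.ofReal (energy u t)
      ≤ ENNReal.ofReal (energy u τ) + C * ∫⁻ s in Icc 0 t, rate u p s := by
    refine le_of_tendsto hct ?_
    filter_upwards [Ioo_mem_nhdsLT hτt] with t₁ ht₁
    exact h2 t₁ ht₁.1 ht₁.2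
  exact h3.trans (add_le_add (ENNReal.ofReal_le_ofReal hτE) le_rfl)

end ConormalEuler

end

theorem proposition3p1 :
    ∃ C : ℝ≥0, ∀ (T : ℝ) (u : ℝ → ConormalEuler.E3 → ConormalEuler.E3)
      (p : ℝ → ConormalEuler.E3 → ℝ), 0 < T → ConormalEuler.IsEulerSolution T u p →
      ∀ t ∈ Set.Icc (0 : ℝ) T,
        ConormalEuler.conormalNorm 4 (u t) ^ 2 ≤
          C * (ConormalEuler.conormalNorm 4 (u 0) ^ 2 +
            ∫⁻ s in Set.Icc (0 : ℝ) t,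
              (ConormalEuler.conormalNorm 4 (u s) ^ 2 *
                  (ConormalEuler.sobolevInftyNorm 1 (u s)
                    + ConormalEuler.conormalInftyNorm 2 (u s) + 1)
                + ConormalEuler.conormalNorm 4 (u s)
                  * ConormalEuler.gradConormalNorm 3 (p s))) := by
  obtain ⟨C, hC⟩ := ConormalEuler.exists_energy_le
  -- The constant must also cover the initial energy, which enters with coefficient 1.
  refine ⟨C + 1, fun T u p hT h t ht => ?_⟩
  rw [h.conormalNorm_sq ht, h.conormalNorm_sq (t := 0) ⟨le_rfl, hT.le⟩]
  refine (hC h ht).trans ?_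
  rw [mul_add]
  push_cast
  refine add_le_add ?_ (mul_le_mul' le_self_add le_rfl)
  rw [add_mul, one_mul]
  exact le_add_self
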